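/- Units with $c=1$, Heaviside–Lorentz charges, metric $g=\mathrm{diag}(-1,1,1,1)$. Consider $N$ point particles with charges $q_n$, masses $m_n$, smooth, timelike, future-directed, inextendible and mutually non-intersecting world-lines $z_n$, four-velocities $u_n=dz_n/d\tau_n$, and an antisymmetric electromagnetic field tensor $F^{\mu\nu}$ which is $C^1$ outside the world-lines. Assume: (a) near the world-line of the $n$-th particle, $F=F_{\mathrm{ret},n}+F_{\mathrm{ext},n}$, where $F_{\mathrm{ret},n}$ is the retarded (Liénard–Wiechert) field of that particle and $F_{\mathrm{ext},n}$ is $C^1$ in a neighbourhood of the world-line; (b) $F$ is locally integrable and satisfies, in the sense of distributions, the Maxwell equations $\partial_\nu F^{\mu\nu}=j^\mu$ and $\partial_\kappa F_{\mu\nu}+\partial_\mu F_{\nu\kappa}+\partial_\nu F_{\kappa\mu}=0$, with $j^\mu(x)=\sum_n q_n\int d\tau_n\,u_n^\mu\,\delta^4(x-z_n(\tau_n))$; (c) the tensor $T^{\mu\nu}=F^{\mu\lambda}F^{\nu}{}_{\lambda}-\frac14 g^{\mu\nu}F^{\eta\lambda}F_{\eta\lambda}$ vanishes sufficiently fast at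 spatial infinity: for every $\beta<1$ there is $\varepsilon>0$ with $T^{\mu\nu}(\mathbf x,t)=O(|\mathbf x|^{-3-\varepsilon})$ for $|\mathbf x|\to\infty$, uniformly in $|t|\le\beta|\mathbf x|$. If $f(r)=a/r+b+O(r)$ for $r\to0^+$, let $\mathcal R\lim_{r\to0}f(r)=b$. In a given inertial frame, define $$P_{\mathrm{em}}^\mu(t)=\mathcal R\lim_{r\to0}\int_{\{|\mathbf x-\mathbf z_n(t)|\ge r\ \forall n\}}T^{0\mu}(\mathbf x,t)\,d^3\mathbf x,\qquad P^\mu(t)=P_{\mathrm{em}}^\mu(t)+\sum_{n=1}^N m_nu_n^\mu(t).$$ Let $x'=\Lambda x+a$ be the coordinates of any other inertial frame, with $\Lambda$ a Lorentz transformation preserving the direction of time, and denote with a prime the quantities defined in the same way in that frame, from the transformed world-lines and the transformed field $F'^{\mu\nu}(x')=\Lambda^\mu{}_\alpha\Lambda^\nu{}_\beta F^{\alpha\beta}(x)$. (i) If $N=1$, then for every event on the world-line, with time coordinates $t$ and $t'$ in the two frames, $P_{\mathrm{em}}(t)$ and $P'_{\mathrm{em}}(t')$ are well defined, $P_{\mathrm{em}}'^\mu(t')=\Lambda^\mu{}_\nu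 P_{\mathrm{em}}^\nu(t)$ and $P'^\mu(t')=\Lambda^\mu{}_\nu P^\nu(t)$. The equation of motion of the particle is not assumed. (ii) For arbitrary $N$, if the particles satisfy in the original frame the equations of motion $$m_n\gamma_n\frac{du_n^\mu}{dt}=q_n\,u_{n,\nu}\,\widetilde F^{\mu\nu}(z_n),\qquad \widetilde F^{\mu\nu}(z_n)=\mathcal R\lim_{r\to0}\int_{|\mathbf x|=r}\frac{d\Omega_{\mathbf x}}{4\pi}F^{\mu\nu}(\mathbf z_n+\mathbf x,t),\quad t=z_n^0,$$ then $P^\mu(t)$ is well defined and does not depend on $t$, $P'^\mu(t')$ is well defined for every $t'$, and $P'^\mu(t')=\Lambda^\mu{}_\nu P^\nu(t)$ for all $t,t'$. -/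

import Mathlib

open MeasureTheory Filter Asymptotics
open scoped Matrix ContDiff Topology

noncomputable section

namespace PointCharges

/-! ### Minkowski space-time (with `c = 1`) -/

/-- Space-time coordinates `(x⁰, x¹, x², x³)` in an inertial frame. -/
abbrev Spacetime : Type := Fin 4 → ℝ

/-- Three-dimensional Euclidean space. -/
abbrev Space : Type := EuclideanSpace ℝ (Fin 3)

/-- The event with time coordinate `t` and spatial coordinates `x`. -/
def event (t : ℝ) (x : Space) : Spacetime := Fin.cons t (fun i => x i)

/-- The spatial coordinates of an event. -/
def spatial (x : Spacetime) : Space := WithLp.toLp 2 (fun i => x i.succ)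

/-- The Minkowski metric `diag (-1, 1, 1, 1)`. -/
def metric : Matrix (Fin 4) (Fin 4) ℝ := Matrix.diagonal ![-1, 1, 1, 1]

/-- The Minkowski scalar product `x · y = x_ν y^ν`. -/
def mdot (x y : Spacetime) : ℝ := x ⬝ᵥ (metric *ᵥ y)

/-- `(x ∧ y)^{μν} = x^μ y^ν - x^ν y^μ`. -/
def wedge (x y : Spacetime) (μ ν : Fin 4) : ℝ := x μ * y ν - x ν * y μ

/-- The matrix of a Lorentz transformation between inertial frames: it preserves the metric and
the direction of time. -/
def IsLorentz (L : Matrix (Fin 4) (Fin 4) ℝ) : Prop :=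
  Lᵀ * metric * L = metric ∧ 0 < L 0 0

/-- The partial derivative `∂_μ φ`. -/
def partialDeriv (μ : Fin 4) (φ : Spacetime → ℝ) (x : Spacetime) : ℝ :=
  fderiv ℝ φ x (Pi.single μ 1)

/-! ### `R`-limits and `R`-integrals -/

/-- `f` has the behaviour `f r = a / r + b + O(r)` as `r → 0⁺`, so that its `R`-limit is `b`. -/
def HasRLim (f : ℝ → ℝ) (b : ℝ) : Prop :=
  ∃ a : ℝ, (fun r => f r - (a / r + b)) =O[𝓝[>] 0] (fun r => r)

/-- The `R`-limit is unique. -/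
theorem HasRLim.unique {f : ℝ → ℝ} {b b' : ℝ} (h : HasRLim f b) (h' : HasRLim f b') :
    b = b' := by
  obtain ⟨a, ha⟩ := h
  obtain ⟨a', ha'⟩ := h'
  have hid : Tendsto (fun r : ℝ => r) (𝓝[>] 0) (𝓝 0) := tendsto_nhdsWithin_of_tendsto_nhds
    (tendsto_id)
  have hd : (fun r : ℝ => (a - a') / r + (b - b')) =O[𝓝[>] 0] (fun r => r) :=
    (ha'.sub ha).congr_left (fun r => by ring)
  have h0 : Tendsto (fun r : ℝ => (a - a') / r + (b - b')) (𝓝[>] 0) (𝓝 0) :=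
    hd.trans_tendsto hid
  have h1 : Tendsto (fun r : ℝ => (a - a') + (b - b') * r) (𝓝[>] 0) (𝓝 0) := by
    have := h0.mul hid
    rw [mul_zero] at this
    refine this.congr' ?_
    filter_upwards [self_mem_nhdsWithin] with r hr
    have : r ≠ 0 := ne_of_gt hr
    field_simp
  have h2 : Tendsto (fun r : ℝ => (a - a') + (b - b') * r) (𝓝[>] 0) (𝓝 (a - a')) := by
    have := (hid.const_mul (b - b')).const_add (a - a')
    simpa using this
  have haa : a - a' = 0 := tendsto_nhds_unique h2 h1
  have h3 : Tendsto (fun r : ℝ => (a - a') / r + (b - b')) (𝓝[>] 0) (𝓝 (b - b')) := by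
    simp [haa]
  exact sub_eq_zero.mp (tendsto_nhds_unique h3 h0)

/-- The complement of the open balls of radius `r` around the points `z n`. -/
def cutoff {N : ℕ} (z : Fin N → Space) (r : ℝ) : Set Space := {x | ∀ n, r ≤ ‖x - z n‖}

/-- The `R`-integral over the whole space of the function `G` with singular points `z n` is
(well defined and) equal to `b`. -/
def HasRIntegral {N : ℕ} (z : Fin N → Space) (G : Space → ℝ) (b : ℝ) : Prop :=
  (∀ r : ℝ, 0 < r → IntegrableOn G (cutoff z r)) ∧ HasRLim (fun r => ∫ x in cutoff z r, G x) b

/-- The average of `f` over the sphere of radius `r` centred at `z`. -/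
def sphereMean (f : Space → ℝ) (z : Space) (r : ℝ) : ℝ :=
  ⨍ e : Metric.sphere (0 : Space) 1, f (z + r • (e : Space)) ∂(volume : Measure Space).toSphere

/-! ### Electromagnetic fields, given by `F^{0i} = E_i` and `F^{ij} = ε_{ijk} B_k` -/

/-- `T^{μν} = F^{μκ} F^ν_κ - (1/4) g^{μν} F^{αβ} F_{αβ}`. -/
def energyMomentum (F : Matrix (Fin 4) (Fin 4) ℝ) (μ ν : Fin 4) : ℝ :=
  ∑ κ, F μ κ * (F * metric) ν κ
    - 1 / 4 * metric μ ν * ∑ α, ∑ β, F α β * (metric * F * metric) α β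

/-! ### World-lines -/

/-- An inextendible, smooth, timelike, future-directed world-line in arbitrary parametrization. -/
structure IsWorldline (X : ℝ → Spacetime) : Prop where
  smooth : ContDiff ℝ ∞ X
  timelike : ∀ s, mdot (deriv X s) (deriv X s) < 0
  future : ∀ s, 0 < deriv X s 0
  inextendible : Function.Surjective (fun s => X s 0)

/-- The rate `dτ/ds` of proper time along a world-line. -/
def properRate (X : ℝ → Spacetime) (s : ℝ) : ℝ := √(-mdot (deriv X s) (deriv X s))

/-- The four-velocity `u = dX/dτ`. -/
def fourVelocity (X : ℝ → Spacetime) (s : ℝ) : Spacetime := (properRate X s)⁻¹ • deriv X s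

/-- The four-acceleration `du/dτ = γ du/dt`. -/
def fourAcceleration (X : ℝ → Spacetime) (s : ℝ) : Spacetime :=
  (properRate X s)⁻¹ • deriv (fourVelocity X) s

/-- `X s` is the retarded point of the world-line `X` with respect to the event `x`. -/
def IsRetarded (X : ℝ → Spacetime) (x : Spacetime) (s : ℝ) : Prop :=
  mdot (x - X s) (x - X s) = 0 ∧ X s 0 < x 0

/-- The Liénard-Wiechert field at `x` of the charge `q`, if `X s` is the retarded point:
with `w = dX/ds`,
`F^{μν} = (q/4π) (w · (x - X))⁻¹ d/ds [(w ∧ (x - X))^{μν} / (w · (x - X))]`.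
The right-hand side does not depend on the parametrization, and the field is
`∂^μ A^ν - ∂^ν A^μ` for `A^μ = -(q/4π) u^μ / (u · (x - X))`. -/
def lienardWiechert (q : ℝ) (X : ℝ → Spacetime) (x : Spacetime) (s : ℝ) (μ ν : Fin 4) : ℝ :=
  q / (4 * Real.pi) * (mdot (deriv X s) (x - X s))⁻¹ *
    deriv (fun σ => wedge (deriv X σ) (x - X σ) μ ν / mdot (deriv X σ) (x - X σ)) s

/-! ### Systems of point charges and fields -/

/-- `N` point particles and an electromagnetic field `F^{μν}`, as described in an inertial
frame. -/
structure System (N : ℕ) where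
  charge : Fin N → ℝ
  mass : Fin N → ℝ
  worldline : Fin N → ℝ → Spacetime
  field : Spacetime → Matrix (Fin 4) (Fin 4) ℝ

namespace System

variable {N : ℕ}

/-- The same system in the inertial frame with coordinates `x' = L x + a`. -/
def transform (L : Matrix (Fin 4) (Fin 4) ℝ) (a : Spacetime) (S : System N) : System N where
  charge := S.charge
  mass := S.mass
  worldline n s := L *ᵥ S.worldline n s + a
  field x := L * S.field (L⁻¹ *ᵥ (x - a)) * Lᵀ

/-- The events that lie on no world-line. -/
def vacuum (S : System N) : Set Spacetime := {x | ∀ n s, x ≠ S.worldline n s}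

/-- World-lines of particles that do not collide, and an antisymmetric field tensor, continuously
differentiable away from the world-lines, such that near each particle the difference between
the field and the retarded field of the particle is non-singular. -/
structure IsRegular (S : System N) : Prop where
  worldlines : ∀ n, IsWorldline (S.worldline n)
  noCollision : ∀ n k, n ≠ k → ∀ s s', S.worldline n s ≠ S.worldline k s'
  antisymm : ∀ x μ ν, S.field x μ ν = -S.field x ν μ
  contDiffOn : ∀ μ ν, ContDiffOn ℝ 1 (fun x => S.field x μ ν) S.vacuum
  nearParticle : ∀ n, ∃ (U : Set Spacetime) (Fext : Spacetime → Matrix (Fin 4) (Fin 4) ℝ),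
    IsOpen U ∧ (∀ s, S.worldline n s ∈ U) ∧
    (∀ μ ν, ContDiffOn ℝ 1 (fun x => Fext x μ ν) U) ∧
    ∀ x ∈ U, (∀ s, x ≠ S.worldline n s) → ∃ s, IsRetarded (S.worldline n) x s ∧
      ∀ μ ν, S.field x μ ν = lienardWiechert (S.charge n) (S.worldline n) x s μ ν + Fext x μ ν

/-- The Maxwell equations `∂_ν F^{μν} = j^μ` and `∂_κ F_{μν} + ∂_μ F_{νκ} + ∂_ν F_{κμ} = 0`, in the
sense of distributions, where `j^μ(x) = ∑ₙ qₙ ∫ (dXₙ^μ/ds) δ⁴(x - Xₙ(s)) ds` is the current of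
the point charges. -/
structure Maxwell (S : System N) : Prop where
  locallyIntegrable : ∀ μ ν, LocallyIntegrable (fun x => S.field x μ ν)
  inhomogeneous : ∀ φ : Spacetime → ℝ, ContDiff ℝ ∞ φ → HasCompactSupport φ → ∀ μ,
    -∫ x, ∑ ν, S.field x μ ν * partialDeriv ν φ x =
      ∑ n, S.charge n * ∫ s, deriv (S.worldline n) s μ * φ (S.worldline n s)
  homogeneous : ∀ φ : Spacetime → ℝ, ContDiff ℝ ∞ φ → HasCompactSupport φ → ∀ κ μ ν,
    ∫ x, ((metric * S.field x * metric) μ ν * partialDeriv κ φ x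
      + (metric * S.field x * metric) ν κ * partialDeriv μ φ x
      + (metric * S.field x * metric) κ μ * partialDeriv ν φ x) = 0

/-- The energy-momentum tensor vanishes sufficiently fast at spatial infinity: as
`O(|x|^(-3-ε))` for some `ε > 0`, in each region `|t| ≤ β |x|` with `β < 1`. -/
def VanishesAtInfinity (S : System N) : Prop :=
  ∀ β : ℝ, 0 < β → β < 1 → ∃ ε C ρ : ℝ, 0 < ε ∧ ∀ (t : ℝ) (x : Space),
    ρ ≤ ‖x‖ → |t| ≤ β * ‖x‖ → ∀ μ ν,
      |energyMomentum (S.field (event t x)) μ ν| ≤ C * ‖x‖ ^ (-3 - ε)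

/-- The value on the `n`-th world-line of the renormalized field: the `R`-limit for `r → 0` of
the average of the field over the sphere of radius `r` around the particle, at the same time. -/
def HasRenormalizedField (S : System N) (n : Fin N) (s : ℝ) (F : Matrix (Fin 4) (Fin 4) ℝ) :
    Prop :=
  ∀ μ ν, HasRLim (fun r => sphereMean
    (fun x => S.field (event (S.worldline n s 0) x) μ ν) (spatial (S.worldline n s)) r) (F μ ν)

/-- The equations of motion of the particles, `mₙ du^μ/dτ = qₙ F^{μν} u_ν` with the renormalized
field on the world-line. -/
def EquationsOfMotion (S : System N) : Prop :=
  ∀ n s, ∃ F, S.HasRenormalizedField n s F ∧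
    S.mass n • fourAcceleration (S.worldline n) s =
      S.charge n • (F *ᵥ (metric *ᵥ fourVelocity (S.worldline n) s))

/-- The parameters `s n` at which the particles are at the time `t`. -/
def AtTime (S : System N) (t : ℝ) (s : Fin N → ℝ) : Prop := ∀ n, S.worldline n (s n) 0 = t

/-- At time `t` the electromagnetic energy-momentum, the `R`-integral of `T^{0μ}` over all space,
is well defined and equal to `P`. -/
def HasFieldMomentum (S : System N) (t : ℝ) (P : Spacetime) : Prop :=
  ∃ s, S.AtTime t s ∧ ∀ μ, HasRIntegral (fun n => spatial (S.worldline n (s n)))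
    (fun x => energyMomentum (S.field (event t x)) 0 μ) (P μ)

/-- At time `t` the total energy-momentum, the electromagnetic one plus `∑ₙ mₙ uₙ`, is well
defined and equal to `P`. -/
def HasTotalMomentum (S : System N) (t : ℝ) (P : Spacetime) : Prop :=
  ∃ s, S.AtTime t s ∧ ∃ Pem, S.HasFieldMomentum t Pem ∧
    P = Pem + ∑ n, S.mass n • fourVelocity (S.worldline n) (s n)

end System

end PointCharges

end

/-!
The energy-momentum tensor `T` is divergence-free away from the world-lines, so the momenta in two
simultaneity planes differ only by what crosses the boundary of the wedge between them. Infinity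
contributes nothing because of the decay of `T`. Everything thus happens near the particles, and
the proof is the statement that, there, renormalization throws away precisely what it should.

*The near field.* At the displacement `y` from an event on a world-line, uniformly over compact
parts of the world-line and over `|y⁰| ≤ β |𝐲|` with `β < 1`, the Liénard-Wiechert field is
`F₂ + F₁ + F₀ + O(|𝐲|)`, with `F_k` homogeneous of degree `-k`, `F₂` odd, `F₁` even, and the even
part of `F₀` constant. This comes from expanding the retarded parameter to third order. Hence
`T = T₄ + T₃ + O(|𝐲|⁻²)`, homogeneous of degrees `-4` and `-3`, with `T₄` even and `T₃` odd
(`IsRegular.exists_near_stress`). In a simultaneity plane `T₄` integrates to a multiple of `1 / r`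
and `T₃` to zero, so that the `R`-integrals exist, and they may be computed with any even cutoff
instead of balls.

*Localization.* A partition of unity (`IsRegular.exists_partition`) splits the momentum in a plane
into a convergent integral `∫ T ψ` off the world-lines and one local piece for each particle. The
change of the first part between two planes is minus the sum of the integrals over the wedge of
`T · ∇ζ_n` (`Maxwell.integral_sub_integral`): `T` is classically conserved in the vacuum, and the
divergence theorem for the wedge holds for the cutoff functions.

*Two planes through the same event of a world-line.* Then the local piece changes by the integral
of `T · ∇ζ_n` over the wedge and nothing else (`IsLocalizer.sub_eq_of_same_event`): after removing
a neighbourhood of the event by a cutoff of size `r`, the error is the wedge integral of `T` against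
the gradient of that cutoff; `T₄` gives a multiple of `1 / r` by scaling, and `T₃` gives zero since
`T₃`, the sign of the wedge, and the gradient are all odd.

*Two parallel planes.* Cut out a tube of radius `r` around the world-line. The momentum that it
loses per unit time is `A / r` plus a constant plus `O(r)`. The constant is bilinear in `F₂` and
the regular field, by parity; Gauss's law for `F₂` evaluates its longitudinal part as the force of
the renormalized field, and its transverse part vanishes by axial symmetry
(`IsRegular.exists_tube_flux`). With the equation of motion this is the opposite of the change of
`m u` (`IsLocalizer.sub_eq_of_motion`).

Adding the pieces, all terms `T · ∇ζ_n` cancel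
(`IsRegular.exists_hasRIntegral_fluxDensity`). For a single particle only planes through the same
event are compared, so no equation of motion is needed.
-/

noncomputable section

namespace PointCharges

/-! ### Algebra of Minkowski space -/

lemma mdot_eq (x y : Spacetime) :
    mdot x y = -(x 0 * y 0) + (x 1 * y 1 + x 2 * y 2 + x 3 * y 3) := by
  simp [mdot, metric, dotProduct, Matrix.mulVec_diagonal, Fin.sum_univ_four]
  ring

lemma mdot_comm (x y : Spacetime) : mdot x y = mdot y x := by simp only [mdot_eq]; ring
lemma mdot_add_left (x y z : Spacetime) : mdot (x + y) z = mdot x z + mdot y z := by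
  simp only [mdot_eq, Pi.add_apply]; ring
lemma mdot_add_right (x y z : Spacetime) : mdot x (y + z) = mdot x y + mdot x z := by
  simp only [mdot_eq, Pi.add_apply]; ring
lemma mdot_sub_left (x y z : Spacetime) : mdot (x - y) z = mdot x z - mdot y z := by
  simp only [mdot_eq, Pi.sub_apply]; ring
lemma mdot_sub_right (x y z : Spacetime) : mdot x (y - z) = mdot x y - mdot x z := by
  simp only [mdot_eq, Pi.sub_apply]; ring
lemma mdot_smul_left (c : ℝ) (x y : Spacetime) : mdot (c • x) y = c * mdot x y := by
  simp only [mdot_eq, Pi.smul_apply, smul_eq_mul]; ring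
lemma mdot_smul_right (c : ℝ) (x y : Spacetime) : mdot x (c • y) = c * mdot x y := by
  simp only [mdot_eq, Pi.smul_apply, smul_eq_mul]; ring
lemma mdot_neg_left (x y : Spacetime) : mdot (-x) y = -mdot x y := by
  simp only [mdot_eq, Pi.neg_apply]; ring
lemma mdot_neg_right (x y : Spacetime) : mdot x (-y) = -mdot x y := by
  simp only [mdot_eq, Pi.neg_apply]; ring

/-- The spatial projection as a continuous linear map. -/
def spatialL : Spacetime →L[ℝ] Space :=
  LinearMap.toContinuousLinearMap
    { toFun := spatial
      map_add' := fun x y => by ext i; simp [spatial]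
      map_smul' := fun c x => by ext i; simp [spatial] }

@[simp] lemma spatialL_apply (x : Spacetime) : spatialL x = spatial x := rfl

@[simp] lemma spatial_apply (x : Spacetime) (i : Fin 3) : spatial x i = x i.succ := rfl

lemma spatial_add (x y : Spacetime) : spatial (x + y) = spatial x + spatial y :=
  spatialL.map_add x y
lemma spatial_sub (x y : Spacetime) : spatial (x - y) = spatial x - spatial y :=
  spatialL.map_sub x y
lemma spatial_neg (x : Spacetime) : spatial (-x) = -spatial x := spatialL.map_neg x
lemma spatial_smul (c : ℝ) (x : Spacetime) : spatial (c • x) = c • spatial x :=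
  spatialL.map_smul c x

@[simp] lemma event_zero (t : ℝ) (x : Space) : event t x 0 = t := rfl
@[simp] lemma event_succ (t : ℝ) (x : Space) (i : Fin 3) : event t x i.succ = x i := rfl
@[simp] lemma spatial_event (t : ℝ) (x : Space) : spatial (event t x) = x := by ext i; simp

@[simp] lemma event_spatial (x : Spacetime) : event (x 0) (spatial x) = x := by
  ext i; refine Fin.cases ?_ (fun j => ?_) i <;> simp

lemma spacetime_ext {x y : Spacetime} (h0 : x 0 = y 0) (h : spatial x = spatial y) : x = y := by
  rw [← event_spatial x, ← event_spatial y, h0, h]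

lemma event_add (t t' : ℝ) (x x' : Space) : event (t + t') (x + x') = event t x + event t' x' :=
  spacetime_ext rfl (by simp [spatial_add])
lemma event_smul (c t : ℝ) (x : Space) : event (c * t) (c • x) = c • event t x :=
  spacetime_ext rfl (by simp [spatial_smul])

/-- Splitting of space-time into time and space, as a continuous linear map. -/
def eventL : ℝ × Space →L[ℝ] Spacetime :=
  LinearMap.toContinuousLinearMap
    { toFun := fun p => event p.1 p.2
      map_add' := fun _ _ => event_add _ _ _ _
      map_smul' := fun _ _ => event_smul _ _ _ }

lemma continuous_event : Continuous (fun p : ℝ × Space => event p.1 p.2) := eventL.continuous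
lemma continuous_spatial : Continuous spatial := spatialL.continuous

lemma mdot_eq_inner (x y : Spacetime) :
    mdot x y = -(x 0 * y 0) + inner ℝ (spatial x) (spatial y) := by
  rw [mdot_eq, PiLp.inner_apply]
  simp only [Fin.sum_univ_three, spatial_apply]
  simp only [RCLike.inner_apply, conj_trivial]
  have : (Fin.succ 0 : Fin 4) = 1 := rfl
  have h2 : (Fin.succ 1 : Fin 4) = 2 := rfl
  have h3 : (Fin.succ 2 : Fin 4) = 3 := rfl
  rw [this, h2, h3]; ring

lemma mdot_self_eq (x : Spacetime) : mdot x x = -(x 0) ^ 2 + ‖spatial x‖ ^ 2 := by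
  rw [mdot_eq_inner, real_inner_self_eq_norm_sq]; ring

lemma abs_le_norm (x : Spacetime) (i : Fin 4) : |x i| ≤ ‖x‖ := norm_le_pi_norm x i

lemma norm_spatial_le_two_mul (x : Spacetime) : ‖spatial x‖ ≤ 2 * ‖x‖ := by
  rw [EuclideanSpace.norm_eq]
  refine Real.sqrt_le_iff.2 ⟨by positivity, ?_⟩
  have h : ∀ i : Fin 3, ‖spatial x i‖ ^ 2 ≤ ‖x‖ ^ 2 := fun i => by
    gcongr; exact norm_le_pi_norm x _
  calc ∑ i, ‖spatial x i‖ ^ 2 ≤ ∑ _i : Fin 3, ‖x‖ ^ 2 := Finset.sum_le_sum fun i _ => h i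
    _ = 3 * ‖x‖ ^ 2 := by simp
    _ ≤ (2 * ‖x‖) ^ 2 := by nlinarith [sq_nonneg ‖x‖]

lemma norm_le_of_spatial (x : Spacetime) : ‖x‖ ≤ max |x 0| ‖spatial x‖ := by
  rw [pi_norm_le_iff_of_nonneg (by positivity)]
  intro i
  refine Fin.cases (le_max_left _ _) (fun j => le_max_of_le_right ?_) i
  exact PiLp.norm_apply_le (spatial x) j

lemma abs_mdot_le (x y : Spacetime) : |mdot x y| ≤ 4 * ‖x‖ * ‖y‖ := by
  rw [mdot_eq]
  have h : ∀ i, |x i * y i| ≤ ‖x‖ * ‖y‖ := fun i => by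
    rw [abs_mul]
    exact mul_le_mul (abs_le_norm x i) (abs_le_norm y i) (abs_nonneg _) (norm_nonneg _)
  have h0 := abs_le.1 (h 0); have h1 := abs_le.1 (h 1)
  have h2 := abs_le.1 (h 2); have h3 := abs_le.1 (h 3)
  rw [abs_le]; constructor <;> linarith

lemma continuous_mdot : Continuous fun p : Spacetime × Spacetime => mdot p.1 p.2 := by
  simp only [mdot_eq]; fun_prop

lemma abs_wedge_le (x y : Spacetime) (μ ν : Fin 4) : |wedge x y μ ν| ≤ 2 * ‖x‖ * ‖y‖ := by
  unfold wedge
  have h : ∀ i j, |x i * y j| ≤ ‖x‖ * ‖y‖ := fun i j => by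
    rw [abs_mul]
    exact mul_le_mul (abs_le_norm x i) (abs_le_norm y j) (abs_nonneg _) (norm_nonneg _)
  have h0 := abs_le.1 (h μ ν); have h1 := abs_le.1 (h ν μ)
  rw [abs_le]; constructor <;> linarith

/-! ### Causal vectors and Lorentz transformations -/

lemma norm_spatial_lt_of_timelike {u : Spacetime} (h : mdot u u < 0) (h0 : 0 < u 0) :
    ‖spatial u‖ < u 0 := by
  rw [mdot_self_eq] at h
  nlinarith [norm_nonneg (spatial u)]

lemma norm_spatial_eq_of_null {k : Spacetime} (h : mdot k k = 0) (h0 : 0 < k 0) :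
    ‖spatial k‖ = k 0 := by
  rw [mdot_self_eq] at h
  have h1 : (‖spatial k‖ - k 0) * (‖spatial k‖ + k 0) = 0 := by nlinarith
  rcases mul_eq_zero.1 h1 with h2 | h2
  · linarith
  · nlinarith [norm_nonneg (spatial k)]

lemma mdot_neg_of_future {u k : Spacetime} (hu : ‖spatial u‖ < u 0) (hk : ‖spatial k‖ ≤ k 0)
    (hk0 : 0 < k 0) : mdot u k < 0 := by
  rw [mdot_eq_inner]
  have h := real_inner_le_norm (spatial u) (spatial k)
  nlinarith [norm_nonneg (spatial k), norm_nonneg (spatial u)]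

lemma metric_mul_metric : metric * metric = 1 := by
  rw [metric, Matrix.diagonal_mul_diagonal, ← Matrix.diagonal_one]
  congr 1; ext i; fin_cases i <;> simp

namespace IsLorentz

variable {L : Matrix (Fin 4) (Fin 4) ℝ}

lemma left_inv (hL : IsLorentz L) : (metric * Lᵀ * metric) * L = 1 := by
  rw [Matrix.mul_assoc, Matrix.mul_assoc, ← Matrix.mul_assoc Lᵀ, hL.1, metric_mul_metric]

lemma inv_eq (hL : IsLorentz L) : L⁻¹ = metric * Lᵀ * metric :=
  Matrix.inv_eq_left_inv hL.left_inv

lemma mul_inv (hL : IsLorentz L) : L * L⁻¹ = 1 := by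
  rw [hL.inv_eq]; exact mul_eq_one_comm.1 hL.left_inv

lemma inv_mul (hL : IsLorentz L) : L⁻¹ * L = 1 := by rw [hL.inv_eq]; exact hL.left_inv

lemma mul_metric_mul_transpose (hL : IsLorentz L) : L * metric * Lᵀ = metric := by
  have h := hL.mul_inv
  rw [hL.inv_eq] at h
  calc L * metric * Lᵀ = L * (metric * Lᵀ * metric) * metric := by
        simp only [Matrix.mul_assoc, metric_mul_metric, Matrix.mul_one]
    _ = metric := by rw [h, Matrix.one_mul]

lemma abs_det (hL : IsLorentz L) : |L.det| = 1 := by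
  have h := congrArg Matrix.det hL.left_inv
  have hm : metric.det * metric.det = 1 := by
    rw [← Matrix.det_mul, metric_mul_metric, Matrix.det_one]
  simp only [Matrix.det_mul, Matrix.det_transpose, Matrix.det_one] at h
  have : L.det * L.det = 1 := by linear_combination h - L.det * L.det * hm
  rw [← sq_eq_sq₀ (abs_nonneg _) zero_le_one, sq_abs]; linarith

lemma mdot_mulVec (hL : IsLorentz L) (x y : Spacetime) : mdot (L *ᵥ x) (L *ᵥ y) = mdot x y := by
  unfold mdot
  conv_rhs => rw [← hL.1]
  rw [← Matrix.mulVec_mulVec, ← Matrix.mulVec_mulVec, Matrix.dotProduct_mulVec x,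
    Matrix.vecMul_transpose]

/-- A Lorentz transformation that preserves the direction of time keeps future-directed causal
vectors future-directed: the rows of `L` satisfy `∑ (L 0 i)² = (L 0 0)² - 1`. -/
lemma future (hL : IsLorentz L) {k : Spacetime} (hk : ‖spatial k‖ ≤ k 0) (hk0 : 0 < k 0) :
    0 < (L *ᵥ k) 0 := by
  have h := congrFun (congrFun hL.mul_metric_mul_transpose 0) 0
  rw [metric, Matrix.mul_apply] at h
  simp [Matrix.mul_diagonal, Fin.sum_univ_four] at h
  have hk2 : k 1 ^ 2 + k 2 ^ 2 + k 3 ^ 2 ≤ k 0 ^ 2 := by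
    have h1 : ‖spatial k‖ ^ 2 ≤ k 0 ^ 2 := by gcongr
    have h2 : ‖spatial k‖ ^ 2 = k 1 ^ 2 + k 2 ^ 2 + k 3 ^ 2 := by
      have e1 := mdot_self_eq k
      have e2 := mdot_eq k k
      linarith
    linarith
  have hL0 := hL.2
  have e : (L *ᵥ k) 0 = L 0 0 * k 0 + (L 0 1 * k 1 + L 0 2 * k 2 + L 0 3 * k 3) := by
    simp [Matrix.mulVec, dotProduct, Fin.sum_univ_four]; ring
  rw [e]
  have cs : (L 0 1 * k 1 + L 0 2 * k 2 + L 0 3 * k 3) ^ 2 ≤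
      (L 0 1 ^ 2 + L 0 2 ^ 2 + L 0 3 ^ 2) * (k 1 ^ 2 + k 2 ^ 2 + k 3 ^ 2) := by
    nlinarith [sq_nonneg (L 0 1 * k 2 - L 0 2 * k 1), sq_nonneg (L 0 1 * k 3 - L 0 3 * k 1),
      sq_nonneg (L 0 2 * k 3 - L 0 3 * k 2)]
  have hlt : (L 0 1 * k 1 + L 0 2 * k 2 + L 0 3 * k 3) ^ 2 < (L 0 0 * k 0) ^ 2 := by
    have h3 : L 0 1 ^ 2 + L 0 2 ^ 2 + L 0 3 ^ 2 = L 0 0 ^ 2 - 1 := by linarith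
    rw [h3] at cs
    have : (0 : ℝ) ≤ L 0 0 ^ 2 - 1 := by rw [← h3]; positivity
    nlinarith [mul_le_mul_of_nonneg_left hk2 this, sq_nonneg (L 0 0), pow_pos hk0 2]
  have := abs_lt_of_sq_lt_sq hlt (by positivity)
  linarith [(abs_lt.1 this).1]

lemma inv (hL : IsLorentz L) : IsLorentz L⁻¹ := by
  have h := hL.mul_metric_mul_transpose
  constructor
  · have h1 : (L⁻¹)ᵀ = metric * L * metric := by
      rw [hL.inv_eq]
      simp only [Matrix.transpose_mul, Matrix.transpose_transpose, metric,
        Matrix.diagonal_transpose, Matrix.mul_assoc]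
    rw [h1, hL.inv_eq]
    calc metric * L * metric * metric * (metric * Lᵀ * metric)
        = metric * L * (metric * metric) * metric * Lᵀ * metric := by
          simp only [Matrix.mul_assoc]
      _ = metric * (L * metric * Lᵀ) * metric := by
          rw [metric_mul_metric]; simp only [Matrix.mul_assoc, Matrix.mul_one]
      _ = metric := by rw [h, metric_mul_metric, Matrix.one_mul]
  · rw [hL.inv_eq, metric, Matrix.mul_diagonal, Matrix.diagonal_mul]
    simpa using hL.2

lemma mulVec_inv (hL : IsLorentz L) (x : Spacetime) : L *ᵥ (L⁻¹ *ᵥ x) = x := by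
  rw [Matrix.mulVec_mulVec, hL.mul_inv, Matrix.one_mulVec]

lemma inv_mulVec (hL : IsLorentz L) (x : Spacetime) : L⁻¹ *ᵥ (L *ᵥ x) = x := by
  rw [Matrix.mulVec_mulVec, hL.inv_mul, Matrix.one_mulVec]

end IsLorentz

/-! ### World-lines -/

namespace IsWorldline

variable {X : ℝ → Spacetime}

lemma differentiable (hX : IsWorldline X) : Differentiable ℝ X :=
  hX.smooth.differentiable (by simp)

lemma hasDerivAt (hX : IsWorldline X) (s : ℝ) : HasDerivAt X (deriv X s) s :=
  (hX.differentiable s).hasDerivAt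

lemma contDiff_deriv (hX : IsWorldline X) : ContDiff ℝ ∞ (deriv X) :=
  (contDiff_infty_iff_deriv.1 hX.smooth).2

lemma continuous (hX : IsWorldline X) : Continuous X := hX.smooth.continuous

lemma continuous_deriv (hX : IsWorldline X) : Continuous (deriv X) := hX.contDiff_deriv.continuous

lemma speed_lt (hX : IsWorldline X) (s : ℝ) : ‖spatial (deriv X s)‖ < deriv X s 0 :=
  norm_spatial_lt_of_timelike (hX.timelike s) (hX.future s)

lemma hasDerivAt_apply (hX : IsWorldline X) (s : ℝ) (i : Fin 4) :
    HasDerivAt (fun s => X s i) (deriv X s i) s := hasDerivAt_pi.1 (hX.hasDerivAt s) i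

lemma hasDerivAt_spatial (hX : IsWorldline X) (s : ℝ) :
    HasDerivAt (fun s => spatial (X s)) (spatial (deriv X s)) s :=
  spatialL.hasFDerivAt.comp_hasDerivAt s (hX.hasDerivAt s)

lemma strictMono_time (hX : IsWorldline X) : StrictMono fun s => X s 0 :=
  strictMono_of_deriv_pos fun s => by rw [(hX.hasDerivAt_apply s 0).deriv]; exact hX.future s

/-- If the speed is at most `v` in an interval, so is the slope of the chords. -/
lemma norm_chord_le (hX : IsWorldline X) {A B v : ℝ}
    (hv : ∀ s ∈ Set.Icc A B, ‖spatial (deriv X s)‖ ≤ v * deriv X s 0) {s s' : ℝ}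
    (hs : s ∈ Set.Icc A B) (hs' : s' ∈ Set.Icc A B) (h : s ≤ s') :
    ‖spatial (X s' - X s)‖ ≤ v * (X s' 0 - X s 0) := by
  have key : ∀ e : Space, ‖e‖ = 1 → inner ℝ e (spatial (X s' - X s)) ≤ v * (X s' 0 - X s 0) := by
    intro e he
    have hd : ∀ s, HasDerivAt (fun s => v * X s 0 - inner ℝ e (spatial (X s)))
        (v * deriv X s 0 - inner ℝ e (spatial (deriv X s))) s := fun s =>
      ((hX.hasDerivAt_apply s 0).const_mul v).sub
        ((innerSL ℝ e).hasFDerivAt.comp_hasDerivAt s (hX.hasDerivAt_spatial s))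
    have hm : MonotoneOn (fun s => v * X s 0 - inner ℝ e (spatial (X s))) (Set.Icc A B) := by
      refine monotoneOn_of_deriv_nonneg (convex_Icc A B)
        (fun s _ => (hd s).continuousAt.continuousWithinAt)
        (fun s _ => (hd s).differentiableAt.differentiableWithinAt) fun s hs => ?_
      rw [(hd s).deriv]
      have := real_inner_le_norm e (spatial (deriv X s))
      rw [he, one_mul] at this
      linarith [hv s (interior_subset hs)]
    have := hm hs hs' h
    simp only [spatial_sub, inner_sub_right] at this ⊢
    linarith
  by_cases h0 : spatial (X s' - X s) = 0
  · have h1 : v * X s 0 ≤ v * X s' 0 := by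
      have := key (EuclideanSpace.single 0 1) (by simp)
      rw [h0] at this; simp at this; linarith
    rw [h0, norm_zero]; linarith
  · have hn : ‖spatial (X s' - X s)‖ ≠ 0 := by simpa using h0
    have := key (‖spatial (X s' - X s)‖⁻¹ • spatial (X s' - X s)) (by
      rw [norm_smul, norm_inv, norm_norm, inv_mul_cancel₀ hn])
    rw [inner_smul_left, real_inner_self_eq_norm_sq] at this
    simp only [conj_trivial] at this
    rwa [sq, inv_mul_cancel_left₀ hn] at this

lemma exists_speed_bound (hX : IsWorldline X) (A B : ℝ) : ∃ v : ℝ, 0 ≤ v ∧ v < 1 ∧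
    ∀ s ∈ Set.Icc A B, ‖spatial (deriv X s)‖ ≤ v * deriv X s 0 := by
  rcases (Set.Icc A B).eq_empty_or_nonempty with he | hne
  · exact ⟨0, le_rfl, one_pos, by simp [he]⟩
  have hc : ContinuousOn (fun s => ‖spatial (deriv X s)‖ / deriv X s 0) (Set.Icc A B) := by
    refine ContinuousOn.div ?_ ?_ fun s _ => (hX.future s).ne'
    · exact (continuous_spatial.comp hX.continuous_deriv).norm.continuousOn
    · exact ((continuous_apply 0).comp hX.continuous_deriv).continuousOn
  obtain ⟨m, hm, hmax⟩ := isCompact_Icc.exists_isMaxOn hne hc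
  refine ⟨_, div_nonneg (norm_nonneg _) (hX.future m).le,
    (div_lt_one (hX.future m)).2 (hX.speed_lt m), fun s hs => ?_⟩
  have := hmax hs
  exact (div_le_iff₀ (hX.future s)).1 this

lemma chord_lt (hX : IsWorldline X) {s s' : ℝ} (h : s < s') :
    ‖spatial (X s' - X s)‖ < X s' 0 - X s 0 := by
  obtain ⟨v, _, hv, hb⟩ := hX.exists_speed_bound s s'
  have := hX.norm_chord_le hb (Set.left_mem_Icc.2 h.le) (Set.right_mem_Icc.2 h.le) h.le
  nlinarith [hX.strictMono_time h]

/-- Two events on a world-line are at timelike separation. -/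
lemma norm_spatial_sub_lt (hX : IsWorldline X) {s s' : ℝ} (h : s ≠ s') :
    ‖spatial (X s' - X s)‖ < |(X s' - X s) 0| := by
  rcases lt_or_gt_of_ne h with h | h
  · exact (hX.chord_lt h).trans_le (le_abs_self _)
  · rw [← norm_neg, ← spatial_neg, neg_sub]
    refine (hX.chord_lt h).trans_le ?_
    rw [Pi.sub_apply, abs_sub_comm]; exact le_abs_self _

/-- The function which vanishes at the retarded point is strictly decreasing. -/
lemma strictAnti_delay (hX : IsWorldline X) (x : Spacetime) :
    StrictAnti fun s => x 0 - X s 0 - ‖spatial (x - X s)‖ := by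
  intro s s' h
  have h1 := hX.chord_lt h
  have h2 : ‖spatial (x - X s)‖ ≤ ‖spatial (x - X s')‖ + ‖spatial (X s' - X s)‖ := by
    refine le_trans (le_of_eq ?_) (norm_add_le _ _)
    rw [← spatial_add]; congr 2; abel
  simp only
  linarith

lemma tendsto_time_atTop (hX : IsWorldline X) : Tendsto (fun s => X s 0) atTop atTop :=
  tendsto_atTop_atTop_of_monotone hX.strictMono_time.monotone fun b =>
    (hX.inextendible b).imp fun _ h => h.ge

lemma tendsto_time_atBot (hX : IsWorldline X) : Tendsto (fun s => X s 0) atBot atBot :=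
  tendsto_atBot_atBot_of_monotone hX.strictMono_time.monotone fun b =>
    (hX.inextendible b).imp fun _ h => h.le

lemma isClosedMap (hX : IsWorldline X) : IsClosedMap X := by
  have h0 : IsProperMap ((fun x : Spacetime => x 0) ∘ X) :=
    (hX.strictMono_time.orderIsoOfSurjective _ hX.inextendible).toHomeomorph.isProperMap
  exact (isProperMap_of_comp_of_t2 hX.continuous (continuous_apply 0) h0).isClosedMap

lemma isClosed_range (hX : IsWorldline X) : IsClosed (Set.range X) :=
  hX.isClosedMap.isClosed_range

end IsWorldline

lemma IsRetarded.norm_spatial {X : ℝ → Spacetime} {x : Spacetime} {s : ℝ}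
    (h : IsRetarded X x s) : ‖spatial (x - X s)‖ = (x - X s) 0 :=
  norm_spatial_eq_of_null h.1 (sub_pos.2 h.2)

/-! ### The coefficients of the near field of a charge -/

lemma wedge_add_left (x y z : Spacetime) (μ ν : Fin 4) :
    wedge (x + y) z μ ν = wedge x z μ ν + wedge y z μ ν := by
  simp only [wedge, Pi.add_apply]; ring
lemma wedge_add_right (x y z : Spacetime) (μ ν : Fin 4) :
    wedge x (y + z) μ ν = wedge x y μ ν + wedge x z μ ν := by
  simp only [wedge, Pi.add_apply]; ring
lemma wedge_sub_right (x y z : Spacetime) (μ ν : Fin 4) :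
    wedge x (y - z) μ ν = wedge x y μ ν - wedge x z μ ν := by
  simp only [wedge, Pi.sub_apply]; ring
lemma wedge_smul_left (c : ℝ) (x y : Spacetime) (μ ν : Fin 4) :
    wedge (c • x) y μ ν = c * wedge x y μ ν := by
  simp only [wedge, Pi.smul_apply, smul_eq_mul]; ring
lemma wedge_smul_right (c : ℝ) (x y : Spacetime) (μ ν : Fin 4) :
    wedge x (c • y) μ ν = c * wedge x y μ ν := by
  simp only [wedge, Pi.smul_apply, smul_eq_mul]; ring
lemma wedge_neg_right (x y : Spacetime) (μ ν : Fin 4) :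
    wedge x (-y) μ ν = -wedge x y μ ν := by
  simp only [wedge, Pi.neg_apply]; ring
lemma wedge_self (x : Spacetime) (μ ν : Fin 4) : wedge x x μ ν = 0 := by
  simp only [wedge]; ring
lemma wedge_swap (x y : Spacetime) (μ ν : Fin 4) : wedge x y μ ν = -wedge y x μ ν := by
  simp only [wedge]; ring
namespace NearField

variable (u a b y : Spacetime)

/-- `√((u·y)² - u² y²)`, which is `√(-u²)` times the distance of `y` from the line `ℝ u` in the rest
frame of `u`. -/
def dist : ℝ := √(mdot y u ^ 2 - mdot u u * mdot y y)

/-- The first-order part of the parameter of the retarded point of `y`, on a curve with the Taylor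
expansion `h u + h² a / 2 + h³ b / 6`. -/
def h₁ : ℝ := (mdot y u + dist u y) / mdot u u

/-- The second-order part of the parameter of the retarded point. -/
def h₂ : ℝ := (h₁ u y ^ 2 * mdot y a - h₁ u y ^ 3 * mdot u a) / (2 * dist u y)

/-- The third-order part of the parameter of the retarded point. -/
def h₃ : ℝ := -(-(h₁ u y ^ 3 * mdot y b / 3) + h₁ u y ^ 4 * (mdot a a / 4 + mdot u b / 3)
  + (-(2 * h₁ u y * mdot y a) + 3 * h₁ u y ^ 2 * mdot u a) * h₂ u a y
  + mdot u u * h₂ u a y ^ 2) / (2 * dist u y)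

/-- The first-order part of the null vector `K` from the retarded point to `y`. -/
def K₀ : Spacetime := y - h₁ u y • u
/-- The second-order part of `K`. -/
def K₁ : Spacetime := -(h₂ u a y • u + (h₁ u y ^ 2 / 2) • a)
/-- The third-order part of `K`. -/
def K₂ : Spacetime :=
  -(h₃ u a b y • u + (h₁ u y * h₂ u a y) • a + (h₁ u y ^ 3 / 6) • b)

/-- The correction of first order to the tangent vector `w = u + w₁ + w₂ + ⋯` at the retarded
point. -/
def w₁ : Spacetime := h₁ u y • a
/-- The correction of second order to the tangent vector. -/
def w₂ : Spacetime := h₂ u a y • a + (h₁ u y ^ 2 / 2) • b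

/-- The leading order of `w · K`. -/
def d₀ : ℝ := mdot u (K₀ u y)
/-- The first correction to `w · K`. -/
def d₁ : ℝ := mdot u (K₁ u a y) + mdot (w₁ u a y) (K₀ u y)
/-- The second correction to `w · K`. -/
def d₂ : ℝ :=
  mdot u (K₂ u a b y) + mdot (w₁ u a y) (K₁ u a y) + mdot (w₂ u a b y) (K₀ u y)

/-- The first correction to `w · w - w' · K`, whose leading order is `u · u`. -/
def g₁ : ℝ := mdot u (w₁ u a y) + mdot (w₁ u a y) u - mdot a (K₀ u y)
/-- The second correction to `w · w - w' · K`. -/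
def g₂ : ℝ :=
  mdot u (w₂ u a b y) + mdot (w₁ u a y) (w₁ u a y) + mdot (w₂ u a b y) u
    - (mdot a (K₁ u a y) + mdot (h₁ u y • b) (K₀ u y))

variable (μ ν : Fin 4)

/-- The leading order of `w ∧ K`. -/
def e₀ : ℝ := wedge u (K₀ u y) μ ν
/-- The first correction to `w ∧ K`. -/
def e₁ : ℝ := wedge u (K₁ u a y) μ ν + wedge (w₁ u a y) (K₀ u y) μ ν
/-- The second correction to `w ∧ K`. -/
def e₂ : ℝ :=
  wedge u (K₂ u a b y) μ ν + wedge (w₁ u a y) (K₁ u a y) μ ν + wedge (w₂ u a b y) (K₀ u y) μ ν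

/-- The leading order of `(w ∧ K) (w · w - w' · K) + (w' ∧ K) (w · K)`. -/
def n₀ : ℝ := e₀ u y μ ν * mdot u u
/-- The first correction to `(w ∧ K) (w · w - w' · K) + (w' ∧ K) (w · K)`. -/
def n₁ : ℝ :=
  e₀ u y μ ν * g₁ u a y + e₁ u a y μ ν * mdot u u + wedge a (K₀ u y) μ ν * d₀ u y
/-- The second correction to `(w ∧ K) (w · w - w' · K) + (w' ∧ K) (w · K)`. -/
def n₂ : ℝ :=
  e₀ u y μ ν * g₂ u a b y + e₁ u a y μ ν * g₁ u a y + e₂ u a b y μ ν * mdot u u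
    + (wedge a (K₀ u y) μ ν * d₁ u a y
      + (wedge a (K₁ u a y) μ ν + wedge (h₁ u y • b) (K₀ u y) μ ν) * d₀ u y)

/-- The leading order of `(w · K)⁻¹`. -/
def i₀ : ℝ := (d₀ u y)⁻¹
/-- The first correction to `(w · K)⁻¹`. -/
def i₁ : ℝ := -(d₁ u a y * (d₀ u y)⁻¹ ^ 2)
/-- The second correction to `(w · K)⁻¹`. -/
def i₂ : ℝ :=
  d₁ u a y ^ 2 * (d₀ u y)⁻¹ ^ 3 - d₂ u a b y * (d₀ u y)⁻¹ ^ 2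

/-- The part of order `-2` of the near field of a unit charge (without the factor `1 / 4π`), the
Coulomb field of the uniform motion along `u`. -/
def F₂ : ℝ := n₀ u y μ ν * i₀ u y ^ 3
/-- The part of order `-1` of the near field of a unit charge (without the factor `1 / 4π`). -/
def F₁ : ℝ := n₀ u y μ ν * (3 * i₀ u y ^ 2 * i₁ u a y) + n₁ u a y μ ν * i₀ u y ^ 3
/-- The part of order `0` of the near field of a unit charge (without the factor `1 / 4π`). -/
def F₀ : ℝ :=
  n₀ u y μ ν * (3 * i₀ u y ^ 2 * i₂ u a b y + 3 * i₀ u y * i₁ u a y ^ 2)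
    + n₁ u a y μ ν * (3 * i₀ u y ^ 2 * i₁ u a y) + n₂ u a b y μ ν * i₀ u y ^ 3

/-- The radiation field on the world-line of a unit charge (without the factor `1 / 4π`). -/
def rad : ℝ :=
  2 / 3 * wedge u b μ ν / mdot u u ^ 2 - 2 * (mdot u a * wedge u a μ ν) / mdot u u ^ 3

variable {u a b y μ ν}

lemma dist_neg : dist u (-y) = dist u y := by
  simp [dist, mdot_neg_left, mdot_neg_right]

lemma d₀_eq (hu : mdot u u ≠ 0) : d₀ u y = -dist u y := by
  simp only [d₀, K₀, h₁, mdot_sub_right, mdot_smul_right, mdot_comm u y]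
  field_simp
  ring

lemma F₂_eq (hu : mdot u u ≠ 0) :
    F₂ u y μ ν = -mdot u u / dist u y ^ 3 * wedge u y μ ν := by
  simp only [F₂, n₀, e₀, i₀, d₀_eq hu, K₀, wedge_sub_right, wedge_smul_right, wedge_self]
  rw [show (-dist u y)⁻¹ ^ 3 = -(dist u y ^ 3)⁻¹ by rw [← inv_pow, inv_neg]; ring]
  ring

lemma F₂_neg (hu : mdot u u ≠ 0) : F₂ u (-y) μ ν = -F₂ u y μ ν := by
  rw [F₂_eq hu, F₂_eq hu, dist_neg, wedge_neg_right]; ring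

lemma F₁_neg (hu : mdot u u ≠ 0) (hS : dist u y ≠ 0) : F₁ u a (-y) μ ν = F₁ u a y μ ν := by
  simp only [F₁, i₀, i₁, d₀_eq hu]
  simp only [n₀, n₁, e₀, e₁, g₁, d₀_eq hu, d₁, K₀, K₁, w₁, h₂, h₁, dist_neg, mdot_neg_left,
    mdot_neg_right, mdot_add_right, mdot_sub_right, mdot_smul_left, mdot_smul_right,
    wedge_add_right, wedge_sub_right, wedge_smul_left, wedge_smul_right,
    wedge_neg_right, wedge_self, mdot_comm a y, mdot_comm a u, wedge_swap a u]
  generalize mdot u u = uu at *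
  generalize mdot y u = yu at *
  generalize mdot y a = ya at *
  generalize mdot u a = ua at *
  generalize wedge u y μ ν = Wuy at *
  generalize wedge a y μ ν = Way at *
  generalize wedge u a μ ν = Wua at *
  generalize dist u y = S at *
  field_simp
  ring

lemma F₀_add_neg (hu : mdot u u ≠ 0) (hS : dist u y ≠ 0) :
    F₀ u a b y μ ν + F₀ u a b (-y) μ ν = 2 * rad u a b μ ν := by
  simp only [F₀, i₀, i₁, i₂, d₀_eq hu, rad]
  simp only [n₀, n₁, n₂, e₀, e₁, e₂, g₁, g₂, d₀_eq hu, d₁, d₂, K₀, K₁, K₂, w₁, w₂, h₃, h₂, h₁,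
    dist_neg, mdot_neg_left,
    mdot_neg_right, mdot_add_left, mdot_add_right, mdot_sub_right, mdot_smul_left, mdot_smul_right,
    wedge_add_left, wedge_add_right, wedge_sub_right, wedge_smul_left, wedge_smul_right,
    wedge_neg_right, wedge_self, mdot_comm a y, mdot_comm b y, mdot_comm a u,
    mdot_comm b u, wedge_swap a u, wedge_swap b u]
  generalize mdot u u = uu at *
  generalize mdot y u = yu at *
  generalize mdot y a = ya at *
  generalize mdot y b = yb at *
  generalize mdot u a = ua at *
  generalize mdot u b = ub at *
  generalize mdot a a = aa at *
  generalize mdot a b = ab at *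
  generalize wedge u y μ ν = Wuy at *
  generalize wedge a y μ ν = Way at *
  generalize wedge b y μ ν = Wby at *
  generalize wedge u a μ ν = Wua at *
  generalize wedge u b μ ν = Wub at *
  generalize wedge a b μ ν = Wab at *
  generalize dist u y = S at *
  field_simp
  ring

lemma dist_smul {r : ℝ} (hr : 0 < r) : dist u (r • y) = r * dist u y := by
  simp only [dist, mdot_smul_left, mdot_smul_right]
  rw [show (r * mdot y u) ^ 2 - mdot u u * (r * (r * mdot y y))
    = r ^ 2 * (mdot y u ^ 2 - mdot u u * mdot y y) by ring, Real.sqrt_mul (by positivity),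
    Real.sqrt_sq hr.le]

lemma F₂_smul (hu : mdot u u ≠ 0) {r : ℝ} (hr : 0 < r) :
    F₂ u (r • y) μ ν = (r ^ 2)⁻¹ * F₂ u y μ ν := by
  rw [F₂_eq hu, F₂_eq hu, dist_smul hr, wedge_smul_right, mul_pow, div_eq_mul_inv, mul_inv]
  field_simp

lemma F₁_smul (hu : mdot u u ≠ 0) (hS : dist u y ≠ 0) {r : ℝ} (hr : 0 < r) :
    F₁ u a (r • y) μ ν = r⁻¹ * F₁ u a y μ ν := by
  simp only [F₁, i₀, i₁, d₀_eq hu]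
  simp only [n₀, n₁, e₀, e₁, g₁, d₀_eq hu, d₁, K₀, K₁, w₁, h₂, h₁, dist_smul hr, mdot_neg_right,
    mdot_add_right, mdot_sub_right, mdot_smul_left, mdot_smul_right,
    wedge_add_right, wedge_sub_right, wedge_smul_left, wedge_smul_right,
    wedge_neg_right, wedge_self, mdot_comm a u]
  generalize mdot u u = uu at *
  generalize mdot y u = yu at *
  generalize mdot y a = ya at *
  generalize mdot a y = ya' at *
  generalize mdot u a = ua at *
  generalize wedge u y μ ν = Wuy at *
  generalize wedge a y μ ν = Way at *
  generalize wedge u a μ ν = Wua at *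
  generalize wedge a u μ ν = Wau at *
  generalize dist u y = S at *
  field_simp

lemma measurable_mdot_left (v : Spacetime) : Measurable fun y => mdot y v := by
  simp only [mdot_eq]; fun_prop
lemma measurable_dist : Measurable fun y => dist u y := by
  unfold dist; simp only [mdot_eq]; fun_prop

lemma measurable_h₁ : Measurable fun y => h₁ u y := by
  unfold h₁
  exact ((measurable_mdot_left u).add measurable_dist).div_const _

lemma measurable_h₂ : Measurable fun y => h₂ u a y := by
  have := measurable_h₁ (u := u); have := measurable_dist (u := u)
  have := measurable_mdot_left a
  unfold h₂; fun_prop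

lemma measurable_F₂ : Measurable fun y => F₂ u y μ ν := by
  have := measurable_h₁ (u := u)
  unfold F₂ n₀ e₀ i₀ d₀ K₀
  simp only [mdot_eq, wedge, Pi.sub_apply, Pi.smul_apply, smul_eq_mul]
  fun_prop

lemma measurable_F₁ : Measurable fun y => F₁ u a y μ ν := by
  have := measurable_h₁ (u := u); have := measurable_h₂ (u := u) (a := a)
  unfold F₁ n₁ n₀ e₁ e₀ g₁ i₁ i₀ d₁ d₀ w₁ K₁ K₀
  simp only [mdot_eq, wedge, Pi.sub_apply, Pi.smul_apply, Pi.neg_apply, Pi.add_apply, smul_eq_mul]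
  fun_prop

end NearField

/-! ### Expansions in powers of a small quantity -/

/-- The function `f` has the expansion `f = f₀ + f₁ + f₂ + O(r ^ (k + 3))` along `l`, with
`fᵢ = O(r ^ (k + i))`. -/
structure Jet {α E : Type*} [NormedAddCommGroup E] (l : Filter α) (r : α → ℝ) (k : ℤ)
    (f f₀ f₁ f₂ : α → E) : Prop where
  zero : f₀ =O[l] fun p => r p ^ k
  one : f₁ =O[l] fun p => r p ^ (k + 1)
  two : f₂ =O[l] fun p => r p ^ (k + 2)
  rem : (fun p => f p - (f₀ p + f₁ p + f₂ p)) =O[l] fun p => r p ^ (k + 3)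

section Jet

variable {α E F G : Type*} [NormedAddCommGroup E] [NormedAddCommGroup F] [NormedAddCommGroup G]
  {l : Filter α} {r : α → ℝ} {k m : ℤ}

lemma isBigO_zpow_of_le (hr : Tendsto r l (𝓝[>] 0)) {k m : ℤ} (h : k ≤ m) :
    (fun p => r p ^ m) =O[l] fun p => r p ^ k := by
  have h1 : ∀ᶠ p in l, r p ∈ Set.Ioc (0 : ℝ) 1 := hr (Ioc_mem_nhdsGT one_pos)
  refine IsBigO.of_bound 1 (h1.mono fun p hp => ?_)
  rw [one_mul, Real.norm_of_nonneg (zpow_nonneg hp.1.le _),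
    Real.norm_of_nonneg (zpow_nonneg hp.1.le _)]
  exact zpow_le_zpow_right_of_le_one₀ hp.1 hp.2 h

lemma isBigO_zpow_mul (hr : Tendsto r l (𝓝[>] 0)) (k m : ℤ) {n : ℤ} (h : n ≤ k + m) :
    (fun p => r p ^ k * r p ^ m) =O[l] fun p => r p ^ n := by
  have h1 : ∀ᶠ p in l, r p ∈ Set.Ioi (0 : ℝ) := hr self_mem_nhdsWithin
  refine IsBigO.trans ?_ (isBigO_zpow_of_le hr h)
  refine EventuallyEq.isBigO (h1.mono fun p hp => ?_)
  exact (zpow_add₀ (ne_of_gt hp) _ _).symm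

lemma IsBigO.mul_zpow (hr : Tendsto r l (𝓝[>] 0)) {f g : α → ℝ} {k m n : ℤ}
    (hf : f =O[l] fun p => r p ^ k) (hg : g =O[l] fun p => r p ^ m) (h : n ≤ k + m) :
    (fun p => f p * g p) =O[l] fun p => r p ^ n :=
  (hf.mul hg).trans (isBigO_zpow_mul hr k m h)

lemma IsBigO.bilin_zpow [NormedSpace ℝ E] [NormedSpace ℝ F] [NormedSpace ℝ G]
    (hr : Tendsto r l (𝓝[>] 0)) (B : E →L[ℝ] F →L[ℝ] G) {f : α → E} {g : α → F} {k m n : ℤ}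
    (hf : f =O[l] fun p => r p ^ k) (hg : g =O[l] fun p => r p ^ m) (h : n ≤ k + m) :
    (fun p => B (f p) (g p)) =O[l] fun p => r p ^ n := by
  refine IsBigO.trans ?_ (IsBigO.mul_zpow hr hf.norm_left hg.norm_left h)
  refine IsBigO.of_bound ‖B‖ (Eventually.of_forall fun p => ?_)
  rw [norm_mul, norm_norm, norm_norm, ← mul_assoc]
  exact B.le_opNorm₂ _ _

lemma IsBigO.weaken (hr : Tendsto r l (𝓝[>] 0)) {f : α → E} {k m : ℤ}
    (hf : f =O[l] fun p => r p ^ k) (h : m ≤ k) : f =O[l] fun p => r p ^ m :=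
  hf.trans (isBigO_zpow_of_le hr h)

namespace Jet

variable {f f₀ f₁ f₂ g g₀ g₁ g₂ : α → E}

lemma isBigO (hr : Tendsto r l (𝓝[>] 0)) (h : Jet l r k f f₀ f₁ f₂) :
    f =O[l] fun p => r p ^ k := by
  have := (IsBigO.weaken hr h.rem (m := k) (by omega)).add
    ((h.zero.add (IsBigO.weaken hr h.one (m := k) (by omega))).add
      (IsBigO.weaken hr h.two (m := k) (by omega)))
  exact this.congr_left fun p => by abel

lemma congr (h : Jet l r k f f₀ f₁ f₂) {f' f₀' f₁' f₂' : α → E} (e : f =ᶠ[l] f')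
    (e₀ : f₀ =ᶠ[l] f₀') (e₁ : f₁ =ᶠ[l] f₁') (e₂ : f₂ =ᶠ[l] f₂') : Jet l r k f' f₀' f₁' f₂' :=
  ⟨h.zero.congr' e₀ .rfl, h.one.congr' e₁ .rfl, h.two.congr' e₂ .rfl,
    h.rem.congr' (by filter_upwards [e, e₀, e₁, e₂] with p h h0 h1 h2; rw [h, h0, h1, h2]) .rfl⟩

lemma add (hf : Jet l r k f f₀ f₁ f₂) (hg : Jet l r k g g₀ g₁ g₂) :
    Jet l r k (fun p => f p + g p) (fun p => f₀ p + g₀ p) (fun p => f₁ p + g₁ p)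
      (fun p => f₂ p + g₂ p) :=
  ⟨hf.zero.add hg.zero, hf.one.add hg.one, hf.two.add hg.two,
    (hf.rem.add hg.rem).congr_left fun p => by abel⟩

lemma sub (hf : Jet l r k f f₀ f₁ f₂) (hg : Jet l r k g g₀ g₁ g₂) :
    Jet l r k (fun p => f p - g p) (fun p => f₀ p - g₀ p) (fun p => f₁ p - g₁ p)
      (fun p => f₂ p - g₂ p) :=
  ⟨hf.zero.sub hg.zero, hf.one.sub hg.one, hf.two.sub hg.two,
    (hf.rem.sub hg.rem).congr_left fun p => by abel⟩

lemma of_isBigO (hf : f =O[l] fun p => r p ^ k) : Jet l r k f f 0 0 :=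
  ⟨hf, isBigO_zero _ _, isBigO_zero _ _, (isBigO_zero _ l).congr_left fun p => by simp⟩

/-- An expansion in which the leading term vanishes. -/
lemma shift (hf : Jet l r k f f₀ f₁ f₂) (hr : Tendsto r l (𝓝[>] 0)) :
    Jet l r (k - 1) f 0 f₀ f₁ :=
  ⟨isBigO_zero _ _, by simpa using hf.zero,
    by simpa [show k - 1 + 2 = k + 1 by ring] using hf.one,
    ((IsBigO.weaken hr hf.rem (m := k - 1 + 3) (by omega)).add
      (IsBigO.weaken hr hf.two (m := k - 1 + 3) (by omega))).congr_left fun p => by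
        simp only [Pi.zero_apply]; abel⟩

lemma bilin {f f₀ f₁ f₂ : α → E} {g g₀ g₁ g₂ : α → F} [NormedSpace ℝ E] [NormedSpace ℝ F]
    [NormedSpace ℝ G] (hr : Tendsto r l (𝓝[>] 0))
    (B : E →L[ℝ] F →L[ℝ] G) (hf : Jet l r k f f₀ f₁ f₂) (hg : Jet l r m g g₀ g₁ g₂) :
    Jet l r (k + m) (fun p => B (f p) (g p)) (fun p => B (f₀ p) (g₀ p))
      (fun p => B (f₀ p) (g₁ p) + B (f₁ p) (g₀ p))
      (fun p => B (f₀ p) (g₂ p) + B (f₁ p) (g₁ p) + B (f₂ p) (g₀ p)) := by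
  refine ⟨IsBigO.bilin_zpow hr B hf.zero hg.zero le_rfl,
    (IsBigO.bilin_zpow hr B hf.zero hg.one (by omega)).add
      (IsBigO.bilin_zpow hr B hf.one hg.zero (by omega)),
    ((IsBigO.bilin_zpow hr B hf.zero hg.two (by omega)).add
      (IsBigO.bilin_zpow hr B hf.one hg.one (by omega))).add
      (IsBigO.bilin_zpow hr B hf.two hg.zero (by omega)), ?_⟩
  have h1 := IsBigO.bilin_zpow hr B hf.rem (hg.isBigO hr) (n := k + m + 3) (by omega)
  have h2 := IsBigO.bilin_zpow hr B hf.zero hg.rem (n := k + m + 3) (by omega)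
  have h3 := IsBigO.bilin_zpow hr B hf.one hg.rem (n := k + m + 3) (by omega)
  have h4 := IsBigO.bilin_zpow hr B hf.two hg.rem (n := k + m + 3) (by omega)
  have h5 := IsBigO.bilin_zpow hr B hf.one hg.two (n := k + m + 3) (by omega)
  have h6 := IsBigO.bilin_zpow hr B hf.two hg.one (n := k + m + 3) (by omega)
  have h7 := IsBigO.bilin_zpow hr B hf.two hg.two (n := k + m + 3) (by omega)
  refine ((h1.add (h2.add (h3.add h4))).add (h5.add (h6.add h7))).congr_left fun p => ?_
  simp only [map_sub, map_add, _root_.sub_apply, _root_.add_apply]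
  abel

lemma mul {f f₀ f₁ f₂ g g₀ g₁ g₂ : α → ℝ} (hr : Tendsto r l (𝓝[>] 0))
    (hf : Jet l r k f f₀ f₁ f₂) (hg : Jet l r m g g₀ g₁ g₂) :
    Jet l r (k + m) (fun p => f p * g p) (fun p => f₀ p * g₀ p)
      (fun p => f₀ p * g₁ p + f₁ p * g₀ p)
      (fun p => f₀ p * g₂ p + f₁ p * g₁ p + f₂ p * g₀ p) :=
  bilin hr (ContinuousLinearMap.mul ℝ ℝ) hf hg

lemma inv {f f₀ f₁ f₂ : α → ℝ} (hr : Tendsto r l (𝓝[>] 0)) (hf : Jet l r k f f₀ f₁ f₂)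
    (h0 : (fun p => r p ^ k) =O[l] f₀) :
    Jet l r (-k) (fun p => (f p)⁻¹) (fun p => (f₀ p)⁻¹) (fun p => -(f₁ p * (f₀ p)⁻¹ ^ 2))
      (fun p => f₁ p ^ 2 * (f₀ p)⁻¹ ^ 3 - f₂ p * (f₀ p)⁻¹ ^ 2) := by
  have hpos : ∀ᶠ p in l, 0 < r p := hr self_mem_nhdsWithin
  have hne : ∀ᶠ p in l, f₀ p ≠ 0 := by
    filter_upwards [hpos, h0.eq_zero_imp] with p hp h hf0
    exact (zpow_pos hp k).ne' (h hf0)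
  have hi0 : (fun p => (f₀ p)⁻¹) =O[l] fun p => r p ^ (-k) := by
    refine (h0.inv_rev ?_).congr_right fun p => by rw [zpow_neg]
    filter_upwards [hpos] with p hp h
    exact absurd h (zpow_pos hp k).ne'
  have hlit : (fun p => f p - f₀ p) =o[l] f₀ := by
    have h1 : (fun p => f p - f₀ p) =O[l] fun p => r p ^ (k + 1) :=
      ((IsBigO.weaken hr hf.rem (m := k + 1) (by omega)).add
        (hf.one.add (IsBigO.weaken hr hf.two (m := k + 1) (by omega)))).congr_left
        fun p => by abel
    refine h1.trans_isLittleO (IsLittleO.trans_isBigO ?_ h0)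
    have h2 : (fun p => r p) =o[l] fun _ => (1 : ℝ) :=
      (isLittleO_one_iff ℝ).2 (hr.mono_right nhdsWithin_le_nhds)
    have h3 := (isBigO_refl (fun p => r p ^ k) l).mul_isLittleO h2
    simp only [mul_one] at h3
    refine h3.congr' ?_ .rfl
    filter_upwards [hpos] with p hp
    rw [zpow_add_one₀ hp.ne']
  have hfeq : IsEquivalent l f f₀ := hlit
  have hi : (fun p => (f p)⁻¹) =O[l] fun p => r p ^ (-k) := hfeq.inv.isBigO.trans hi0
  have hfne : ∀ᶠ p in l, f p ≠ 0 := by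
    filter_upwards [hfeq.symm.isBigO.eq_zero_imp, hne] with p h h0 hf
    exact h0 (h hf)
  have h1 : (fun p => -(f₁ p * (f₀ p)⁻¹ ^ 2)) =O[l] fun p => r p ^ (-k + 1) := by
    have := IsBigO.mul_zpow hr hf.one (IsBigO.mul_zpow hr hi0 hi0 le_rfl) (n := -k + 1) (by omega)
    exact this.neg_left.congr_left fun p => by ring
  have h2 : (fun p => f₁ p ^ 2 * (f₀ p)⁻¹ ^ 3 - f₂ p * (f₀ p)⁻¹ ^ 2) =O[l]
      fun p => r p ^ (-k + 2) := by
    have a1 := IsBigO.mul_zpow hr hi0 hi0 le_rfl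
    have a2 := IsBigO.mul_zpow hr hf.two a1 (n := -k + 2) (by omega)
    have a3 := IsBigO.mul_zpow hr (IsBigO.mul_zpow hr hf.one hf.one le_rfl)
      (IsBigO.mul_zpow hr hi0 a1 le_rfl) (n := -k + 2) (by omega)
    exact (a3.sub a2).congr_left fun p => by ring
  refine ⟨hi0, h1, h2, ?_⟩
  have he : Jet l r (-k) (fun p => (f₀ p)⁻¹ + -(f₁ p * (f₀ p)⁻¹ ^ 2)
      + (f₁ p ^ 2 * (f₀ p)⁻¹ ^ 3 - f₂ p * (f₀ p)⁻¹ ^ 2)) _ _ _ :=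
    ⟨hi0, h1, h2, (isBigO_zero _ l).congr_left fun p => by simp⟩
  have hm := (mul hr hf he).rem
  have := IsBigO.mul_zpow hr hi hm (n := -k + 3) (by omega)
  refine this.neg_left.congr' ?_ .rfl
  filter_upwards [hfne, hne] with p hp hp0
  field_simp
  ring

end Jet

end Jet

/-! ### Expansion of the retarded field -/

/-- The Minkowski product as a continuous bilinear map. -/
def mdotL : Spacetime →L[ℝ] Spacetime →L[ℝ] ℝ :=
  LinearMap.mkContinuous₂
    (LinearMap.mk₂ ℝ mdot mdot_add_left mdot_smul_left mdot_add_right mdot_smul_right) 4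
    fun x y => abs_mdot_le x y

@[simp] lemma mdotL_apply (x y : Spacetime) : mdotL x y = mdot x y := rfl

/-- A component of the wedge product as a continuous bilinear map. -/
def wedgeL (μ ν : Fin 4) : Spacetime →L[ℝ] Spacetime →L[ℝ] ℝ :=
  LinearMap.mkContinuous₂
    (LinearMap.mk₂ ℝ (fun x y => wedge x y μ ν) (fun x y z => wedge_add_left x y z μ ν)
      (fun c x y => wedge_smul_left c x y μ ν) (fun x y z => wedge_add_right x y z μ ν)
      (fun c x y => wedge_smul_right c x y μ ν)) 2
    fun x y => abs_wedge_le x y μ ν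

@[simp] lemma wedgeL_apply (μ ν : Fin 4) (x y : Spacetime) :
    wedgeL μ ν x y = wedge x y μ ν := rfl

lemma IsBigO.pow_zpow {α : Type*} {l : Filter α} {r : α → ℝ} (hr : Tendsto r l (𝓝[>] 0))
    {f : α → ℝ} {k m : ℤ} (hf : f =O[l] fun p => r p ^ k) (n : ℕ) (h : m ≤ k * n) :
    (fun p => f p ^ n) =O[l] fun p => r p ^ m := by
  refine IsBigO.trans ((hf.pow n).congr_right fun p => ?_) (isBigO_zpow_of_le hr h)
  rw [zpow_mul, zpow_natCast]

namespace NearField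

variable {α : Type*} {l : Filter α} {r : α → ℝ} {u a b y : α → Spacetime}

/-- The size of the quantities which enter the expansion at points `y` in a cone of space-like
directions, of size `r → 0`. -/
structure Bounds (l : Filter α) (r : α → ℝ) (u a b y : α → Spacetime) : Prop where
  tendsto : Tendsto r l (𝓝[>] 0)
  hu : u =O[l] fun p => r p ^ (0 : ℤ)
  ha : a =O[l] fun p => r p ^ (0 : ℤ)
  hb : b =O[l] fun p => r p ^ (0 : ℤ)
  hy : y =O[l] fun p => r p ^ (1 : ℤ)
  huu : (fun p => (mdot (u p) (u p))⁻¹) =O[l] fun p => r p ^ (0 : ℤ)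
  huu_neg : ∀ p, mdot (u p) (u p) < 0
  hdist : (fun p => r p ^ (1 : ℤ)) =O[l] fun p => dist (u p) (y p)

namespace Bounds

lemma mono (H : Bounds l r u a b y) {l' : Filter α} (h : l' ≤ l) : Bounds l' r u a b y :=
  ⟨H.tendsto.mono_left h, H.hu.mono h, H.ha.mono h, H.hb.mono h, H.hy.mono h, H.huu.mono h,
    H.huu_neg,
    H.hdist.mono h⟩

lemma mdot_zpow (H : Bounds l r u a b y) {x y : α → Spacetime} {k m n : ℤ}
    (hx : x =O[l] fun p => r p ^ k)
    (hy : y =O[l] fun p => r p ^ m) (h : n ≤ k + m) :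
    (fun p => mdot (x p) (y p)) =O[l] fun p => r p ^ n :=
  IsBigO.bilin_zpow H.tendsto mdotL hx hy h

lemma dist_isBigO (H : Bounds l r u a b y) :
    (fun p => NearField.dist (u p) (y p)) =O[l] fun p => r p ^ (1 : ℤ) := by
  have h1 := IsBigO.pow_zpow H.tendsto (H.mdot_zpow H.hy H.hu (n := 1) (by norm_num)) 2
    (m := 2) (by norm_num)
  have h2 := IsBigO.mul_zpow H.tendsto (H.mdot_zpow H.hu H.hu (n := 0) (by norm_num))
    (H.mdot_zpow H.hy H.hy (n := 2) (by norm_num)) (n := 2) (by norm_num)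
  have h3 := h1.sub h2
  obtain ⟨C, hC, h⟩ := h3.exists_pos
  refine IsBigO.of_bound (√C) ?_
  filter_upwards [h.bound, H.tendsto self_mem_nhdsWithin] with p hp hr
  have hr : 0 < r p := hr
  rw [NearField.dist, Real.norm_of_nonneg (Real.sqrt_nonneg _), zpow_one,
    Real.norm_of_nonneg hr.le]
  refine Real.sqrt_le_iff.2 ⟨by positivity, ?_⟩
  rw [mul_pow, Real.sq_sqrt hC.le]
  refine (le_abs_self _).trans (hp.trans (le_of_eq ?_))
  rw [Real.norm_of_nonneg (by positivity)]; norm_cast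

lemma dist_inv (H : Bounds l r u a b y) :
    (fun p => (NearField.dist (u p) (y p))⁻¹) =O[l] fun p => r p ^ (-1 : ℤ) := by
  refine (H.hdist.inv_rev ?_).congr_right fun p => by rw [zpow_neg]
  filter_upwards [H.tendsto self_mem_nhdsWithin] with p hp h
  exact absurd h (zpow_pos (show (0 : ℝ) < r p from hp) _).ne'

lemma dist_pos (H : Bounds l r u a b y) : ∀ᶠ p in l, 0 < NearField.dist (u p) (y p) := by
  filter_upwards [H.hdist.eq_zero_imp, H.tendsto self_mem_nhdsWithin] with p h hp
  refine lt_of_le_of_ne (Real.sqrt_nonneg _) fun h0 => ?_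
  exact absurd (h h0.symm) (zpow_pos (show (0 : ℝ) < r p from hp) _).ne'

lemma h₁_isBigO (H : Bounds l r u a b y) : (fun p => h₁ (u p) (y p)) =O[l] fun p => r p ^ (1 : ℤ) :=
  IsBigO.mul_zpow H.tendsto ((H.mdot_zpow H.hy H.hu (n := 1) (by norm_num)).add H.dist_isBigO) H.huu
    (by norm_num)

lemma half_dist_inv (H : Bounds l r u a b y) :
    (fun p => (2 * NearField.dist (u p) (y p))⁻¹) =O[l] fun p => r p ^ (-1 : ℤ) :=
  (H.dist_inv.const_mul_left (2⁻¹ : ℝ)).congr_left fun p => by rw [mul_inv]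

lemma h₂_isBigO (H : Bounds l r u a b y) :
    (fun p => h₂ (u p) (a p) (y p)) =O[l] fun p => r p ^ (2 : ℤ) := by
  have h1 := H.h₁_isBigO
  have e1 := IsBigO.mul_zpow H.tendsto (IsBigO.pow_zpow H.tendsto h1 2 (m := 2) (by norm_num))
    (H.mdot_zpow H.hy H.ha (n := 1) (by norm_num)) (n := 3) (by norm_num)
  have e2 := IsBigO.mul_zpow H.tendsto (IsBigO.pow_zpow H.tendsto h1 3 (m := 3) (by norm_num))
    (H.mdot_zpow H.hu H.ha (n := 0) (by norm_num)) (n := 3) (by norm_num)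
  exact IsBigO.mul_zpow H.tendsto (e1.sub e2) H.half_dist_inv (by norm_num)

lemma h₃_isBigO (H : Bounds l r u a b y) :
    (fun p => h₃ (u p) (a p) (b p) (y p)) =O[l] fun p => r p ^ (3 : ℤ) := by
  have h1 := H.h₁_isBigO
  have h2 := H.h₂_isBigO
  have e1 := (IsBigO.mul_zpow H.tendsto (IsBigO.pow_zpow H.tendsto h1 3 (m := 3) (by norm_num))
    (H.mdot_zpow H.hy H.hb (n := 1) (by norm_num)) (n := 4)
      (by norm_num)).const_mul_left (1 / 3 : ℝ)
  have e2 := IsBigO.mul_zpow H.tendsto (IsBigO.pow_zpow H.tendsto h1 4 (m := 4) (by norm_num))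
    (((H.mdot_zpow H.ha H.ha (n := 0) (by norm_num)).const_mul_left (1 / 4 : ℝ)).add
      ((H.mdot_zpow H.hu H.hb (n := 0) (by norm_num)).const_mul_left (1 / 3 : ℝ)))
      (n := 4) (by norm_num)
  have e3 := (IsBigO.mul_zpow H.tendsto h1
    (H.mdot_zpow H.hy H.ha (n := 1) (by norm_num)) (n := 2) (by norm_num)).const_mul_left (2 : ℝ)
  have e4 := (IsBigO.mul_zpow H.tendsto (IsBigO.pow_zpow H.tendsto h1 2 (m := 2) (by norm_num))
    (H.mdot_zpow H.hu H.ha (n := 0) (by norm_num)) (n := 2) (by norm_num)).const_mul_left (3 : ℝ)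
  have e5 := IsBigO.mul_zpow H.tendsto (e4.sub e3) h2 (n := 4) (by norm_num)
  have e6 := IsBigO.mul_zpow H.tendsto (H.mdot_zpow H.hu H.hu (n := 0) (by norm_num))
    (IsBigO.pow_zpow H.tendsto h2 2 (m := 4) (by norm_num)) (n := 4) (by norm_num)
  have e7 := IsBigO.mul_zpow H.tendsto (((e2.sub e1).add (e5.add e6)).neg_left) H.half_dist_inv
    (n := 3) (by norm_num)
  refine e7.congr_left fun p => ?_
  rw [h₃, div_eq_mul_inv]
  ring

lemma mdot_jet (H : Bounds l r u a b y) {k m : ℤ} {x x₀ x₁ x₂ z z₀ z₁ z₂ : α → Spacetime}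
    (hx : Jet l r k x x₀ x₁ x₂)
    (hz : Jet l r m z z₀ z₁ z₂) :
    Jet l r (k + m) (fun p => mdot (x p) (z p)) (fun p => mdot (x₀ p) (z₀ p))
      (fun p => mdot (x₀ p) (z₁ p) + mdot (x₁ p) (z₀ p))
      (fun p => mdot (x₀ p) (z₂ p) + mdot (x₁ p) (z₁ p) + mdot (x₂ p) (z₀ p)) :=
  Jet.bilin H.tendsto mdotL hx hz

lemma wedge_jet (H : Bounds l r u a b y) {k m : ℤ} {x x₀ x₁ x₂ z z₀ z₁ z₂ : α → Spacetime}
    (hx : Jet l r k x x₀ x₁ x₂)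
    (hz : Jet l r m z z₀ z₁ z₂) (μ ν : Fin 4) :
    Jet l r (k + m) (fun p => wedge (x p) (z p) μ ν) (fun p => wedge (x₀ p) (z₀ p) μ ν)
      (fun p => wedge (x₀ p) (z₁ p) μ ν + wedge (x₁ p) (z₀ p) μ ν)
      (fun p => wedge (x₀ p) (z₂ p) μ ν + wedge (x₁ p) (z₁ p) μ ν + wedge (x₂ p) (z₀ p) μ ν) :=
  Jet.bilin H.tendsto (wedgeL μ ν) hx hz

lemma smul_jet (H : Bounds l r u a b y) {k m : ℤ} {x x₀ x₁ x₂ : α → ℝ} {z z₀ z₁ z₂ : α → Spacetime}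
    (hx : Jet l r k x x₀ x₁ x₂) (hz : Jet l r m z z₀ z₁ z₂) :
    Jet l r (k + m) (fun p => x p • z p) (fun p => x₀ p • z₀ p)
      (fun p => x₀ p • z₁ p + x₁ p • z₀ p)
      (fun p => x₀ p • z₂ p + x₁ p • z₁ p + x₂ p • z₀ p) :=
  Jet.bilin H.tendsto (ContinuousLinearMap.lsmul ℝ ℝ) hx hz

end Bounds

/-- The interval between `y` and the point with parameter `h` of the curve, up to the order of
`r⁴`. -/
def interval (u a b y : Spacetime) (h : ℝ) : ℝ :=
  mdot y y - 2 * h * mdot y u + h ^ 2 * mdot u u + (h ^ 3 * mdot u a - h ^ 2 * mdot y a)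
    + (h ^ 4 * (mdot a a / 4 + mdot u b / 3) - h ^ 3 * mdot y b / 3)

lemma Bounds.interval_approx (H : Bounds l r u a b y) :
    (fun p => interval (u p) (a p) (b p) (y p)
      (h₁ (u p) (y p) + h₂ (u p) (a p) (y p) + h₃ (u p) (a p) (b p) (y p))) =O[l]
      fun p => r p ^ (5 : ℤ) := by
  have hr := H.tendsto
  have hJ : Jet l r 1
      (fun p => h₁ (u p) (y p) + h₂ (u p) (a p) (y p) + h₃ (u p) (a p) (b p) (y p)) _ _ _ :=
    ⟨H.h₁_isBigO, H.h₂_isBigO, H.h₃_isBigO, (isBigO_zero _ l).congr_left fun p => by simp⟩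
  have hyy := Jet.of_isBigO (H.mdot_zpow H.hy H.hy (n := 2) (by norm_num))
  have hyu := Jet.of_isBigO (H.mdot_zpow H.hy H.hu (n := 1) (by norm_num))
  have hya := Jet.of_isBigO (H.mdot_zpow H.hy H.ha (n := 1) (by norm_num))
  have hyb := Jet.of_isBigO ((H.mdot_zpow H.hy H.hb (n := 1) (by norm_num)).const_mul_left (1 / 3))
  have huu := Jet.of_isBigO (H.mdot_zpow H.hu H.hu (n := 0) (by norm_num))
  have hua := Jet.of_isBigO (H.mdot_zpow H.hu H.ha (n := 0) (by norm_num))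
  have hk := Jet.of_isBigO
    (((H.mdot_zpow H.ha H.ha (n := 0) (by norm_num)).const_mul_left (1 / 4 : ℝ)).add
      ((H.mdot_zpow H.hu H.hb (n := 0) (by norm_num)).const_mul_left (1 / 3 : ℝ)))
  have hJ2 : Jet l r 2 _ _ _ _ := Jet.mul hr hJ hJ
  have hJ3 : Jet l r 3 _ _ _ _ := Jet.mul hr hJ2 hJ
  have hJ4 : Jet l r 4 _ _ _ _ := Jet.mul hr hJ3 hJ
  have m1 : Jet l r 2 _ _ _ _ := Jet.mul hr hJ hyu
  have m2 : Jet l r 2 _ _ _ _ := Jet.mul hr hJ2 huu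
  have m3 : Jet l r 3 _ _ _ _ := Jet.mul hr hJ3 hua
  have m4 : Jet l r 3 _ _ _ _ := Jet.mul hr hJ2 hya
  have m5 : Jet l r 4 _ _ _ _ := Jet.mul hr hJ4 hk
  have m6 : Jet l r 4 _ _ _ _ := Jet.mul hr hJ3 hyb
  have t0 := (hyy.sub (m1.add m1)).add m2
  have t1' : Jet l r 3 _ _ _ _ := m3.sub m4
  have t1 : Jet l r 2 _ _ _ _ := t1'.shift hr
  have t2' : Jet l r 4 _ _ _ _ := m5.sub m6
  have t2 : Jet l r 2 _ _ _ _ := (t2'.shift hr).shift hr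
  have t : Jet l r 2 _ _ _ _ := (t0.add t1).add t2
  have hrem := t.rem
  refine hrem.congr' ?_ .rfl
  filter_upwards [H.dist_pos] with p hS
  have hsq : mdot (y p) (y p) =
      (mdot (y p) (u p) ^ 2 - dist (u p) (y p) ^ 2) / mdot (u p) (u p) := by
    have h0 : 0 ≤ mdot (y p) (u p) ^ 2 - mdot (u p) (u p) * mdot (y p) (y p) := by
      by_contra h
      rw [dist, Real.sqrt_eq_zero_of_nonpos (not_le.1 h).le] at hS
      exact lt_irrefl _ hS
    rw [eq_div_iff (H.huu_neg p).ne, dist, Real.sq_sqrt h0]; ring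
  have hu := (H.huu_neg p).ne
  have hS' := hS.ne'
  simp only [interval, Pi.zero_apply]
  have key : ∀ A B : ℝ, B = 0 → A - B = A := fun A B h => by rw [h, sub_zero]
  refine (key _ _ ?_).trans ?_
  · simp only [h₃, h₂, h₁, hsq]
    generalize mdot (u p) (u p) = uu at *
    generalize mdot (y p) (u p) = yu at *
    generalize dist (u p) (y p) = S at *
    field_simp
    ring
  · ring

end NearField

lemma Jet.of_sub {α E : Type*} [NormedAddCommGroup E] {l : Filter α} {r : α → ℝ} {k : ℤ}
    {f g f₀ f₁ f₂ : α → E} (hf : Jet l r k f f₀ f₁ f₂)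
    (hg : (fun p => g p - f p) =O[l] fun p => r p ^ (k + 3)) : Jet l r k g f₀ f₁ f₂ :=
  ⟨hf.zero, hf.one, hf.two, (hg.add hf.rem).congr_left fun p => by abel⟩

namespace NearField

variable {α : Type*} {l : Filter α} {r : α → ℝ} {u a b y : α → Spacetime}

lemma dist_nonneg (u y : Spacetime) : 0 ≤ dist u y := Real.sqrt_nonneg _

/-- Expansion of the parameter of the retarded point. The quadratic part of `interval` has two
zeros; the sign of `w · K` singles out the retarded one. -/
lemma Bounds.jet_param (H : Bounds l r u a b y) {h : α → ℝ} {K w : α → Spacetime}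
    (hh : h =O[l] fun p => r p ^ (1 : ℤ))
    (hK : (fun p => K p - (y p - h p • u p - (h p ^ 2 / 2) • a p - (h p ^ 3 / 6) • b p)) =O[l]
      fun p => r p ^ (4 : ℤ))
    (hw : (fun p => w p - u p) =O[l] fun p => r p ^ (1 : ℤ))
    (hnull : ∀ᶠ p in l, mdot (K p) (K p) = 0) (hneg : ∀ᶠ p in l, mdot (w p) (K p) < 0) :
    Jet l r 1 h (fun p => h₁ (u p) (y p)) (fun p => h₂ (u p) (a p) (y p))
      (fun p => h₃ (u p) (a p) (b p) (y p)) := by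
  have hr := H.tendsto
  have hpos : ∀ᶠ p in l, 0 < r p := hr self_mem_nhdsWithin
  set e := fun p => K p - (y p - h p • u p - (h p ^ 2 / 2) • a p - (h p ^ 3 / 6) • b p) with he
  have sm : ∀ {f : α → ℝ} {z : α → Spacetime} {k m : ℤ}, f =O[l] (fun p => r p ^ k) →
      z =O[l] (fun p => r p ^ (0 : ℤ)) → m ≤ k → (fun p => f p • z p) =O[l] fun p => r p ^ m :=
    fun hf hz hm => IsBigO.bilin_zpow hr (ContinuousLinearMap.lsmul ℝ ℝ) hf hz (by omega)
  have hh2 : (fun p => h p ^ 2) =O[l] fun p => r p ^ (2 : ℤ) :=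
    IsBigO.pow_zpow hr hh 2 (by norm_num)
  have hh3 : (fun p => h p ^ 3) =O[l] fun p => r p ^ (3 : ℤ) :=
    IsBigO.pow_zpow hr hh 3 (by norm_num)
  have hh5 : (fun p => h p ^ 5) =O[l] fun p => r p ^ (5 : ℤ) :=
    IsBigO.pow_zpow hr hh 5 (by norm_num)
  have hh6 : (fun p => h p ^ 6) =O[l] fun p => r p ^ (5 : ℤ) :=
    IsBigO.pow_zpow hr hh 6 (by norm_num)
  have hh2' : (fun p => h p ^ 2 / 2) =O[l] fun p => r p ^ (2 : ℤ) :=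
    (hh2.const_mul_left (1 / 2 : ℝ)).congr_left fun p => by ring
  have hh3' : (fun p => h p ^ 3 / 6) =O[l] fun p => r p ^ (3 : ℤ) :=
    (hh3.const_mul_left (1 / 6 : ℝ)).congr_left fun p => by ring
  have hlow : (fun p => (h p ^ 2 / 2) • a p + (h p ^ 3 / 6) • b p - e p) =O[l]
      fun p => r p ^ (2 : ℤ) :=
    ((sm hh2' H.ha le_rfl).add (sm hh3' H.hb (by norm_num))).sub
      (IsBigO.weaken hr hK (by norm_num))
  have hKO : K =O[l] fun p => r p ^ (1 : ℤ) := by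
    refine ((H.hy.sub (sm hh H.hu le_rfl)).sub
      (IsBigO.weaken hr hlow (by norm_num))).congr_left fun p => ?_
    simp only [he]; abel
  have hKt : ∀ p, y p - h p • u p - (h p ^ 2 / 2) • a p - (h p ^ 3 / 6) • b p = K p - e p :=
    fun p => by simp only [he]; abel
  -- the exact parameter is a zero of `interval` up to the order of `r⁵`
  have hP : (fun p => interval (u p) (a p) (b p) (y p) (h p)) =O[l] fun p => r p ^ (5 : ℤ) := by
    have t1 := (H.mdot_zpow hKO hK (n := 5) (by norm_num)).const_mul_left (-2 : ℝ)
    have t2 := H.mdot_zpow hK hK (n := 5) (by norm_num)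
    have t3 := (IsBigO.mul_zpow hr hh5 (H.mdot_zpow H.ha H.hb (n := 0) (by norm_num)) (n := 5)
      (by norm_num)).const_mul_left (1 / 6 : ℝ)
    have t4 := (IsBigO.mul_zpow hr hh6 (H.mdot_zpow H.hb H.hb (n := 0) (by norm_num)) (n := 5)
      (by norm_num)).const_mul_left (1 / 36 : ℝ)
    refine ((t1.add t2).sub (t3.add t4)).congr' ?_ .rfl
    filter_upwards [hnull] with p hp
    have q1 : mdot (K p - e p) (K p - e p) = -2 * mdot (K p) (e p) + mdot (e p) (e p) := by
      simp only [mdot_sub_left, mdot_sub_right, hp, mdot_comm (e p) (K p)]; ring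
    have q2 := q1
    rw [← hKt p] at q2
    simp only [mdot_sub_left, mdot_sub_right, mdot_smul_left, mdot_smul_right,
      mdot_comm (u p) (y p), mdot_comm (a p) (y p), mdot_comm (b p) (y p), mdot_comm (a p) (u p),
      mdot_comm (b p) (u p), mdot_comm (b p) (a p)] at q2
    simp only [interval]
    linear_combination -q2
  set h' := fun p => h₁ (u p) (y p) + h₂ (u p) (a p) (y p) + h₃ (u p) (a p) (b p) (y p) with hh'
  have h'O : h' =O[l] fun p => r p ^ (1 : ℤ) :=
    (H.h₁_isBigO.add (IsBigO.weaken hr H.h₂_isBigO (by norm_num))).add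
      (IsBigO.weaken hr H.h₃_isBigO (by norm_num))
  have hdiff := hP.sub H.interval_approx
  -- the divided difference of `interval` between the two parameters is at least of order `r`
  set Q := fun p => -2 * mdot (y p) (u p) + mdot (u p) (u p) * (h p + h' p)
    + ((h p ^ 2 + h p * h' p + h' p ^ 2) * mdot (u p) (a p) - (h p + h' p) * mdot (y p) (a p))
    + ((h p + h' p) * (h p ^ 2 + h' p ^ 2) * (mdot (a p) (a p) / 4 + mdot (u p) (b p) / 3)
      - (h p ^ 2 + h p * h' p + h' p ^ 2) * (mdot (y p) (b p) / 3)) with hQ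
  have hsum := hh.add h'O
  have hsq := (hh2.add (IsBigO.mul_zpow hr hh h'O (n := 2) (by norm_num))).add
    (IsBigO.pow_zpow hr h'O 2 (m := 2) (by norm_num))
  have hQrest : (fun p => Q p - NearField.dist (u p) (y p) + mdot (w p) (K p)) =O[l]
      fun p => r p ^ (2 : ℤ) := by
    have t1 := IsBigO.mul_zpow hr hsq (H.mdot_zpow H.hu H.ha (n := 0) (by norm_num)) (n := 2)
      (by norm_num)
    have t2 := IsBigO.mul_zpow hr hsum (H.mdot_zpow H.hy H.ha (n := 1) (by norm_num)) (n := 2)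
      (by norm_num)
    have hk := ((H.mdot_zpow H.ha H.ha (n := 0) (by norm_num)).const_mul_left (1 / 4 : ℝ)).add
      ((H.mdot_zpow H.hu H.hb (n := 0) (by norm_num)).const_mul_left (1 / 3 : ℝ))
    have t3 := IsBigO.mul_zpow hr (IsBigO.mul_zpow hr hsum
      (hh2.add (IsBigO.pow_zpow hr h'O 2 (m := 2) (by norm_num))) (n := 2) (by norm_num)) hk
      (n := 2) (by norm_num)
    have t4 := (IsBigO.mul_zpow hr hsq (H.mdot_zpow H.hy H.hb (n := 0) (by norm_num)) (n := 2)
      (by norm_num)).const_mul_left (1 / 3 : ℝ)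
    have t5 := IsBigO.mul_zpow hr (H.mdot_zpow H.hu H.hu (n := 0) (by norm_num))
      (H.h₂_isBigO.add (IsBigO.weaken hr H.h₃_isBigO (m := 2) (by norm_num))) (n := 2) (by norm_num)
    have t6 := H.mdot_zpow hw hKO (n := 2) (by norm_num)
    have t7 := H.mdot_zpow H.hu hlow (n := 2) (by norm_num)
    refine (((((t1.sub t2).add (t3.sub t4)).add t5).add t6).sub t7).congr_left fun p => ?_
    have q : mdot (u p) (K p) = mdot (u p) (y p) - h p * mdot (u p) (u p)
        - mdot (u p) ((h p ^ 2 / 2) • a p + (h p ^ 3 / 6) • b p - e p) := by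
      rw [← mdot_smul_right, ← mdot_sub_right, ← mdot_sub_right]
      congr 1; simp only [he]; abel
    have q1 : mdot (u p) (u p) * h₁ (u p) (y p) = mdot (y p) (u p) + dist (u p) (y p) := by
      rw [h₁, mul_div_cancel₀ _ (H.huu_neg p).ne]
    simp only [hQ, hh', mdot_sub_left, mdot_comm (u p) (y p)] at q ⊢
    linear_combination -q - q1
  have hQr : (fun p => r p ^ (1 : ℤ)) =O[l] Q := by
    obtain ⟨c, hc, hcb⟩ := H.hdist.exists_pos
    obtain ⟨C, hC, hCb⟩ := hQrest.exists_pos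
    have hsmall : ∀ᶠ p in l, C * r p < 1 / (2 * c) := by
      have : Tendsto (fun p => C * r p) l (𝓝 (C * 0)) :=
        (hr.mono_right nhdsWithin_le_nhds).const_mul C
      rw [mul_zero] at this
      exact this.eventually (gt_mem_nhds (by positivity))
    refine IsBigO.of_bound (2 * c) ?_
    filter_upwards [hcb.bound, hCb.bound, hneg, hpos, hsmall] with p h1 h2 h3 h4 h5
    rw [zpow_one, Real.norm_of_nonneg h4.le, Real.norm_of_nonneg (dist_nonneg _ _)] at h1
    rw [Real.norm_eq_abs, Real.norm_of_nonneg (zpow_nonneg h4.le _)] at h2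
    have h6 := (abs_le.1 h2).1
    have e2 : r p ^ (2 : ℤ) = r p * r p := by norm_cast; ring
    rw [e2] at h6
    have h7 : C * r p * r p ≤ 1 / (2 * c) * r p := by nlinarith
    have h8 : r p / c ≤ NearField.dist (u p) (y p) := by rwa [div_le_iff₀' hc]
    have h9 : 1 / (2 * c) * r p = r p / c / 2 := by field_simp
    have h10 : r p / c / 2 ≤ Q p := by nlinarith
    rw [zpow_one, Real.norm_of_nonneg h4.le]
    calc r p = 2 * c * (r p / c / 2) := by field_simp
      _ ≤ 2 * c * Q p := by gcongr
      _ ≤ 2 * c * ‖Q p‖ := by gcongr; exact le_abs_self _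
  have hfin : (fun p => h p - h' p) =O[l] fun p => r p ^ (4 : ℤ) := by
    have t1 : (fun p => (h p - h' p) * Q p) =O[l] fun p => r p ^ (5 : ℤ) := by
      refine hdiff.congr_left fun p => ?_
      simp only [interval, hQ]
      ring
    have t2 : (fun p => (h p - h' p) * r p ^ (1 : ℤ)) =O[l] fun p => r p ^ (5 : ℤ) :=
      ((isBigO_refl (fun p => h p - h' p) l).mul hQr).trans t1
    have t3 := IsBigO.mul_zpow hr t2 (isBigO_refl (fun p => r p ^ (-1 : ℤ)) l) (n := 4)
      (by norm_num)
    refine t3.congr' ?_ .rfl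
    filter_upwards [hpos] with p hp
    rw [zpow_one, zpow_neg_one, mul_assoc, mul_inv_cancel₀ hp.ne', mul_one]
  exact ⟨H.h₁_isBigO, H.h₂_isBigO, H.h₃_isBigO, hfin⟩

/-- Expansion of the field of a unit charge, in terms of the null vector `K` from the retarded point
to the field point and the derivatives `w`, `w'` at the retarded point. -/
lemma Bounds.jet_field (H : Bounds l r u a b y) {h : α → ℝ} {K w w' : α → Spacetime}
    (hh : h =O[l] fun p => r p ^ (1 : ℤ))
    (hK : (fun p => K p - (y p - h p • u p - (h p ^ 2 / 2) • a p - (h p ^ 3 / 6) • b p)) =O[l]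
      fun p => r p ^ (4 : ℤ))
    (hw : (fun p => w p - (u p + h p • a p + (h p ^ 2 / 2) • b p)) =O[l] fun p => r p ^ (3 : ℤ))
    (hw' : (fun p => w' p - (a p + h p • b p)) =O[l] fun p => r p ^ (2 : ℤ))
    (hnull : ∀ᶠ p in l, mdot (K p) (K p) = 0) (hneg : ∀ᶠ p in l, mdot (w p) (K p) < 0)
    (μ ν : Fin 4) :
    Jet l r (-2) (fun p => (wedge (w p) (K p) μ ν * (mdot (w p) (w p) - mdot (w' p) (K p))
        + wedge (w' p) (K p) μ ν * mdot (w p) (K p)) * (mdot (w p) (K p))⁻¹ ^ 3)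
      (fun p => F₂ (u p) (y p) μ ν) (fun p => F₁ (u p) (a p) (y p) μ ν)
      (fun p => F₀ (u p) (a p) (b p) (y p) μ ν) := by
  have hr := H.tendsto
  have sm : ∀ {f : α → ℝ} {z : α → Spacetime} {k m : ℤ}, f =O[l] (fun p => r p ^ k) →
      z =O[l] (fun p => r p ^ (0 : ℤ)) → m ≤ k → (fun p => f p • z p) =O[l] fun p => r p ^ m :=
    fun hf hz hm => IsBigO.bilin_zpow hr (ContinuousLinearMap.lsmul ℝ ℝ) hf hz (by omega)
  have hw0 : (fun p => w p - u p) =O[l] fun p => r p ^ (1 : ℤ) := by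
    refine ((IsBigO.weaken hr hw (by norm_num)).add ((sm hh H.ha le_rfl).add
      (sm (((IsBigO.pow_zpow hr hh 2 (m := 2) (by norm_num)).const_mul_left
        (1 / 2 : ℝ))) H.hb (m := 1) (by norm_num)))).congr_left fun p => ?_
    rw [show 1 / 2 * h p ^ 2 = h p ^ 2 / 2 by ring]; abel
  have jh := H.jet_param hh hK hw0 hnull hneg
  have ju : Jet l r 0 u _ _ _ := Jet.of_isBigO H.hu
  have ja : Jet l r 0 a _ _ _ := Jet.of_isBigO H.ha
  have jb : Jet l r 0 b _ _ _ := Jet.of_isBigO H.hb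
  have jy : Jet l r 1 y _ _ _ := Jet.of_isBigO H.hy
  have jhalf : Jet l r 0 (fun _ => (1 / 2 : ℝ)) _ _ _ := Jet.of_isBigO
    ((isBigO_const_const _ one_ne_zero l).congr_right fun p => (zpow_zero (r p)).symm)
  have jsixth : Jet l r 0 (fun _ => (1 / 6 : ℝ)) _ _ _ := Jet.of_isBigO
    ((isBigO_const_const _ one_ne_zero l).congr_right fun p => (zpow_zero (r p)).symm)
  have jh2 : Jet l r 2 _ _ _ _ := Jet.mul hr jh jh
  have jh2' : Jet l r 2 _ _ _ _ := Jet.mul hr jhalf jh2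
  have jh3 : Jet l r 3 _ _ _ _ := Jet.mul hr jh2 jh
  have jh3' : Jet l r 3 _ _ _ _ := Jet.mul hr jsixth jh3
  have jhu : Jet l r 1 _ _ _ _ := H.smul_jet jh ju
  have jha : Jet l r 1 _ _ _ _ := H.smul_jet jh ja
  have jhha : Jet l r 2 _ _ _ _ := H.smul_jet jh2' ja
  have jhhb : Jet l r 2 _ _ _ _ := H.smul_jet jh2' jb
  have jhhhb : Jet l r 3 _ _ _ _ := H.smul_jet jh3' jb
  have jhha1 : Jet l r 1 _ _ _ _ := jhha.shift hr
  have jhhhb1 : Jet l r 1 _ _ _ _ := (jhhhb.shift hr).shift hr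
  have jha0 : Jet l r 0 _ _ _ _ := jha.shift hr
  have jhhb0 : Jet l r 0 _ _ _ _ := (jhhb.shift hr).shift hr
  have jK : Jet l r 1 K (fun p => K₀ (u p) (y p)) (fun p => K₁ (u p) (a p) (y p))
      (fun p => K₂ (u p) (a p) (b p) (y p)) := by
    refine ((((jy.sub jhu).sub jhha1).sub jhhhb1).of_sub ?_).congr .rfl ?_ ?_ ?_
    · refine hK.congr_left fun p => ?_
      rw [show 1 / 2 * (h p * h p) = h p ^ 2 / 2 by ring,
        show 1 / 6 * (h p * h p * h p) = h p ^ 3 / 6 by ring]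
    all_goals refine Eventually.of_forall fun p => ?_
    · simp [K₀]
    · simp only [K₁, Pi.zero_apply, smul_zero, zero_add, zero_sub, sub_zero]
      rw [show 1 / 2 * (h₁ (u p) (y p) * h₁ (u p) (y p)) = h₁ (u p) (y p) ^ 2 / 2 by ring]
      abel
    · simp only [K₂, Pi.zero_apply, smul_zero, zero_add, zero_sub, zero_mul, add_zero]
      module
  have jw : Jet l r 0 w u (fun p => w₁ (u p) (a p) (y p))
      (fun p => w₂ (u p) (a p) (b p) (y p)) := by
    refine (((ju.add jha0).add jhhb0).of_sub (g := w) ?_).congr .rfl ?_ ?_ ?_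
    · refine hw.congr_left fun p => ?_
      module
    all_goals refine Eventually.of_forall fun p => ?_
    · simp
    · simp [w₁]
    · simp only [w₂, Pi.zero_apply, smul_zero, zero_add]
      module
  have jw' : Jet l r (-1) w' 0 a (fun p => h₁ (u p) (y p) • b p) := by
    refine ⟨isBigO_zero _ _, H.ha, sm H.h₁_isBigO H.hb (by norm_num), ?_⟩
    have t : (fun p => h p - h₁ (u p) (y p)) =O[l] fun p => r p ^ (2 : ℤ) := by
      refine ((IsBigO.weaken hr jh.rem (m := 2) (by norm_num)).add (H.h₂_isBigO.add
        (IsBigO.weaken hr H.h₃_isBigO (m := 2) (by norm_num)))).congr_left fun p => by ring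
    refine (hw'.add (sm t H.hb le_rfl)).congr_left fun p => ?_
    simp only [Pi.zero_apply]; module
  have jd : Jet l r 1 (fun p => mdot (w p) (K p)) (fun p => d₀ (u p) (y p))
      (fun p => d₁ (u p) (a p) (y p)) (fun p => d₂ (u p) (a p) (b p) (y p)) := by
    have : Jet l r 1 _ _ _ _ := H.mdot_jet jw jK
    exact this
  have je : Jet l r 1 (fun p => wedge (w p) (K p) μ ν) (fun p => e₀ (u p) (y p) μ ν)
      (fun p => e₁ (u p) (a p) (y p) μ ν) (fun p => e₂ (u p) (a p) (b p) (y p) μ ν) := by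
    have : Jet l r 1 _ _ _ _ := H.wedge_jet jw jK μ ν
    exact this
  have jww : Jet l r 0 _ _ _ _ := H.mdot_jet jw jw
  have jwK : Jet l r 0 _ _ _ _ := H.mdot_jet jw' jK
  have jwK' : Jet l r 0 _ _ _ _ := H.wedge_jet jw' jK μ ν
  have jg := jww.sub jwK
  have jn1 : Jet l r 1 _ _ _ _ := Jet.mul hr je jg
  have jn2 : Jet l r 1 _ _ _ _ := Jet.mul hr jwK' jd
  have ji : Jet l r (-1) (fun p => (mdot (w p) (K p))⁻¹) (fun p => i₀ (u p) (y p))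
      (fun p => i₁ (u p) (a p) (y p)) (fun p => i₂ (u p) (a p) (b p) (y p)) := by
    refine Jet.inv hr jd (H.hdist.neg_right.congr_right fun p => ?_)
    rw [d₀_eq (H.huu_neg p).ne]
  have ji2 : Jet l r (-2) _ _ _ _ := Jet.mul hr ji ji
  have ji3 : Jet l r (-3) _ _ _ _ := Jet.mul hr ji2 ji
  have jF : Jet l r (-2) _ _ _ _ := Jet.mul hr (jn1.add jn2) ji3
  refine jF.congr ?_ ?_ ?_ ?_ <;> refine Eventually.of_forall fun p => ?_
  · simp only; ring
  all_goals
    have z1 : ∀ z, mdot 0 z = 0 := fun z => by simp [mdot_eq]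
    have z2 : ∀ z μ ν, wedge 0 z μ ν = 0 := fun z μ ν => by simp [wedge]
    simp only [Pi.zero_apply, z1, z2, F₂, F₁, F₀, n₀, n₁, n₂, g₁, g₂, zero_add, zero_mul, sub_zero]
    ring

end NearField

/-! ### The near field of a particle -/

lemma hasDerivAt_mdot {f g : ℝ → Spacetime} {f' g' : Spacetime} {s : ℝ} (hf : HasDerivAt f f' s)
    (hg : HasDerivAt g g' s) :
    HasDerivAt (fun s => mdot (f s) (g s)) (mdot (f s) g' + mdot f' (g s)) s := by
  have := mdotL.hasFDerivAt_of_bilinear hf.hasFDerivAt hg.hasFDerivAt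
  have h := this.hasDerivAt
  simpa using h

lemma hasDerivAt_wedge {f g : ℝ → Spacetime} {f' g' : Spacetime} {s : ℝ} (hf : HasDerivAt f f' s)
    (hg : HasDerivAt g g' s) (μ ν : Fin 4) :
    HasDerivAt (fun s => wedge (f s) (g s) μ ν) (wedge (f s) g' μ ν + wedge f' (g s) μ ν) s := by
  have := (wedgeL μ ν).hasFDerivAt_of_bilinear hf.hasFDerivAt hg.hasFDerivAt
  have h := this.hasDerivAt
  simpa using h

namespace IsWorldline

variable {X : ℝ → Spacetime}

lemma contDiff_deriv_deriv (hX : IsWorldline X) : ContDiff ℝ ∞ (deriv (deriv X)) :=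
  (contDiff_infty_iff_deriv.1 hX.contDiff_deriv).2

lemma contDiff_deriv_deriv_deriv (hX : IsWorldline X) : ContDiff ℝ ∞ (deriv (deriv (deriv X))) :=
  (contDiff_infty_iff_deriv.1 hX.contDiff_deriv_deriv).2

lemma hasDerivAt_deriv (hX : IsWorldline X) (s : ℝ) :
    HasDerivAt (deriv X) (deriv (deriv X) s) s :=
  (hX.contDiff_deriv.differentiable (by simp) s).hasDerivAt

lemma mdot_deriv_neg (hX : IsWorldline X) {x : Spacetime} {s : ℝ} (h : IsRetarded X x s) :
    mdot (deriv X s) (x - X s) < 0 :=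
  mdot_neg_of_future (hX.speed_lt s) h.norm_spatial.le (sub_pos.2 h.2)

/-- The Liénard–Wiechert field in terms of `w = dX/ds`, `w' = d²X/ds²` and `K = x - X`. -/
lemma lienardWiechert_eq (hX : IsWorldline X) (q : ℝ) {x : Spacetime} {s : ℝ}
    (h : mdot (deriv X s) (x - X s) ≠ 0) (μ ν : Fin 4) :
    lienardWiechert q X x s μ ν = q / (4 * Real.pi) *
      ((wedge (deriv X s) (x - X s) μ ν *
          (mdot (deriv X s) (deriv X s) - mdot (deriv (deriv X) s) (x - X s))
        + wedge (deriv (deriv X) s) (x - X s) μ ν * mdot (deriv X s) (x - X s)) *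
        (mdot (deriv X s) (x - X s))⁻¹ ^ 3) := by
  have hK : HasDerivAt (fun σ => x - X σ) (-deriv X s) s := (hX.hasDerivAt s).const_sub x
  have h1 := (hasDerivAt_wedge (hX.hasDerivAt_deriv s) hK μ ν).div
    (hasDerivAt_mdot (hX.hasDerivAt_deriv s) hK) h
  have h2 : deriv (fun σ => wedge (deriv X σ) (x - X σ) μ ν / mdot (deriv X σ) (x - X σ)) s = _ :=
    h1.deriv
  rw [lienardWiechert, h2, wedge_neg_right, wedge_self, mdot_neg_right]
  field_simp
  ring

/-- The parameter of the retarded point is close to `c` for points near `X c`. -/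
lemma exists_retarded_mem (hX : IsWorldline X) (A B : ℝ) : ∃ δ > 0, ∀ c ∈ Set.Icc A B,
    ∀ y : Spacetime, ‖y‖ < δ → ∀ s, IsRetarded X (X c + y) s → s ∈ Set.Icc (c - 1) (c + 1) := by
  have hc : ContinuousOn (fun c => min (X (c + 1) 0 - X c 0)
      (X c 0 - X (c - 1) 0 - ‖spatial (X c - X (c - 1))‖)) (Set.Icc A B) := by
    have h0 := hX.continuous
    have h1 : Continuous fun c => X (c + 1) := h0.comp (by fun_prop)
    have h2 : Continuous fun c => X (c - 1) := h0.comp (by fun_prop)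
    have h3 : Continuous fun c => spatial (X c - X (c - 1)) := continuous_spatial.comp (h0.sub h2)
    exact Continuous.continuousOn (by fun_prop)
  obtain ⟨m, hm, hmin⟩ := isCompact_Icc.exists_forall_le' hc (a := 0) fun c _ =>
    lt_min (sub_pos.2 (hX.strictMono_time (by simp)))
      (sub_pos.2 (hX.chord_lt (by simp)))
  refine ⟨m / 3, by positivity, fun c hcI y hy s hs => ?_⟩
  have hm1 := (le_min_iff.1 (hmin c hcI)).1
  have hm2 := (le_min_iff.1 (hmin c hcI)).2
  have hy0 := abs_le.1 (abs_le_norm y 0)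
  have hys := norm_spatial_le_two_mul y
  have hg : (X c + y) 0 - X s 0 - ‖spatial (X c + y - X s)‖ = 0 := by
    rw [hs.norm_spatial]; simp
  have hanti := hX.strictAnti_delay (X c + y)
  constructor
  · by_contra h
    have := hanti (not_le.1 h)
    simp only [hg] at this
    have h2 : ‖spatial (X c + y - X (c - 1))‖ ≤ ‖spatial (X c - X (c - 1))‖ + ‖spatial y‖ := by
      refine le_trans (le_of_eq ?_) (norm_add_le _ _)
      rw [← spatial_add]; congr 2; abel
    simp only [Pi.add_apply] at this
    linarith
  · by_contra h
    have := hanti (not_le.1 h)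
    simp only [hg] at this
    have h2 := norm_nonneg (spatial (X c + y - X (c + 1)))
    simp only [Pi.add_apply] at this
    linarith

/-- The retarded point of a point at distance `r` from `X c` is at a distance of order `r` from
`X c`, since the speed of the particle is bounded away from one. -/
lemma exists_retarded_bound (hX : IsWorldline X) (A B : ℝ) : ∃ C : ℝ, ∀ c ∈ Set.Icc A B,
    ∀ s ∈ Set.Icc A B, ∀ y : Spacetime, IsRetarded X (X c + y) s → |s - c| ≤ C * ‖y‖ := by
  obtain ⟨v, hv0, hv1, hv⟩ := hX.exists_speed_bound A B
  obtain ⟨m, hm, hmin⟩ := isCompact_Icc.exists_forall_le' (a := 0)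
    ((continuous_apply (0 : Fin 4)).comp hX.continuous_deriv).continuousOn
    (fun s (_ : s ∈ Set.Icc A B) => hX.future s)
  have hmv : ∀ s ∈ Set.Icc A B, ∀ s' ∈ Set.Icc A B, s ≤ s' → m * (s' - s) ≤ X s' 0 - X s 0 :=
    fun s hs s' hs' h => (convex_Icc A B).mul_sub_le_image_sub_of_le_deriv
      (f := fun s => X s 0)
      (fun s _ => (hX.hasDerivAt_apply s 0).continuousAt.continuousWithinAt)
      (fun s _ => (hX.hasDerivAt_apply s 0).differentiableAt.differentiableWithinAt)
      (fun s hs => by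
        rw [(hX.hasDerivAt_apply s 0).deriv]; exact hmin s (interior_subset hs)) s hs s' hs' h
  refine ⟨3 / (1 - v) / m, fun c hc s hs y hr => ?_⟩
  have hy0 := abs_le.1 (abs_le_norm y 0)
  have hys := norm_spatial_le_two_mul y
  have h1v : 0 < 1 - v := by linarith
  have key : |X s 0 - X c 0| ≤ 3 / (1 - v) * ‖y‖ := by
    rw [div_mul_eq_mul_div, le_div_iff₀ h1v]
    rcases le_total c s with h | h
    · have h1 := hr.2
      rw [abs_of_nonneg (sub_nonneg.2 (hX.strictMono_time.monotone h))]
      simp only [Pi.add_apply] at h1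
      have h0 : 0 ≤ X s 0 - X c 0 := sub_nonneg.2 (hX.strictMono_time.monotone h)
      nlinarith [norm_nonneg y]
    · have h1 := hr.norm_spatial
      have h2 := hX.norm_chord_le hv hs hc h
      have h3 : ‖spatial (X c + y - X s)‖ ≤ ‖spatial (X c - X s)‖ + ‖spatial y‖ := by
        refine le_trans (le_of_eq ?_) (norm_add_le _ _)
        rw [← spatial_add]; congr 2; abel
      rw [abs_sub_comm, abs_of_nonneg (sub_nonneg.2 (hX.strictMono_time.monotone h))]
      simp only [Pi.sub_apply, Pi.add_apply] at h1
      nlinarith [norm_nonneg y]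
  rw [div_mul_eq_mul_div, le_div_iff₀ hm]
  refine le_trans ?_ key
  rcases le_total c s with h | h
  · rw [abs_of_nonneg (sub_nonneg.2 h)]
    have := hmv c hc s hs h
    exact le_trans (by linarith) (le_abs_self _)
  · rw [abs_sub_comm, abs_of_nonneg (sub_nonneg.2 h), abs_sub_comm]
    have := hmv s hs c hc h
    exact le_trans (by linarith) (le_abs_self _)

end IsWorldline

/-- Integration of a bound on the derivative. -/
lemma norm_le_pow_succ {E : Type*} [NormedAddCommGroup E] [NormedSpace ℝ E] {g g' : ℝ → E}
    {A B M c : ℝ} {n : ℕ} (hM : 0 ≤ M) (hg : ∀ s, HasDerivAt g (g' s) s) (hc : c ∈ Set.Icc A B)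
    (h0 : g c = 0) (hb : ∀ s ∈ Set.Icc A B, ‖g' s‖ ≤ M * |s - c| ^ n) {s : ℝ}
    (hs : s ∈ Set.Icc A B) : ‖g s‖ ≤ M * |s - c| ^ (n + 1) := by
  have hsub : Set.uIcc c s ⊆ Set.Icc A B := Set.uIcc_subset_Icc hc hs
  have := (convex_uIcc c s).norm_image_sub_le_of_norm_hasDerivWithin_le (f := g) (f' := g')
    (C := M * |s - c| ^ n) (fun σ _ => (hg σ).hasDerivWithinAt)
    (fun σ hσ => (hb σ (hsub hσ)).trans (by
      have : |σ - c| ≤ |s - c| := by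
        rw [Set.mem_uIcc] at hσ
        rcases hσ with ⟨h1, h2⟩ | ⟨h1, h2⟩
        · rw [abs_of_nonneg (by linarith), abs_of_nonneg (by linarith)]; linarith
        · rw [abs_of_nonpos (by linarith), abs_of_nonpos (by linarith)]; linarith
      gcongr))
    Set.left_mem_uIcc Set.right_mem_uIcc
  rw [h0, sub_zero, Real.norm_eq_abs] at this
  rw [pow_succ, ← mul_assoc]; exact this

lemma IsWorldline.exists_taylor_bound {X : ℝ → Spacetime} (hX : IsWorldline X) (A B : ℝ) :
    ∃ M : ℝ, ∀ c ∈ Set.Icc A B, ∀ s ∈ Set.Icc A B,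
      ‖deriv (deriv X) s - (deriv (deriv X) c + (s - c) • deriv (deriv (deriv X)) c)‖
        ≤ M * |s - c| ^ 2 ∧
      ‖deriv X s - (deriv X c + (s - c) • deriv (deriv X) c
        + ((s - c) ^ 2 / 2) • deriv (deriv (deriv X)) c)‖ ≤ M * |s - c| ^ 3 ∧
      ‖X s - (X c + (s - c) • deriv X c + ((s - c) ^ 2 / 2) • deriv (deriv X) c
        + ((s - c) ^ 3 / 6) • deriv (deriv (deriv X)) c)‖ ≤ M * |s - c| ^ 4 := by
  have hd3 : ∀ s, HasDerivAt (deriv (deriv (deriv X))) (deriv (deriv (deriv (deriv X))) s) s :=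
    fun s => (hX.contDiff_deriv_deriv_deriv.differentiable (by simp) s).hasDerivAt
  have hd2 : ∀ s, HasDerivAt (deriv (deriv X)) (deriv (deriv (deriv X)) s) s :=
    fun s => (hX.contDiff_deriv_deriv.differentiable (by simp) s).hasDerivAt
  obtain ⟨M, hM⟩ := (isCompact_Icc (a := A) (b := B)).exists_bound_of_continuousOn
    (contDiff_infty_iff_deriv.1 hX.contDiff_deriv_deriv_deriv).2.continuous.continuousOn
  refine ⟨|M|, fun c hc s hs => ?_⟩
  set u := deriv X c
  set a := deriv (deriv X) c with ha
  set b := deriv (deriv (deriv X)) c with hb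
  have d1 : ∀ s, HasDerivAt (fun s : ℝ => s - c) 1 s := fun s => (hasDerivAt_id s).sub_const c
  have d2 : ∀ s, HasDerivAt (fun s : ℝ => (s - c) ^ 2 / 2) (s - c) s := fun s => by
    refine (((d1 s).pow 2).div_const 2).congr_deriv ?_
    simp
  have d3 : ∀ s, HasDerivAt (fun s : ℝ => (s - c) ^ 3 / 6) ((s - c) ^ 2 / 2) s := fun s => by
    refine (((d1 s).pow 3).div_const 6).congr_deriv ?_
    simp; ring
  have b3 : ∀ s ∈ Set.Icc A B, ‖deriv (deriv (deriv X)) s - b‖ ≤ |M| * |s - c| ^ 1 := fun s hs =>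
    norm_le_pow_succ (n := 0) (abs_nonneg M) (fun s => (hd3 s).sub_const b) hc (by simp [hb])
      (fun s hs => by simpa using (hM s hs).trans (le_abs_self M)) hs
  have b2 : ∀ s ∈ Set.Icc A B, ‖deriv (deriv X) s - (a + (s - c) • b)‖ ≤ |M| * |s - c| ^ 2 :=
    fun s hs => norm_le_pow_succ (n := 1) (g' := fun s => deriv (deriv (deriv X)) s - b)
      (abs_nonneg M) (fun s => by
        refine ((hd2 s).sub (((d1 s).smul_const b).const_add a)).congr_deriv ?_
        simp) hc (by simp [ha]) b3 hs
  have b1 : ∀ s ∈ Set.Icc A B, ‖deriv X s - (u + (s - c) • a + ((s - c) ^ 2 / 2) • b)‖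
      ≤ |M| * |s - c| ^ 3 :=
    fun s hs => norm_le_pow_succ (n := 2) (g' := fun s => deriv (deriv X) s - (a + (s - c) • b))
      (abs_nonneg M) (fun s => by
        refine ((hX.hasDerivAt_deriv s).sub ((((d1 s).smul_const a).const_add u).add
          ((d2 s).smul_const b))).congr_deriv ?_
        simp) hc (by simp [u]) b2 hs
  refine ⟨b2 s hs, b1 s hs, ?_⟩
  exact norm_le_pow_succ (n := 3)
    (g' := fun s => deriv X s - (u + (s - c) • a + ((s - c) ^ 2 / 2) • b))
    (abs_nonneg M) (fun s => by
      refine ((hX.hasDerivAt s).sub (((((d1 s).smul_const u).const_add (X c)).add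
        ((d2 s).smul_const a)).add ((d3 s).smul_const b))).congr_deriv ?_
      simp) hc (by simp) b1 hs

section

open NearField

/-- Triples `(c, y, s)` with `c` in an interval and `y → 0` in a cone of space-like directions. -/
def nearFilter (A B β : ℝ) : Filter (ℝ × Spacetime × ℝ) :=
  comap (fun p => ‖spatial p.2.1‖) (𝓝[>] 0) ⊓
    𝓟 {p | p.1 ∈ Set.Icc A B ∧ |p.2.1 0| ≤ β * ‖spatial p.2.1‖}

lemma eventually_nearFilter {A B β : ℝ} {P : ℝ × Spacetime × ℝ → Prop} :
    (∀ᶠ p in nearFilter A B β, P p) ↔ ∃ δ > 0, ∀ c ∈ Set.Icc A B, ∀ y : Spacetime,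
      |y 0| ≤ β * ‖spatial y‖ → 0 < ‖spatial y‖ → ‖spatial y‖ < δ → ∀ s, P (c, y, s) := by
  rw [nearFilter, eventually_inf_principal,
    ((nhdsGT_basis (0 : ℝ)).comap _).eventually_iff]
  constructor
  · rintro ⟨δ, hδ, h⟩
    exact ⟨δ, hδ, fun c hc y hy h0 h1 s => h (x := (c, y, s)) ⟨h0, h1⟩ ⟨hc, hy⟩⟩
  · rintro ⟨δ, hδ, h⟩
    exact ⟨δ, hδ, fun {p} hp hq => h p.1 hq.1 p.2.1 hq.2 hp.1 hp.2 p.2.2⟩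

lemma tendsto_nearFilter (A B β : ℝ) :
    Tendsto (fun p => ‖spatial p.2.1‖) (nearFilter A B β) (𝓝[>] 0) :=
  tendsto_comap.mono_left inf_le_left

namespace IsWorldline

variable {X : ℝ → Spacetime}

lemma isBigO_nearFilter {E : Type*} [NormedAddCommGroup E] {f : ℝ → E} (hf : Continuous f)
    (A B β : ℝ) : (fun p : ℝ × Spacetime × ℝ => f p.1) =O[nearFilter A B β]
      fun p => ‖spatial p.2.1‖ ^ (0 : ℤ) := by
  obtain ⟨M, hM⟩ := (isCompact_Icc (a := A) (b := B)).exists_bound_of_continuousOn hf.continuousOn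
  refine IsBigO.of_bound M ?_
  rw [eventually_nearFilter]
  exact ⟨1, one_pos, fun c hc y _ _ _ s => by simpa using hM c hc⟩

lemma bounds (hX : IsWorldline X) (A B : ℝ) {β : ℝ} (hβ0 : 0 ≤ β) (hβ : β < 1) :
    Bounds (nearFilter A B β) (fun p => ‖spatial p.2.1‖) (fun p => deriv X p.1)
      (fun p => deriv (deriv X) p.1) (fun p => deriv (deriv (deriv X)) p.1) (fun p => p.2.1) where
  tendsto := tendsto_nearFilter A B β
  hu := isBigO_nearFilter hX.continuous_deriv A B β
  ha := isBigO_nearFilter hX.contDiff_deriv_deriv.continuous A B β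
  hb := isBigO_nearFilter hX.contDiff_deriv_deriv_deriv.continuous A B β
  hy := by
    refine IsBigO.of_bound 1 ?_
    rw [eventually_nearFilter]
    refine ⟨1, one_pos, fun c _ y hy h0 _ s => ?_⟩
    rw [zpow_one, norm_norm, one_mul]
    refine (norm_le_of_spatial y).trans (max_le (hy.trans ?_) le_rfl)
    nlinarith
  huu := by
    refine isBigO_nearFilter (f := fun c => (mdot (deriv X c) (deriv X c))⁻¹) ?_ A B β
    exact (continuous_mdot.comp (hX.continuous_deriv.prodMk hX.continuous_deriv)).inv₀
      fun c => (hX.timelike c).ne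
  huu_neg p := hX.timelike p.1
  hdist := by
    have hc : Continuous fun c => -mdot (deriv X c) (deriv X c) :=
      (continuous_mdot.comp (hX.continuous_deriv.prodMk hX.continuous_deriv)).neg
    obtain ⟨m, hm, hmin⟩ := isCompact_Icc.exists_forall_le' (a := 0) hc.continuousOn
      (fun s (_ : s ∈ Set.Icc A B) => neg_pos.2 (hX.timelike s))
    have h1 : 0 < 1 - β ^ 2 := by nlinarith
    refine IsBigO.of_bound (√(m * (1 - β ^ 2)))⁻¹ ?_
    rw [eventually_nearFilter]
    refine ⟨1, one_pos, fun c hc y hy h0 _ s => ?_⟩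
    have hpos : 0 < √(m * (1 - β ^ 2)) := Real.sqrt_pos.2 (by positivity)
    rw [zpow_one, norm_norm, Real.norm_of_nonneg (dist_nonneg _ _), le_inv_mul_iff₀ hpos]
    refine Real.le_sqrt_of_sq_le ?_
    rw [mul_pow, Real.sq_sqrt (by positivity), mdot_self_eq y]
    have h2 : y 0 ^ 2 ≤ β ^ 2 * ‖spatial y‖ ^ 2 := by
      rw [← mul_pow, ← sq_abs]; gcongr
    have h3 := hmin c hc
    have h4 : (1 - β ^ 2) * ‖spatial y‖ ^ 2 ≤ -y 0 ^ 2 + ‖spatial y‖ ^ 2 := by linarith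
    have h5 : m * ((1 - β ^ 2) * ‖spatial y‖ ^ 2) ≤
        -mdot (deriv X c) (deriv X c) * (-y 0 ^ 2 + ‖spatial y‖ ^ 2) :=
      mul_le_mul h3 h4 (by positivity) (hm.le.trans h3)
    nlinarith [sq_nonneg (mdot y (deriv X c))]

lemma jet_lienardWiechert (hX : IsWorldline X) (A B : ℝ) {β : ℝ} (hβ0 : 0 ≤ β) (hβ : β < 1)
    (μ ν : Fin 4) :
    Jet (nearFilter A B β ⊓ 𝓟 {p | IsRetarded X (X p.1 + p.2.1) p.2.2})
      (fun p => ‖spatial p.2.1‖) (-2)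
      (fun p => (wedge (deriv X p.2.2) (X p.1 + p.2.1 - X p.2.2) μ ν *
          (mdot (deriv X p.2.2) (deriv X p.2.2)
            - mdot (deriv (deriv X) p.2.2) (X p.1 + p.2.1 - X p.2.2))
        + wedge (deriv (deriv X) p.2.2) (X p.1 + p.2.1 - X p.2.2) μ ν
          * mdot (deriv X p.2.2) (X p.1 + p.2.1 - X p.2.2)) *
        (mdot (deriv X p.2.2) (X p.1 + p.2.1 - X p.2.2))⁻¹ ^ 3)
      (fun p => F₂ (deriv X p.1) p.2.1 μ ν)
      (fun p => F₁ (deriv X p.1) (deriv (deriv X) p.1) p.2.1 μ ν)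
      (fun p => F₀ (deriv X p.1) (deriv (deriv X) p.1) (deriv (deriv (deriv X)) p.1)
        p.2.1 μ ν) := by
  set l := nearFilter A B β ⊓ 𝓟 {p | IsRetarded X (X p.1 + p.2.1) p.2.2} with hl
  have H := (hX.bounds A B hβ0 hβ).mono (l' := l) inf_le_left
  have hr := H.tendsto
  have hret : ∀ᶠ p in l, IsRetarded X (X p.1 + p.2.1) p.2.2 := by
    rw [hl, eventually_inf_principal]; exact Eventually.of_forall fun p h => h
  have hsub : ∀ c ∈ Set.Icc A B, c ∈ Set.Icc (A - 1) (B + 1) := fun c hc =>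
    ⟨by linarith [hc.1], by linarith [hc.2]⟩
  obtain ⟨δ, hδ, hmem⟩ := hX.exists_retarded_mem A B
  have hc : ∀ᶠ p in l, p.1 ∈ Set.Icc (A - 1) (B + 1) ∧ p.2.2 ∈ Set.Icc (A - 1) (B + 1) := by
    rw [hl, eventually_inf_principal, eventually_nearFilter]
    refine ⟨δ, hδ, fun c hc y hy h0 h1 s hs => ⟨hsub c hc, ?_⟩⟩
    have hy' : ‖y‖ < δ := (norm_le_of_spatial y).trans_lt
      (max_lt (lt_of_le_of_lt (hy.trans (by nlinarith)) h1) h1)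
    have := hmem c hc y hy' s hs
    exact ⟨by linarith [this.1, hc.1], by linarith [this.2, hc.2]⟩
  obtain ⟨C, hC⟩ := hX.exists_retarded_bound (A - 1) (B + 1)
  have hh : (fun p : ℝ × Spacetime × ℝ => p.2.2 - p.1) =O[l]
      fun p => ‖spatial p.2.1‖ ^ (1 : ℤ) := by
    refine IsBigO.trans (IsBigO.of_bound C ?_) H.hy
    filter_upwards [hc, hret] with p hp hs
    exact hC p.1 hp.1 p.2.2 hp.2 p.2.1 hs
  obtain ⟨M, hM⟩ := hX.exists_taylor_bound (A - 1) (B + 1)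
  have tay : ∀ {f : ℝ × Spacetime × ℝ → Spacetime} {n : ℕ} {m : ℤ},
      (∀ᶠ p in l, ‖f p‖ ≤ M * |p.2.2 - p.1| ^ n) → m ≤ 1 * n →
      f =O[l] fun p => ‖spatial p.2.1‖ ^ m := by
    intro f n m hf hm
    refine IsBigO.trans (IsBigO.of_bound M ?_) (IsBigO.pow_zpow hr hh n hm)
    filter_upwards [hf] with p hp
    rwa [norm_pow, Real.norm_eq_abs]
  refine H.jet_field (h := fun p => p.2.2 - p.1) (K := fun p => X p.1 + p.2.1 - X p.2.2)
    (w := fun p => deriv X p.2.2) (w' := fun p => deriv (deriv X) p.2.2) hh ?_ ?_ ?_ ?_ ?_ μ ν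
  · refine tay (n := 4) ?_ (by norm_num)
    filter_upwards [hc] with p hp
    refine le_trans (le_of_eq ?_) (hM p.1 hp.1 p.2.2 hp.2).2.2
    rw [← norm_neg]; congr 1; abel
  · refine tay (n := 3) ?_ (by norm_num)
    filter_upwards [hc] with p hp using (hM p.1 hp.1 p.2.2 hp.2).2.1
  · refine tay (n := 2) ?_ (by norm_num)
    filter_upwards [hc] with p hp using (hM p.1 hp.1 p.2.2 hp.2).1
  · filter_upwards [hret] with p hp using hp.1
  · filter_upwards [hret] with p hp using hX.mdot_deriv_neg hp

/-- An event at space-like separation from an event of the world-line is not on the world-line. -/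
lemma ne_of_spacelike (hX : IsWorldline X) {c : ℝ} {y : Spacetime} (h : |y 0| ≤ ‖spatial y‖)
    (h0 : 0 < ‖spatial y‖) (s : ℝ) : X c + y ≠ X s := by
  intro he
  have hy : y = X s - X c := by rw [← he]; abel
  rcases eq_or_ne c s with hcs | hcs
  · subst hcs
    rw [sub_self] at hy
    rw [hy, ← spatialL_apply, map_zero, norm_zero] at h0
    exact lt_irrefl _ h0
  · have := hX.norm_spatial_sub_lt hcs
    rw [← hy] at this
    exact absurd this (not_lt.2 h)

end IsWorldline

/-- A function which is continuously differentiable near a compact set is Lipschitz continuous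
there, uniformly. -/
lemma exists_lipschitz_near {E F : Type*} [NormedAddCommGroup E] [NormedSpace ℝ E]
    [FiniteDimensional ℝ E]
    [NormedAddCommGroup F] [NormedSpace ℝ F] {f : E → F} {U K : Set E} (hU : IsOpen U)
    (hK : IsCompact K) (hKU : K ⊆ U) (hf : ContDiffOn ℝ 1 f U) :
    ∃ δ > 0, ∃ C, ∀ x ∈ K, ∀ y, ‖y‖ < δ → x + y ∈ U ∧ ‖f (x + y) - f x‖ ≤ C * ‖y‖ := by
  obtain ⟨δ, hδ, hsub⟩ := hK.exists_cthickening_subset_open hU hKU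
  have hcomp : IsCompact (Metric.cthickening δ K) := hK.cthickening
  obtain ⟨C, hC⟩ := hcomp.exists_bound_of_continuousOn
    ((hf.continuousOn_fderiv_of_isOpen hU le_rfl).mono hsub)
  refine ⟨δ, hδ, C, fun x hx y hy => ?_⟩
  have hball : Metric.ball x δ ⊆ Metric.cthickening δ K :=
    (Metric.ball_subset_thickening hx δ).trans (Metric.thickening_subset_cthickening δ K)
  have hxy : x + y ∈ Metric.ball x δ := by simpa [Metric.mem_ball, dist_eq_norm] using hy
  refine ⟨hsub (hball hxy), ?_⟩
  have := (convex_ball x δ).norm_image_sub_le_of_norm_fderiv_le (𝕜 := ℝ) (f := f) (C := C)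
    (fun z hz => (hf.differentiableOn one_ne_zero).differentiableAt
      (hU.mem_nhds (hsub (hball hz))))
    (fun z hz => hC z (hball hz)) (Metric.mem_ball_self hδ) hxy
  simpa using this

namespace System

variable {N : ℕ} {S : System N}

variable (S) in
/-- The part of order `-2` of the field at `X + y`, where `X` is the event of the `n`-th world-line
with parameter `c`. -/
def near₂ (n : Fin N) (c : ℝ) (y : Spacetime) : Matrix (Fin 4) (Fin 4) ℝ :=
  Matrix.of fun μ ν => S.charge n / (4 * Real.pi) * F₂ (deriv (S.worldline n) c) y μ ν

variable (S) in
/-- The part of order `-1` of the field near the `n`-th world-line. -/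
def near₁ (n : Fin N) (c : ℝ) (y : Spacetime) : Matrix (Fin 4) (Fin 4) ℝ :=
  Matrix.of fun μ ν => S.charge n / (4 * Real.pi) *
    F₁ (deriv (S.worldline n) c) (deriv (deriv (S.worldline n)) c) y μ ν

variable (S) in
/-- The part of order `0` of the field near the `n`-th world-line, without the external field. -/
def near₀ (n : Fin N) (c : ℝ) (y : Spacetime) : Matrix (Fin 4) (Fin 4) ℝ :=
  Matrix.of fun μ ν => S.charge n / (4 * Real.pi) *
    F₀ (deriv (S.worldline n) c) (deriv (deriv (S.worldline n)) c)
      (deriv (deriv (deriv (S.worldline n))) c) y μ ν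

variable (S) in
/-- The radiation field of the `n`-th particle on its world-line. -/
def radiation (n : Fin N) (c : ℝ) : Matrix (Fin 4) (Fin 4) ℝ :=
  Matrix.of fun μ ν => S.charge n / (4 * Real.pi) *
    rad (deriv (S.worldline n) c) (deriv (deriv (S.worldline n)) c)
      (deriv (deriv (deriv (S.worldline n))) c) μ ν

/-- The near field of a particle: the expansion of the field around the world-line, uniform on
compact parts of the world-line and in cones of space-like directions. -/
theorem IsRegular.exists_near_field (hreg : S.IsRegular) (n : Fin N) :
    ∃ Fe : ℝ → Matrix (Fin 4) (Fin 4) ℝ, ∀ A B β : ℝ, 0 ≤ β → β < 1 → ∃ C > 0, ∃ δ > 0,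
      ∀ c ∈ Set.Icc A B, ∀ y : Spacetime, |y 0| ≤ β * ‖spatial y‖ → 0 < ‖spatial y‖ →
        ‖spatial y‖ < δ → ∀ μ ν,
          |S.near₂ n c y μ ν| ≤ C * ‖spatial y‖ ^ (-2 : ℤ) ∧
          |S.near₁ n c y μ ν| ≤ C * ‖spatial y‖ ^ (-1 : ℤ) ∧
          |S.near₀ n c y μ ν + Fe c μ ν| ≤ C ∧
          |S.field (S.worldline n c + y) μ ν - (S.near₂ n c y μ ν + S.near₁ n c y μ ν
            + (S.near₀ n c y μ ν + Fe c μ ν))| ≤ C * ‖spatial y‖ := by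
  obtain ⟨U, Fext, hU, hXU, hFext, hF⟩ := hreg.nearParticle n
  set X := S.worldline n with hXdef
  have hX : IsWorldline X := hreg.worldlines n
  refine ⟨fun c => Fext (X c), fun A B β hβ0 hβ => ?_⟩
  suffices h : ∀ μ ν, ∃ C > 0, ∃ δ > 0,
      ∀ c ∈ Set.Icc A B, ∀ y : Spacetime, |y 0| ≤ β * ‖spatial y‖ → 0 < ‖spatial y‖ →
        ‖spatial y‖ < δ →
          |S.near₂ n c y μ ν| ≤ C * ‖spatial y‖ ^ (-2 : ℤ) ∧
          |S.near₁ n c y μ ν| ≤ C * ‖spatial y‖ ^ (-1 : ℤ) ∧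
          |S.near₀ n c y μ ν + Fext (X c) μ ν| ≤ C ∧
          |S.field (X c + y) μ ν - (S.near₂ n c y μ ν + S.near₁ n c y μ ν
            + (S.near₀ n c y μ ν + Fext (X c) μ ν))| ≤ C * ‖spatial y‖ by
    choose C hC δ hδ h using h
    refine ⟨∑ μ, ∑ ν, C μ ν, Finset.sum_pos (fun μ _ => Finset.sum_pos (fun ν _ => hC μ ν)
      Finset.univ_nonempty) Finset.univ_nonempty, ?_⟩
    have hle : ∀ μ ν, C μ ν ≤ ∑ μ, ∑ ν, C μ ν := fun μ ν =>
      (Finset.single_le_sum (f := fun ν => C μ ν) (fun i _ => (hC μ i).le)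
        (Finset.mem_univ ν)).trans
      (Finset.single_le_sum (f := fun μ => ∑ ν, C μ ν)
        (fun i _ => Finset.sum_nonneg fun j _ => (hC i j).le) (Finset.mem_univ μ))
    have hev : ∀ᶠ d in 𝓝[>] (0 : ℝ), ∀ μ ν, d ≤ δ μ ν := by
      simp only [eventually_all]
      exact fun μ ν => (Ioc_mem_nhdsGT (hδ μ ν)) |> mem_of_superset <| fun d hd => hd.2
    obtain ⟨d, hd, hd0⟩ := (hev.and self_mem_nhdsWithin).exists
    refine ⟨d, hd0, fun c hc y hy h0 h1 μ ν => ?_⟩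
    obtain ⟨a1, a2, a3, a4⟩ := h μ ν c hc y hy h0 (h1.trans_le (hd μ ν))
    have := hle μ ν
    refine ⟨a1.trans ?_, a2.trans ?_, a3.trans this, a4.trans ?_⟩ <;> gcongr
  intro μ ν
  -- the external field is Lipschitz continuous
  obtain ⟨δ₁, hδ₁, C₁, hLip⟩ := exists_lipschitz_near (f := fun x => Fext x μ ν) hU
    (isCompact_Icc.image hX.continuous) (K := X '' Set.Icc A B)
    (by rintro _ ⟨s, _, rfl⟩; exact hXU s) (hFext μ ν)
  have hcf : ContinuousOn (fun c => Fext (X c) μ ν) (Set.Icc A B) :=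
    (hFext μ ν).continuousOn.comp hX.continuous.continuousOn fun c _ => hXU c
  obtain ⟨C₂, hC₂⟩ := isCompact_Icc.exists_bound_of_continuousOn hcf
  have hJ := hX.jet_lienardWiechert A B hβ0 hβ μ ν
  obtain ⟨c₂, hc₂p, hc₂⟩ := hJ.zero.exists_pos
  obtain ⟨c₁, hc₁p, hc₁⟩ := hJ.one.exists_pos
  obtain ⟨c₀, hc₀p, hc₀⟩ := hJ.two.exists_pos
  obtain ⟨cr, hcrp, hcr⟩ := hJ.rem.exists_pos
  have hall := ((hc₂.bound.and hc₁.bound).and hc₀.bound).and hcr.bound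
  rw [eventually_inf_principal, eventually_nearFilter] at hall
  obtain ⟨δ₂, hδ₂, hall⟩ := hall
  set q := S.charge n / (4 * Real.pi) with hq
  set C := |q| * (c₂ + c₁ + c₀ + cr) + |C₁| + |C₂| + 1 with hC
  have hqn := abs_nonneg q
  have hC₁n := abs_nonneg C₁
  have hC₂n := abs_nonneg C₂
  refine ⟨C, by positivity, min δ₁ δ₂, lt_min hδ₁ hδ₂, fun c hc y hy h0 h1 => ?_⟩
  have hy' : |y 0| ≤ ‖spatial y‖ := hy.trans (by nlinarith)
  have hny : ‖y‖ ≤ ‖spatial y‖ := (norm_le_of_spatial y).trans (max_le hy' le_rfl)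
  obtain ⟨hyU, hyL⟩ := hLip (X c) ⟨c, hc, rfl⟩ y (hny.trans_lt (h1.trans_le (min_le_left _ _)))
  obtain ⟨s, hs, hfield⟩ := hF (X c + y) hyU (hX.ne_of_spacelike hy' h0)
  obtain ⟨⟨⟨b₂, b₁⟩, b₀⟩, br⟩ := hall c hc y hy h0 (h1.trans_le (min_le_right _ _)) s hs
  have hp : ∀ k : ℤ, (0 : ℝ) < ‖spatial y‖ ^ k := fun k => zpow_pos h0 k
  simp only [Real.norm_eq_abs, abs_of_pos (hp _)] at b₂ b₁ b₀ br
  have hcs : ∀ {c' t : ℝ}, 0 < c' → c' ≤ c₂ + c₁ + c₀ + cr → 0 ≤ t → |q| * (c' * t) ≤ C * t := by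
    intro c' t _ hle ht
    rw [← mul_assoc]
    refine mul_le_mul_of_nonneg_right ?_ ht
    have := mul_le_mul_of_nonneg_left hle hqn
    rw [hC]; linarith
  refine ⟨?_, ?_, ?_, ?_⟩
  · simp only [near₂, Matrix.of_apply, abs_mul, ← hq, ← hXdef]
    exact (mul_le_mul_of_nonneg_left b₂ hqn).trans (hcs hc₂p (by linarith) (hp _).le)
  · simp only [near₁, Matrix.of_apply, abs_mul, ← hq, ← hXdef]
    exact (mul_le_mul_of_nonneg_left b₁ hqn).trans (hcs hc₁p (by linarith) (hp _).le)
  · refine (abs_add_le _ _).trans ?_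
    simp only [near₀, Matrix.of_apply, abs_mul, ← hq, ← hXdef]
    have e1 := mul_le_mul_of_nonneg_left b₀ hqn
    have e2 := hC₂ c hc
    rw [Real.norm_eq_abs] at e2
    have e3 : c₀ * ‖spatial y‖ ^ (-2 + 2 : ℤ) = c₀ := by norm_num
    rw [e3] at e1
    have e4 : |q| * c₀ ≤ |q| * (c₂ + c₁ + c₀ + cr) :=
      mul_le_mul_of_nonneg_left (by linarith) hqn
    have e5 := le_abs_self C₂
    rw [hC]; linarith
  · rw [hfield μ ν, hX.lienardWiechert_eq _ (hX.mdot_deriv_neg hs).ne]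
    simp only [near₀, near₁, near₂, Matrix.of_apply, ← hq, ← hXdef]
    rw [Real.norm_eq_abs] at hyL
    have e1 := mul_le_mul_of_nonneg_left br hqn
    rw [← abs_mul] at e1
    have e3 : cr * ‖spatial y‖ ^ (-2 + 3 : ℤ) = cr * ‖spatial y‖ := by norm_num
    rw [e3] at e1
    have e4 : |q| * (cr * ‖spatial y‖) ≤ |q| * (c₂ + c₁ + c₀ + cr) * ‖spatial y‖ := by
      rw [← mul_assoc]
      exact mul_le_mul_of_nonneg_right (mul_le_mul_of_nonneg_left (by linarith) hqn) h0.le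
    have e5 : C₁ * ‖y‖ ≤ |C₁| * ‖spatial y‖ :=
      mul_le_mul (le_abs_self _) hny (norm_nonneg _) (abs_nonneg _)
    refine le_trans ?_ (show |q| * (c₂ + c₁ + c₀ + cr) * ‖spatial y‖ + |C₁| * ‖spatial y‖
      ≤ C * ‖spatial y‖ by rw [hC]; nlinarith)
    refine le_trans ?_ (add_le_add (e1.trans e4) (hyL.trans e5))
    refine le_trans (le_of_eq ?_) (abs_add_le _ _)
    congr 1; ring

end System

end

section

open NearField

/-! ### The energy-momentum tensor near a particle -/

/-- The bilinear form whose diagonal is the energy-momentum tensor. -/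
def stress (F G : Matrix (Fin 4) (Fin 4) ℝ) (μ ν : Fin 4) : ℝ :=
  ∑ κ, F μ κ * (G * metric) ν κ
    - 1 / 4 * metric μ ν * ∑ α, ∑ β, F α β * (metric * G * metric) α β

lemma energyMomentum_eq_stress (F : Matrix (Fin 4) (Fin 4) ℝ) (μ ν : Fin 4) :
    energyMomentum F μ ν = stress F F μ ν := rfl

lemma stress_add_left (F F' G : Matrix (Fin 4) (Fin 4) ℝ) (μ ν : Fin 4) :
    stress (F + F') G μ ν = stress F G μ ν + stress F' G μ ν := by
  simp only [stress, Matrix.add_apply, add_mul, Finset.sum_add_distrib]; ring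

lemma stress_add_right (F G G' : Matrix (Fin 4) (Fin 4) ℝ) (μ ν : Fin 4) :
    stress F (G + G') μ ν = stress F G μ ν + stress F G' μ ν := by
  simp only [stress, Matrix.add_mul, Matrix.add_apply, mul_add,
    Finset.sum_add_distrib]; ring

lemma stress_smul_left (c : ℝ) (F G : Matrix (Fin 4) (Fin 4) ℝ) (μ ν : Fin 4) :
    stress (c • F) G μ ν = c * stress F G μ ν := by
  simp only [stress, Matrix.smul_apply, smul_eq_mul, mul_assoc, ← Finset.mul_sum]; ring

lemma stress_smul_right (c : ℝ) (F G : Matrix (Fin 4) (Fin 4) ℝ) (μ ν : Fin 4) :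
    stress F (c • G) μ ν = c * stress F G μ ν := by
  simp only [stress, Matrix.smul_mul, Matrix.mul_smul, Matrix.smul_apply, smul_eq_mul,
    mul_left_comm _ c, ← Finset.mul_sum]; ring

lemma stress_neg_left (F G : Matrix (Fin 4) (Fin 4) ℝ) (μ ν : Fin 4) :
    stress (-F) G μ ν = -stress F G μ ν := by
  rw [← neg_one_smul ℝ F, stress_smul_left]; ring

lemma stress_neg_right (F G : Matrix (Fin 4) (Fin 4) ℝ) (μ ν : Fin 4) :
    stress F (-G) μ ν = -stress F G μ ν := by
  rw [← neg_one_smul ℝ G, stress_smul_right]; ring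

lemma mul_metric_apply (F : Matrix (Fin 4) (Fin 4) ℝ) (μ ν : Fin 4) :
    (F * metric) μ ν = F μ ν * (![-1, 1, 1, 1] : Fin 4 → ℝ) ν := by
  rw [metric, Matrix.mul_diagonal]

lemma metric_mul_mul_metric_apply (F : Matrix (Fin 4) (Fin 4) ℝ) (μ ν : Fin 4) :
    (metric * F * metric) μ ν =
      (![-1, 1, 1, 1] : Fin 4 → ℝ) μ * F μ ν * (![-1, 1, 1, 1] : Fin 4 → ℝ) ν := by
  rw [metric, Matrix.mul_diagonal, Matrix.diagonal_mul]

lemma abs_metric_le (μ : Fin 4) : |(![-1, 1, 1, 1] : Fin 4 → ℝ) μ| = 1 := by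
  fin_cases μ <;> simp

lemma abs_metric_apply_le (μ ν : Fin 4) : |metric μ ν| ≤ 1 := by
  rw [metric, Matrix.diagonal_apply]
  split_ifs
  · rw [abs_metric_le]
  · simp

lemma abs_stress_le {F G : Matrix (Fin 4) (Fin 4) ℝ} {a b : ℝ} (hF : ∀ μ ν, |F μ ν| ≤ a)
    (hG : ∀ μ ν, |G μ ν| ≤ b) (μ ν : Fin 4) : |stress F G μ ν| ≤ 8 * (a * b) := by
  have ha : 0 ≤ a := (abs_nonneg _).trans (hF 0 0)
  have h1 : |∑ κ, F μ κ * (G * metric) ν κ| ≤ 4 * (a * b) := by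
    refine (Finset.abs_sum_le_sum_abs _ _).trans ?_
    calc ∑ κ, |F μ κ * (G * metric) ν κ| ≤ ∑ _κ : Fin 4, a * b := by
          refine Finset.sum_le_sum fun κ _ => ?_
          rw [mul_metric_apply, abs_mul, abs_mul, abs_metric_le, mul_one]
          exact mul_le_mul (hF _ _) (hG _ _) (abs_nonneg _) ha
      _ = 4 * (a * b) := by simp
  have h2 : |∑ α, ∑ β, F α β * (metric * G * metric) α β| ≤ 16 * (a * b) := by
    refine (Finset.abs_sum_le_sum_abs _ _).trans ?_
    calc ∑ α, |∑ β, F α β * (metric * G * metric) α β| ≤ ∑ _α : Fin 4, ∑ _β : Fin 4, a * b := by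
          refine Finset.sum_le_sum fun α _ => (Finset.abs_sum_le_sum_abs _ _).trans
            (Finset.sum_le_sum fun β _ => ?_)
          rw [metric_mul_mul_metric_apply, abs_mul, abs_mul, abs_mul, abs_metric_le, abs_metric_le,
            mul_one, one_mul]
          exact mul_le_mul (hF _ _) (hG _ _) (abs_nonneg _) ha
      _ = 16 * (a * b) := by simp; ring
  have h3 : |1 / 4 * metric μ ν * ∑ α, ∑ β, F α β * (metric * G * metric) α β| ≤ 4 * (a * b) := by
    rw [abs_mul, abs_mul]
    have := abs_metric_apply_le μ ν
    have h4 : |(1 / 4 : ℝ)| = 1 / 4 := by norm_num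
    rw [h4]
    have h5 : 0 ≤ |∑ α, ∑ β, F α β * (metric * G * metric) α β| := abs_nonneg _
    nlinarith
  rw [stress]
  refine (abs_sub _ _).trans ?_
  linarith

namespace System

variable {N : ℕ} {S : System N}

variable (S) in
/-- The part of order `-4` of the energy-momentum tensor near the `n`-th particle. -/
def stress₄ (n : Fin N) (c : ℝ) (y : Spacetime) (μ ν : Fin 4) : ℝ :=
  stress (S.near₂ n c y) (S.near₂ n c y) μ ν

variable (S) in
/-- The part of order `-3` of the energy-momentum tensor near the `n`-th particle. -/
def stress₃ (n : Fin N) (c : ℝ) (y : Spacetime) (μ ν : Fin 4) : ℝ :=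
  stress (S.near₂ n c y) (S.near₁ n c y) μ ν + stress (S.near₁ n c y) (S.near₂ n c y) μ ν

lemma _root_.PointCharges.IsWorldline.dist_pos {X : ℝ → Spacetime} (hX : IsWorldline X) {c : ℝ}
    {y : Spacetime} (hy : |y 0| < ‖spatial y‖) : 0 < NearField.dist (deriv X c) y := by
  refine Real.sqrt_pos.2 ?_
  have h1 : 0 < mdot y y := by
    rw [mdot_self_eq, ← sq_abs (y 0)]
    have := pow_lt_pow_left₀ hy (abs_nonneg _) two_ne_zero
    linarith
  nlinarith [hX.timelike c, sq_nonneg (mdot y (deriv X c))]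

lemma near₂_neg (hreg : S.IsRegular) (n : Fin N) (c : ℝ) (y : Spacetime) :
    S.near₂ n c (-y) = -S.near₂ n c y := by
  ext μ ν
  simp only [near₂, Matrix.of_apply, Matrix.neg_apply,
    F₂_neg ((hreg.worldlines n).timelike c).ne]
  ring

lemma near₁_neg (hreg : S.IsRegular) (n : Fin N) (c : ℝ) {y : Spacetime}
    (hy : |y 0| < ‖spatial y‖) : S.near₁ n c (-y) = S.near₁ n c y := by
  ext μ ν
  simp only [near₁, Matrix.of_apply, F₁_neg ((hreg.worldlines n).timelike c).ne
    ((hreg.worldlines n).dist_pos hy).ne']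

lemma near₀_neg (hreg : S.IsRegular) (n : Fin N) (c : ℝ) {y : Spacetime}
    (hy : |y 0| < ‖spatial y‖) :
    S.near₀ n c (-y) = (2 : ℝ) • S.radiation n c - S.near₀ n c y := by
  ext μ ν
  have := F₀_add_neg (u := deriv (S.worldline n) c) (a := deriv (deriv (S.worldline n)) c)
    (b := deriv (deriv (deriv (S.worldline n))) c) (μ := μ) (ν := ν)
    ((hreg.worldlines n).timelike c).ne ((hreg.worldlines n).dist_pos hy).ne'
  simp only [near₀, radiation, Matrix.of_apply, Matrix.sub_apply, Matrix.smul_apply, smul_eq_mul]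
  linear_combination S.charge n / (4 * Real.pi) * this

lemma near₂_smul (hreg : S.IsRegular) (n : Fin N) (c : ℝ) (y : Spacetime) {r : ℝ} (hr : 0 < r) :
    S.near₂ n c (r • y) = (r ^ 2)⁻¹ • S.near₂ n c y := by
  ext μ ν
  simp only [near₂, Matrix.of_apply, Matrix.smul_apply, smul_eq_mul,
    F₂_smul ((hreg.worldlines n).timelike c).ne hr]
  ring

lemma near₁_smul (hreg : S.IsRegular) (n : Fin N) (c : ℝ) {y : Spacetime}
    (hy : |y 0| < ‖spatial y‖) {r : ℝ} (hr : 0 < r) :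
    S.near₁ n c (r • y) = r⁻¹ • S.near₁ n c y := by
  ext μ ν
  simp only [near₁, Matrix.of_apply, Matrix.smul_apply, smul_eq_mul,
    F₁_smul ((hreg.worldlines n).timelike c).ne ((hreg.worldlines n).dist_pos hy).ne' hr]
  ring

lemma stress₄_smul (hreg : S.IsRegular) (n : Fin N) (c : ℝ) (y : Spacetime) {r : ℝ} (hr : 0 < r)
    (μ ν : Fin 4) : S.stress₄ n c (r • y) μ ν = (r ^ 4)⁻¹ * S.stress₄ n c y μ ν := by
  simp only [stress₄, near₂_smul hreg n c y hr, stress_smul_left, stress_smul_right]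
  field_simp

lemma stress₃_smul (hreg : S.IsRegular) (n : Fin N) (c : ℝ) {y : Spacetime}
    (hy : |y 0| < ‖spatial y‖) {r : ℝ} (hr : 0 < r)
    (μ ν : Fin 4) : S.stress₃ n c (r • y) μ ν = (r ^ 3)⁻¹ * S.stress₃ n c y μ ν := by
  simp only [stress₃, near₂_smul hreg n c y hr, near₁_smul hreg n c hy hr, stress_smul_left,
    stress_smul_right]
  field_simp

lemma measurable_near₂ (n : Fin N) (c : ℝ) (μ ν : Fin 4) :
    Measurable fun y => S.near₂ n c y μ ν := measurable_F₂.const_mul _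

lemma measurable_near₁ (n : Fin N) (c : ℝ) (μ ν : Fin 4) :
    Measurable fun y => S.near₁ n c y μ ν := measurable_F₁.const_mul _

lemma _root_.PointCharges.measurable_stress {α : Type*} [MeasurableSpace α]
    {F G : α → Matrix (Fin 4) (Fin 4) ℝ} (hF : ∀ μ ν, Measurable fun x => F x μ ν)
    (hG : ∀ μ ν, Measurable fun x => G x μ ν) (μ ν : Fin 4) :
    Measurable fun x => stress (F x) (G x) μ ν := by
  simp only [stress, metric_mul_mul_metric_apply]
  simp only [mul_metric_apply]
  exact (Finset.measurable_fun_sum _ fun κ _ => (hF μ κ).mul ((hG ν κ).mul_const _)).sub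
    (measurable_const.mul (Finset.measurable_fun_sum _ fun α _ =>
      Finset.measurable_fun_sum _ fun β _ => (hF α β).mul (((hG α β).const_mul _).mul_const _)))

lemma measurable_stress₄ (n : Fin N) (c : ℝ) (μ ν : Fin 4) :
    Measurable fun y => S.stress₄ n c y μ ν :=
  measurable_stress (measurable_near₂ n c) (measurable_near₂ n c) μ ν

lemma measurable_stress₃ (n : Fin N) (c : ℝ) (μ ν : Fin 4) :
    Measurable fun y => S.stress₃ n c y μ ν :=
  (measurable_stress (measurable_near₂ n c) (measurable_near₁ n c) μ ν).add
    (measurable_stress (measurable_near₁ n c) (measurable_near₂ n c) μ ν)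

/-- The even and odd parts of the field and of the energy-momentum tensor near a particle, where
`Fr` is the sum of the radiation field and the external field on the world-line. The parts which the
renormalization has to control have a definite parity, since the near field is odd in order `-2`,
even in order `-1`, and odd up to the constant `Fr` in order `0`. -/
theorem IsRegular.exists_near_stress (hreg : S.IsRegular) (n : Fin N) :
    ∃ Fr : ℝ → Matrix (Fin 4) (Fin 4) ℝ, ∀ A B β : ℝ, 0 ≤ β → β < 1 → ∃ C > 0, ∃ δ > 0,
      ∀ c ∈ Set.Icc A B, ∀ y : Spacetime, |y 0| ≤ β * ‖spatial y‖ → 0 < ‖spatial y‖ →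
        ‖spatial y‖ < δ → ∀ μ ν,
          |S.field (S.worldline n c + y) μ ν + S.field (S.worldline n c - y) μ ν
            - 2 * (S.near₁ n c y μ ν + Fr c μ ν)| ≤ C * ‖spatial y‖ ∧
          |energyMomentum (S.field (S.worldline n c + y)) μ ν| ≤ C * ‖spatial y‖ ^ (-4 : ℤ) ∧
          |energyMomentum (S.field (S.worldline n c + y)) μ ν
            + energyMomentum (S.field (S.worldline n c - y)) μ ν
            - 2 * S.stress₄ n c y μ ν| ≤ C * ‖spatial y‖ ^ (-2 : ℤ) ∧
          |energyMomentum (S.field (S.worldline n c + y)) μ ν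
            - energyMomentum (S.field (S.worldline n c - y)) μ ν
            - 2 * S.stress₃ n c y μ ν
            - 2 * (stress (S.near₂ n c y) (Fr c) μ ν + stress (Fr c) (S.near₂ n c y) μ ν)|
              ≤ C * ‖spatial y‖ ^ (-1 : ℤ) ∧
          |S.stress₄ n c y μ ν| ≤ C * ‖spatial y‖ ^ (-4 : ℤ) ∧
          |S.stress₃ n c y μ ν| ≤ C * ‖spatial y‖ ^ (-3 : ℤ) ∧
          |S.near₂ n c y μ ν| ≤ C * ‖spatial y‖ ^ (-2 : ℤ) ∧
          |S.near₁ n c y μ ν| ≤ C * ‖spatial y‖ ^ (-1 : ℤ) := by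
  obtain ⟨Fe, hFe⟩ := hreg.exists_near_field n
  refine ⟨fun c => S.radiation n c + Fe c, fun A B β hβ0 hβ => ?_⟩
  obtain ⟨C, hC, δ, hδ, hb⟩ := hFe A B β hβ0 hβ
  refine ⟨2 * C + 1000 * C ^ 2, by positivity, min δ 1, lt_min hδ one_pos,
    fun c hc y hy h0 h1 => ?_⟩
  set r := ‖spatial y‖ with hr
  have hr1 : r ≤ 1 := h1.le.trans (min_le_right _ _)
  have hlt : |y 0| < ‖spatial y‖ := lt_of_le_of_lt hy (by nlinarith)
  have hb1 := hb c hc y hy h0 (h1.trans_le (min_le_left _ _))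
  have hb2 := hb c hc (-y) (by simpa [spatial_neg] using hy) (by rwa [spatial_neg, norm_neg])
    (by rw [spatial_neg, norm_neg]; exact h1.trans_le (min_le_left _ _))
  simp only [spatial_neg, norm_neg, near₂_neg hreg, near₁_neg hreg n c hlt,
    near₀_neg hreg n c hlt, ← hr, ← sub_eq_add_neg] at hb2
  set F := S.field (S.worldline n c + y) with hF
  set G := S.field (S.worldline n c - y) with hG
  set A2 := S.near₂ n c y with hA2
  set A1 := S.near₁ n c y with hA1
  set A0 := S.near₀ n c y + Fe c with hA0
  set A0' := (2 : ℝ) • S.radiation n c - S.near₀ n c y + Fe c with hA0'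
  set R := F - (A2 + A1 + A0) with hR
  set R' := G - (-A2 + A1 + A0') with hR'
  have eF : F = A2 + (A1 + (A0 + R)) := by rw [hR]; abel
  have eG : G = -A2 + (A1 + (A0' + R')) := by rw [hR']; abel
  have hFr : ∀ M : Matrix (Fin 4) (Fin 4) ℝ, M = S.radiation n c + Fe c →
      A0 + A0' = (2 : ℝ) • M := by
    rintro M rfl; rw [hA0, hA0']; module
  set Fr := S.radiation n c + Fe c with hFrd
  have hFr := hFr Fr rfl
  have n2 : ∀ μ ν, |A2 μ ν| ≤ C * r ^ (-2 : ℤ) := fun μ ν => (hb1 μ ν).1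
  have n1 : ∀ μ ν, |A1 μ ν| ≤ C * r ^ (-1 : ℤ) := fun μ ν => (hb1 μ ν).2.1
  have n0 : ∀ μ ν, |A0 μ ν| ≤ C := fun μ ν => (hb1 μ ν).2.2.1
  have n0' : ∀ μ ν, |A0' μ ν| ≤ C := fun μ ν => (hb2 μ ν).2.2.1
  have nR : ∀ μ ν, |R μ ν| ≤ C * r := fun μ ν => (hb1 μ ν).2.2.2
  have nR' : ∀ μ ν, |R' μ ν| ≤ C * r := fun μ ν => (hb2 μ ν).2.2.2
  -- powers of `r`
  have hz : ∀ k m : ℤ, r ^ k * r ^ m = r ^ (k + m) := fun k m => (zpow_add₀ h0.ne' _ _).symm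
  have hmono : ∀ {k m : ℤ}, k ≤ m → r ^ m ≤ r ^ k := fun h =>
    zpow_le_zpow_right_of_le_one₀ h0 hr1 h
  have hpos : ∀ k : ℤ, 0 < r ^ k := fun k => zpow_pos h0 k
  have bd : ∀ {P Q : Matrix (Fin 4) (Fin 4) ℝ} {k m j : ℤ}, (∀ μ ν, |P μ ν| ≤ C * r ^ k) →
      (∀ μ ν, |Q μ ν| ≤ C * r ^ m) → j ≤ k + m → ∀ μ ν, |stress P Q μ ν| ≤ 8 * C ^ 2 * r ^ j := by
    intro P Q k m j hP hQ hj μ ν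
    refine (abs_stress_le hP hQ μ ν).trans ?_
    have : C * r ^ k * (C * r ^ m) = C ^ 2 * r ^ (k + m) := by rw [← hz]; ring
    rw [this, mul_assoc]
    have := hmono hj
    gcongr
  have n0z : ∀ μ ν, |A0 μ ν| ≤ C * r ^ (0 : ℤ) := fun μ ν => by simpa using n0 μ ν
  have n0z' : ∀ μ ν, |A0' μ ν| ≤ C * r ^ (0 : ℤ) := fun μ ν => by simpa using n0' μ ν
  have nRz : ∀ μ ν, |R μ ν| ≤ C * r ^ (1 : ℤ) := fun μ ν => by simpa using nR μ ν
  have nRz' : ∀ μ ν, |R' μ ν| ≤ C * r ^ (1 : ℤ) := fun μ ν => by simpa using nR' μ ν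
  intro μ ν
  have hC2 : 0 ≤ C ^ 2 := sq_nonneg C
  have hle : ∀ {x : ℝ} {k : ℤ}, x ≤ 1000 * C ^ 2 * r ^ k → x ≤ (2 * C + 1000 * C ^ 2) * r ^ k :=
    fun h => h.trans (mul_le_mul_of_nonneg_right (by linarith) (hpos _).le)
  have hle' : ∀ {x : ℝ} {k : ℤ}, x ≤ C * r ^ k → x ≤ (2 * C + 1000 * C ^ 2) * r ^ k :=
    fun h => h.trans (mul_le_mul_of_nonneg_right (by linarith) (hpos _).le)
  refine ⟨?_, ?_, ?_, ?_, ?_, ?_, hle' (n2 μ ν), hle' (n1 μ ν)⟩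
  · have : F μ ν + G μ ν - 2 * (A1 μ ν + Fr μ ν) = R μ ν + R' μ ν := by
      have h2 := congrFun (congrFun hFr μ) ν
      simp only [Matrix.add_apply, Matrix.smul_apply, smul_eq_mul] at h2
      rw [eF, eG]
      simp only [Matrix.add_apply, Matrix.neg_apply]
      linear_combination h2
    rw [this]
    refine (abs_add_le _ _).trans ?_
    have := nR μ ν; have := nR' μ ν
    nlinarith [mul_nonneg hC2 h0.le]
  · rw [energyMomentum_eq_stress, eF]
    simp only [stress_add_left, stress_add_right]
    refine hle ?_
    have e1 := bd n2 n2 (j := -4) (by norm_num) μ ν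
    have e2 := bd n2 n1 (j := -4) (by norm_num) μ ν
    have e3 := bd n2 n0z (j := -4) (by norm_num) μ ν
    have e4 := bd n2 nRz (j := -4) (by norm_num) μ ν
    have f1 := bd n1 n2 (j := -4) (by norm_num) μ ν
    have f2 := bd n1 n1 (j := -4) (by norm_num) μ ν
    have f3 := bd n1 n0z (j := -4) (by norm_num) μ ν
    have f4 := bd n1 nRz (j := -4) (by norm_num) μ ν
    have g1 := bd n0z n2 (j := -4) (by norm_num) μ ν
    have g2 := bd n0z n1 (j := -4) (by norm_num) μ ν
    have g3 := bd n0z n0z (j := -4) (by norm_num) μ ν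
    have g4 := bd n0z nRz (j := -4) (by norm_num) μ ν
    have k1 := bd nRz n2 (j := -4) (by norm_num) μ ν
    have k2 := bd nRz n1 (j := -4) (by norm_num) μ ν
    have k3 := bd nRz n0z (j := -4) (by norm_num) μ ν
    have k4 := bd nRz nRz (j := -4) (by norm_num) μ ν
    rw [abs_le] at *
    have := mul_nonneg hC2 (hpos (-4)).le
    constructor <;> linarith
  · rw [energyMomentum_eq_stress, energyMomentum_eq_stress, stress₄, ← hA2, eF, eG]
    simp only [stress_add_left, stress_add_right, stress_neg_left, stress_neg_right]
    refine hle ?_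
    have e3 := bd n2 n0z (j := -2) (by norm_num) μ ν
    have e4 := bd n2 nRz (j := -2) (by norm_num) μ ν
    have e3' := bd n2 n0z' (j := -2) (by norm_num) μ ν
    have e4' := bd n2 nRz' (j := -2) (by norm_num) μ ν
    have f2 := bd n1 n1 (j := -2) (by norm_num) μ ν
    have f3 := bd n1 n0z (j := -2) (by norm_num) μ ν
    have f4 := bd n1 nRz (j := -2) (by norm_num) μ ν
    have f3' := bd n1 n0z' (j := -2) (by norm_num) μ ν
    have f4' := bd n1 nRz' (j := -2) (by norm_num) μ ν
    have g1 := bd n0z n2 (j := -2) (by norm_num) μ ν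
    have g2 := bd n0z n1 (j := -2) (by norm_num) μ ν
    have g3 := bd n0z n0z (j := -2) (by norm_num) μ ν
    have g4 := bd n0z nRz (j := -2) (by norm_num) μ ν
    have k1 := bd nRz n2 (j := -2) (by norm_num) μ ν
    have k2 := bd nRz n1 (j := -2) (by norm_num) μ ν
    have k3 := bd nRz n0z (j := -2) (by norm_num) μ ν
    have k4 := bd nRz nRz (j := -2) (by norm_num) μ ν
    have g1' := bd n0z' n2 (j := -2) (by norm_num) μ ν
    have g2' := bd n0z' n1 (j := -2) (by norm_num) μ ν
    have g3' := bd n0z' n0z' (j := -2) (by norm_num) μ ν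
    have g4' := bd n0z' nRz' (j := -2) (by norm_num) μ ν
    have k1' := bd nRz' n2 (j := -2) (by norm_num) μ ν
    have k2' := bd nRz' n1 (j := -2) (by norm_num) μ ν
    have k3' := bd nRz' n0z' (j := -2) (by norm_num) μ ν
    have k4' := bd nRz' nRz' (j := -2) (by norm_num) μ ν
    rw [abs_le] at *
    have := mul_nonneg hC2 (hpos (-2)).le
    constructor <;> linarith
  · rw [energyMomentum_eq_stress, energyMomentum_eq_stress, stress₃, ← hA2, ← hA1, eF, eG]
    have s1 : 2 * stress A2 Fr μ ν = stress A2 A0 μ ν + stress A2 A0' μ ν := by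
      rw [← stress_smul_right, ← hFr, stress_add_right]
    have s2 : 2 * stress Fr A2 μ ν = stress A0 A2 μ ν + stress A0' A2 μ ν := by
      rw [← stress_smul_left, ← hFr, stress_add_left]
    rw [mul_add 2 (stress A2 Fr μ ν), s1, s2]
    simp only [stress_add_left, stress_add_right, stress_neg_left, stress_neg_right]
    refine hle ?_
    have e4 := bd n2 nRz (j := -1) (by norm_num) μ ν
    have e4' := bd n2 nRz' (j := -1) (by norm_num) μ ν
    have f3 := bd n1 n0z (j := -1) (by norm_num) μ ν
    have f4 := bd n1 nRz (j := -1) (by norm_num) μ ν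
    have f3' := bd n1 n0z' (j := -1) (by norm_num) μ ν
    have f4' := bd n1 nRz' (j := -1) (by norm_num) μ ν
    have g2 := bd n0z n1 (j := -1) (by norm_num) μ ν
    have g3 := bd n0z n0z (j := -1) (by norm_num) μ ν
    have g4 := bd n0z nRz (j := -1) (by norm_num) μ ν
    have k1 := bd nRz n2 (j := -1) (by norm_num) μ ν
    have k2 := bd nRz n1 (j := -1) (by norm_num) μ ν
    have k3 := bd nRz n0z (j := -1) (by norm_num) μ ν
    have k4 := bd nRz nRz (j := -1) (by norm_num) μ ν
    have g2' := bd n0z' n1 (j := -1) (by norm_num) μ ν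
    have g3' := bd n0z' n0z' (j := -1) (by norm_num) μ ν
    have g4' := bd n0z' nRz' (j := -1) (by norm_num) μ ν
    have k1' := bd nRz' n2 (j := -1) (by norm_num) μ ν
    have k2' := bd nRz' n1 (j := -1) (by norm_num) μ ν
    have k3' := bd nRz' n0z' (j := -1) (by norm_num) μ ν
    have k4' := bd nRz' nRz' (j := -1) (by norm_num) μ ν
    rw [abs_le] at *
    have := mul_nonneg hC2 (hpos (-1)).le
    constructor <;> linarith
  · refine hle ((bd n2 n2 (j := -4) (by norm_num) μ ν).trans ?_)
    exact mul_le_mul_of_nonneg_right (by linarith) (hpos _).le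
  · refine hle ((abs_add_le _ _).trans ?_)
    have e1 := bd n2 n1 (j := -3) (by norm_num) μ ν
    have e2 := bd n1 n2 (j := -3) (by norm_num) μ ν
    have := mul_nonneg hC2 (hpos (-3)).le
    linarith

end System

end

/-! ### Calculus of `R`-limits -/

lemma HasRLim.add {f g : ℝ → ℝ} {b c : ℝ} (hf : HasRLim f b) (hg : HasRLim g c) :
    HasRLim (fun r => f r + g r) (b + c) := by
  obtain ⟨a, ha⟩ := hf
  obtain ⟨a', ha'⟩ := hg
  exact ⟨a + a', (ha.add ha').congr_left fun r => by ring⟩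

lemma HasRLim.const_mul {f : ℝ → ℝ} {b : ℝ} (hf : HasRLim f b) (k : ℝ) :
    HasRLim (fun r => k * f r) (k * b) := by
  obtain ⟨a, ha⟩ := hf
  exact ⟨k * a, (ha.const_mul_left k).congr_left fun r => by ring⟩

lemma hasRLim_const (b : ℝ) : HasRLim (fun _ => b) b :=
  ⟨0, (isBigO_zero (fun r : ℝ => r) (𝓝[>] 0)).congr_left fun r => by simp⟩

lemma HasRLim.sum {ι : Type*} (s : Finset ι) {f : ι → ℝ → ℝ} {b : ι → ℝ}
    (h : ∀ i ∈ s, HasRLim (f i) (b i)) : HasRLim (fun r => ∑ i ∈ s, f i r) (∑ i ∈ s, b i) := by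
  classical
  induction s using Finset.induction_on with
  | empty => simpa using hasRLim_const 0
  | insert i s hi ih =>
    simp only [Finset.sum_insert hi]
    exact (h i (Finset.mem_insert_self i s)).add
      (ih fun j hj => h j (Finset.mem_insert_of_mem hj))

lemma HasRLim.congr {f g : ℝ → ℝ} {b : ℝ} (hf : HasRLim f b) (h : ∀ᶠ r in 𝓝[>] 0, f r = g r) :
    HasRLim g b := by
  obtain ⟨a, ha⟩ := hf
  exact ⟨a, ha.congr' (h.mono fun r hr => by simp only [hr]) (EventuallyEq.refl _ _)⟩

lemma eventually_pos_lt {δ : ℝ} (hδ : 0 < δ) : ∀ᶠ r : ℝ in 𝓝[>] 0, 0 < r ∧ r < δ :=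
  Ioo_mem_nhdsGT hδ

/-- The constant term of an `R`-limit is not affected by a term `a / r + O(r)`. -/
lemma HasRLim.of_abs_sub_le {f g : ℝ → ℝ} {b a C δ : ℝ} (hf : HasRLim f b) (hδ : 0 < δ)
    (h : ∀ r, 0 < r → r < δ → |g r - f r - a / r| ≤ C * r) : HasRLim g b := by
  obtain ⟨a', ha'⟩ := hf
  refine ⟨a' + a, ?_⟩
  have h1 : (fun r => g r - f r - a / r) =O[𝓝[>] 0] fun r => r := by
    refine IsBigO.of_bound C ?_
    filter_upwards [eventually_pos_lt hδ] with r hr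
    rw [Real.norm_eq_abs, Real.norm_eq_abs, abs_of_pos hr.1]
    exact h r hr.1 hr.2
  exact (ha'.add h1).congr_left fun r => by ring

/-! ### Integrals near a singularity which is symmetric up to lower order -/

section Symmetrization

variable {E : Type*} [MeasurableSpace E] {μ : Measure E}

lemma abs_integral_mul_le {K : Set E} (hK : μ K < ⊤) {f Φ : E → ℝ} {M ε : ℝ}
    (hΦ : ∀ y ∉ K, Φ y = 0) (hM : ∀ y, |Φ y| ≤ M) (hε : 0 ≤ ε) (h : ∀ y ∈ K, |f y| ≤ ε) :
    |∫ y, f y * Φ y ∂μ| ≤ ε * M * μ.real K := by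
  have h0 : ∀ y ∉ K, f y * Φ y = 0 := fun y hy => by simp [hΦ y hy]
  have h1 : ∫ y in K, f y * Φ y ∂μ = ∫ y, f y * Φ y ∂μ :=
    setIntegral_eq_integral_of_forall_compl_eq_zero h0
  rw [← h1]
  change ‖∫ y in K, f y * Φ y ∂μ‖ ≤ _
  refine norm_setIntegral_le_of_norm_le_const hK fun y hy => ?_
  rw [norm_mul]
  exact mul_le_mul (h y hy) (hM y) (norm_nonneg _) hε

lemma integrable_mul_of_bounded {K : Set E} (hK : μ K < ⊤) (hKm : MeasurableSet K) {f Φ : E → ℝ}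
    {M B : ℝ} (hf : AEStronglyMeasurable f (μ.restrict K)) (hΦm : AEStronglyMeasurable Φ μ)
    (hΦ : ∀ y ∉ K, Φ y = 0) (hM : ∀ y, |Φ y| ≤ M) (h : ∀ y ∈ K, |f y| ≤ B) :
    Integrable (fun y => f y * Φ y) μ := by
  have h1 : IntegrableOn (fun y => f y * Φ y) K μ := by
    refine IntegrableOn.of_bound hK (hf.mul hΦm.restrict) (B * M) ?_
    refine (ae_restrict_iff' hKm).2 (ae_of_all _ fun y hy => ?_)
    rw [norm_mul]
    exact mul_le_mul (h y hy) (hM y) (norm_nonneg _) ((abs_nonneg _).trans (h y hy))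
  exact h1.integrable_of_forall_notMem_eq_zero fun y hy => by simp [hΦ y hy]

variable [AddCommGroup E] [MeasurableNeg E] [μ.IsNegInvariant]

/-- If the weight `Φ` has the parity `σ`, then only the part of `f` of the same parity matters. -/
lemma abs_integral_sub_le_of_parity {K : Set E} (hK : μ K < ⊤) (hKm : MeasurableSet K)
    {f h Φ : E → ℝ} {M B ε σ : ℝ}
    (hf : AEStronglyMeasurable f (μ.restrict K)) (hΦm : AEStronglyMeasurable Φ μ)
    (hΦ : ∀ y ∉ K, Φ y = 0) (hM : ∀ y, |Φ y| ≤ M) (hΦσ : ∀ y, Φ (-y) = σ * Φ y)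
    (hfB : ∀ y ∈ K, |f y| ≤ B)
    (hh : Integrable (fun y => h y * Φ y) μ) (hε : 0 ≤ ε)
    (hs : ∀ y ∈ K, |f y + σ * f (-y) - 2 * h y| ≤ 2 * ε) :
    |∫ y, f y * Φ y ∂μ - ∫ y, h y * Φ y ∂μ| ≤ ε * M * μ.real K := by
  have h1 : Integrable (fun y => f y * Φ y) μ := integrable_mul_of_bounded hK hKm hf hΦm hΦ hM hfB
  have h2 : Integrable (fun y => f (-y) * Φ (-y)) μ := h1.comp_neg
  have h3 : ∫ y, f (-y) * Φ (-y) ∂μ = ∫ y, f y * Φ y ∂μ :=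
    integral_neg_eq_self (fun y => f y * Φ y) μ
  have h4 : ∫ y, f y * Φ y ∂μ - ∫ y, h y * Φ y ∂μ =
      ∫ y, ((f y + σ * f (-y) - 2 * h y) / 2) * Φ y ∂μ := by
    have : ∀ y, ((f y + σ * f (-y) - 2 * h y) / 2) * Φ y =
        (1 / 2) * (f y * Φ y) + (1 / 2) * (f (-y) * Φ (-y)) - h y * Φ y := fun y => by
      rw [hΦσ]; ring
    simp_rw [this]
    have h12 : Integrable (fun y => 1 / 2 * (f y * Φ y) + 1 / 2 * (f (-y) * Φ (-y))) μ :=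
      (h1.const_mul _).add (h2.const_mul _)
    rw [integral_sub h12 hh, integral_add (h1.const_mul _) (h2.const_mul _), integral_const_mul,
      integral_const_mul, h3]
    ring
  rw [h4]
  refine abs_integral_mul_le hK hΦ hM hε fun y hy => ?_
  rw [abs_div, abs_of_pos (two_pos : (0 : ℝ) < 2)]
  linarith [hs y hy]

end Symmetrization

lemma zpow_neg_le_zpow_neg {a b : ℝ} (ha : 0 < a) (h : a ≤ b) (k : ℕ) :
    b ^ (-(k : ℤ)) ≤ a ^ (-(k : ℤ)) := by
  rw [zpow_neg, zpow_neg, zpow_natCast, zpow_natCast]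
  gcongr

/-- The function `G` on space has a singularity at `z` like the energy density of a point charge: of
order `-4`, and symmetric under reflection in `z` up to order `-2`. -/
def IsCoulomb (G : Space → ℝ) (z : Space) : Prop :=
  ∃ G₄ : Space → ℝ, Measurable G₄ ∧ (∀ (y : Space) (r : ℝ), 0 < r → G₄ (r • y) = (r ^ 4)⁻¹ * G₄ y) ∧
    ∃ C > 0, ∃ δ > 0, ∀ y : Space, 0 < ‖y‖ → ‖y‖ < δ →
      |G (z + y)| ≤ C * ‖y‖ ^ (-4 : ℤ) ∧ |G₄ y| ≤ C * ‖y‖ ^ (-4 : ℤ) ∧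
      |G (z + y) + G (z - y) - 2 * G₄ y| ≤ C * ‖y‖ ^ (-2 : ℤ)

lemma IsCoulomb.congr {G G' : Space → ℝ} {z : Space} (h : IsCoulomb G z)
    (hG : ∀ᶠ x in 𝓝 z, G' x = G x) : IsCoulomb G' z := by
  obtain ⟨G₄, hm, hs, C, hC, δ, hδ, hb⟩ := h
  obtain ⟨ρ, hρ, hρ'⟩ := Metric.eventually_nhds_iff.1 hG
  refine ⟨G₄, hm, hs, C, hC, min δ ρ, lt_min hδ hρ, fun y h0 h1 => ?_⟩
  rw [hρ' (show dist (z + y) z < ρ by simpa using h1.trans_le (min_le_right _ _)),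
    hρ' (show dist (z - y) z < ρ by simpa [dist_eq_norm] using h1.trans_le (min_le_right _ _))]
  exact hb y h0 (h1.trans_le (min_le_left _ _))

lemma abs_le_of_homogeneous {G₄ : Space → ℝ}
    (hs : ∀ (y : Space) (r : ℝ), 0 < r → G₄ (r • y) = (r ^ 4)⁻¹ * G₄ y) {C δ : ℝ} (hδ : 0 < δ)
    (hb : ∀ y : Space, 0 < ‖y‖ → ‖y‖ < δ → |G₄ y| ≤ C * ‖y‖ ^ (-4 : ℤ)) (y : Space) (hy : 0 < ‖y‖) :
    |G₄ y| ≤ C * ‖y‖ ^ (-4 : ℤ) := by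
  set r := δ / 2 / ‖y‖ with hr
  have hr0 : 0 < r := by positivity
  have h1 : ‖r • y‖ = r * ‖y‖ := by rw [norm_smul, Real.norm_eq_abs, abs_of_pos hr0]
  have h2 : r * ‖y‖ = δ / 2 := by rw [hr]; field_simp
  have h3 := hb (r • y) (by rw [h1]; positivity) (by rw [h1, h2]; linarith)
  rw [hs y r hr0, h1, abs_mul, abs_of_pos (by positivity : 0 < (r ^ 4)⁻¹), mul_zpow] at h3
  have h4 : r ^ (-4 : ℤ) = (r ^ 4)⁻¹ := by rw [zpow_neg]; norm_cast
  rw [h4] at h3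
  have h5 : 0 < (r ^ 4)⁻¹ := by positivity
  refine le_of_mul_le_mul_left (h3.trans_eq ?_) h5
  ring

lemma integral_comp_div (f : Space → ℝ) (z : Space) {r : ℝ} (hr : 0 < r) :
    ∫ x, f x = r ^ 3 * ∫ y, f (z + r • y) := by
  have h1 := Measure.integral_comp_smul (volume : Measure Space) (fun y => f (z + y)) r
  rw [integral_add_left_eq_self f z] at h1
  simp only [finrank_euclideanSpace, Fintype.card_fin, smul_eq_mul] at h1
  rw [h1, abs_of_pos (by positivity)]
  field_simp

/-- Two even weights, which cut off the singularity at the scale `r` in different ways, give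
integrals which differ by `a / r + O(r)`. -/
theorem IsCoulomb.exists_weight_diff {G : Space → ℝ} {z : Space} (hG : IsCoulomb G z)
    (hGm : AEStronglyMeasurable G) {Φ : Space → ℝ} (hΦm : Measurable Φ) {η M B : ℝ} (hη : 0 < η)
    (hΦ : ∀ y, ‖y‖ < η ∨ M < ‖y‖ → Φ y = 0) (hB : ∀ y, |Φ y| ≤ B) (hs : ∀ y, Φ (-y) = Φ y) :
    ∃ a C δ : ℝ, 0 < δ ∧ ∀ r, 0 < r → r < δ →
      |(∫ x, G x * Φ (r⁻¹ • (x - z))) - a / r| ≤ C * r := by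
  obtain ⟨G₄, hm, hsm, C, hC, δ, hδ, hb⟩ := hG
  set M' := max M 1
  have hM' : 0 < M' := lt_max_of_lt_right one_pos
  set K : Set Space := {y | η ≤ ‖y‖ ∧ ‖y‖ ≤ M'} with hK
  have hKm : MeasurableSet K :=
    (measurableSet_le measurable_const measurable_norm).inter
      (measurableSet_le measurable_norm measurable_const)
  have hKf : volume K < ⊤ := by
    refine (measure_mono ?_).trans_lt (measure_closedBall_lt_top (x := (0 : Space)) (r := M'))
    intro y hy
    simpa using hy.2
  have hΦK : ∀ y ∉ K, Φ y = 0 := fun y hy => by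
    refine hΦ y ?_
    by_contra! hcon
    exact hy ⟨hcon.1, hcon.2.trans (le_max_left _ _)⟩
  have hG₄ : ∀ y ∈ K, |G₄ y| ≤ C * η ^ (-4 : ℤ) := fun y hy => by
    refine (abs_le_of_homogeneous hsm hδ (fun y h0 h1 => (hb y h0 h1).2.1) y
      (hη.trans_le hy.1)).trans ?_
    exact mul_le_mul_of_nonneg_left (zpow_neg_le_zpow_neg hη hy.1 4) hC.le
  have hint : Integrable fun y => G₄ y * Φ y :=
    integrable_mul_of_bounded hKf hKm hm.aestronglyMeasurable hΦm.aestronglyMeasurable hΦK hB hG₄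
  refine ⟨∫ y, G₄ y * Φ y, C * η ^ (-2 : ℤ) * B * volume.real K, δ / M', div_pos hδ hM',
    fun r hr hrδ => ?_⟩
  have hsmall : ∀ y ∈ K, ‖r • y‖ = r * ‖y‖ ∧ 0 < ‖r • y‖ ∧ ‖r • y‖ < δ := fun y hy => by
    have h1 : ‖r • y‖ = r * ‖y‖ := by rw [norm_smul, Real.norm_eq_abs, abs_of_pos hr]
    refine ⟨h1, h1 ▸ mul_pos hr (hη.trans_le hy.1), h1 ▸ ?_⟩
    calc r * ‖y‖ ≤ r * M' := mul_le_mul_of_nonneg_left hy.2 hr.le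
      _ < δ := by rwa [lt_div_iff₀ hM'] at hrδ
  rw [integral_comp_div _ z hr]
  have h1 : ∀ y : Space, r⁻¹ • (z + r • y - z) = y := fun y => by
    rw [add_sub_cancel_left, smul_smul, inv_mul_cancel₀ hr.ne', one_smul]
  simp only [h1]
  have hGr : AEStronglyMeasurable (fun y => G (z + r • y)) volume := by
    have h2 : Measure.QuasiMeasurePreserving (fun y : Space => z + r • y) volume volume := by
      have h3 := (measurePreserving_add_left (volume : Measure Space) z).quasiMeasurePreserving
      refine h3.comp ⟨measurable_const_smul r, ?_⟩
      rw [Measure.map_addHaar_smul _ hr.ne']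
      exact Measure.smul_absolutelyContinuous
    exact hGm.comp_quasiMeasurePreserving h2
  have key := abs_integral_sub_le_of_parity (μ := (volume : Measure Space)) (K := K) hKf hKm
    (f := fun y => G (z + r • y))
    (h := fun y => (r ^ 4)⁻¹ * G₄ y) (Φ := Φ) (M := B) (B := C * (r * η) ^ (-4 : ℤ))
    (ε := C * (r * η) ^ (-2 : ℤ) / 2) (σ := 1)
    hGr.restrict hΦm.aestronglyMeasurable hΦK hB (by simpa using hs)
    (fun y hy => by
      obtain ⟨e1, e2, e3⟩ := hsmall y hy
      refine (hb _ e2 e3).1.trans ?_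
      rw [e1]
      exact mul_le_mul_of_nonneg_left (zpow_neg_le_zpow_neg (mul_pos hr hη)
        (mul_le_mul_of_nonneg_left hy.1 hr.le) 4) hC.le)
    ((hint.const_mul ((r ^ 4)⁻¹)).congr (ae_of_all _ fun y => by ring))
    (by positivity)
    (fun y hy => by
      obtain ⟨e1, e2, e3⟩ := hsmall y hy
      rw [← hsm y r hr, one_mul, smul_neg, ← sub_eq_add_neg]
      refine (hb _ e2 e3).2.2.trans ?_
      have e4 : C * ‖r • y‖ ^ (-2 : ℤ) ≤ C * (r * η) ^ (-2 : ℤ) := by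
        rw [e1]
        exact mul_le_mul_of_nonneg_left (zpow_neg_le_zpow_neg (mul_pos hr hη)
          (mul_le_mul_of_nonneg_left hy.1 hr.le) 2) hC.le
      linarith)
  have h5 : ∫ y, (r ^ 4)⁻¹ * G₄ y * Φ y = (r ^ 4)⁻¹ * ∫ y, G₄ y * Φ y := by
    rw [← integral_const_mul]; congr 1; ext y; ring
  rw [h5] at key
  set I := ∫ y, G (z + r • y) * Φ y
  set J := ∫ y, G₄ y * Φ y
  have h6 : r ^ 3 * I - J / r = r ^ 3 * (I - (r ^ 4)⁻¹ * J) := by field_simp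
  rw [h6, abs_mul, abs_of_pos (by positivity)]
  have hB0 : 0 ≤ B := (abs_nonneg _).trans (hB 0)
  calc r ^ 3 * |I - (r ^ 4)⁻¹ * J|
      ≤ r ^ 3 * (C * (r * η) ^ (-2 : ℤ) / 2 * B * volume.real K) := by gcongr
    _ = C * η ^ (-2 : ℤ) * B * volume.real K * r / 2 := by
        rw [mul_zpow]
        have : r ^ (-2 : ℤ) = (r ^ 2)⁻¹ := by rw [zpow_neg]; norm_cast
        rw [this]; field_simp
    _ ≤ C * η ^ (-2 : ℤ) * B * volume.real K * r := by
        have : 0 ≤ C * η ^ (-2 : ℤ) * B * volume.real K * r := by positivity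
        linarith

/-- The `R`-limit may be computed with any even cutoff weight instead of the complements of
balls. -/
theorem IsCoulomb.hasRLim_weight {G : Space → ℝ} {z : Space} (hG : IsCoulomb G z)
    (hGi : ∀ r, 0 < r → IntegrableOn G {x | r ≤ ‖x - z‖}) {b : ℝ}
    (hb : HasRLim (fun r => ∫ x in {x | r ≤ ‖x - z‖}, G x) b)
    {H : Space → ℝ} (hHm : Measurable H) {η M B : ℝ} (hη : 0 < η)
    (hH0 : ∀ y, ‖y‖ < η → H y = 0) (hH1 : ∀ y, M < ‖y‖ → H y = 1) (hB : ∀ y, |H y| ≤ B)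
    (hs : ∀ y, H (-y) = H y) :
    HasRLim (fun r => ∫ x, G x * H (r⁻¹ • (x - z))) b := by
  have hms : ∀ r : ℝ, MeasurableSet {x : Space | r ≤ ‖x - z‖} := fun r =>
    (isClosed_le continuous_const (by fun_prop)).measurableSet
  have hGm : AEStronglyMeasurable G volume := by
    have h1 : (⋃ n : ℕ, {x : Space | (n + 1 : ℝ)⁻¹ ≤ ‖x - z‖}) = {z}ᶜ := by
      ext x
      simp only [Set.mem_iUnion, Set.mem_ofPred_eq, Set.mem_compl_iff, Set.mem_singleton_iff]
      constructor
      · rintro ⟨n, hn⟩ rfl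
        have : (0 : ℝ) < (n + 1 : ℝ)⁻¹ := by positivity
        simp at hn
        linarith
      · intro hx
        obtain ⟨n, hn⟩ := exists_nat_one_div_lt (norm_pos_iff.2 (sub_ne_zero.2 hx))
        exact ⟨n, by rw [← one_div]; exact hn.le⟩
    have h2 : AEStronglyMeasurable G (volume.restrict {z}ᶜ) := by
      rw [← h1]
      exact aestronglyMeasurable_iUnion_iff.2 fun n => (hGi _ (by positivity)).1
    rwa [Measure.restrict_eq_self_of_ae_mem] at h2
    exact compl_mem_ae_iff.2 (by simp)
  set S : Set Space := {y | 1 ≤ ‖y‖} with hS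
  have hSm : MeasurableSet S := measurableSet_le measurable_const measurable_norm
  have hind : Measurable (S.indicator (1 : Space → ℝ)) := measurable_one.indicator hSm
  obtain ⟨a, C, δ, hδ, hd⟩ := hG.exists_weight_diff hGm (Φ := fun y => H y - S.indicator 1 y)
    (η := min η 1) (M := max M 1) (B := B + 1) (hHm.sub hind) (lt_min hη one_pos)
    (by
      rintro y (hy | hy)
      · rw [hH0 y (hy.trans_le (min_le_left _ _)), Set.indicator_of_notMem, sub_zero]
        simpa [hS] using hy.trans_le (min_le_right _ _)
      · rw [hH1 y ((le_max_left _ _).trans_lt hy), Set.indicator_of_mem, Pi.one_apply, sub_self]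
        exact ((le_max_right _ _).trans_lt hy).le)
    (fun y => by
      refine (abs_sub _ _).trans (add_le_add (hB y) ?_)
      by_cases hy : y ∈ S <;> simp [hy])
    (fun y => by simp [hs, hS, Set.indicator])
  refine hb.of_abs_sub_le (a := a) (C := C) hδ fun r h0 hr => ?_
  have hscale : ∀ x : Space, ‖r⁻¹ • (x - z)‖ = r⁻¹ * ‖x - z‖ := fun x => by
    rw [norm_smul, Real.norm_eq_abs, abs_of_pos (inv_pos.2 h0)]
  have h1 : ∫ x in {x | r ≤ ‖x - z‖}, G x = ∫ x, G x * S.indicator 1 (r⁻¹ • (x - z)) := by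
    rw [← integral_indicator (hms r)]
    congr 1; ext x
    by_cases hx : r ≤ ‖x - z‖
    · rw [Set.indicator_of_mem (by exact hx), Set.indicator_of_mem, Pi.one_apply, mul_one]
      rw [hS, Set.mem_ofPred_eq, hscale, le_inv_mul_iff₀ h0, mul_one]; exact hx
    · rw [Set.indicator_of_notMem (by exact hx), Set.indicator_of_notMem, mul_zero]
      rw [hS, Set.mem_ofPred_eq, hscale, le_inv_mul_iff₀ h0, mul_one]; exact hx
  have hi : ∀ {H' : Space → ℝ} {B' η' : ℝ}, Measurable H' → 0 < η' → (∀ y, |H' y| ≤ B') →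
      (∀ y, ‖y‖ < η' → H' y = 0) → Integrable fun x => G x * H' (r⁻¹ • (x - z)) := by
    intro H' B' η' hm' hη' hB' h0'
    have h3 : IntegrableOn (fun x => G x * H' (r⁻¹ • (x - z))) {x | r * η' ≤ ‖x - z‖} :=
      (hGi _ (by positivity)).mul_bdd (c := B')
        ((hm'.comp (by fun_prop : Measurable fun x : Space => r⁻¹ • (x - z))).aestronglyMeasurable)
        (ae_of_all _ fun x => hB' _)
    refine h3.integrable_of_forall_notMem_eq_zero fun x hx => ?_
    rw [h0', mul_zero]
    rw [hscale, inv_mul_lt_iff₀ h0]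
    simpa using hx
  have h2 : (∫ x, G x * (H (r⁻¹ • (x - z)) - S.indicator 1 (r⁻¹ • (x - z)))) =
      (∫ x, G x * H (r⁻¹ • (x - z))) - ∫ x in {x | r ≤ ‖x - z‖}, G x := by
    rw [h1, ← integral_sub (hi hHm hη hB hH0) (hi (B' := 1) hind one_pos
      (fun y => by by_cases hy : y ∈ S <;> simp [hy]) fun y hy => by simp [hS, hy])]
    congr 1; ext x; ring
  rw [← h2]
  exact hd r h0 hr

lemma integrableOn_norm_zpow_ball (δ : ℝ) :
    IntegrableOn (fun y : Space => ‖y‖ ^ (-2 : ℤ)) (Metric.ball 0 δ) := by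
  rw [integrableOn_fun_norm_addHaar volume (f := fun x => x ^ (-2 : ℤ))]
  have h1 : IntegrableOn (fun _ : ℝ => (1 : ℝ)) (Set.Ioo 0 δ) := by
    simp [integrableOn_const_iff]
  refine h1.congr_fun (fun x hx => ?_) measurableSet_Ioo
  have : x ≠ 0 := hx.1.ne'
  simp only [finrank_euclideanSpace, Fintype.card_fin, smul_eq_mul]
  rw [zpow_neg]
  norm_cast
  field_simp

lemma integrableOn_norm_rpow_compl {δ k : ℝ} (hδ : 0 < δ) (hk : 3 < k) :
    IntegrableOn (fun y : Space => ‖y‖ ^ (-k)) {y | δ ≤ ‖y‖} := by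
  have h1 : Integrable (fun y : Space => (1 + 1 / δ) ^ k * (1 + ‖y‖) ^ (-k)) :=
    (integrable_one_add_norm (by simpa using hk)).const_mul _
  refine h1.integrableOn.mono' ?_ ?_
  · exact (measurable_norm.pow_const _).aestronglyMeasurable
  · refine (ae_restrict_iff' (measurableSet_le measurable_const measurable_norm)).2
      (ae_of_all _ fun y (hy : δ ≤ ‖y‖) => ?_)
    have hy0 : 0 < ‖y‖ := hδ.trans_le hy
    rw [Real.norm_eq_abs, abs_of_nonneg (by positivity), Real.rpow_neg hy0.le,
      Real.rpow_neg (by positivity), ← div_eq_mul_inv, ← Real.div_rpow (by positivity)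
      (by positivity), ← Real.inv_rpow hy0.le]
    refine Real.rpow_le_rpow (by positivity) ?_ (by linarith)
    rw [inv_eq_one_div, div_le_div_iff₀ hy0 (by positivity), one_mul, add_mul, one_mul]
    have : 1 ≤ 1 / δ * ‖y‖ := by rw [one_div, le_inv_mul_iff₀ hδ, mul_one]; exact hy
    linarith

open scoped Pointwise in
/-- The `R`-limit of the integral of a function with a singularity of Coulomb type exists: the
leading part of the singularity contributes exactly a multiple of `1 / r` plus a constant, the
remaining part is integrable after symmetrization. -/
theorem IsCoulomb.exists_hasRLim {G : Space → ℝ} {z : Space} (hG : IsCoulomb G z)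
    (hGi : ∀ r, 0 < r → IntegrableOn G {x | r ≤ ‖x - z‖}) :
    ∃ b, HasRLim (fun r => ∫ x in {x | r ≤ ‖x - z‖}, G x) b := by
  obtain ⟨G₄, hm, hsm, C, hC, δ, hδ, hb⟩ := hG
  have hG₄b := abs_le_of_homogeneous hsm hδ (fun y h0 h1 => (hb y h0 h1).2.1)
  set f : Space → ℝ := fun y => G (z + y) with hf
  have hms : ∀ r : ℝ, MeasurableSet {x : Space | r ≤ ‖x‖} := fun r =>
    measurableSet_le measurable_const measurable_norm
  -- everything in terms of `y = x - z`
  have htr : ∀ r : ℝ, ∫ x in {x | r ≤ ‖x - z‖}, G x = ∫ y in {y | r ≤ ‖y‖}, f y := fun r => by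
    have h1 := (measurePreserving_add_left (volume : Measure Space) z).setIntegral_preimage_emb
      (measurableEmbedding_addLeft z) G {x | r ≤ ‖x - z‖}
    rw [← h1]
    congr 2
    ext y; simp
  have hfi : ∀ r, 0 < r → IntegrableOn f {y | r ≤ ‖y‖} := fun r hr => by
    have h1 := (measurePreserving_add_left (volume : Measure Space) z).integrableOn_comp_preimage
      (measurableEmbedding_addLeft z) (f := G) (s := {x | r ≤ ‖x - z‖})
    have h2 := h1.2 (hGi r hr)
    have h3 : {y : Space | r ≤ ‖y‖} = (fun y => z + y) ⁻¹' {x | r ≤ ‖x - z‖} := by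
      ext y
      change r ≤ ‖y‖ ↔ r ≤ ‖z + y - z‖
      rw [add_sub_cancel_left]
    rw [h3]
    exact h2
  have hfi' : ∀ r, 0 < r → IntegrableOn (fun y => f (-y)) {y | r ≤ ‖y‖} := fun r hr => by
    have h2 := (integrable_indicator_iff (hms r)).2 (hfi r hr)
    refine (integrable_indicator_iff (hms r)).1 (h2.comp_neg.congr (ae_of_all _ fun y => ?_))
    simp [Set.indicator]
  have hG₄i : ∀ r, 0 < r → IntegrableOn G₄ {y | r ≤ ‖y‖} := fun r hr => by
    refine ((integrableOn_norm_rpow_compl hr (by norm_num : (3 : ℝ) < 4)).const_mul C).mono'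
      hm.aestronglyMeasurable ((ae_restrict_iff' (hms r)).2
        (ae_of_all _ fun y (hy : r ≤ ‖y‖) => ?_))
    have := hG₄b y (hr.trans_le hy)
    rw [← Real.rpow_intCast] at this
    simpa using this
  -- the symmetrized remainder
  set D : Space → ℝ := fun y => (f y + f (-y)) / 2 - G₄ y with hD
  have hDi : ∀ r, 0 < r → IntegrableOn D {y | r ≤ ‖y‖} := fun r hr =>
    (((hfi r hr).add (hfi' r hr)).div_const 2).sub (hG₄i r hr)
  have hDb : ∀ y : Space, 0 < ‖y‖ → ‖y‖ < δ → |D y| ≤ C * ‖y‖ ^ (-2 : ℤ) := fun y h0 h1 => by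
    have := (hb y h0 h1).2.2
    have e : D y = (G (z + y) + G (z - y) - 2 * G₄ y) / 2 := by
      simp only [hD, hf, ← sub_eq_add_neg]; ring
    rw [e, abs_div, abs_of_pos (two_pos : (0 : ℝ) < 2)]
    have h2 : 0 ≤ C * ‖y‖ ^ (-2 : ℤ) := by positivity
    linarith
  have hDm : AEStronglyMeasurable D volume := by
    have h1 : (⋃ n : ℕ, {x : Space | (n + 1 : ℝ)⁻¹ ≤ ‖x‖}) = {0}ᶜ := by
      ext x
      simp only [Set.mem_iUnion, Set.mem_ofPred_eq, Set.mem_compl_iff, Set.mem_singleton_iff]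
      constructor
      · rintro ⟨n, hn⟩ rfl
        have : (0 : ℝ) < (n + 1 : ℝ)⁻¹ := by positivity
        simp at hn
        linarith
      · intro hx
        obtain ⟨n, hn⟩ := exists_nat_one_div_lt (norm_pos_iff.2 hx)
        exact ⟨n, by rw [← one_div]; exact hn.le⟩
    have h2 : AEStronglyMeasurable D (volume.restrict {0}ᶜ) := by
      rw [← h1]
      exact aestronglyMeasurable_iUnion_iff.2 fun n => (hDi _ (by positivity)).1
    rwa [Measure.restrict_eq_self_of_ae_mem] at h2
    exact compl_mem_ae_iff.2 (by simp)
  have hne : ∀ᵐ y : Space, y ≠ 0 := Measure.ae_ne volume 0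
  have hDball : ∀ r, r ≤ δ → IntegrableOn D (Metric.ball 0 r) := fun r hr => by
    refine ((integrableOn_norm_zpow_ball r).const_mul C).mono' hDm.restrict
      ((ae_restrict_iff' measurableSet_ball).2 ?_)
    filter_upwards [hne] with y h0 hy
    exact hDb y (norm_pos_iff.2 h0) ((by simpa using hy : ‖y‖ < r).trans_le hr)
  have hDint : Integrable D := by
    have h1 : Metric.ball (0 : Space) δ ∪ {y | δ ≤ ‖y‖} = Set.univ := by
      ext y; simp [lt_or_ge]
    rw [← integrableOn_univ, ← h1]
    exact (hDball δ le_rfl).union (hDi δ hδ)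
  -- the contribution of the leading part
  have hG₄s : ∀ r, 0 < r → ∫ y in {y | r ≤ ‖y‖}, G₄ y = (∫ y in {y | 1 ≤ ‖y‖}, G₄ y) / r :=
    fun r hr => by
    have h1 := Measure.setIntegral_comp_smul_of_pos (volume : Measure Space) G₄
      {y | 1 ≤ ‖y‖} hr
    have h2 : r • {y : Space | 1 ≤ ‖y‖} = {y | r ≤ ‖y‖} := by
      ext y
      rw [Set.mem_smul_set_iff_inv_smul_mem₀ hr.ne']
      simp only [Set.mem_ofPred_eq]
      rw [norm_smul, Real.norm_eq_abs, abs_of_pos (inv_pos.2 hr), le_inv_mul_iff₀ hr, mul_one]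
    simp only [hsm _ r hr, h2, integral_const_mul, finrank_euclideanSpace, Fintype.card_fin,
      smul_eq_mul] at h1
    rw [eq_div_iff hr.ne']
    field_simp at h1
    linarith
  refine ⟨∫ y, D y, ∫ y in {y | 1 ≤ ‖y‖}, G₄ y, ?_⟩
  refine IsBigO.of_bound (C * ∫ y in Metric.ball (0 : Space) 1, ‖y‖ ^ (-2 : ℤ)) ?_
  filter_upwards [eventually_pos_lt hδ] with r ⟨h0, hr⟩
  have h1 : ∫ y in {y | r ≤ ‖y‖}, f (-y) = ∫ y in {y | r ≤ ‖y‖}, f y := by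
    rw [← integral_indicator (hms r), ← integral_indicator (hms r),
      ← integral_neg_eq_self ({y : Space | r ≤ ‖y‖}.indicator f)]
    congr 1; ext y
    simp [Set.indicator]
  have h2 : ∫ y in {y | r ≤ ‖y‖}, f y =
      (∫ y in {y | 1 ≤ ‖y‖}, G₄ y) / r + ∫ y in {y | r ≤ ‖y‖}, D y := by
    have hadd : IntegrableOn (fun y => (f y + f (-y)) / 2) {y | r ≤ ‖y‖} :=
      ((hfi r h0).add (hfi' r h0)).div_const 2
    rw [← hG₄s r h0, hD, integral_sub hadd (hG₄i r h0), integral_div,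
      integral_add (hfi r h0) (hfi' r h0), h1]
    ring
  have h3 : ∫ y, D y = (∫ y in Metric.ball (0 : Space) r, D y) + ∫ y in {y | r ≤ ‖y‖}, D y := by
    have e : {y : Space | r ≤ ‖y‖} = (Metric.ball (0 : Space) r)ᶜ := by
      ext y; simp
    rw [e, integral_add_compl measurableSet_ball hDint]
  have h4 : ∫ y in Metric.ball (0 : Space) r, ‖y‖ ^ (-2 : ℤ) =
      r * ∫ y in Metric.ball (0 : Space) 1, ‖y‖ ^ (-2 : ℤ) := by
    have h5 := Measure.setIntegral_comp_smul_of_pos (volume : Measure Space)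
      (fun y => ‖y‖ ^ (-2 : ℤ)) (Metric.ball 0 1) h0
    rw [smul_unitBall h0.ne', Real.norm_eq_abs, abs_of_pos h0] at h5
    have h6 : ∀ y : Space, ‖r • y‖ ^ (-2 : ℤ) = (r ^ 2)⁻¹ * ‖y‖ ^ (-2 : ℤ) := fun y => by
      rw [norm_smul, mul_zpow, Real.norm_eq_abs, abs_of_pos h0, zpow_neg r]
      norm_cast
    simp only [h6, integral_const_mul, finrank_euclideanSpace, Fintype.card_fin,
      smul_eq_mul] at h5
    revert h5
    generalize (∫ y in Metric.ball (0 : Space) 1, ‖y‖ ^ (-2 : ℤ)) = I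
    generalize (∫ y in Metric.ball (0 : Space) r, ‖y‖ ^ (-2 : ℤ)) = J
    intro h5
    field_simp at h5
    linarith
  rw [htr, h2, h3, Real.norm_eq_abs, Real.norm_eq_abs, abs_of_pos h0]
  have h7 : |∫ y in Metric.ball (0 : Space) r, D y| ≤
      ∫ y in Metric.ball (0 : Space) r, C * ‖y‖ ^ (-2 : ℤ) := by
    change ‖∫ y in Metric.ball (0 : Space) r, D y‖ ≤ _
    refine norm_integral_le_of_norm_le ((integrableOn_norm_zpow_ball r).const_mul C) ?_
    refine (ae_restrict_iff' measurableSet_ball).2 ?_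
    filter_upwards [hne] with y hy0 hy
    exact hDb y (norm_pos_iff.2 hy0) ((by simpa using hy : ‖y‖ < r).trans hr)
  rw [integral_const_mul, h4] at h7
  have h8 : ((∫ y in {y : Space | 1 ≤ ‖y‖}, G₄ y) / r + ∫ y in {y | r ≤ ‖y‖}, D y)
      - ((∫ y in {y : Space | 1 ≤ ‖y‖}, G₄ y) / r + ((∫ y in Metric.ball (0 : Space) r, D y)
        + ∫ y in {y | r ≤ ‖y‖}, D y)) = -∫ y in Metric.ball (0 : Space) r, D y := by ring
  rw [h8, abs_neg]
  linarith

/-! ### The divergence theorem for a half-space-time -/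

lemma measurePreserving_event : MeasurePreserving (fun p : ℝ × Space => event p.1 p.2) := by
  have h1 := (volume_preserving_piFinSuccAbove (fun _ : Fin 4 => ℝ) 0).symm
  have h2 : MeasurePreserving (fun p : ℝ × Space => (p.1, WithLp.ofLp p.2))
      (volume : Measure (ℝ × Space)) (volume : Measure (ℝ × (Fin 3 → ℝ))) :=
    (MeasurePreserving.id volume).prod (PiLp.volume_preserving_ofLp (Fin 3))
  have h3 : (fun p : ℝ × Space => event p.1 p.2) =
      (MeasurableEquiv.piFinSuccAbove (fun _ : Fin 4 => ℝ) 0).symm ∘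
        fun p : ℝ × Space => (p.1, WithLp.ofLp p.2) := by
    ext p i
    refine Fin.cases ?_ (fun j => ?_) i <;>
      simp [event, MeasurableEquiv.piFinSuccAbove_symm_apply, Fin.insertNthEquiv]
  rw [h3]
  exact h1.comp h2

/-- Space-time as the product of the time axis and space. -/
def eventEquiv : ℝ × Space ≃ᵐ Spacetime where
  toFun p := event p.1 p.2
  invFun x := (x 0, spatial x)
  left_inv p := by simp [event_zero, spatial_event]
  right_inv x := event_spatial x
  measurable_toFun := measurePreserving_event.measurable
  measurable_invFun := (measurable_pi_apply 0).prodMk continuous_spatial.measurable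

lemma integral_spacetime (f : Spacetime → ℝ) (hf : Integrable f) :
    ∫ x, f x = ∫ t, ∫ x : Space, f (event t x) := by
  have h1 := measurePreserving_event.integral_comp (eventEquiv.measurableEmbedding) f
  have h2 : Integrable (fun p : ℝ × Space => f (event p.1 p.2)) (volume.prod volume) :=
    (measurePreserving_event.integrable_comp_emb (eventEquiv.measurableEmbedding)).2 hf
  rw [← h1]
  exact integral_prod _ h2

lemma integral_space_cons (f : Spacetime → ℝ) (t : ℝ) :
    ∫ x : Fin 3 → ℝ, f (Fin.cons t x) = ∫ x : Space, f (event t x) :=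
  ((PiLp.volume_preserving_ofLp (Fin 3)).integral_comp
    (MeasurableEquiv.toLp 2 (Fin 3 → ℝ)).symm.measurableEmbedding
    (fun x => f (Fin.cons t x))).symm

/-- The divergence of a vector field on space-time. -/
def divergence (V : Spacetime → Spacetime) (x : Spacetime) : ℝ :=
  ∑ ν, fderiv ℝ V x (Pi.single ν 1) ν

lemma divergence_eq_zero {V : Spacetime → Spacetime} {x : Spacetime} (hx : x ∉ tsupport V) :
    divergence V x = 0 := by
  have h1 : fderiv ℝ V x = 0 :=
    image_eq_zero_of_notMem_tsupport fun h => hx (tsupport_fderiv_subset ℝ h)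
  simp [divergence, h1]

lemma continuous_divergence {V : Spacetime → Spacetime} (hV : ContDiff ℝ 1 V) :
    Continuous (divergence V) := by
  have h1 : Continuous (fderiv ℝ V) := hV.continuous_fderiv one_ne_zero
  exact continuous_finsetSum _ fun ν _ =>
    (continuous_apply ν).comp (h1.clm_apply continuous_const)

lemma integrable_divergence {V : Spacetime → Spacetime} (hV : ContDiff ℝ 1 V)
    (hc : HasCompactSupport V) : Integrable (divergence V) :=
  (continuous_divergence hV).integrable_of_hasCompactSupport
    (hc.mono' fun x hx => by
      by_contra h
      exact hx (divergence_eq_zero h))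

lemma integral_divergence_box {V : Spacetime → Spacetime} (hV : ContDiff ℝ 1 V)
    (hc : HasCompactSupport V) {M : ℝ} (hM : ∀ x, M ≤ ‖x‖ → V x = 0) {a b : Spacetime}
    (hab : a ≤ b) (ha : ∀ i : Fin 3, a i.succ = -M) (hb : ∀ i : Fin 3, b i.succ = M) :
    ∫ x in Set.Icc a b, divergence V x =
      (∫ x : Space, V (event (b 0) x) 0) - ∫ x : Space, V (event (a 0) x) 0 := by
  have hbig : ∀ (x : Spacetime) i, M ≤ |x i| → V x = 0 := fun x i hi =>
    hM x (hi.trans (norm_le_pi_norm x i))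
  have h1 := integral_divergence_of_hasFDerivAt_off_countable a b hab V (fderiv ℝ V) ∅
    Set.countable_empty hV.continuous.continuousOn
    (fun x _ => (hV.differentiable one_ne_zero x).hasFDerivAt)
    (integrable_divergence hV hc).integrableOn
  have hface : ∀ t : ℝ, ∫ x in Set.Icc (a ∘ Fin.succAbove 0) (b ∘ Fin.succAbove 0),
      V (Fin.insertNth 0 t x) 0 = ∫ x : Space, V (event t x) 0 := fun t => by
    rw [← integral_space_cons (fun x => V x 0) t]
    have h2 : ∀ x : Fin 3 → ℝ, x ∉ Set.Icc (a ∘ Fin.succAbove 0) (b ∘ Fin.succAbove 0) →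
        V (Fin.insertNth (α := fun _ => ℝ) 0 t x) 0 = 0 := fun x hx => by
      by_contra hne
      apply hx
      have h3 : ∀ i, |x i| < M := fun i => by
        by_contra! hcon
        exact hne (by
          rw [hbig (Fin.insertNth (α := fun _ => ℝ) 0 t x) i.succ (by simpa using hcon)]; rfl)
      constructor <;> intro i
      · simpa [ha] using (abs_lt.1 (h3 i)).1.le
      · simpa [hb] using (abs_lt.1 (h3 i)).2.le
    rw [setIntegral_eq_integral_of_forall_compl_eq_zero h2]
    simp [Fin.insertNth_zero']
  have hrest : ∀ i : Fin 3,
      ((∫ x in Set.Icc (a ∘ Fin.succAbove i.succ) (b ∘ Fin.succAbove i.succ),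
          V (Fin.insertNth i.succ (b i.succ) x) i.succ) -
        ∫ x in Set.Icc (a ∘ Fin.succAbove i.succ) (b ∘ Fin.succAbove i.succ),
          V (Fin.insertNth i.succ (a i.succ) x) i.succ) = 0 := fun i => by
    have e1 : ∀ x : Fin 3 → ℝ, V (Fin.insertNth (α := fun _ => ℝ) i.succ (b i.succ) x) = 0 :=
      fun x => hbig _ i.succ (by simpa [hb] using le_abs_self M)
    have e2 : ∀ x : Fin 3 → ℝ, V (Fin.insertNth (α := fun _ => ℝ) i.succ (a i.succ) x) = 0 :=
      fun x => hbig _ i.succ (by simpa [ha] using le_abs_self M)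
    simp [e1, e2]
  rw [show (∫ x in Set.Icc a b, divergence V x) =
    ∫ x in Set.Icc a b, ∑ i, fderiv ℝ V x (Pi.single i 1) i from rfl, h1, Fin.sum_univ_succ,
    Finset.sum_eq_zero fun i _ => hrest i, add_zero, hface, hface]

lemma volume_time_eq (t : ℝ) : (volume : Measure Spacetime) {x | x 0 = t} = 0 :=
  Measure.pi_hyperplane (fun _ : Fin 4 => (volume : Measure ℝ)) 0 t

/-- Half the difference between the integrals of the divergence over the past and over the future of
a time is the flux at this time. -/
theorem integral_sign_mul_divergence {V : Spacetime → Spacetime} (hV : ContDiff ℝ 1 V)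
    (hc : HasCompactSupport V) (t : ℝ) :
    ∫ x, Real.sign (t - x 0) * divergence V x = 2 * ∫ x : Space, V (event t x) 0 := by
  obtain ⟨M₀, hM₀⟩ := hc.isCompact.isBounded.exists_norm_le
  set M := max M₀ |t| + 1 with hMd
  have hM : ∀ x, M ≤ ‖x‖ → V x = 0 := fun x hx => by
    by_contra h
    have := hM₀ x (subset_tsupport V h)
    have := le_max_left M₀ |t|
    linarith
  have htM : |t| < M := lt_of_le_of_lt (le_max_right M₀ |t|) (lt_add_one _)
  have hM0 : 0 < M := (abs_nonneg t).trans_lt htM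
  obtain ⟨ht1, ht2⟩ := abs_lt.1 htM
  set a : Spacetime := fun _ => -M
  set b : Spacetime := fun _ => M
  set c : Spacetime := Fin.cons t fun _ => M
  set d : Spacetime := Fin.cons t fun _ => -M
  have hac : a ≤ c := by
    intro i; refine Fin.cases ?_ (fun j => ?_) i
    · exact ht1.le
    · show -M ≤ M; linarith
  have hdb : d ≤ b := by
    intro i; refine Fin.cases ?_ (fun j => ?_) i
    · exact ht2.le
    · show -M ≤ M; linarith
  have h1 := integral_divergence_box hV hc hM hac (fun _ => rfl) (fun _ => rfl)
  have h2 := integral_divergence_box hV hc hM hdb (fun _ => rfl) (fun _ => rfl)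
  have hV0 : ∀ (s : ℝ) (x : Space), M ≤ |s| → V (event s x) = 0 := fun s x hs =>
    hM _ (hs.trans (by simpa [event_zero] using norm_le_pi_norm (event s x) 0))
  have h3 : ∫ x : Space, V (event (a 0) x) 0 = 0 := by
    simp [hV0 (a 0) _ (by simpa [a] using le_abs_self M)]
  have h4 : ∫ x : Space, V (event (b 0) x) 0 = 0 := by
    simp [hV0 (b 0) _ (by simpa [b] using le_abs_self M)]
  have h5 : ∫ x, Real.sign (t - x 0) * divergence V x =
      ∫ x, ((Set.Icc a c).indicator (divergence V) x -
        (Set.Icc d b).indicator (divergence V) x) := by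
    refine integral_congr_ae ?_
    filter_upwards [compl_mem_ae_iff.2 (volume_time_eq t)] with x hx
    by_cases hxM : M ≤ ‖x‖
    · have : divergence V x = 0 := divergence_eq_zero fun h => by
        have := hM₀ x h
        have := le_max_left M₀ |t|
        linarith
      simp [Set.indicator, this]
    · have hxi : ∀ i, |x i| < M := fun i => (norm_le_pi_norm x i).trans_lt (not_le.1 hxM)
      rcases lt_or_gt_of_ne hx with h | h
      · rw [Real.sign_of_pos (sub_pos.2 h), Set.indicator_of_mem, Set.indicator_of_notMem]
        · ring
        · intro hmem
          exact absurd (hmem.1 0) (not_le.2 h)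
        · constructor
          · intro i; exact (abs_lt.1 (hxi i)).1.le
          · intro i; refine Fin.cases ?_ (fun j => ?_) i
            · exact h.le
            · exact (abs_lt.1 (hxi j.succ)).2.le
      · rw [Real.sign_of_neg (sub_neg.2 h), Set.indicator_of_notMem, Set.indicator_of_mem]
        · ring
        · constructor
          · intro i; refine Fin.cases ?_ (fun j => ?_) i
            · exact h.le
            · exact (abs_lt.1 (hxi j.succ)).1.le
          · intro i; exact (abs_lt.1 (hxi i)).2.le
        · intro hmem
          exact absurd (hmem.2 0) (not_le.2 h)
  have hi := integrable_divergence hV hc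
  rw [h5, integral_sub (hi.indicator measurableSet_Icc) (hi.indicator measurableSet_Icc),
    integral_indicator measurableSet_Icc, integral_indicator measurableSet_Icc, h1, h2, h3, h4]
  change (∫ x : Space, V (event t x) 0) - 0 - (0 - ∫ x : Space, V (event t x) 0) = _
  ring

/-! ### Flux through the simultaneity planes of another inertial frame -/

/-- The event with coordinates `(t, x)` in the frame with coordinates `x' = L x + a`. -/
def frameEvent (L : Matrix (Fin 4) (Fin 4) ℝ) (a : Spacetime) (t : ℝ) (x : Space) : Spacetime :=
  L⁻¹ *ᵥ (event t x - a)

lemma IsLorentz.measurePreserving {L : Matrix (Fin 4) (Fin 4) ℝ} (hL : IsLorentz L)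
    (a : Spacetime) : MeasurePreserving (fun x : Spacetime => L *ᵥ x + a) := by
  have hd : L.det ≠ 0 := fun h => by have := hL.abs_det; simp [h] at this
  have h1 : MeasurePreserving (fun x : Spacetime => L *ᵥ x) := by
    refine ⟨(Continuous.matrix_mulVec continuous_const continuous_id).measurable, ?_⟩
    have h2 := Real.map_matrix_volume_pi_eq_smul_volume_pi hd
    rw [abs_inv, hL.abs_det] at h2
    rw [inv_one, ENNReal.ofReal_one, one_smul] at h2
    exact h2
  exact (measurePreserving_add_right volume a).comp h1

lemma IsLorentz.integral_comp {L : Matrix (Fin 4) (Fin 4) ℝ} (hL : IsLorentz L) (a : Spacetime)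
    (f : Spacetime → ℝ) : ∫ x, f (L *ᵥ x + a) = ∫ x, f x := by
  have hemb : MeasurableEmbedding (fun x : Spacetime => L *ᵥ x + a) := by
    refine Continuous.measurableEmbedding (by fun_prop) fun x y hxy => ?_
    have h1 : L *ᵥ x = L *ᵥ y := add_right_cancel hxy
    rw [← hL.inv_mulVec x, h1, hL.inv_mulVec]
  exact (hL.measurePreserving a).integral_comp hemb f

theorem IsLorentz.integral_sign_mul_divergence {L : Matrix (Fin 4) (Fin 4) ℝ} (hL : IsLorentz L)
    (a : Spacetime) {V : Spacetime → Spacetime} (hV : ContDiff ℝ 1 V)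
    (hc : HasCompactSupport V) (t : ℝ) :
    ∫ x, Real.sign (t - (L *ᵥ x + a) 0) * divergence V x =
      2 * ∫ x : Space, (L *ᵥ V (frameEvent L a t x)) 0 := by
  set A : Spacetime → Spacetime := fun x => L⁻¹ *ᵥ (x - a) with hA
  set V' : Spacetime → Spacetime := fun x => L *ᵥ V (A x) with hV'
  have hAL : ∀ x, A (L *ᵥ x + a) = x := fun x => by
    simp only [hA, add_sub_cancel_right, hL.inv_mulVec]
  have hLA : ∀ x, L *ᵥ A x + a = x := fun x => by
    simp only [hA, hL.mulVec_inv, sub_add_cancel]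
  set ℓ : Spacetime →L[ℝ] Spacetime := LinearMap.toContinuousLinearMap (Matrix.toLin' L) with hℓ
  set ℓ' : Spacetime →L[ℝ] Spacetime := LinearMap.toContinuousLinearMap (Matrix.toLin' L⁻¹) with hℓ'
  have hAd : ∀ x, HasFDerivAt A ℓ' x := fun x => by
    have h1 : A = fun x => ℓ' (x - a) := by ext; simp [hA, hℓ']
    rw [h1]
    exact ℓ'.hasFDerivAt.comp x ((hasFDerivAt_id x).sub_const a)
  have hAc : ContDiff ℝ 1 A := by
    have h1 : A = fun x => ℓ' (x - a) := by ext; simp [hA, hℓ']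
    rw [h1]
    exact ℓ'.contDiff.comp (contDiff_id.sub contDiff_const)
  have hVℓ : V' = fun x => ℓ (V (A x)) := by ext; simp [hV', hℓ]
  have hV'c : ContDiff ℝ 1 V' := by
    rw [hVℓ]
    exact ℓ.contDiff.comp (hV.comp hAc)
  have hcs : HasCompactSupport V' := by
    set e : Spacetime ≃ₜ Spacetime :=
      { toFun := A, invFun := fun x => L *ᵥ x + a, left_inv := hLA, right_inv := hAL,
        continuous_toFun := hAc.continuous, continuous_invFun := by fun_prop }
    exact (hc.comp_homeomorph e).comp_left (g := fun v => L *ᵥ v) (Matrix.mulVec_zero L)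
  have hdiv : ∀ x, divergence V' x = divergence V (A x) := fun x => by
    have h1 : HasFDerivAt V' (ℓ.comp ((fderiv ℝ V (A x)).comp ℓ')) x := by
      rw [hVℓ]
      exact ℓ.hasFDerivAt.comp x
        (((hV.differentiable one_ne_zero (A x)).hasFDerivAt).comp x (hAd x))
    set M : Matrix (Fin 4) (Fin 4) ℝ :=
      LinearMap.toMatrix' (fderiv ℝ V (A x) : Spacetime →ₗ[ℝ] Spacetime) with hM
    have h2 : ∀ v, fderiv ℝ V (A x) v = M *ᵥ v := fun v => by
      rw [hM, LinearMap.toMatrix'_mulVec]; rfl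
    have h3 : ∀ B : Matrix (Fin 4) (Fin 4) ℝ, ∑ ν, (B *ᵥ Pi.single ν 1) ν = B.trace := fun B => by
      simp [Matrix.trace]
    have h4 : divergence V' x = (L * (M * L⁻¹)).trace := by
      rw [divergence, h1.fderiv, ← h3]
      refine Finset.sum_congr rfl fun ν _ => ?_
      simp only [ContinuousLinearMap.comp_apply, hℓ, hℓ', LinearMap.coe_toContinuousLinearMap',
        Matrix.toLin'_apply, h2, Matrix.mulVec_mulVec]
    rw [h4, ← Matrix.mul_assoc, Matrix.trace_mul_comm, ← Matrix.mul_assoc, hL.inv_mul,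
      Matrix.one_mul, divergence, ← h3]
    simp only [h2]
  have h5 := PointCharges.integral_sign_mul_divergence hV'c hcs t
  rw [← hL.integral_comp a] at h5
  simp only [hdiv, hAL] at h5
  exact h5

/-! ### The Maxwell equations in the vacuum -/

/-- The bilinear identity behind the conservation of energy and momentum: `D κ μ ν` stands for the
derivative `∂_κ F^{μν}`. -/
lemma divergence_energyMomentum_aux {F : Fin 4 → Fin 4 → ℝ} {D : Fin 4 → Fin 4 → Fin 4 → ℝ}
    (hF : ∀ μ ν, F μ ν = -F ν μ) (hD : ∀ κ μ ν, D κ μ ν = -D κ ν μ)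
    (h1 : ∀ μ, ∑ ν, D ν μ ν = 0)
    (h2 : ∀ κ μ ν, (metric * Matrix.of (D κ) * metric) μ ν + (metric * Matrix.of (D μ) * metric) ν κ
      + (metric * Matrix.of (D ν) * metric) κ μ = 0) (β : Fin 4) :
    ∑ ν, (stress (Matrix.of (D ν)) (Matrix.of F) ν β
      + stress (Matrix.of F) (Matrix.of (D ν)) ν β) = 0 := by
  have f0 : ∀ μ, F μ μ = 0 := fun μ => by linarith [hF μ μ]
  have d0 : ∀ κ μ, D κ μ μ = 0 := fun κ μ => by linarith [hD κ μ μ]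
  simp only [stress, metric_mul_mul_metric_apply] at h2 ⊢
  simp only [mul_metric_apply]
  have m : ∀ μ ν : Fin 4, metric μ ν = if μ = ν then (![-1, 1, 1, 1] : Fin 4 → ℝ) μ else 0 :=
    fun μ ν => by rw [metric, Matrix.diagonal_apply]
  simp only [m, Fin.sum_univ_four, Matrix.of_apply] at h1 h2 ⊢
  have e0 := h1 0
  have e1 := h1 1
  have e2 := h1 2
  have e3 := h1 3
  have c012 := h2 0 1 2
  have c013 := h2 0 1 3
  have c023 := h2 0 2 3
  have c123 := h2 1 2 3
  clear h1 h2 m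
  simp only [f0, d0, hF 1 0, hF 2 0, hF 3 0, hF 2 1, hF 3 1, hF 3 2, hD _ 1 0, hD _ 2 0, hD _ 3 0,
    hD _ 2 1, hD _ 3 1, hD _ 3 2, Matrix.cons_val] at e0 e1 e2 e3 c012 c013 c023 c123 ⊢
  fin_cases β <;>
    simp [f0, d0, hF 1 0, hF 2 0, hF 3 0, hF 2 1, hF 3 1, hF 3 2, hD _ 1 0, hD _ 2 0, hD _ 3 0,
      hD _ 2 1, hD _ 3 1, hD _ 3 2] at e0 e1 e2 e3 c012 c013 c023 c123 ⊢
  · linear_combination -(F 0 1 * e1 + F 0 2 * e2 + F 0 3 * e3) + F 1 2 * c012 + F 1 3 * c013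
      + F 2 3 * c023
  · linear_combination -(F 0 1 * e0 + F 1 2 * e2 + F 1 3 * e3) + F 0 2 * c012 + F 0 3 * c013
      - F 2 3 * c123
  · linear_combination -(F 0 2 * e0 - F 1 2 * e1 + F 2 3 * e3) - F 0 1 * c012 + F 0 3 * c023
      + F 1 3 * c123
  · linear_combination -(F 0 3 * e0 - F 1 3 * e1 - F 2 3 * e2) - F 0 1 * c013 - F 0 2 * c023
      - F 1 2 * c123

namespace System

variable {N : ℕ} {S : System N}

lemma IsRegular.isOpen_vacuum (hreg : S.IsRegular) : IsOpen S.vacuum := by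
  have h1 : S.vacuum = ⋂ n, (Set.range (S.worldline n))ᶜ := by
    ext x
    simp only [vacuum, Set.mem_ofPred_eq, Set.mem_iInter, Set.mem_compl_iff, Set.mem_range,
      not_exists]
    exact forall_congr' fun n => forall_congr' fun s =>
      ⟨fun h h' => h h'.symm, fun h h' => h h'.symm⟩
  rw [h1]
  exact isOpen_iInter_of_finite fun n => (hreg.worldlines n).isClosed_range.isOpen_compl

lemma IsRegular.hasFDerivAt_field (hreg : S.IsRegular) {x : Spacetime} (hx : x ∈ S.vacuum)
    (μ ν : Fin 4) :
    HasFDerivAt (fun x => S.field x μ ν) (fderiv ℝ (fun x => S.field x μ ν) x) x :=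
  (((hreg.contDiffOn μ ν).contDiffAt (hreg.isOpen_vacuum.mem_nhds hx)).differentiableAt
    one_ne_zero).hasFDerivAt

lemma IsRegular.continuousOn_fderiv_field (hreg : S.IsRegular) (μ ν : Fin 4) :
    ContinuousOn (fderiv ℝ fun x => S.field x μ ν) S.vacuum :=
  (hreg.contDiffOn μ ν).continuousOn_fderiv_of_isOpen hreg.isOpen_vacuum le_rfl

end System

lemma integrable_mul_of_tsupport_subset {U : Set Spacetime} (hU : IsOpen U) {f g : Spacetime → ℝ}
    (hf : ContinuousOn f U) (hg : Continuous g) (hc : HasCompactSupport g) (hgU : tsupport g ⊆ U) :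
    Integrable fun x => f x * g x := by
  have h1 : tsupport (fun x => f x * g x) ⊆ tsupport g := tsupport_mul_subset_right
  exact (ContinuousOn.continuous_of_tsupport_subset (hf.mul hg.continuousOn) hU
    (h1.trans hgU)).integrable_of_hasCompactSupport hc.mul_left

lemma tsupport_partialDeriv_subset (μ : Fin 4) (φ : Spacetime → ℝ) :
    tsupport (partialDeriv μ φ) ⊆ tsupport φ :=
  closure_minimal (fun x hx => by
    by_contra h
    have h1 : fderiv ℝ φ x = 0 :=
      image_eq_zero_of_notMem_tsupport fun h' => h (tsupport_fderiv_subset ℝ h')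
    exact hx (by simp [partialDeriv, h1])) (isClosed_tsupport φ)

lemma continuous_partialDeriv {φ : Spacetime → ℝ} (hφ : ContDiff ℝ 1 φ) (μ : Fin 4) :
    Continuous (partialDeriv μ φ) :=
  (hφ.continuous_fderiv one_ne_zero).clm_apply continuous_const

lemma integrable_mul_partialDeriv {U : Set Spacetime} (hU : IsOpen U) {f φ : Spacetime → ℝ}
    (hf : ContinuousOn f U) (hφ : ContDiff ℝ 1 φ) (hc : HasCompactSupport φ)
    (hφU : tsupport φ ⊆ U) (μ : Fin 4) : Integrable fun x => f x * partialDeriv μ φ x :=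
  integrable_mul_of_tsupport_subset hU hf (continuous_partialDeriv hφ μ)
    (hc.of_isClosed_subset (isClosed_tsupport _) (tsupport_partialDeriv_subset μ φ))
    ((tsupport_partialDeriv_subset μ φ).trans hφU)

lemma integral_mul_partialDeriv {U : Set Spacetime} (hU : IsOpen U) {f φ : Spacetime → ℝ}
    (hf : ContDiffOn ℝ 1 f U) (hφ : ContDiff ℝ 1 φ) (hc : HasCompactSupport φ)
    (hφU : tsupport φ ⊆ U) (μ : Fin 4) :
    ∫ x, f x * partialDeriv μ φ x = -∫ x, partialDeriv μ f x * φ x := by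
  have hpf : ContinuousOn (partialDeriv μ f) U :=
    (hf.continuousOn_fderiv_of_isOpen hU le_rfl).clm_apply continuousOn_const
  refine integral_mul_fderiv_eq_neg_fderiv_mul_of_integrable
    (integrable_mul_of_tsupport_subset hU hpf hφ.continuous hc hφU)
    (integrable_mul_partialDeriv hU hf.continuousOn hφ hc hφU μ)
    (integrable_mul_of_tsupport_subset hU hf.continuousOn hφ.continuous hc hφU)
    (fun x hx => (hf.contDiffAt (hU.mem_nhds (hφU hx))).differentiableAt one_ne_zero)
    (fun x _ => hφ.differentiable one_ne_zero x)

/-- A continuous function on an open set vanishes if its integrals against test functions do. -/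
lemma eq_zero_of_integral_mul_eq_zero {U : Set Spacetime} (hU : IsOpen U) {f : Spacetime → ℝ}
    (hf : ContinuousOn f U) (h : ∀ φ : Spacetime → ℝ, ContDiff ℝ ∞ φ → HasCompactSupport φ →
      tsupport φ ⊆ U → ∫ x, f x * φ x = 0) {x : Spacetime} (hx : x ∈ U) : f x = 0 := by
  have h1 := hU.ae_eq_zero_of_integral_contDiff_smul_eq_zero (μ := volume)
    (hf.locallyIntegrableOn hU.measurableSet)
    (fun g h1 h2 h3 => by simpa [mul_comm] using h g h1 h2 h3)
  have h2 : f =ᵐ[volume.restrict U] fun _ => 0 :=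
    (ae_restrict_iff' hU.measurableSet).2 h1
  exact Measure.eqOn_open_of_ae_eq h2 hU hf continuousOn_const hx

namespace System

variable {N : ℕ} {S : System N}

lemma partialDeriv_contDiffOn (hreg : S.IsRegular) (κ μ ν : Fin 4) :
    ContinuousOn (partialDeriv κ fun x => S.field x μ ν) S.vacuum :=
  (hreg.continuousOn_fderiv_field μ ν).clm_apply continuousOn_const

/-- The inhomogeneous Maxwell equations in the vacuum. -/
lemma Maxwell.sum_partialDeriv_eq_zero (hreg : S.IsRegular) (hmax : S.Maxwell) {x : Spacetime}
    (hx : x ∈ S.vacuum) (μ : Fin 4) : ∑ ν, partialDeriv ν (fun x => S.field x μ ν) x = 0 := by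
  refine eq_zero_of_integral_mul_eq_zero hreg.isOpen_vacuum
    (f := fun x => ∑ ν, partialDeriv ν (fun x => S.field x μ ν) x)
    (continuousOn_finsetSum _ fun ν _ => partialDeriv_contDiffOn hreg ν μ ν)
    (fun φ h1 h2 h3 => ?_) hx
  have h4 := hmax.inhomogeneous φ h1 h2 μ
  have h5 : ∀ n s, φ (S.worldline n s) = 0 := fun n s => by
    by_contra h
    exact h3 (subset_tsupport φ h) n s rfl
  simp only [h5, mul_zero, integral_zero, Finset.sum_const_zero] at h4
  have h1' : ContDiff ℝ 1 φ := h1.of_le (by simp)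
  have hU := hreg.isOpen_vacuum
  have hint : ∀ ν, Integrable fun x => partialDeriv ν (fun x => S.field x μ ν) x * φ x := fun ν =>
    integrable_mul_of_tsupport_subset hU (partialDeriv_contDiffOn hreg ν μ ν) h1'.continuous h2 h3
  have hint' : ∀ ν, Integrable fun x => S.field x μ ν * partialDeriv ν φ x := fun ν =>
    integrable_mul_partialDeriv hU (hreg.contDiffOn μ ν).continuousOn h1' h2 h3 ν
  simp only [Finset.sum_mul]
  rw [integral_finsetSum _ fun ν _ => hint ν]
  rw [integral_finsetSum _ fun ν _ => hint' ν] at h4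
  have h6 : ∀ ν, ∫ x, S.field x μ ν * partialDeriv ν φ x =
      -∫ x, partialDeriv ν (fun x => S.field x μ ν) x * φ x := fun ν =>
    integral_mul_partialDeriv hU (hreg.contDiffOn μ ν) h1' h2 h3 ν
  simp only [h6, Finset.sum_neg_distrib, neg_neg] at h4
  exact h4

/-- The homogeneous Maxwell equations in the vacuum. -/
lemma Maxwell.cyclic_partialDeriv_eq_zero (hreg : S.IsRegular) (hmax : S.Maxwell) {x : Spacetime}
    (hx : x ∈ S.vacuum) (κ μ ν : Fin 4) :
    (metric * Matrix.of (fun α β => partialDeriv κ (fun x => S.field x α β) x) * metric) μ ν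
      + (metric * Matrix.of (fun α β => partialDeriv μ (fun x => S.field x α β) x) * metric) ν κ
      + (metric * Matrix.of (fun α β => partialDeriv ν (fun x => S.field x α β) x) * metric) κ μ
      = 0 := by
  simp only [metric_mul_mul_metric_apply, Matrix.of_apply]
  set g : Fin 4 → ℝ := ![-1, 1, 1, 1] with hg
  have hU := hreg.isOpen_vacuum
  refine eq_zero_of_integral_mul_eq_zero hU
    (f := fun x => g μ * partialDeriv κ (fun x => S.field x μ ν) x * g ν
      + g ν * partialDeriv μ (fun x => S.field x ν κ) x * g κ
      + g κ * partialDeriv ν (fun x => S.field x κ μ) x * g μ)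
    ?_
    (fun φ h1 h2 h3 => ?_) hx
  · have := partialDeriv_contDiffOn hreg
    exact (((continuousOn_const.mul (this κ μ ν)).mul continuousOn_const).add
      ((continuousOn_const.mul (this μ ν κ)).mul continuousOn_const)).add
      ((continuousOn_const.mul (this ν κ μ)).mul continuousOn_const)
  have h4 := hmax.homogeneous φ h1 h2 κ μ ν
  have h1' : ContDiff ℝ 1 φ := h1.of_le (by simp)
  have hint : ∀ κ μ ν, Integrable fun x => partialDeriv κ (fun x => S.field x μ ν) x * φ x :=
    fun κ μ ν => integrable_mul_of_tsupport_subset hU (partialDeriv_contDiffOn hreg κ μ ν)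
      h1'.continuous h2 h3
  have hint' : ∀ κ μ ν, Integrable fun x => S.field x μ ν * partialDeriv κ φ x := fun κ μ ν =>
    integrable_mul_partialDeriv hU (hreg.contDiffOn μ ν).continuousOn h1' h2 h3 κ
  have h6 : ∀ κ μ ν, ∫ x, S.field x μ ν * partialDeriv κ φ x =
      -∫ x, partialDeriv κ (fun x => S.field x μ ν) x * φ x := fun κ μ ν =>
    integral_mul_partialDeriv hU (hreg.contDiffOn μ ν) h1' h2 h3 κ
  have split : ∀ (a b c : ℝ) (f₁ f₂ f₃ : Spacetime → ℝ), Integrable f₁ → Integrable f₂ →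
      Integrable f₃ → ∫ x, (a * f₁ x + b * f₂ x + c * f₃ x) =
        a * (∫ x, f₁ x) + b * (∫ x, f₂ x) + c * ∫ x, f₃ x := by
    intro a b c f₁ f₂ f₃ i1 i2 i3
    have i12 : Integrable (fun x => a * f₁ x + b * f₂ x) := (i1.const_mul a).add (i2.const_mul b)
    rw [integral_add i12 (i3.const_mul c), integral_add (i1.const_mul a) (i2.const_mul b),
      integral_const_mul, integral_const_mul, integral_const_mul]
  have e1 := split (g μ * g ν) (g ν * g κ) (g κ * g μ) _ _ _ (hint κ μ ν) (hint μ ν κ) (hint ν κ μ)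
  have e2 := split (g μ * g ν) (g ν * g κ) (g κ * g μ) _ _ _ (hint' κ μ ν) (hint' μ ν κ)
    (hint' ν κ μ)
  rw [h6, h6, h6] at e2
  have e3 : ∫ x, (g μ * g ν * (S.field x μ ν * partialDeriv κ φ x)
      + g ν * g κ * (S.field x ν κ * partialDeriv μ φ x)
      + g κ * g μ * (S.field x κ μ * partialDeriv ν φ x)) = 0 := by
    rw [← h4]
    congr 1; ext x
    simp only [metric_mul_mul_metric_apply, ← hg]
    ring
  rw [e3] at e2
  have e4 : ∫ x, (g μ * partialDeriv κ (fun x => S.field x μ ν) x * g ν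
      + g ν * partialDeriv μ (fun x => S.field x ν κ) x * g κ
      + g κ * partialDeriv ν (fun x => S.field x κ μ) x * g μ) * φ x =
      ∫ x, (g μ * g ν * (partialDeriv κ (fun x => S.field x μ ν) x * φ x)
      + g ν * g κ * (partialDeriv μ (fun x => S.field x ν κ) x * φ x)
      + g κ * g μ * (partialDeriv ν (fun x => S.field x κ μ) x * φ x)) := by
    congr 1; ext x; ring
  rw [e4, e1]
  linarith

/-- Derivatives of the energy-momentum tensor in the vacuum. -/
lemma IsRegular.hasFDerivAt_energyMomentum (hreg : S.IsRegular) {x : Spacetime} (hx : x ∈ S.vacuum)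
    (α β : Fin 4) : ∃ T' : Spacetime →L[ℝ] ℝ,
      HasFDerivAt (fun x => energyMomentum (S.field x) α β) T' x ∧ ∀ κ, T' (Pi.single κ 1) =
        stress (Matrix.of fun μ ν => partialDeriv κ (fun x => S.field x μ ν) x) (S.field x) α β
        + stress (S.field x) (Matrix.of fun μ ν => partialDeriv κ (fun x => S.field x μ ν) x)
          α β := by
  have hF := fun μ ν => hreg.hasFDerivAt_field hx μ ν
  have h1 := (HasFDerivAt.fun_sum fun κ (_ : κ ∈ Finset.univ) =>
    (hF α κ).mul ((hF β κ).mul_const ((![-1, 1, 1, 1] : Fin 4 → ℝ) κ))).sub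
    ((HasFDerivAt.fun_sum fun κ (_ : κ ∈ Finset.univ) => HasFDerivAt.fun_sum
      fun ν (_ : ν ∈ Finset.univ) => (hF κ ν).mul ((((hF κ ν).const_mul
        ((![-1, 1, 1, 1] : Fin 4 → ℝ) κ)).mul_const ((![-1, 1, 1, 1] : Fin 4 → ℝ) ν)))).const_mul
      (1 / 4 * metric α β))
  refine ⟨_, h1.congr_of_eventuallyEq (Eventually.of_forall fun x => ?_), fun κ => ?_⟩
  · simp only [energyMomentum, metric_mul_mul_metric_apply]
    simp only [mul_metric_apply]
    rfl
  · simp only [stress, metric_mul_mul_metric_apply]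
    simp only [mul_metric_apply]
    simp only [sub_apply, sum_apply, add_apply, smul_apply, smul_eq_mul, Matrix.of_apply,
      partialDeriv, Finset.sum_add_distrib, mul_add]
    simp only [Fin.sum_univ_four]
    ring

lemma IsRegular.contDiffOn_energyMomentum (hreg : S.IsRegular) (α β : Fin 4) :
    ContDiffOn ℝ 1 (fun x => energyMomentum (S.field x) α β) S.vacuum := by
  simp only [energyMomentum, metric_mul_mul_metric_apply]
  simp only [mul_metric_apply]
  have hF := hreg.contDiffOn
  exact (ContDiffOn.sum fun κ _ => (hF α κ).mul ((hF β κ).mul contDiffOn_const)).sub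
    (contDiffOn_const.mul (ContDiffOn.sum fun κ _ => ContDiffOn.sum fun ν _ =>
      (hF κ ν).mul ((contDiffOn_const.mul (hF κ ν)).mul contDiffOn_const)))

/-- Conservation of the field energy-momentum in the vacuum. -/
lemma Maxwell.divergence_energyMomentum (hreg : S.IsRegular) (hmax : S.Maxwell) {x : Spacetime}
    (hx : x ∈ S.vacuum) (β : Fin 4) :
    ∑ ν, partialDeriv ν (fun x => energyMomentum (S.field x) ν β) x = 0 := by
  have h1 : ∀ ν, partialDeriv ν (fun x => energyMomentum (S.field x) ν β) x =
      stress (Matrix.of fun μ κ => partialDeriv ν (fun x => S.field x μ κ) x) (S.field x) ν β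
      + stress (S.field x) (Matrix.of fun μ κ => partialDeriv ν (fun x => S.field x μ κ) x) ν β :=
    fun ν => by
      obtain ⟨T', h1, h2⟩ := hreg.hasFDerivAt_energyMomentum hx ν β
      rw [partialDeriv, h1.fderiv, h2]
  simp only [h1]
  refine divergence_energyMomentum_aux (F := S.field x)
    (D := fun κ μ ν => partialDeriv κ (fun x => S.field x μ ν) x) (hreg.antisymm x)
    (fun κ μ ν => ?_) (fun μ => hmax.sum_partialDeriv_eq_zero hreg hx μ)
    (fun κ μ ν => hmax.cyclic_partialDeriv_eq_zero hreg hx κ μ ν) β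
  have h2 : (fun x => S.field x μ ν) = fun x => -S.field x ν μ :=
    funext fun x => hreg.antisymm x μ ν
  simp only [partialDeriv]
  rw [h2, fderiv_fun_neg]
  simp

variable (S) in
/-- The current `T^{νβ} χ` of the `β`-component of the field energy-momentum, cut off by `χ`. -/
def current (β : Fin 4) (χ : Spacetime → ℝ) (x : Spacetime) : Spacetime :=
  fun ν => energyMomentum (S.field x) ν β * χ x

variable (S) in
/-- The density `T^{νβ} ∂_ν χ`. -/
def exchange (β : Fin 4) (χ : Spacetime → ℝ) (x : Spacetime) : ℝ :=
  ∑ ν, energyMomentum (S.field x) ν β * partialDeriv ν χ x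

variable (S) in
/-- The density `T'^{0α} (L⁻¹)^β_α` in the frame with coordinates `x' = L x + a` at the time `t`,
i.e. the flux of the `β`-component of the energy-momentum through the simultaneity plane. -/
def fluxDensity (L : Matrix (Fin 4) (Fin 4) ℝ) (a : Spacetime) (t : ℝ) (β : Fin 4)
    (x : Space) : ℝ :=
  ∑ α, L 0 α * energyMomentum (S.field (frameEvent L a t x)) α β

lemma hasCompactSupport_current {χ : Spacetime → ℝ} (hc : HasCompactSupport χ) (β : Fin 4) :
    HasCompactSupport (S.current β χ) :=
  hc.mono fun x hx => by
    contrapose! hx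
    rw [Function.notMem_support] at hx ⊢
    ext ν
    simp [current, hx]

lemma IsRegular.contDiff_current (hreg : S.IsRegular) {χ : Spacetime → ℝ} (hχ : ContDiff ℝ 1 χ)
    (hv : tsupport χ ⊆ S.vacuum) (β : Fin 4) : ContDiff ℝ 1 (S.current β χ) := by
  refine contDiff_iff_contDiffAt.2 fun x => ?_
  by_cases hx : x ∈ tsupport χ
  · exact contDiffAt_pi.2 fun ν => ((hreg.contDiffOn_energyMomentum ν β).contDiffAt
      (hreg.isOpen_vacuum.mem_nhds (hv hx))).mul hχ.contDiffAt
  · refine contDiffAt_const (c := (0 : Spacetime)).congr_of_eventuallyEq ?_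
    filter_upwards [(isClosed_tsupport χ).isOpen_compl.mem_nhds hx] with y hy
    ext ν
    simp [current, image_eq_zero_of_notMem_tsupport hy]

lemma Maxwell.divergence_current (hreg : S.IsRegular) (hmax : S.Maxwell) {χ : Spacetime → ℝ}
    (hχ : ContDiff ℝ 1 χ) (hv : tsupport χ ⊆ S.vacuum) (β : Fin 4) (x : Spacetime) :
    divergence (S.current β χ) x = S.exchange β χ x := by
  by_cases hx : x ∈ tsupport χ
  · have hxv := hv hx
    have h1 : ∀ ν, HasFDerivAt (fun x => energyMomentum (S.field x) ν β * χ x)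
        (energyMomentum (S.field x) ν β • fderiv ℝ χ x
          + χ x • fderiv ℝ (fun x => energyMomentum (S.field x) ν β) x) x := fun ν =>
      ((((hreg.contDiffOn_energyMomentum ν β).contDiffAt
        (hreg.isOpen_vacuum.mem_nhds hxv)).differentiableAt one_ne_zero).hasFDerivAt).mul
        (hχ.differentiable one_ne_zero x).hasFDerivAt
    have h2 : HasFDerivAt (S.current β χ) (ContinuousLinearMap.pi fun ν =>
        energyMomentum (S.field x) ν β • fderiv ℝ χ x
          + χ x • fderiv ℝ (fun x => energyMomentum (S.field x) ν β) x) x := hasFDerivAt_pi.2 h1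
    have h3 := hmax.divergence_energyMomentum hreg hxv β
    rw [divergence, h2.fderiv, exchange]
    simp only [ContinuousLinearMap.pi_apply, add_apply, smul_apply, smul_eq_mul,
      Finset.sum_add_distrib, ← Finset.mul_sum]
    simp only [partialDeriv] at h3 ⊢
    rw [h3, mul_zero, add_zero]
  · have h1 : x ∉ tsupport (S.current β χ) := fun h => hx <| by
      refine closure_mono (fun y hy => ?_) h
      contrapose! hy
      rw [Function.notMem_support] at hy ⊢
      ext ν
      simp [current, hy]
    rw [divergence_eq_zero h1, exchange, Finset.sum_eq_zero]
    intro ν _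
    rw [image_eq_zero_of_notMem_tsupport fun h => hx (tsupport_partialDeriv_subset ν χ h), mul_zero]

lemma IsRegular.integrable_exchange (hreg : S.IsRegular) {χ : Spacetime → ℝ}
    (hχ : ContDiff ℝ 1 χ) (hc : HasCompactSupport χ) (hv : tsupport χ ⊆ S.vacuum) (β : Fin 4) :
    Integrable (S.exchange β χ) :=
  integrable_finsetSum _ fun ν _ => integrable_mul_partialDeriv hreg.isOpen_vacuum
    (hreg.contDiffOn_energyMomentum ν β).continuousOn hχ hc hv ν

/-- The balance of energy and momentum, for a current cut off away from the particles. -/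
theorem Maxwell.integral_sign_mul_exchange (hreg : S.IsRegular) (hmax : S.Maxwell)
    {L : Matrix (Fin 4) (Fin 4) ℝ} (hL : IsLorentz L) (a : Spacetime) {χ : Spacetime → ℝ}
    (hχ : ContDiff ℝ 1 χ) (hc : HasCompactSupport χ) (hv : tsupport χ ⊆ S.vacuum) (t : ℝ)
    (β : Fin 4) :
    ∫ x, Real.sign (t - (L *ᵥ x + a) 0) * S.exchange β χ x =
      2 * ∫ x, S.fluxDensity L a t β x * χ (frameEvent L a t x) := by
  have h1 := hL.integral_sign_mul_divergence a (hreg.contDiff_current hχ hv β)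
    (hasCompactSupport_current hc β) t
  simp only [hmax.divergence_current hreg hχ hv] at h1
  rw [h1]
  congr 2; ext x
  simp only [fluxDensity, Matrix.mulVec, dotProduct, current, Finset.sum_mul]
  exact Finset.sum_congr rfl fun α _ => by ring

end System

/-! ### Simultaneity planes -/

namespace IsLorentz

variable {L : Matrix (Fin 4) (Fin 4) ℝ}

lemma mulVec_zero_eq (L : Matrix (Fin 4) (Fin 4) ℝ) (w : Spacetime) :
    (L *ᵥ w) 0 = L 0 0 * w 0 + inner ℝ (spatial (L 0)) (spatial w) := by
  simp only [Matrix.mulVec, dotProduct, Fin.sum_univ_succ (n := 3), spatial, PiLp.inner_apply]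
  congr 1
  simp [mul_comm]

lemma norm_row_sq (hL : IsLorentz L) : ‖spatial (L 0)‖ ^ 2 = L 0 0 ^ 2 - 1 := by
  have h := congrFun (congrFun hL.mul_metric_mul_transpose 0) 0
  rw [metric, Matrix.mul_apply] at h
  simp [Matrix.mul_diagonal, Fin.sum_univ_four] at h
  rw [EuclideanSpace.norm_sq_eq]
  simp only [Fin.sum_univ_three, Real.norm_eq_abs, sq_abs, spatial]
  change L 0 1 ^ 2 + L 0 2 ^ 2 + L 0 3 ^ 2 = _
  linarith

lemma norm_row_lt (hL : IsLorentz L) : ‖spatial (L 0)‖ < L 0 0 :=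
  lt_of_pow_lt_pow_left₀ 2 hL.2.le (by rw [hL.norm_row_sq]; linarith)

lemma abs_mulVec_zero_sub_le (w : Spacetime) :
    |(L *ᵥ w) 0 - L 0 0 * w 0| ≤ ‖spatial (L 0)‖ * ‖spatial w‖ := by
  rw [mulVec_zero_eq, add_sub_cancel_left]
  exact abs_real_inner_le_norm _ _

/-- A vector which does not point to the same side of two simultaneity planes is spacelike, with a
uniform bound of its slope. -/
lemma exists_slope (hL : IsLorentz L) : ∃ β : ℝ, 0 ≤ β ∧ β < 1 ∧
    ∀ (w : Spacetime) (τ τ' : ℝ), (w 0 - τ) * ((L *ᵥ w) 0 - τ') ≤ 0 →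
      |w 0| ≤ β * ‖spatial w‖ + (|τ| + |τ'|) := by
  have hl := hL.norm_row_lt
  have hL0 := hL.2
  have hL1 : 1 ≤ L 0 0 := by nlinarith [hL.norm_row_sq, sq_nonneg ‖spatial (L 0)‖]
  refine ⟨‖spatial (L 0)‖ / L 0 0, by positivity, (div_lt_one hL0).2 hl, fun w τ τ' h => ?_⟩
  have h1 := abs_le.1 (abs_mulVec_zero_sub_le (L := L) w)
  set b := ‖spatial (L 0)‖ * ‖spatial w‖ with hb
  have hb0 : 0 ≤ b := by positivity
  have h2 : L 0 0 * |w 0| ≤ b + L 0 0 * (|τ| + |τ'|) := by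
    have hτ := abs_le.1 (le_refl |τ|)
    have hτ' := abs_le.1 (le_refl |τ'|)
    have h3 : |τ'| ≤ L 0 0 * |τ'| := le_mul_of_one_le_left (abs_nonneg _) hL1
    have h4 : 0 ≤ L 0 0 * |τ| := by positivity
    by_contra! hcon
    rcases le_or_gt 0 (w 0) with hw | hw
    · rw [abs_of_nonneg hw] at hcon
      have e1 : 0 < w 0 - τ := by
        have : L 0 0 * |τ| < L 0 0 * w 0 := by linarith
        have := lt_of_mul_lt_mul_left this hL0.le
        linarith
      have e2 : 0 < (L *ᵥ w) 0 - τ' := by linarith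
      exact absurd h (not_le.2 (mul_pos e1 e2))
    · rw [abs_of_neg hw] at hcon
      have e1 : w 0 - τ < 0 := by
        have : L 0 0 * |τ| < L 0 0 * -w 0 := by linarith
        have := lt_of_mul_lt_mul_left this hL0.le
        linarith
      have e2 : (L *ᵥ w) 0 - τ' < 0 := by linarith
      exact absurd h (not_le.2 (mul_pos_of_neg_of_neg e1 e2))
  calc |w 0| = L 0 0 * |w 0| / L 0 0 := by field_simp
    _ ≤ (b + L 0 0 * (|τ| + |τ'|)) / L 0 0 := by gcongr
    _ = _ := by rw [hb]; field_simp

/-- A Lorentz transformation delays causal vectors at most by a factor. -/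
lemma exists_time_le (hL : IsLorentz L) : ∃ κ > 0, ∀ w : Spacetime, ‖spatial w‖ ≤ w 0 →
    κ * w 0 ≤ (L *ᵥ w) 0 := by
  refine ⟨L 0 0 - ‖spatial (L 0)‖, sub_pos.2 hL.norm_row_lt, fun w hw => ?_⟩
  have h1 := abs_le.1 (abs_mulVec_zero_sub_le (L := L) w)
  have h2 : ‖spatial (L 0)‖ * ‖spatial w‖ ≤ ‖spatial (L 0)‖ * w 0 := by gcongr
  linarith

lemma zero_inv_mulVec (hL : IsLorentz L) (y : Space) : (L *ᵥ (L⁻¹ *ᵥ event 0 y)) 0 = 0 := by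
  rw [hL.mulVec_inv, event_zero]

/-- Lengths in a simultaneity plane, compared with those of the spatial parts. -/
lemma exists_norm_le (hL : IsLorentz L) : ∃ β K : ℝ, 0 ≤ β ∧ β < 1 ∧ 0 < K ∧ ∀ y : Space,
    |(L⁻¹ *ᵥ event 0 y) 0| ≤ β * ‖spatial (L⁻¹ *ᵥ event 0 y)‖ ∧
    ‖y‖ ≤ ‖spatial (L⁻¹ *ᵥ event 0 y)‖ ∧ ‖spatial (L⁻¹ *ᵥ event 0 y)‖ ≤ K * ‖y‖ := by
  obtain ⟨β, hβ0, hβ1, hβ⟩ := hL.exists_slope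
  have hpos : 0 < 1 - β ^ 2 := by nlinarith
  refine ⟨β, (√(1 - β ^ 2))⁻¹, hβ0, hβ1, inv_pos.2 (Real.sqrt_pos.2 hpos), fun y => ?_⟩
  set w := L⁻¹ *ᵥ event 0 y with hw
  have h1 : |w 0| ≤ β * ‖spatial w‖ := by
    have := hβ w 0 0 (by rw [hw, hL.zero_inv_mulVec]; simp)
    simpa using this
  have h2 : ‖y‖ ^ 2 = ‖spatial w‖ ^ 2 - w 0 ^ 2 := by
    have e1 := hL.inv.mdot_mulVec (event 0 y) (event 0 y)
    rw [← hw, mdot_self_eq, mdot_self_eq, event_zero, spatial_event] at e1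
    linarith
  refine ⟨h1, ?_, ?_⟩
  · refine le_of_sq_le_sq ?_ (norm_nonneg _)
    rw [h2]; nlinarith [sq_nonneg (w 0)]
  · rw [le_inv_mul_iff₀ (Real.sqrt_pos.2 hpos)]
    refine le_of_sq_le_sq ?_ (norm_nonneg _)
    rw [mul_pow, Real.sq_sqrt hpos.le, h2]
    have h3 : w 0 ^ 2 ≤ (β * ‖spatial w‖) ^ 2 := by
      rw [← sq_abs (w 0)]; gcongr
    nlinarith

end IsLorentz

lemma frameEvent_add (L : Matrix (Fin 4) (Fin 4) ℝ) (a : Spacetime) (t : ℝ) (z y : Space) :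
    frameEvent L a t (z + y) = frameEvent L a t z + L⁻¹ *ᵥ event 0 y := by
  rw [frameEvent, frameEvent, ← Matrix.mulVec_add]
  congr 1
  have : event t (z + y) = event t z + event 0 y := by rw [← event_add, add_zero]
  rw [this]; abel

lemma continuous_frameEvent (L : Matrix (Fin 4) (Fin 4) ℝ) (a : Spacetime) (t : ℝ) :
    Continuous (frameEvent L a t) :=
  Continuous.matrix_mulVec continuous_const
    ((continuous_event.comp (continuous_const.prodMk continuous_id)).sub continuous_const)

lemma IsLorentz.frameEvent_eq_iff {L : Matrix (Fin 4) (Fin 4) ℝ} (hL : IsLorentz L) (a : Spacetime)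
    {t : ℝ} {z : Space} {x : Spacetime} : frameEvent L a t z = x ↔
      (L *ᵥ x + a) 0 = t ∧ spatial (L *ᵥ x + a) = z := by
  have h1 : frameEvent L a t z = x ↔ event t z = L *ᵥ x + a := by
    rw [frameEvent]
    constructor
    · rintro rfl; rw [hL.mulVec_inv]; abel
    · intro h; rw [h, add_sub_cancel_right, hL.inv_mulVec]
  rw [h1]
  constructor
  · intro h; rw [← h, event_zero, spatial_event]; exact ⟨rfl, rfl⟩
  · rintro ⟨rfl, rfl⟩; exact event_spatial _

/-- A world-line in the coordinates of another inertial frame. -/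
lemma IsWorldline.transform {X : ℝ → Spacetime} (hX : IsWorldline X)
    {L : Matrix (Fin 4) (Fin 4) ℝ} (hL : IsLorentz L) (a : Spacetime) :
    IsWorldline fun s => L *ᵥ X s + a := by
  set ℓ : Spacetime →L[ℝ] Spacetime := LinearMap.toContinuousLinearMap (Matrix.toLin' L) with hℓ
  have hd : ∀ s, HasDerivAt (fun s => L *ᵥ X s + a) (L *ᵥ deriv X s) s := fun s =>
    (ℓ.hasFDerivAt.comp_hasDerivAt s (hX.hasDerivAt s)).add_const a
  have hsm : ContDiff ℝ ∞ fun s => L *ᵥ X s + a := (ℓ.contDiff.comp hX.smooth).add contDiff_const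
  refine ⟨hsm, fun s => ?_, fun s => ?_, ?_⟩
  · rw [(hd s).deriv, hL.mdot_mulVec]; exact hX.timelike s
  · rw [(hd s).deriv]
    exact hL.future (hX.speed_lt s).le (hX.future s)
  · obtain ⟨κ, hκ, hb⟩ := hL.exists_time_le
    have hle : ∀ s s' : ℝ, s ≤ s' →
        κ * (X s' 0 - X s 0) ≤ (L *ᵥ X s' + a) 0 - (L *ᵥ X s + a) 0 := fun s s' h => by
      have h1 : ‖spatial (X s' - X s)‖ ≤ (X s' - X s) 0 := by
        rcases h.eq_or_lt with rfl | h
        · rw [sub_self, show spatial 0 = 0 from rfl, norm_zero]; rfl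
        · exact (hX.chord_lt h).le
      have := hb _ h1
      rw [Matrix.mulVec_sub] at this
      simpa using this
    refine Continuous.surjective ((continuous_apply 0).comp hsm.continuous) ?_ ?_
    · have h1 : Tendsto (fun s => κ * (X s 0 - X 0 0) + (L *ᵥ X 0 + a) 0) atTop atTop :=
        tendsto_atTop_add_const_right _ _
          ((tendsto_atTop_add_const_right _ _ hX.tendsto_time_atTop).const_mul_atTop hκ)
      refine tendsto_atTop_mono' _ ?_ h1
      filter_upwards [eventually_ge_atTop 0] with s hs
      have := hle 0 s hs
      change _ ≤ (L *ᵥ X s + a) 0; linarith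
    · have h1 : Tendsto (fun s => κ * (X s 0 - X 0 0) + (L *ᵥ X 0 + a) 0) atBot atBot :=
        tendsto_atBot_add_const_right _ _
          ((tendsto_atBot_add_const_right _ _ hX.tendsto_time_atBot).const_mul_atBot hκ)
      refine tendsto_atBot_mono' _ ?_ h1
      filter_upwards [eventually_le_atBot 0] with s hs
      have := hle s 0 hs
      change (L *ᵥ X s + a) 0 ≤ _; linarith

/-! ### The energy-momentum density in a simultaneity plane -/

namespace System

variable {N : ℕ} {S : System N} {L : Matrix (Fin 4) (Fin 4) ℝ}

/-- The density of energy-momentum in any simultaneity plane through a particle has a singularity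
of Coulomb type. -/
theorem IsRegular.isCoulomb_fluxDensity (hreg : S.IsRegular) (hL : IsLorentz L) {a : Spacetime}
    {t : ℝ} {n : Fin N} {c : ℝ} {z : Space} (hc : frameEvent L a t z = S.worldline n c)
    (β : Fin 4) : IsCoulomb (S.fluxDensity L a t β) z := by
  obtain ⟨Fr, hFr⟩ := hreg.exists_near_stress n
  obtain ⟨v, K, hv0, hv1, hK, hw⟩ := hL.exists_norm_le
  obtain ⟨C, hC, δ, hδ, hb⟩ := hFr c c v hv0 hv1
  set w : Space → Spacetime := fun y => L⁻¹ *ᵥ event 0 y with hwd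
  set Λ := ∑ α, |L 0 α| with hΛ
  have hwc : Continuous w := Continuous.matrix_mulVec continuous_const
    (continuous_event.comp (continuous_const.prodMk continuous_id))
  have hws : ∀ (y : Space) (r : ℝ), w (r • y) = r • w y := fun y r => by
    rw [hwd]; simp only
    rw [← Matrix.mulVec_smul, ← event_smul, mul_zero]
  have hwn : ∀ y : Space, w (-y) = -w y := fun y => by
    have := hws y (-1); simpa using this
  have hΛ0 : 0 ≤ Λ := Finset.sum_nonneg fun _ _ => abs_nonneg _
  have hsum : ∀ {f : Fin 4 → ℝ} {B : ℝ}, (∀ α, |f α| ≤ B) → |∑ α, L 0 α * f α| ≤ (Λ + 1) * B := by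
    intro f B hf
    refine (Finset.abs_sum_le_sum_abs _ _).trans ?_
    have hB : 0 ≤ B := (abs_nonneg _).trans (hf 0)
    calc ∑ α, |L 0 α * f α| ≤ ∑ α, |L 0 α| * B := Finset.sum_le_sum fun α _ => by
          rw [abs_mul]; exact mul_le_mul_of_nonneg_left (hf α) (abs_nonneg _)
      _ = Λ * B := by rw [← Finset.sum_mul]
      _ ≤ (Λ + 1) * B := by linarith
  refine ⟨fun y => ∑ α, L 0 α * S.stress₄ n c (w y) α β, ?_, fun y r hr => ?_,
    (Λ + 1) * (C * 1), by positivity, δ / K, div_pos hδ hK, fun y h0 h1 => ?_⟩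
  · exact Finset.measurable_fun_sum _ fun α _ =>
      ((measurable_stress₄ n c α β).comp hwc.measurable).const_mul _
  · simp only [hws, stress₄_smul hreg n c _ hr, Finset.mul_sum]
    exact Finset.sum_congr rfl fun α _ => by ring
  obtain ⟨hw1, hw2, hw3⟩ := hw y
  have hs0 : 0 < ‖spatial (w y)‖ := h0.trans_le hw2
  have hs1 : ‖spatial (w y)‖ < δ := hw3.trans_lt (by rwa [lt_div_iff₀' hK] at h1)
  have hbd := fun α => hb c ⟨le_rfl, le_rfl⟩ (w y) hw1 hs0 hs1 α β
  have hz : ∀ k : ℕ, C * ‖spatial (w y)‖ ^ (-(k : ℤ)) ≤ C * ‖y‖ ^ (-(k : ℤ)) := fun k =>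
    mul_le_mul_of_nonneg_left (zpow_neg_le_zpow_neg h0 hw2 k) hC.le
  have e1 : ∀ α, fluxDensity S L a t α (z + y) =
      ∑ κ, L 0 κ * energyMomentum (S.field (S.worldline n c + w y)) κ α := fun α => by
    rw [fluxDensity, frameEvent_add, hc]
  have e2 : ∀ α, fluxDensity S L a t α (z - y) =
      ∑ κ, L 0 κ * energyMomentum (S.field (S.worldline n c - w y)) κ α := fun α => by
    rw [fluxDensity, sub_eq_add_neg, frameEvent_add, hc, sub_eq_add_neg, ← hwn]
  refine ⟨?_, ?_, ?_⟩
  · rw [e1]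
    exact (hsum fun α => (hbd α).2.1.trans (hz 4)).trans_eq (by push_cast; ring)
  · exact (hsum fun α => (hbd α).2.2.2.2.1.trans (hz 4)).trans_eq (by push_cast; ring)
  · rw [e1, e2, Finset.mul_sum, ← Finset.sum_add_distrib, ← Finset.sum_sub_distrib]
    have e3 : ∀ κ, L 0 κ * energyMomentum (S.field (S.worldline n c + w y)) κ β
        + L 0 κ * energyMomentum (S.field (S.worldline n c - w y)) κ β
        - 2 * (L 0 κ * S.stress₄ n c (w y) κ β) =
        L 0 κ * (energyMomentum (S.field (S.worldline n c + w y)) κ β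
          + energyMomentum (S.field (S.worldline n c - w y)) κ β
          - 2 * S.stress₄ n c (w y) κ β) := fun κ => by ring
    simp only [e3]
    exact (hsum fun α => (hbd α).2.2.1.trans (hz 2)).trans_eq (by push_cast; ring)

lemma IsRegular.continuousOn_fluxDensity (hreg : S.IsRegular) (L : Matrix (Fin 4) (Fin 4) ℝ)
    (a : Spacetime) (t : ℝ) (β : Fin 4) :
    ContinuousOn (S.fluxDensity L a t β) (frameEvent L a t ⁻¹' S.vacuum) :=
  continuousOn_finsetSum _ fun α _ => continuousOn_const.mul
    ((hreg.contDiffOn_energyMomentum α β).continuousOn.comp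
      (continuous_frameEvent L a t).continuousOn fun _ h => h)

/-- The decay of the energy-momentum density in the simultaneity planes of all frames. -/
lemma VanishesAtInfinity.fluxDensity_le (hinf : S.VanishesAtInfinity) (hL : IsLorentz L)
    (a : Spacetime) (t : ℝ) : ∃ ε C R : ℝ, 0 < ε ∧ 0 < R ∧ ∀ (x : Space), R ≤ ‖x‖ → ∀ β,
      |S.fluxDensity L a t β x| ≤ C * ‖x‖ ^ (-3 - ε) := by
  obtain ⟨v, K, hv0, hv1, hK, hw⟩ := hL.exists_norm_le
  obtain ⟨ε, C, ρ, hε, hb⟩ := hinf ((1 + v) / 2) (by linarith) (by linarith)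
  set p := frameEvent L a t 0 with hp
  set A := max |p 0| ‖spatial p‖ with hA
  have hA0 : 0 ≤ A := (abs_nonneg _).trans (le_max_left _ _)
  have hC0 : 0 ≤ |C| := abs_nonneg C
  refine ⟨ε, (∑ α, |L 0 α|) * (|C| * 2 ^ (3 + ε)),
    max (2 * ρ) (4 * A / (1 - v) + 2 * A) + 1, hε, by
      have : 0 ≤ 4 * A / (1 - v) := div_nonneg (by linarith) (by linarith)
      have := le_max_right (2 * ρ) (4 * A / (1 - v) + 2 * A)
      linarith, fun x hx β => ?_⟩
  obtain ⟨hw1, hw2, -⟩ := hw x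
  have hx1 : 2 * ρ ≤ ‖x‖ := (le_max_left _ _).trans ((le_add_of_nonneg_right zero_le_one).trans hx)
  have hx2 : 4 * A / (1 - v) + 2 * A + 1 ≤ ‖x‖ :=
    (add_le_add_left (le_max_right _ _) 1).trans hx
  have hx3 : 4 * A / (1 - v) ≤ ‖x‖ := by linarith
  have hx3' : 4 * A ≤ ‖x‖ * (1 - v) := by rwa [div_le_iff₀ (by linarith)] at hx3
  have hx4 : 0 ≤ 4 * A / (1 - v) := div_nonneg (by linarith) (by linarith)
  set w := L⁻¹ *ᵥ event 0 x with hwd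
  set e := frameEvent L a t x with he
  have hew : e = p + w := by
    have := frameEvent_add L a t 0 x
    rwa [zero_add] at this
  have h1 : ‖spatial w‖ ≤ ‖spatial e‖ + A := by
    have : spatial w = spatial e - spatial p := by rw [hew, spatial_add]; abel
    rw [this]
    exact (norm_sub_le _ _).trans (add_le_add_right (le_max_right _ _) _)
  have h2 : ‖x‖ / 2 ≤ ‖spatial e‖ := by linarith
  have h3 : |e 0| ≤ (1 + v) / 2 * ‖spatial e‖ := by
    have h4 : |e 0| ≤ A + v * ‖spatial w‖ := by
      rw [hew]
      exact (abs_add_le _ _).trans (add_le_add (le_max_left _ _) hw1)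
    nlinarith
  have hx0 : 0 < ‖x‖ := by linarith
  have h5 : ∀ α, |energyMomentum (S.field e) α β| ≤ |C| * 2 ^ (3 + ε) * ‖x‖ ^ (-3 - ε) :=
      fun α => by
    have := hb (e 0) (spatial e) (by linarith) h3 α β
    rw [event_spatial] at this
    refine this.trans ?_
    have h6 : ‖spatial e‖ ^ (-3 - ε) ≤ (‖x‖ / 2) ^ (-3 - ε) :=
      Real.rpow_le_rpow_of_nonpos (by positivity) h2 (by linarith)
    have h7 : (‖x‖ / 2) ^ (-3 - ε) = 2 ^ (3 + ε) * ‖x‖ ^ (-3 - ε) := by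
      rw [Real.div_rpow hx0.le (by norm_num), div_eq_mul_inv, ← Real.rpow_neg (by norm_num),
        mul_comm]
      congr 2; ring
    calc C * ‖spatial e‖ ^ (-3 - ε) ≤ |C| * ‖spatial e‖ ^ (-3 - ε) :=
          mul_le_mul_of_nonneg_right (le_abs_self C) (by positivity)
      _ ≤ |C| * (‖x‖ / 2) ^ (-3 - ε) := by gcongr
      _ = _ := by rw [h7]; ring
  rw [fluxDensity]
  refine (Finset.abs_sum_le_sum_abs _ _).trans ?_
  calc ∑ α, |L 0 α * energyMomentum (S.field e) α β|
      ≤ ∑ α, |L 0 α| * (|C| * 2 ^ (3 + ε) * ‖x‖ ^ (-3 - ε)) := Finset.sum_le_sum fun α _ => by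
        rw [abs_mul]; exact mul_le_mul_of_nonneg_left (h5 α) (abs_nonneg _)
    _ = _ := by rw [← Finset.sum_mul]; ring

/-- A function on space which is continuous on a closed set and decays faster than `‖x‖⁻³` is
integrable there. -/
lemma _root_.PointCharges.integrableOn_of_decay {G : Space → ℝ} {s : Set Space} (hs : IsClosed s)
    (hG : ContinuousOn G s) {ε C R : ℝ} (hε : 0 < ε) (hR : 0 < R)
    (hb : ∀ x, R ≤ ‖x‖ → |G x| ≤ C * ‖x‖ ^ (-3 - ε)) : IntegrableOn G s := by
  have h1 : IntegrableOn G (s ∩ Metric.closedBall 0 R) :=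
    (hG.mono Set.inter_subset_left).integrableOn_compact
      ((isCompact_closedBall 0 R).inter_left hs)
  have hm : MeasurableSet {x : Space | R ≤ ‖x‖} := measurableSet_le measurable_const measurable_norm
  have h2 : IntegrableOn G (s ∩ {x | R ≤ ‖x‖}) := by
    have h3 : IntegrableOn (fun x : Space => C * ‖x‖ ^ (-(3 + ε))) {x | R ≤ ‖x‖} :=
      (integrableOn_norm_rpow_compl hR (by linarith : 3 < 3 + ε)).const_mul C
    refine (h3.mono_set Set.inter_subset_right).mono'
      ((hG.mono Set.inter_subset_left).aestronglyMeasurable (hs.measurableSet.inter hm)) ?_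
    refine (ae_restrict_iff' (hs.measurableSet.inter hm)).2 (ae_of_all _ fun x hx => ?_)
    have := hb x hx.2
    rwa [neg_add']
  refine (h1.union h2).mono_set fun x hx => ?_
  rcases le_total R ‖x‖ with h | h
  · exact Or.inr ⟨hx, h⟩
  · exact Or.inl ⟨hx, by simpa using h⟩

end System

/-! ### Smooth cutoffs around the particles -/

/-- A smooth even function on space, which vanishes near the origin and equals `1` outside the unit
ball. -/
def hole (y : Space) : ℝ := Real.smoothTransition (2 * ‖y‖ ^ 2 - 1)

lemma contDiff_hole : ContDiff ℝ ∞ hole :=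
  Real.smoothTransition.contDiff.comp
    ((contDiff_const.mul (contDiff_norm_sq ℝ)).sub contDiff_const)

lemma hole_neg (y : Space) : hole (-y) = hole y := by simp [hole]

lemma hole_eq_zero {y : Space} (hy : ‖y‖ ≤ 1 / 2) : hole y = 0 :=
  Real.smoothTransition.zero_of_nonpos (by nlinarith [norm_nonneg y])

lemma hole_eq_one {y : Space} (hy : 1 ≤ ‖y‖) : hole y = 1 :=
  Real.smoothTransition.one_of_one_le (by nlinarith)

lemma abs_hole_le (y : Space) : |hole y| ≤ 1 := by
  rw [hole, abs_of_nonneg (Real.smoothTransition.nonneg _)]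
  exact Real.smoothTransition.le_one _

lemma fderiv_hole (y v : Space) :
    fderiv ℝ hole y v = 4 * deriv Real.smoothTransition (2 * ‖y‖ ^ 2 - 1) * inner ℝ y v := by
  have h1 : HasFDerivAt (fun y : Space => 2 * ‖y‖ ^ 2 - 1) ((2 : ℝ) • (2 • (innerSL ℝ y))) y :=
    ((hasStrictFDerivAt_norm_sq y).hasFDerivAt.const_mul 2).sub_const 1
  have h2 : HasDerivAt Real.smoothTransition (deriv Real.smoothTransition (2 * ‖y‖ ^ 2 - 1))
      (2 * ‖y‖ ^ 2 - 1) :=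
    ((Real.smoothTransition.contDiff (n := 1)).differentiable one_ne_zero _).hasDerivAt
  have h3 : HasFDerivAt hole _ y := h2.comp_hasFDerivAt y h1
  rw [h3.fderiv]
  simp
  ring

lemma fderiv_hole_eq_zero {y : Space} (hy : ‖y‖ < 1 / 2 ∨ 1 < ‖y‖) : fderiv ℝ hole y = 0 := by
  rcases hy with hy | hy
  · have h1 : hole =ᶠ[𝓝 y] fun _ => 0 := by
      filter_upwards [(isOpen_lt continuous_norm continuous_const).mem_nhds hy] with x hx
      exact hole_eq_zero hx.le
    rw [h1.fderiv_eq]; simp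
  · have h1 : hole =ᶠ[𝓝 y] fun _ => 1 := by
      filter_upwards [(isOpen_lt continuous_const continuous_norm).mem_nhds hy] with x hx
      exact hole_eq_one hx.le
    rw [h1.fderiv_eq]; simp

lemma fderiv_hole_neg (y v : Space) : fderiv ℝ hole (-y) v = -fderiv ℝ hole y v := by
  rw [fderiv_hole, fderiv_hole, norm_neg, inner_neg_left]; ring

lemma exists_fderiv_hole_le : ∃ M > 0, ∀ y v : Space, |fderiv ℝ hole y v| ≤ M * ‖v‖ := by
  have hc : Continuous (fderiv ℝ hole) := contDiff_hole.continuous_fderiv (by simp)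
  have hs : HasCompactSupport (fderiv ℝ hole) :=
    HasCompactSupport.intro (isCompact_closedBall (0 : Space) 1) fun y hy =>
      fderiv_hole_eq_zero (Or.inr (by simpa using hy))
  obtain ⟨M, hM⟩ := hc.bounded_above_of_compact_support hs
  refine ⟨max M 1, lt_max_of_lt_right one_pos, fun y v => ?_⟩
  exact ((fderiv ℝ hole y).le_opNorm v).trans
    (mul_le_mul_of_nonneg_right ((hM y).trans (le_max_left _ _)) (norm_nonneg _))

namespace IsWorldline

variable {X : ℝ → Spacetime} (hX : IsWorldline X)

/-- The parameter at which a world-line reaches the time `t`. -/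
def param (hX : IsWorldline X) (t : ℝ) : ℝ := Function.surjInv hX.inextendible t

lemma time_param (hX : IsWorldline X) (t : ℝ) : X (hX.param t) 0 = t :=
  Function.surjInv_eq hX.inextendible t

lemma param_time (hX : IsWorldline X) (s : ℝ) : hX.param (X s 0) = s :=
  hX.strictMono_time.injective (hX.time_param _)

lemma strictMono_param (hX : IsWorldline X) : StrictMono hX.param := fun t t' h => by
  rw [← hX.time_param t, ← hX.time_param t'] at h
  exact hX.strictMono_time.lt_iff_lt.1 h

lemma continuous_param (hX : IsWorldline X) : Continuous hX.param :=
  hX.strictMono_param.monotone.continuous_of_surjective fun s => ⟨_, hX.param_time s⟩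

lemma hasDerivAt_param (hX : IsWorldline X) (t : ℝ) :
    HasDerivAt hX.param (deriv X (hX.param t) 0)⁻¹ t :=
  HasDerivAt.of_local_left_inverse hX.continuous_param.continuousAt
    (hX.hasDerivAt_apply (hX.param t) 0) (hX.future _).ne' (Eventually.of_forall hX.time_param)

lemma contDiff_param (hX : IsWorldline X) : ContDiff ℝ 1 hX.param := by
  rw [contDiff_one_iff_deriv]
  refine ⟨fun t => (hX.hasDerivAt_param t).differentiableAt, ?_⟩
  have : deriv hX.param = fun t => (deriv X (hX.param t) 0)⁻¹ :=
    funext fun t => (hX.hasDerivAt_param t).deriv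
  rw [this]
  exact ((continuous_apply 0).comp (hX.continuous_deriv.comp hX.continuous_param)).inv₀
    fun t => (hX.future _).ne'

/-- The position of the particle at the time `t`. -/
def position (hX : IsWorldline X) (t : ℝ) : Space := spatial (X (hX.param t))

/-- The velocity of the particle at the time `t`. -/
def velocity (hX : IsWorldline X) (t : ℝ) : Space :=
  (deriv X (hX.param t) 0)⁻¹ • spatial (deriv X (hX.param t))

lemma event_position (hX : IsWorldline X) (t : ℝ) : event t (hX.position t) = X (hX.param t) := by
  conv_lhs => rw [← hX.time_param t]
  rw [hX.time_param, position]
  exact (congrArg (fun s => event s (spatial (X (hX.param t)))) (hX.time_param t)).symm.trans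
    (event_spatial _)

lemma position_time (hX : IsWorldline X) (s : ℝ) : hX.position (X s 0) = spatial (X s) := by
  rw [position, hX.param_time]

lemma hasDerivAt_position (hX : IsWorldline X) (t : ℝ) :
    HasDerivAt hX.position (hX.velocity t) t :=
  (hX.hasDerivAt_spatial (hX.param t)).scomp t (hX.hasDerivAt_param t)

lemma contDiff_position (hX : IsWorldline X) : ContDiff ℝ 1 hX.position :=
  spatialL.contDiff.comp ((hX.smooth.of_le (by simp)).comp hX.contDiff_param)

lemma continuous_position (hX : IsWorldline X) : Continuous hX.position :=
  hX.contDiff_position.continuous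

/-- The position of an event relative to the particle at the same time. -/
def offset (hX : IsWorldline X) (x : Spacetime) : Space := spatial x - hX.position (x 0)

lemma contDiff_offset (hX : IsWorldline X) : ContDiff ℝ 1 hX.offset :=
  spatialL.contDiff.sub (hX.contDiff_position.comp (contDiff_apply ℝ ℝ 0))

lemma offset_event (hX : IsWorldline X) (t : ℝ) (x : Space) :
    hX.offset (event t x) = x - hX.position t := by rw [offset, spatial_event, event_zero]

lemma offset_eq_zero (hX : IsWorldline X) (s : ℝ) : hX.offset (X s) = 0 := by
  rw [offset, hX.position_time, sub_self]

lemma hasFDerivAt_offset (hX : IsWorldline X) (x : Spacetime) :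
    HasFDerivAt hX.offset (spatialL - (ContinuousLinearMap.proj (R := ℝ) (φ := fun _ : Fin 4 => ℝ)
      0).smulRight (hX.velocity (x 0))) x := by
  refine spatialL.hasFDerivAt.sub ?_
  have h1 : HasFDerivAt (fun x : Spacetime => x 0)
      (ContinuousLinearMap.proj (R := ℝ) (φ := fun _ : Fin 4 => ℝ) 0) x :=
    (ContinuousLinearMap.proj (R := ℝ) (φ := fun _ : Fin 4 => ℝ) 0).hasFDerivAt
  have h2 := (hX.hasDerivAt_position (x 0)).hasFDerivAt.comp x h1
  have h3 : (ContinuousLinearMap.proj (R := ℝ) (φ := fun _ : Fin 4 => ℝ) 0).smulRight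
      (hX.velocity (x 0)) = (ContinuousLinearMap.toSpanSingleton ℝ (hX.velocity (x 0))).comp
        (ContinuousLinearMap.proj (R := ℝ) (φ := fun _ : Fin 4 => ℝ) 0) :=
    ContinuousLinearMap.ext fun v => by simp
  rw [h3]
  exact h2

/-- The cutoff which removes a tube of radius `r` around the world-line. -/
def tube (hX : IsWorldline X) (r : ℝ) (x : Spacetime) : ℝ := hole (r⁻¹ • hX.offset x)

lemma contDiff_tube (hX : IsWorldline X) (r : ℝ) : ContDiff ℝ 1 (hX.tube r) :=
  (contDiff_hole.of_le (by simp)).comp (hX.contDiff_offset.const_smul r⁻¹)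

lemma norm_inv_smul {r : ℝ} (hr : 0 < r) (y : Space) : ‖r⁻¹ • y‖ = r⁻¹ * ‖y‖ := by
  rw [norm_smul, Real.norm_eq_abs, abs_of_pos (inv_pos.2 hr)]

lemma tube_eq_one (hX : IsWorldline X) {r : ℝ} (hr : 0 < r) {x : Spacetime}
    (hx : r ≤ ‖hX.offset x‖) : hX.tube r x = 1 :=
  hole_eq_one (by rwa [norm_inv_smul hr, le_inv_mul_iff₀ hr, mul_one])

lemma tube_eq_zero (hX : IsWorldline X) {r : ℝ} (hr : 0 < r) {x : Spacetime}
    (hx : ‖hX.offset x‖ ≤ r / 2) : hX.tube r x = 0 :=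
  hole_eq_zero (by rw [norm_inv_smul hr, inv_mul_le_iff₀ hr]; linarith)

lemma abs_tube_le (hX : IsWorldline X) (r : ℝ) (x : Spacetime) : |hX.tube r x| ≤ 1 := abs_hole_le _

lemma notMem_tsupport_tube (hX : IsWorldline X) {r : ℝ} (hr : 0 < r) (s : ℝ) :
    X s ∉ tsupport (hX.tube r) := by
  rw [notMem_tsupport_iff_eventuallyEq]
  have h1 : {x | ‖hX.offset x‖ < r / 2} ∈ 𝓝 (X s) :=
    (isOpen_lt hX.contDiff_offset.continuous.norm continuous_const).mem_nhds (by
      change ‖hX.offset (X s)‖ < r / 2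
      rw [hX.offset_eq_zero, norm_zero]; positivity)
  filter_upwards [h1] with x hx
  exact hX.tube_eq_zero hr (le_of_lt hx)

lemma partialDeriv_tube (hX : IsWorldline X) (r : ℝ) (x : Spacetime) (ν : Fin 4) :
    partialDeriv ν (hX.tube r) x = r⁻¹ * fderiv ℝ hole (r⁻¹ • hX.offset x)
      (spatial (Pi.single ν 1) - (Pi.single ν 1 : Spacetime) 0 • hX.velocity (x 0)) := by
  have h1 : HasFDerivAt (fun x => r⁻¹ • hX.offset x) _ x := (hX.hasFDerivAt_offset x).const_smul r⁻¹
  have h2 : HasFDerivAt hole _ (r⁻¹ • hX.offset x) :=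
    (contDiff_hole.differentiable (by simp) _).hasFDerivAt
  have h3 : HasFDerivAt (hX.tube r) _ x := h2.comp x h1
  rw [partialDeriv, h3.fderiv]
  simp only [ContinuousLinearMap.comp_apply, smul_apply, map_smul, smul_eq_mul]
  rfl

end IsWorldline

/-! ### The energy-momentum near a particle in a simultaneity plane -/

lemma IsLorentz.hasCompactSupport_comp_frameEvent {L : Matrix (Fin 4) (Fin 4) ℝ} (hL : IsLorentz L)
    (a : Spacetime) (t : ℝ) {ζ : Spacetime → ℝ} (hc : HasCompactSupport ζ) :
    HasCompactSupport fun x => ζ (frameEvent L a t x) := by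
  have h1 : Continuous fun x : Spacetime => spatial (L *ᵥ x + a) :=
    continuous_spatial.comp (by fun_prop)
  refine HasCompactSupport.intro (hc.isCompact.image h1) fun x hx => ?_
  by_contra h
  exact hx ⟨_, subset_tsupport ζ h, ((hL.frameEvent_eq_iff a).1 rfl).2⟩

lemma isLorentz_one : IsLorentz 1 := ⟨by simp, by simp⟩

lemma frameEvent_one (t : ℝ) (x : Space) : frameEvent 1 0 t x = event t x := by
  simp [frameEvent]

namespace System

variable {N : ℕ} {S : System N} {L : Matrix (Fin 4) (Fin 4) ℝ}

/-- A cutoff function in space-time whose support meets at most the `n`-th world-line. -/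
structure IsLocalizer (S : System N) (n : Fin N) (ζ : Spacetime → ℝ) : Prop where
  contDiff : ContDiff ℝ 1 ζ
  compact : HasCompactSupport ζ
  avoids : ∀ k, k ≠ n → ∀ s, S.worldline k s ∉ tsupport ζ

/-- The energy-momentum in the part of a simultaneity plane cut out by `ζ`, renormalized at the
point `z`, is well defined and equal to `b`. -/
def HasLocalFlux (S : System N) (L : Matrix (Fin 4) (Fin 4) ℝ) (a : Spacetime) (t : ℝ) (β : Fin 4)
    (ζ : Spacetime → ℝ) (z : Space) (b : ℝ) : Prop :=
  HasRLim (fun r => ∫ x in {x | r ≤ ‖x - z‖}, S.fluxDensity L a t β x * ζ (frameEvent L a t x)) b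

lemma IsRegular.frameEvent_ne (hreg : S.IsRegular) (hL : IsLorentz L) {a : Spacetime} {t : ℝ}
    {n : Fin N} {c : ℝ} {z x : Space} (hz : frameEvent L a t z = S.worldline n c) (hx : x ≠ z)
    (s : ℝ) : frameEvent L a t x ≠ S.worldline n s := by
  intro h
  rw [hL.frameEvent_eq_iff] at h hz
  have h1 : s = c := ((hreg.worldlines n).transform hL a).strictMono_time.injective
    (h.1.trans hz.1.symm)
  subst h1
  exact hx (h.2.symm.trans hz.2)

lemma IsLocalizer.continuousOn (hreg : S.IsRegular) {n : Fin N} {ζ : Spacetime → ℝ}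
    (hζ : S.IsLocalizer n ζ) (hL : IsLorentz L) {a : Spacetime} {t : ℝ} {c : ℝ} {z : Space}
    (hz : frameEvent L a t z = S.worldline n c) (β : Fin 4) :
    ContinuousOn (fun x => S.fluxDensity L a t β x * ζ (frameEvent L a t x)) {z}ᶜ := by
  have hfe := continuous_frameEvent L a t
  intro x hx
  refine ContinuousAt.continuousWithinAt ?_
  by_cases h : frameEvent L a t x ∈ tsupport ζ
  · have hv : frameEvent L a t x ∈ S.vacuum := fun k s => by
      by_cases hk : k = n
      · subst hk; exact hreg.frameEvent_ne hL hz hx s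
      · intro h'; rw [h'] at h; exact hζ.avoids k hk s h
    exact ((hreg.continuousOn_fluxDensity L a t β).continuousAt
      ((hreg.isOpen_vacuum.preimage hfe).mem_nhds hv)).mul
      (hζ.contDiff.continuous.comp hfe).continuousAt
  · refine (continuousAt_const (y := (0 : ℝ))).congr ?_
    filter_upwards [((isClosed_tsupport ζ).isOpen_compl.preimage hfe).mem_nhds h] with y hy
    rw [image_eq_zero_of_notMem_tsupport hy, mul_zero]

lemma IsLocalizer.integrableOn (hreg : S.IsRegular) {n : Fin N} {ζ : Spacetime → ℝ}
    (hζ : S.IsLocalizer n ζ) (hL : IsLorentz L) {a : Spacetime} {t : ℝ} {c : ℝ} {z : Space}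
    (hz : frameEvent L a t z = S.worldline n c) (β : Fin 4) {r : ℝ} (hr : 0 < r) :
    IntegrableOn (fun x => S.fluxDensity L a t β x * ζ (frameEvent L a t x))
      {x | r ≤ ‖x - z‖} := by
  have hc := hL.hasCompactSupport_comp_frameEvent a t hζ.compact
  have hcl : IsClosed {x : Space | r ≤ ‖x - z‖} := isClosed_le continuous_const (by fun_prop)
  have h1 : IntegrableOn (fun x => S.fluxDensity L a t β x * ζ (frameEvent L a t x))
      ({x | r ≤ ‖x - z‖} ∩ tsupport fun x => ζ (frameEvent L a t x)) := by
    refine ContinuousOn.integrableOn_compact (hc.isCompact.inter_left hcl)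
      ((hζ.continuousOn hreg hL hz β).mono fun x hx h => ?_)
    rw [Set.mem_singleton_iff] at h
    have h2 : r ≤ ‖x - z‖ := hx.1
    rw [h, sub_self, norm_zero] at h2
    linarith
  refine h1.of_forall_sdiff_eq_zero hcl.measurableSet fun x hx => ?_
  have h2 : x ∉ tsupport fun x => ζ (frameEvent L a t x) := fun h => hx.2 ⟨hx.1, h⟩
  rw [image_eq_zero_of_notMem_tsupport h2, mul_zero]

lemma IsLocalizer.isCoulomb (hreg : S.IsRegular) {ζ : Spacetime → ℝ}
    (hL : IsLorentz L) {a : Spacetime} {t : ℝ} {n : Fin N} {c : ℝ} {z : Space}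
    (hz : frameEvent L a t z = S.worldline n c) (h1 : ∀ᶠ x in 𝓝 (S.worldline n c), ζ x = 1)
    (β : Fin 4) :
    IsCoulomb (fun x => S.fluxDensity L a t β x * ζ (frameEvent L a t x)) z := by
  refine (hreg.isCoulomb_fluxDensity hL hz β).congr ?_
  rw [← hz] at h1
  filter_upwards [(continuous_frameEvent L a t).continuousAt.eventually h1] with x hx
  rw [hx, mul_one]

lemma IsLocalizer.exists_hasLocalFlux (hreg : S.IsRegular) {n : Fin N} {ζ : Spacetime → ℝ}
    (hζ : S.IsLocalizer n ζ) (hL : IsLorentz L) {a : Spacetime} {t : ℝ} {c : ℝ} {z : Space}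
    (hz : frameEvent L a t z = S.worldline n c) (h1 : ∀ᶠ x in 𝓝 (S.worldline n c), ζ x = 1)
    (β : Fin 4) : ∃ b, S.HasLocalFlux L a t β ζ z b :=
  (IsLocalizer.isCoulomb hreg hL hz h1 β).exists_hasRLim fun _ hr =>
    hζ.integrableOn hreg hL hz β hr

/-- The local energy-momentum can be computed with the smooth cutoff `hole`, applied to the spatial
distance from the particle in the original frame. -/
lemma IsLocalizer.hasRLim_hole (hreg : S.IsRegular) {n : Fin N} {ζ : Spacetime → ℝ}
    (hζ : S.IsLocalizer n ζ) (hL : IsLorentz L) {a : Spacetime} {t : ℝ} {c : ℝ} {z : Space}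
    (hz : frameEvent L a t z = S.worldline n c) (h1 : ∀ᶠ x in 𝓝 (S.worldline n c), ζ x = 1)
    {β : Fin 4} {b : ℝ} (hb : S.HasLocalFlux L a t β ζ z b) :
    HasRLim (fun r => ∫ x, S.fluxDensity L a t β x * ζ (frameEvent L a t x) *
      hole (r⁻¹ • spatial (frameEvent L a t x - S.worldline n c))) b := by
  obtain ⟨v, K, hv0, hv1, hK, hw⟩ := hL.exists_norm_le
  have hwc : Continuous fun y : Space => L⁻¹ *ᵥ event 0 y :=
    Continuous.matrix_mulVec continuous_const
      (continuous_event.comp (continuous_const.prodMk continuous_id))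
  have key := (IsLocalizer.isCoulomb hreg hL hz h1 β).hasRLim_weight
    (fun r hr => hζ.integrableOn hreg hL hz β hr) hb
    (H := fun y => hole (spatial (L⁻¹ *ᵥ event 0 y))) (η := (2 * K)⁻¹) (M := 1) (B := 1)
    (contDiff_hole.continuous.comp (continuous_spatial.comp hwc)).measurable (by positivity)
    (fun y hy => hole_eq_zero ((hw y).2.2.trans (by
      have h3 := mul_lt_mul_of_pos_left hy hK
      have h4 : K * (2 * K)⁻¹ = 1 / 2 := by field_simp
      linarith)))
    (fun y hy => hole_eq_one (hy.le.trans (hw y).2.1))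
    (fun y => abs_hole_le _)
    (fun y => by
      have : event 0 (-y) = -event 0 y := by
        have := event_smul (-1) 0 y; simpa using this
      rw [this, Matrix.mulVec_neg, spatial_neg, hole_neg])
  convert key using 4 with r x
  have h2 := frameEvent_add L a t z (x - z)
  rw [add_sub_cancel] at h2
  rw [h2, hz, add_sub_cancel_left, ← spatial_smul, ← Matrix.mulVec_smul, ← event_smul, mul_zero]

/-- The difference of the indicator functions of the pasts of two simultaneity planes. -/
def slab (L : Matrix (Fin 4) (Fin 4) ℝ) (a : Spacetime) (t' t : ℝ) (x : Spacetime) : ℝ :=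
  (Real.sign (t' - (L *ᵥ x + a) 0) - Real.sign (t - x 0)) / 2

lemma measurable_slab (a : Spacetime) (t' t : ℝ) : Measurable (slab L a t' t) := by
  have hs : Measurable Real.sign :=
    Measurable.ite measurableSet_Iio measurable_const
      (Measurable.ite measurableSet_Ioi measurable_const measurable_const)
  have h1 : Measurable fun x : Spacetime => (L *ᵥ x + a) 0 := by
    have : Continuous fun x : Spacetime => (L *ᵥ x + a) 0 := by fun_prop
    exact this.measurable
  exact ((hs.comp (measurable_const.sub h1)).sub
    (hs.comp (measurable_const.sub (measurable_pi_apply 0)))).div_const 2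

lemma abs_sign_le (x : ℝ) : |Real.sign x| ≤ 1 := by
  rcases Real.sign_apply_eq x with h | h | h <;> simp [h]

lemma abs_slab_le (a : Spacetime) (t' t : ℝ) (x : Spacetime) : |slab L a t' t x| ≤ 1 := by
  rw [slab, abs_div, abs_of_pos (two_pos : (0 : ℝ) < 2)]
  have := (abs_sub (Real.sign (t' - (L *ᵥ x + a) 0)) (Real.sign (t - x 0))).trans
    (add_le_add (abs_sign_le _) (abs_sign_le _))
  linarith

lemma of_slab_ne_zero {a : Spacetime} {t' t : ℝ} {x : Spacetime} (h : slab L a t' t x ≠ 0) :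
    (t' - (L *ᵥ x + a) 0) * (t - x 0) ≤ 0 := by
  by_contra! hcon
  apply h
  rcases pos_and_pos_or_neg_and_neg_of_mul_pos hcon with ⟨h1, h2⟩ | ⟨h1, h2⟩
  · rw [slab, Real.sign_of_pos h1, Real.sign_of_pos h2]; simp
  · rw [slab, Real.sign_of_neg h1, Real.sign_of_neg h2]; simp

/-- The difference of the fluxes through two simultaneity planes. -/
lemma Maxwell.integral_slab_mul_exchange (hreg : S.IsRegular) (hmax : S.Maxwell)
    (hL : IsLorentz L) (a : Spacetime) {χ : Spacetime → ℝ} (hχ : ContDiff ℝ 1 χ)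
    (hc : HasCompactSupport χ) (hv : tsupport χ ⊆ S.vacuum) (t' t : ℝ) (β : Fin 4) :
    Integrable (fun x => slab L a t' t x * S.exchange β χ x) ∧
    ∫ x, slab L a t' t x * S.exchange β χ x =
      (∫ x, S.fluxDensity L a t' β x * χ (frameEvent L a t' x))
        - ∫ x, S.fluxDensity 1 0 t β x * χ (frameEvent 1 0 t x) := by
  have hI := hreg.integrable_exchange hχ hc hv β
  have hs : Measurable Real.sign :=
    Measurable.ite measurableSet_Iio measurable_const
      (Measurable.ite measurableSet_Ioi measurable_const measurable_const)
  have hi : ∀ (M : Matrix (Fin 4) (Fin 4) ℝ) (d : Spacetime) (τ : ℝ),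
      Integrable fun x => Real.sign (τ - (M *ᵥ x + d) 0) * S.exchange β χ x := fun M d τ => by
    have h1 : Measurable fun x : Spacetime => (M *ᵥ x + d) 0 := by
      have : Continuous fun x : Spacetime => (M *ᵥ x + d) 0 := by fun_prop
      exact this.measurable
    exact hI.bdd_mul (c := 1) (hs.comp (measurable_const.sub h1)).aestronglyMeasurable
      (ae_of_all _ fun x => abs_sign_le _)
  have e1 := hmax.integral_sign_mul_exchange hreg hL a hχ hc hv t' β
  have e2 := hmax.integral_sign_mul_exchange hreg isLorentz_one 0 hχ hc hv t β
  have e3 : ∀ x, slab L a t' t x * S.exchange β χ x =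
      1 / 2 * (Real.sign (t' - (L *ᵥ x + a) 0) * S.exchange β χ x)
        - 1 / 2 * (Real.sign (t - ((1 : Matrix (Fin 4) (Fin 4) ℝ) *ᵥ x + 0) 0)
          * S.exchange β χ x) := fun x => by
    rw [slab, Matrix.one_mulVec, add_zero]; ring
  have i1 := (hi L a t').const_mul (1 / 2)
  have i2 := (hi 1 0 t).const_mul (1 / 2)
  simp only [e3]
  refine ⟨i1.sub i2, ?_⟩
  rw [integral_sub i1 i2, integral_const_mul, integral_const_mul, e1, e2]
  ring

end System

/-! ### Simultaneity planes which meet at an event on a world-line -/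

lemma IsWorldline.le_norm_offset {X : ℝ → Spacetime} (hX : IsWorldline X) (c : ℝ) (y : Spacetime) :
    ‖spatial y‖ - |y 0| ≤ ‖hX.offset (X c + y)‖ := by
  set s := hX.param ((X c + y) 0) with hs
  have h1 : ‖spatial (X s - X c)‖ ≤ |y 0| := by
    have h2 : (X s - X c) 0 = y 0 := by
      rw [Pi.sub_apply, hs, hX.time_param, Pi.add_apply]; ring
    rw [← h2]
    by_cases h : c = s
    · rw [← h, sub_self, show spatial 0 = 0 from rfl, norm_zero]; exact abs_nonneg _
    · exact (hX.norm_spatial_sub_lt h).le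
  have h3 : spatial y = hX.offset (X c + y) + spatial (X s - X c) := by
    rw [offset, position, ← hs, spatial_add, spatial_sub]; abel
  have h4 := norm_add_le (hX.offset (X c + y)) (spatial (X s - X c))
  rw [← h3] at h4
  linarith

lemma integral_comp_scale (f : Spacetime → ℝ) (z : Spacetime) {r : ℝ} (hr : 0 < r) :
    ∫ x, f x = r ^ 4 * ∫ y, f (z + r • y) := by
  have h1 := Measure.integral_comp_smul (volume : Measure Spacetime) (fun y => f (z + y)) r
  rw [integral_add_left_eq_self f z] at h1
  simp only [Module.finrank_fintype_fun_eq_card, Fintype.card_fin, smul_eq_mul] at h1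
  rw [h1, abs_of_pos (by positivity)]
  field_simp

lemma sign_mul_of_pos {r : ℝ} (hr : 0 < r) (x : ℝ) : Real.sign (r * x) = Real.sign x := by
  rcases lt_trichotomy x 0 with h | rfl | h
  · rw [Real.sign_of_neg h, Real.sign_of_neg (mul_neg_of_pos_of_neg hr h)]
  · simp
  · rw [Real.sign_of_pos h, Real.sign_of_pos (mul_pos hr h)]

namespace System

variable {N : ℕ} {S : System N} {L : Matrix (Fin 4) (Fin 4) ℝ}

lemma exchange_congr {χ χ' : Spacetime → ℝ} {x : Spacetime} (h : χ =ᶠ[𝓝 x] χ') (β : Fin 4) :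
    S.exchange β χ x = S.exchange β χ' x := by
  simp only [exchange, partialDeriv, h.fderiv_eq]

lemma exchange_eq_zero {χ : Spacetime → ℝ} {k : ℝ} {x : Spacetime} (h : χ =ᶠ[𝓝 x] fun _ => k)
    (β : Fin 4) : S.exchange β χ x = 0 := by
  rw [exchange_congr h]
  simp [exchange, partialDeriv]

/-- The contribution of a small cutoff around an event on a world-line to the difference of the
fluxes through two simultaneity planes which meet there. By scaling and symmetry, it has no constant
term. -/
lemma IsRegular.exists_integral_slab_hole (hreg : S.IsRegular) (hL : IsLorentz L) (a : Spacetime)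
    (n : Fin N) (c : ℝ) (β : Fin 4) :
    ∃ A C δ : ℝ, 0 < δ ∧ ∀ r, 0 < r → r < δ →
      |(∫ x, slab L a ((L *ᵥ S.worldline n c + a) 0) (S.worldline n c 0) x *
        S.exchange β (fun x => hole (r⁻¹ • spatial (x - S.worldline n c))) x) - A / r| ≤ C * r := by
  set p := S.worldline n c with hp
  have hX := hreg.worldlines n
  obtain ⟨v, hv0, hv1, hv⟩ := hL.exists_slope
  have hv : ∀ w : Spacetime, w 0 * (L *ᵥ w) 0 ≤ 0 → |w 0| ≤ v * ‖spatial w‖ := fun w hw => by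
    simpa using hv w 0 0 (by simpa using hw)
  obtain ⟨Fr, hFr⟩ := hreg.exists_near_stress n
  obtain ⟨C, hC, δ, hδ, hb⟩ := hFr c c v hv0 hv1
  obtain ⟨M, hM, hMb⟩ := exists_fderiv_hole_le
  -- a neighbourhood of the event which no other particle meets
  obtain ⟨δ₁, hδ₁, hδ₁v⟩ : ∃ δ₁ > 0, ∀ x, dist x p < δ₁ → ∀ k, k ≠ n → ∀ s,
      x ≠ S.worldline k s := by
    have h1 : ∀ᶠ x in 𝓝 p, ∀ k, k ≠ n → ∀ s, x ≠ S.worldline k s := by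
      refine eventually_all.2 fun k => ?_
      by_cases hk : k = n
      · exact Eventually.of_forall fun x h => absurd hk h
      · have h2 : p ∉ Set.range (S.worldline k) := by
          rintro ⟨s, hs⟩
          exact hreg.noCollision k n hk s c hs
        filter_upwards [(hreg.worldlines k).isClosed_range.isOpen_compl.mem_nhds h2] with x hx _ s h
        exact hx ⟨s, h.symm⟩
    exact Metric.eventually_nhds_iff.1 h1
  -- the sign of the wedge at the event is odd, and invariant under scaling
  set W : Spacetime → ℝ := fun y => (Real.sign (-(L *ᵥ y) 0) - Real.sign (-(y 0))) / 2 with hW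
  have hWs : ∀ {r : ℝ}, 0 < r → ∀ y, slab L a ((L *ᵥ p + a) 0) (p 0) (p + r • y) = W y :=
    fun {r} hr y => by
    have e1 : (L *ᵥ p + a) 0 - (L *ᵥ (p + r • y) + a) 0 = r * -(L *ᵥ y) 0 := by
      rw [Matrix.mulVec_add, Matrix.mulVec_smul]; simp
    have e2 : p 0 - (p + r • y) 0 = r * -(y 0) := by simp
    rw [slab, e1, e2, sign_mul_of_pos hr, sign_mul_of_pos hr]
  have hW1 : ∀ y, |W y| ≤ 1 := fun y => by
    rw [← hWs one_pos]; exact abs_slab_le _ _ _ _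
  have hW0 : ∀ y, W y ≠ 0 → |y 0| ≤ v * ‖spatial y‖ := fun y hy => by
    rw [← hWs one_pos] at hy
    have h1 := of_slab_ne_zero hy
    refine hv _ ?_
    have e1 : (L *ᵥ p + a) 0 - (L *ᵥ (p + (1 : ℝ) • y) + a) 0 = -(L *ᵥ y) 0 := by
      rw [Matrix.mulVec_add, Matrix.mulVec_smul]; simp
    have e2 : p 0 - (p + (1 : ℝ) • y) 0 = -(y 0) := by simp
    rw [e1, e2] at h1
    linarith
  have hWn : ∀ y, W (-y) = -W y := fun y => by
    simp only [hW, Matrix.mulVec_neg, Pi.neg_apply, Real.sign_neg]; ring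
  have hWm : Measurable W := by
    have : W = fun y => slab L a ((L *ᵥ p + a) 0) (p 0) (p + (1 : ℝ) • y) :=
      funext fun y => (hWs one_pos y).symm
    rw [this]
    exact (measurable_slab _ _ _).comp (by fun_prop)
  -- the region to which the scaled integral is confined
  set K : Set Spacetime := {y | |y 0| ≤ v * ‖spatial y‖ ∧ 1 / 2 ≤ ‖spatial y‖ ∧ ‖spatial y‖ ≤ 1}
    with hK
  have hKcl : IsClosed K := by
    have h1 : Continuous fun y : Spacetime => |y 0| := (continuous_apply 0).abs
    exact (isClosed_le h1 (continuous_const.mul continuous_spatial.norm)).inter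
      ((isClosed_le continuous_const continuous_spatial.norm).inter
        (isClosed_le continuous_spatial.norm continuous_const))
  have hKb : ∀ y ∈ K, ‖y‖ ≤ 1 := fun y hy => by
    refine (norm_le_of_spatial y).trans (max_le ?_ hy.2.2)
    nlinarith [hy.1, hy.2.2, norm_nonneg (spatial y)]
  have hKf : volume K < ⊤ := (measure_mono fun y hy => by simpa using hKb y hy).trans_lt
    (measure_closedBall_lt_top (x := (0 : Spacetime)) (r := 1))
  -- the weight is even, as the product of two odd factors, so that it selects the even part of the
  -- energy-momentum tensor
  set Φ : Fin 4 → Spacetime → ℝ := fun ν y =>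
    W y * fderiv ℝ hole (spatial y) (spatial (Pi.single ν 1)) with hΦ
  have hΦ0 : ∀ ν, ∀ y ∉ K, Φ ν y = 0 := fun ν y hy => by
    by_cases h1 : W y = 0
    · simp [hΦ, h1]
    · have h2 : fderiv ℝ hole (spatial y) = 0 := by
        refine fderiv_hole_eq_zero ?_
        by_contra! hcon
        exact hy ⟨hW0 y h1, hcon.1, hcon.2⟩
      simp [hΦ, h2]
  have hΦM : ∀ ν y, |Φ ν y| ≤ M * ‖spatial (Pi.single ν 1)‖ := fun ν y => by
    rw [hΦ]; simp only
    rw [abs_mul]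
    calc |W y| * |fderiv ℝ hole (spatial y) (spatial (Pi.single ν 1))|
        ≤ 1 * (M * ‖spatial (Pi.single ν 1)‖) :=
          mul_le_mul (hW1 y) (hMb _ _) (abs_nonneg _) zero_le_one
      _ = _ := one_mul _
  have hΦn : ∀ ν y, Φ ν (-y) = 1 * Φ ν y := fun ν y => by
    simp only [hΦ, hWn, spatial_neg, fderiv_hole_neg]; ring
  have hΦm : ∀ ν, Measurable (Φ ν) := fun ν => by
    have h1 : Continuous fun y : Spacetime =>
        fderiv ℝ hole (spatial y) (spatial (Pi.single ν 1)) :=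
      ((contDiff_hole.continuous_fderiv (by simp)).comp continuous_spatial).clm_apply
        continuous_const
    exact hWm.mul h1.measurable
  have hz4 : ∀ y ∈ K, ‖spatial y‖ ^ (-4 : ℤ) ≤ 16 := fun y hy => by
    have := zpow_neg_le_zpow_neg (by norm_num : (0 : ℝ) < 1 / 2) hy.2.1 4
    norm_num at this ⊢
    exact this
  have hz2 : ∀ y ∈ K, ‖spatial y‖ ^ (-2 : ℤ) ≤ 4 := fun y hy => by
    have := zpow_neg_le_zpow_neg (by norm_num : (0 : ℝ) < 1 / 2) hy.2.1 2
    norm_num at this ⊢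
    exact this
  set T : Fin 4 → Spacetime → ℝ := fun ν x => energyMomentum (S.field x) ν β with hT
  have hbd : ∀ {r : ℝ}, 0 < r → r < δ → ∀ y ∈ K, ∀ ν,
      |T ν (p + r • y)| ≤ 16 * C * (r ^ 4)⁻¹ ∧
      |T ν (p + r • y) + T ν (p - r • y) - 2 * ((r ^ 4)⁻¹ * S.stress₄ n c y ν β)|
        ≤ 4 * C * (r ^ 2)⁻¹ := fun {r} hr hrδ y hy ν => by
    have e1 : ‖spatial (r • y)‖ = r * ‖spatial y‖ := by
      rw [spatial_smul, norm_smul, Real.norm_eq_abs, abs_of_pos hr]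
    have e2 : 0 < ‖spatial y‖ := lt_of_lt_of_le (by norm_num) hy.2.1
    have e3 : |(r • y) 0| ≤ v * ‖spatial (r • y)‖ := by
      rw [e1, Pi.smul_apply, smul_eq_mul, abs_mul, abs_of_pos hr]
      nlinarith [hy.1]
    obtain ⟨-, h2, h3, -⟩ := hb c ⟨le_rfl, le_rfl⟩ (r • y) e3 (by rw [e1]; positivity)
      (by rw [e1]; nlinarith [hy.2.2]) ν β
    rw [stress₄_smul hreg n c y hr] at h3
    have e4 : r ^ (-4 : ℤ) = (r ^ 4)⁻¹ := by rw [zpow_neg]; norm_cast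
    have e5 : r ^ (-2 : ℤ) = (r ^ 2)⁻¹ := by rw [zpow_neg]; norm_cast
    rw [e1, mul_zpow, e4] at h2
    rw [e1, mul_zpow, e5] at h3
    have p4 : 0 ≤ C * (r ^ 4)⁻¹ := by positivity
    have p2 : 0 ≤ C * (r ^ 2)⁻¹ := by positivity
    constructor
    · refine h2.trans ?_
      nlinarith [mul_le_mul_of_nonneg_left (hz4 y hy) p4]
    · refine h3.trans ?_
      nlinarith [mul_le_mul_of_nonneg_left (hz2 y hy) p2]
  have hTm : ∀ {r : ℝ}, 0 < r → r < δ₁ → ∀ ν,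
      AEStronglyMeasurable (fun y => T ν (p + r • y)) (volume.restrict K) := fun {r} hr hrδ ν => by
    have h1 : ContinuousOn (fun y => T ν (p + r • y)) K := by
      refine (hreg.contDiffOn_energyMomentum ν β).continuousOn.comp (by fun_prop) fun y hy => ?_
      intro k s hks
      have e1 : ‖spatial (r • y)‖ = r * ‖spatial y‖ := by
        rw [spatial_smul, norm_smul, Real.norm_eq_abs, abs_of_pos hr]
      by_cases hk : k = n
      · subst hk
        have h2 := hX.le_norm_offset c (r • y)
        rw [← hp, hks, hX.offset_eq_zero, norm_zero, e1, Pi.smul_apply, smul_eq_mul, abs_mul,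
          abs_of_pos hr] at h2
        have h3 := mul_le_mul_of_nonneg_left hy.1 hr.le
        have h4 : 0 < ‖spatial y‖ := lt_of_lt_of_le (by norm_num) hy.2.1
        have h5 : 0 < r * ‖spatial y‖ * (1 - v) := by
          have : 0 < 1 - v := by linarith
          positivity
        nlinarith
      · refine hδ₁v (p + r • y) ?_ k hk s hks
        rw [dist_eq_norm, add_sub_cancel_left, norm_smul, Real.norm_eq_abs, abs_of_pos hr]
        nlinarith [hKb y hy]
    exact h1.aestronglyMeasurable hKcl.measurableSet
  have hh : ∀ ν, Integrable fun y => S.stress₄ n c y ν β * Φ ν y := fun ν => by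
    refine integrable_mul_of_bounded (B := 16 * C * (δ / 2) ^ (-4 : ℤ) * (δ / 2) ^ 4) hKf
      hKcl.measurableSet (measurable_stress₄ n c ν β).aestronglyMeasurable
      (hΦm ν).aestronglyMeasurable (hΦ0 ν) (hΦM ν) fun y hy => ?_
    have hd2 : 0 < δ / 2 := by positivity
    have e1 : ‖spatial ((δ / 2) • y)‖ = δ / 2 * ‖spatial y‖ := by
      rw [spatial_smul, norm_smul, Real.norm_eq_abs, abs_of_pos hd2]
    have e2 : 0 < ‖spatial y‖ := lt_of_lt_of_le (by norm_num) hy.2.1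
    have e3 : |((δ / 2) • y) 0| ≤ v * ‖spatial ((δ / 2) • y)‖ := by
      rw [e1, Pi.smul_apply, smul_eq_mul, abs_mul, abs_of_pos hd2]
      nlinarith [hy.1]
    have h2 := (hb c ⟨le_rfl, le_rfl⟩ ((δ / 2) • y) e3 (by rw [e1]; positivity)
      (by rw [e1]; nlinarith [hy.2.2]) ν β).2.2.2.2.1
    rw [stress₄_smul hreg n c y hd2, e1, mul_zpow, abs_mul,
      abs_of_pos (by positivity : 0 < ((δ / 2) ^ 4)⁻¹)] at h2
    have h3 : 0 < (δ / 2) ^ 4 := by positivity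
    rw [inv_mul_le_iff₀ h3] at h2
    refine h2.trans ?_
    have h4 : 0 ≤ C * (δ / 2) ^ (-4 : ℤ) * (δ / 2) ^ 4 := by positivity
    nlinarith [mul_le_mul_of_nonneg_left (hz4 y hy) h4]
  refine ⟨∑ ν, ∫ y, S.stress₄ n c y ν β * Φ ν y,
    ∑ ν : Fin 4, 2 * C * (M * ‖spatial (Pi.single ν 1)‖) * volume.real K, min δ δ₁,
    lt_min hδ hδ₁, fun r hr hrδ => ?_⟩
  have hrδ0 := hrδ.trans_le (min_le_left _ _)
  have hrδ1 := hrδ.trans_le (min_le_right _ _)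
  have hI : ∀ ν, Integrable fun y => T ν (p + r • y) * Φ ν y := fun ν =>
    integrable_mul_of_bounded hKf hKcl.measurableSet (hTm hr hrδ1 ν) (hΦm ν).aestronglyMeasurable
      (hΦ0 ν) (hΦM ν) fun y hy => (hbd hr hrδ0 y hy ν).1
  have hpd : ∀ y ν, partialDeriv ν (fun x => hole (r⁻¹ • spatial (x - p))) (p + r • y) =
      r⁻¹ * fderiv ℝ hole (spatial y) (spatial (Pi.single ν 1)) := fun y ν => by
    have e1 : r⁻¹ • spatial (p + r • y - p) = spatial y := by
      rw [add_sub_cancel_left, spatial_smul, smul_smul, inv_mul_cancel₀ hr.ne', one_smul]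
    have h1 : HasFDerivAt (fun x : Spacetime => r⁻¹ • spatial (x - p)) (r⁻¹ • spatialL)
        (p + r • y) :=
      (spatialL.hasFDerivAt.comp (p + r • y) ((hasFDerivAt_id _).sub_const p)).const_smul r⁻¹
    have h2 : HasFDerivAt hole (fderiv ℝ hole (r⁻¹ • spatial (p + r • y - p)))
        (r⁻¹ • spatial (p + r • y - p)) :=
      (contDiff_hole.differentiable (by simp) _).hasFDerivAt
    have h3 : HasFDerivAt (fun x => hole (r⁻¹ • spatial (x - p))) _ (p + r • y) :=
      HasFDerivAt.comp (g := hole) (p + r • y) h2 h1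
    rw [partialDeriv, h3.fderiv, e1]
    simp only [ContinuousLinearMap.comp_apply, smul_apply, map_smul, smul_eq_mul]
    rfl
  -- four powers of `r` from the volume, and one inverse power from the gradient
  have hscale : ∫ x, slab L a ((L *ᵥ p + a) 0) (p 0) x *
      S.exchange β (fun x => hole (r⁻¹ • spatial (x - p))) x =
      r ^ 3 * ∑ ν, ∫ y, T ν (p + r • y) * Φ ν y := by
    rw [integral_comp_scale _ p hr, ← integral_finsetSum _ fun ν _ => hI ν]
    have h1 : ∀ y, slab L a ((L *ᵥ p + a) 0) (p 0) (p + r • y) *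
        S.exchange β (fun x => hole (r⁻¹ • spatial (x - p))) (p + r • y) =
        r⁻¹ * ∑ ν, T ν (p + r • y) * Φ ν y := fun y => by
      rw [hWs hr, exchange, Finset.mul_sum, Finset.mul_sum]
      refine Finset.sum_congr rfl fun ν _ => ?_
      rw [hpd]; ring
    simp only [h1]
    rw [integral_const_mul]
    field_simp
  have hν : ∀ ν, |r ^ 3 * (∫ y, T ν (p + r • y) * Φ ν y)
      - (∫ y, S.stress₄ n c y ν β * Φ ν y) / r| ≤
      2 * C * (M * ‖spatial (Pi.single ν 1)‖) * volume.real K * r := fun ν => by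
    have key := abs_integral_sub_le_of_parity (μ := (volume : Measure Spacetime)) (K := K) hKf
      hKcl.measurableSet (f := fun y => T ν (p + r • y))
      (h := fun y => (r ^ 4)⁻¹ * S.stress₄ n c y ν β) (Φ := Φ ν)
      (ε := 2 * C * (r ^ 2)⁻¹) (σ := 1) (hTm hr hrδ1 ν) (hΦm ν).aestronglyMeasurable (hΦ0 ν)
      (hΦM ν) (hΦn ν) (fun y hy => (hbd hr hrδ0 y hy ν).1)
      (((hh ν).const_mul ((r ^ 4)⁻¹)).congr (ae_of_all _ fun y => by ring)) (by positivity)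
      (fun y hy => by
        rw [one_mul, smul_neg, ← sub_eq_add_neg]
        exact (hbd hr hrδ0 y hy ν).2.trans_eq (by ring))
    have h5 : ∫ y, (r ^ 4)⁻¹ * S.stress₄ n c y ν β * Φ ν y =
        (r ^ 4)⁻¹ * ∫ y, S.stress₄ n c y ν β * Φ ν y := by
      rw [← integral_const_mul]; congr 1; ext y; ring
    rw [h5] at key
    revert key
    generalize (∫ y, T ν (p + r • y) * Φ ν y) = I
    generalize (∫ y, S.stress₄ n c y ν β * Φ ν y) = J
    intro key
    have h6 : r ^ 3 * I - J / r = r ^ 3 * (I - (r ^ 4)⁻¹ * J) := by field_simp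
    rw [h6, abs_mul, abs_of_pos (by positivity)]
    calc r ^ 3 * |I - (r ^ 4)⁻¹ * J| ≤ r ^ 3 *
          (2 * C * (r ^ 2)⁻¹ * (M * ‖spatial (Pi.single ν 1)‖) * volume.real K) := by gcongr
      _ = _ := by field_simp
  rw [hscale, Finset.sum_div, Finset.mul_sum, ← Finset.sum_sub_distrib, Finset.sum_mul]
  exact (Finset.abs_sum_le_sum_abs _ _).trans (Finset.sum_le_sum fun ν _ => hν ν)

/-- In two simultaneity planes which meet at an event on a world-line, the renormalized
energy-momentum near the particle is the same, up to the exchange with the surroundings. -/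
theorem IsLocalizer.sub_eq_of_same_event (hreg : S.IsRegular) (hmax : S.Maxwell) (hL : IsLorentz L)
    (a : Spacetime) {n : Fin N} {c : ℝ} {ζ : Spacetime → ℝ} (hζ : S.IsLocalizer n ζ)
    (h1 : ∀ᶠ x in 𝓝 (S.worldline n c), ζ x = 1) {β : Fin 4} {z z' : Space} {b b' t t' : ℝ}
    (ht : S.worldline n c 0 = t) (ht' : (L *ᵥ S.worldline n c + a) 0 = t')
    (hz : frameEvent 1 0 t z = S.worldline n c) (hz' : frameEvent L a t' z' = S.worldline n c)
    (hb : S.HasLocalFlux 1 0 t β ζ z b) (hb' : S.HasLocalFlux L a t' β ζ z' b') :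
    Integrable (fun x => slab L a t' t x * S.exchange β ζ x) ∧
      b' - b = ∫ x, slab L a t' t x * S.exchange β ζ x := by
  set p := S.worldline n c with hp
  have hX := hreg.worldlines n
  obtain ⟨v, hv0, hv1, hv⟩ := hL.exists_slope
  have hv : ∀ w : Spacetime, w 0 * (L *ᵥ w) 0 ≤ 0 → |w 0| ≤ v * ‖spatial w‖ := fun w hw => by
    simpa using hv w 0 0 (by simpa using hw)
  -- `ζ` equals `1` in the neighbourhood of size `δ` of the event
  obtain ⟨δ, hδ, hδ1⟩ := Metric.eventually_nhds_iff.1 h1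
  have hsp : Continuous fun x : Spacetime => spatial (x - p) :=
    continuous_spatial.comp (continuous_id.sub continuous_const)
  have hcone : ∀ x, |(x - p) 0| ≤ v * ‖spatial (x - p)‖ → ‖spatial (x - p)‖ < δ →
      ∀ᶠ y in 𝓝 x, ζ y = 1 := fun x hx hxδ => by
    have h3 : dist x p < δ := by
      rw [dist_eq_norm]
      refine (norm_le_of_spatial (x - p)).trans_lt (max_lt ?_ hxδ)
      nlinarith [norm_nonneg (spatial (x - p))]
    filter_upwards [Metric.isOpen_ball.mem_nhds (show x ∈ Metric.ball p δ from h3)] with y hy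
    exact hδ1 hy
  have hslab : ∀ x, slab L a t' t x ≠ 0 → |(x - p) 0| ≤ v * ‖spatial (x - p)‖ := fun x hx => by
    have h3 := of_slab_ne_zero hx
    refine hv _ ?_
    have e1 : (L *ᵥ (x - p)) 0 = (L *ᵥ x + a) 0 - t' := by
      rw [← ht', Matrix.mulVec_sub]; simp
    have e2 : (x - p) 0 = x 0 - t := by rw [Pi.sub_apply, ht]
    rw [e1, e2]; linarith
  -- `H r` cuts out a ball around the event; the thinner tube makes the product vanish near the whole
  -- world-line, and is invisible in the wedge, where `H r` vanishes unless the distance from the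
  -- world-line exceeds its radius
  set H : ℝ → Spacetime → ℝ := fun r x => hole (r⁻¹ • spatial (x - p)) with hH
  set χ : ℝ → Spacetime → ℝ := fun r x => ζ x * (H r x * hX.tube ((1 - v) * r / 4) x) with hχ
  have hnorm : ∀ {r : ℝ}, 0 < r → ∀ x : Spacetime, ‖r⁻¹ • spatial (x - p)‖ =
      r⁻¹ * ‖spatial (x - p)‖ := fun hr x => IsWorldline.norm_inv_smul hr _
  have hH0 : ∀ {r : ℝ}, 0 < r → ∀ x, ‖spatial (x - p)‖ ≤ r / 2 → H r x = 0 := fun hr x hx =>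
    hole_eq_zero (by rw [hnorm hr, inv_mul_le_iff₀ hr]; linarith)
  have hH1 : ∀ {r : ℝ}, 0 < r → ∀ x, r ≤ ‖spatial (x - p)‖ → H r x = 1 := fun hr x hx =>
    hole_eq_one (by rwa [hnorm hr, le_inv_mul_iff₀ hr, mul_one])
  have hHc : ∀ r, ContDiff ℝ 1 (H r) := fun r =>
    (contDiff_hole.of_le (by simp)).comp
      ((spatialL.contDiff.comp (contDiff_id.sub contDiff_const)).const_smul r⁻¹)
  have hgeo : ∀ {r : ℝ}, 0 < r → ∀ x, |(x - p) 0| ≤ v * ‖spatial (x - p)‖ →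
      r / 2 ≤ ‖spatial (x - p)‖ → (1 - v) * r / 4 < ‖hX.offset x‖ := fun hr x hx hx' => by
    have h3 := hX.le_norm_offset c (x - p)
    rw [← hp, add_sub_cancel] at h3
    nlinarith
  have hρ : ∀ {r : ℝ}, 0 < r → 0 < (1 - v) * r / 4 := fun hr => by
    have : 0 < 1 - v := by linarith
    positivity
  have hT1 : ∀ {r : ℝ}, 0 < r → ∀ x, |(x - p) 0| ≤ v * ‖spatial (x - p)‖ →
      r / 2 ≤ ‖spatial (x - p)‖ → ∀ᶠ y in 𝓝 x, hX.tube ((1 - v) * r / 4) y = 1 :=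
    fun hr x hx hx' => by
    filter_upwards [(isOpen_lt continuous_const hX.contDiff_offset.continuous.norm).mem_nhds
      (hgeo hr x hx hx')] with y hy
    exact hX.tube_eq_one (hρ hr) (le_of_lt hy)
  have hχc : ∀ r, ContDiff ℝ 1 (χ r) := fun r =>
    hζ.contDiff.mul ((hHc r).mul (hX.contDiff_tube _))
  have hχs : ∀ r, HasCompactSupport (χ r) := fun r => hζ.compact.mul_right
  have hχv : ∀ {r : ℝ}, 0 < r → tsupport (χ r) ⊆ S.vacuum := fun hr x hx k s hk => by
    by_cases hkn : k = n
    · subst hkn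
      have h3 := tsupport_mul_subset_right (tsupport_mul_subset_right hx)
      exact hX.notMem_tsupport_tube (hρ hr) s (hk ▸ h3)
    · exact hζ.avoids k hkn s (hk ▸ tsupport_mul_subset_left hx)
  -- on the planes the tube does not matter
  have hplane : ∀ {r : ℝ}, 0 < r → ∀ x, |(x - p) 0| ≤ v * ‖spatial (x - p)‖ →
      χ r x = ζ x * H r x := fun {r} hr x hx => by
    rw [hχ]
    rcases le_total ‖spatial (x - p)‖ (r / 2) with h | h
    · simp only [hH0 hr x h, mul_zero, zero_mul]
    · simp only [(hT1 hr x hx h).self_of_nhds, mul_one]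
  -- between the planes
  have hnear : ∀ {r : ℝ}, 0 < r → ∀ x, slab L a t' t x ≠ 0 → ‖spatial (x - p)‖ < δ →
      χ r =ᶠ[𝓝 x] H r := fun {r} hr x hx hxδ => by
    have h3 := hslab x hx
    rcases lt_or_ge ‖spatial (x - p)‖ (r / 2) with h | h
    · filter_upwards [(isOpen_lt hsp.norm continuous_const).mem_nhds h] with y hy
      simp only [hχ, hH0 hr y (le_of_lt hy), zero_mul, mul_zero]
    · filter_upwards [hcone x h3 hxδ, hT1 hr x h3 h] with y hy1 hy2
      simp only [hχ, hy1, hy2, mul_one, one_mul]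
  have hfar : ∀ {r : ℝ}, 0 < r → ∀ x, slab L a t' t x ≠ 0 → r < ‖spatial (x - p)‖ →
      χ r =ᶠ[𝓝 x] ζ ∧ H r =ᶠ[𝓝 x] fun _ => 1 := fun {r} hr x hx hxr => by
    have h3 := hslab x hx
    have h4 : H r =ᶠ[𝓝 x] fun _ => 1 := by
      filter_upwards [(isOpen_lt continuous_const hsp.norm).mem_nhds hxr] with y hy
      exact hH1 hr y (le_of_lt hy)
    refine ⟨?_, h4⟩
    filter_upwards [h4, hT1 hr x h3 (by linarith)] with y hy1 hy2
    simp only [hχ, hy1, hy2, mul_one]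
  have hbal := fun {r : ℝ} (hr : 0 < r) =>
    hmax.integral_slab_mul_exchange hreg hL a (hχc r) (hχs r) (hχv hr) t' t β
  have hIζ : Integrable fun x => slab L a t' t x * S.exchange β ζ x := by
    have h3 := (hbal (half_pos hδ)).1.indicator
      (isClosed_le continuous_const hsp.norm : IsClosed {x | δ ≤ ‖spatial (x - p)‖}).measurableSet
    refine h3.congr (ae_of_all _ fun x => ?_)
    by_cases hx : slab L a t' t x = 0
    · simp [hx, Set.indicator]
    by_cases hxδ : δ ≤ ‖spatial (x - p)‖
    · rw [Set.indicator_of_mem (by exact hxδ),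
        exchange_congr (hfar (half_pos hδ) x hx (by linarith)).1]
    · rw [Set.indicator_of_notMem (by exact hxδ)]
      change 0 = slab L a t' t x * S.exchange β ζ x
      rw [exchange_eq_zero (hcone x (hslab x hx) (not_le.1 hxδ)), mul_zero]
  have hpt : ∀ {r : ℝ}, 0 < r → r < δ → ∀ x, slab L a t' t x * S.exchange β (χ r) x =
      slab L a t' t x * S.exchange β ζ x + slab L a t' t x * S.exchange β (H r) x :=
    fun {r} hr hrδ x => by
    by_cases hx : slab L a t' t x = 0
    · simp [hx]
    by_cases hxδ : δ ≤ ‖spatial (x - p)‖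
    · obtain ⟨e1, e2⟩ := hfar hr x hx (hrδ.trans_le hxδ)
      rw [exchange_congr e1, exchange_eq_zero e2, mul_zero, add_zero]
    · rw [exchange_congr (hnear hr x hx (not_le.1 hxδ)),
        exchange_eq_zero (hcone x (hslab x hx) (not_le.1 hxδ)), mul_zero, zero_add]
  have hIH : ∀ r, 0 < r → r < δ → Integrable fun x => slab L a t' t x * S.exchange β (H r) x :=
    fun r hr hrδ => ((hbal hr).1.sub hIζ).congr (ae_of_all _ fun x => by
      simp only [Pi.sub_apply, hpt hr hrδ x, add_sub_cancel_left])
  refine ⟨hIζ, ?_⟩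
  obtain ⟨A, C, δ', hδ', hA⟩ := hreg.exists_integral_slab_hole hL a n c β
  rw [← hp, ht, ht'] at hA
  -- the two fluxes
  have hfl := hζ.hasRLim_hole hreg isLorentz_one hz h1 hb
  have hfl' := hζ.hasRLim_hole hreg hL hz' h1 hb'
  have hR := hfl'.add (hfl.const_mul (-1))
  have hconst := hasRLim_const (∫ x, slab L a t' t x * S.exchange β ζ x)
  have hR' := hconst.of_abs_sub_le (g := fun r => (∫ x, S.fluxDensity L a t' β x *
      ζ (frameEvent L a t' x) * hole (r⁻¹ • spatial (frameEvent L a t' x - p))) +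
      -1 * ∫ x, S.fluxDensity 1 0 t β x * ζ (frameEvent 1 0 t x) *
        hole (r⁻¹ • spatial (frameEvent 1 0 t x - p))) (a := A) (C := C) (lt_min hδ hδ')
    fun r hr hrδ => by
      have h3 := (hbal hr).2
      have h4 : ∫ x, slab L a t' t x * S.exchange β (χ r) x =
          (∫ x, slab L a t' t x * S.exchange β ζ x) +
            ∫ x, slab L a t' t x * S.exchange β (H r) x := by
        rw [← integral_add hIζ (hIH r hr (hrδ.trans_le (min_le_left _ _)))]
        exact integral_congr_ae (ae_of_all _ (hpt hr (hrδ.trans_le (min_le_left _ _))))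
      have h5 : ∀ x, χ r (frameEvent L a t' x) =
          ζ (frameEvent L a t' x) * H r (frameEvent L a t' x) := fun x => by
        refine hplane hr _ (hv _ ?_)
        have e1 := ((hL.frameEvent_eq_iff a (t := t') (z := x)).1 rfl).1
        have e2 : (L *ᵥ (frameEvent L a t' x - p)) 0 = 0 := by
          have : (L *ᵥ (frameEvent L a t' x - p)) 0 =
              (L *ᵥ frameEvent L a t' x + a) 0 - (L *ᵥ p + a) 0 := by
            rw [Matrix.mulVec_sub]; simp
          rw [this, e1, ht', sub_self]
        rw [e2, mul_zero]
      have h6 : ∀ x, χ r (frameEvent 1 0 t x) =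
          ζ (frameEvent 1 0 t x) * H r (frameEvent 1 0 t x) := fun x => by
        refine hplane hr _ ?_
        have e1 : (frameEvent 1 0 t x - p) 0 = 0 := by
          rw [frameEvent_one, Pi.sub_apply, event_zero, ht, sub_self]
        rw [e1, abs_zero]; positivity
      simp only [h5, h6] at h3
      simp only [← mul_assoc] at h3
      have h7 := hA r hr (hrδ.trans_le (min_le_right _ _))
      have h8 : ((∫ x, S.fluxDensity L a t' β x * ζ (frameEvent L a t' x) *
          hole (r⁻¹ • spatial (frameEvent L a t' x - p))) +
          -1 * ∫ x, S.fluxDensity 1 0 t β x * ζ (frameEvent 1 0 t x) *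
            hole (r⁻¹ • spatial (frameEvent 1 0 t x - p))) -
          (∫ x, slab L a t' t x * S.exchange β ζ x) =
          ∫ x, slab L a t' t x * S.exchange β (H r) x := by
        have h9 := h3.symm.trans h4
        linarith
      rw [h8]
      exact h7
  have := hR.unique hR'
  linarith

end System

/-! ### Integrals of homogeneous functions -/

/-- The integral of a function which is homogeneous of degree `-3`, cut off by a function `G` of a
gauge `k`, does not depend on the gauge. -/
lemma integral_homogeneous_mul {f k : Space → ℝ} {G : ℝ → ℝ}
    (hf : ∀ r : ℝ, 0 < r → ∀ y, f (r • y) = (r ^ 3)⁻¹ * f y)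
    (hk : ∀ r : ℝ, 0 < r → ∀ y, k (r • y) = r * k y) (hk0 : ∀ y, y ≠ 0 → 0 < k y)
    (hI : Integrable fun y => f y * G (k y)) :
    ∫ y, f y * G (k y) = (∫ e : Metric.sphere (0 : Space) 1, f e ∂(volume : Measure Space).toSphere)
      * ∫ ρ in Set.Ioi (0 : ℝ), G ρ / ρ := by
  set g : Space → ℝ := fun y => f y * G (k y) with hg
  have hmp := (volume : Measure Space).measurePreserving_homeomorphUnitSphereProd
  have hme := (homeomorphUnitSphereProd Space).measurableEmbedding
  set g' : Metric.sphere (0 : Space) 1 × Set.Ioi (0 : ℝ) → ℝ :=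
    fun p => g ((p.2 : ℝ) • (p.1 : Space))
    with hg'
  have hgg : ∀ x : ({0}ᶜ : Set Space), g' (homeomorphUnitSphereProd Space x) = g x := fun x => by
    have hx : ‖(x : Space)‖ ≠ 0 := norm_ne_zero_iff.2 x.2
    simp [hg', smul_smul, hx]
  have hdim : Module.finrank ℝ Space = 3 := by simp
  have h0 : (volume : Measure Space).restrict {0}ᶜ = volume := restrict_compl_singleton 0
  have h1 : ∫ y, g y = ∫ p, g' p ∂(volume : Measure Space).toSphere.prod (.volumeIoiPow 2) := by
    rw [hdim] at hmp
    rw [← hmp.integral_comp hme]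
    simp only [hgg]
    rw [integral_subtype_comap (measurableSet_singleton _).compl g, h0]
  have hI' : Integrable g' ((volume : Measure Space).toSphere.prod (.volumeIoiPow 2)) := by
    rw [hdim] at hmp
    rw [← hmp.integrable_comp_emb hme]
    have h2 : g' ∘ homeomorphUnitSphereProd Space = g ∘ Subtype.val := funext hgg
    rw [h2, ← integrableOn_iff_comap_subtypeVal (measurableSet_singleton _).compl, IntegrableOn, h0]
    exact hI
  rw [h1, integral_prod _ hI', ← integral_mul_const]
  refine integral_congr_ae (ae_of_all _ fun e => ?_)
  have he : 0 < k e := hk0 _ fun h => by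
    have := e.2
    rw [h] at this
    simp at this
  have h2 : ∫ ρ : Set.Ioi (0 : ℝ), g' (e, ρ) ∂.volumeIoiPow 2 =
      ∫ ρ in Set.Ioi (0 : ℝ), ρ ^ 2 * g (ρ • (e : Space)) := by
    simp only [Measure.volumeIoiPow, ENNReal.ofReal]
    rw [integral_withDensity_eq_integral_smul (measurable_subtype_coe.pow_const _).real_toNNReal,
      integral_subtype_comap measurableSet_Ioi
        fun a : ℝ => Real.toNNReal (a ^ 2) • g (a • (e : Space)),
      setIntegral_congr_fun measurableSet_Ioi fun x hx => ?_]
    rw [NNReal.smul_def, Real.coe_toNNReal _ (by positivity), smul_eq_mul]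
  have h3 : ∀ ρ ∈ Set.Ioi (0 : ℝ), ρ ^ 2 * g (ρ • (e : Space)) =
      f e * k e * (fun ρ => G ρ / ρ) (k e * ρ) := fun ρ hρ => by
    have hρ : 0 < ρ := hρ
    simp only [hg, hf ρ hρ, hk ρ hρ]
    rw [mul_comm ρ (k e)]
    field_simp
  beta_reduce
  rw [h2, setIntegral_congr_fun measurableSet_Ioi h3, integral_const_mul,
    integral_comp_mul_left_Ioi (fun ρ => G ρ / ρ) 0 he, mul_zero, smul_eq_mul]
  field_simp

/-- The radial derivative `y · ∇ hole`, as a function of the radius. -/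
def holeRate (ρ : ℝ) : ℝ := 4 * deriv Real.smoothTransition (2 * ρ ^ 2 - 1) * ρ ^ 2

lemma fderiv_hole_self (y : Space) : fderiv ℝ hole y y = holeRate ‖y‖ := by
  rw [fderiv_hole, real_inner_self_eq_norm_sq, holeRate]

lemma continuous_holeRate : Continuous holeRate := by
  have h1 : Continuous (deriv Real.smoothTransition) :=
    (Real.smoothTransition.contDiff (n := 1)).continuous_deriv le_rfl
  unfold holeRate; fun_prop

lemma holeRate_eq_zero {ρ : ℝ} (h0 : 0 ≤ ρ) (hρ : ρ < 1 / 2 ∨ 1 < ρ) : holeRate ρ = 0 := by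
  obtain ⟨y, hy⟩ : ∃ y : Space, ‖y‖ = ρ := by
    obtain ⟨y, hy⟩ := exists_norm_eq Space h0
    exact ⟨y, hy⟩
  rw [← hy] at hρ ⊢
  rw [← fderiv_hole_self, fderiv_hole_eq_zero hρ, zero_apply]

lemma exists_holeRate_le : ∃ M > 0, ∀ ρ, 0 ≤ ρ → |holeRate ρ| ≤ M := by
  obtain ⟨M, hM, h⟩ := exists_fderiv_hole_le
  refine ⟨M, hM, fun ρ hρ => ?_⟩
  rcases lt_or_ge 1 ρ with h1 | h1
  · rw [holeRate_eq_zero hρ (Or.inr h1), abs_zero]; exact hM.le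
  · obtain ⟨y, hy⟩ := exists_norm_eq Space hρ
    rw [← hy, ← fderiv_hole_self]
    refine (h y y).trans ?_
    rw [hy]; nlinarith

lemma integral_holeRate : ∫ ρ in Set.Ioi (0 : ℝ), holeRate ρ / ρ = 1 := by
  have h1 : ∀ x ∈ Set.Ici (0 : ℝ), HasDerivAt (fun ρ => Real.smoothTransition (2 * ρ ^ 2 - 1))
      (4 * deriv Real.smoothTransition (2 * x ^ 2 - 1) * x) x := fun x _ => by
    have h2 : HasDerivAt (fun ρ : ℝ => 2 * ρ ^ 2 - 1) (2 * (2 * x)) x := by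
      simpa using ((hasDerivAt_pow 2 x).const_mul 2).sub_const 1
    have h3 : HasDerivAt Real.smoothTransition (deriv Real.smoothTransition (2 * x ^ 2 - 1))
        (2 * x ^ 2 - 1) :=
      ((Real.smoothTransition.contDiff (n := 1)).differentiable one_ne_zero _).hasDerivAt
    have h5 : HasDerivAt (fun ρ => Real.smoothTransition (2 * ρ ^ 2 - 1)) _ x :=
      HasDerivAt.comp (h₂ := Real.smoothTransition) x h3 h2
    exact h5.congr_deriv (by ring)
  have h2 : Tendsto (fun ρ : ℝ => Real.smoothTransition (2 * ρ ^ 2 - 1)) atTop (𝓝 1) := by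
    refine tendsto_const_nhds.congr' ?_
    filter_upwards [eventually_ge_atTop 1] with ρ hρ
    rw [Real.smoothTransition.one_of_one_le (by nlinarith)]
  have h4 : ∀ x ∈ Set.Ioi (0 : ℝ), holeRate x / x =
      4 * deriv Real.smoothTransition (2 * x ^ 2 - 1) * x := fun x hx => by
    have : x ≠ 0 := ne_of_gt hx
    rw [holeRate]; field_simp
  have hc : Continuous fun x : ℝ => 4 * deriv Real.smoothTransition (2 * x ^ 2 - 1) * x := by
    have h1 : Continuous (deriv Real.smoothTransition) :=
      (Real.smoothTransition.contDiff (n := 1)).continuous_deriv le_rfl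
    fun_prop
  have h5 : IntegrableOn (fun x : ℝ => 4 * deriv Real.smoothTransition (2 * x ^ 2 - 1) * x)
      (Set.Ioi 0) := by
    refine (hc.continuousOn.integrableOn_Icc (a := 0) (b := 1)).of_forall_sdiff_eq_zero
      measurableSet_Ioi fun x hx => ?_
    rw [← h4 x hx.1, holeRate_eq_zero (le_of_lt hx.1), zero_div]
    right
    by_contra! h
    exact hx.2 ⟨le_of_lt hx.1, h⟩
  rw [setIntegral_congr_fun measurableSet_Ioi h4,
    integral_Ioi_of_hasDerivAt_of_tendsto' h1 h5 h2,
    Real.smoothTransition.zero_of_nonpos (by norm_num), sub_zero]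

/-- A function of the position which is even under the reflections that fix `v` has no
moment transverse to `v`. -/
lemma integral_mul_eq_zero_of_reflection (v : Space) {k ℓ : Space → ℝ}
    (hk : ∀ y, k ((ℝ ∙ v).reflection y) = k y)
    (hℓ : ∀ y, ℓ ((ℝ ∙ v).reflection y) = -ℓ y) : ∫ y, k y * ℓ y = 0 := by
  have h1 := ((ℝ ∙ v).reflection).measurePreserving.integral_comp
    ((ℝ ∙ v).reflection).toMeasurableEquiv.measurableEmbedding (fun y => k y * ℓ y)
  simp only [hk, hℓ, mul_neg] at h1
  rw [integral_neg] at h1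
  linarith

/-! ### Gauss's law for the near field of a moving charge -/

/-- The linear map of the rest space of the four-velocity direction `u` which makes the near field
spherically symmetric. -/
def restMap (u : Spacetime) : Space →ₗ[ℝ] Space :=
  Matrix.toEuclideanLin (√(-mdot u u) • (1 : Matrix (Fin 3) (Fin 3) ℝ) +
    (u 0 + √(-mdot u u))⁻¹ • Matrix.vecMulVec (fun i => u i.succ) (fun i => u i.succ))

lemma restMap_apply (u : Spacetime) (y : Space) : restMap u y =
    √(-mdot u u) • y + ((u 0 + √(-mdot u u))⁻¹ * inner ℝ (spatial u) y) • spatial u := by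
  ext i
  simp [restMap, Matrix.toEuclideanLin,
    Matrix.vecMulVec_mulVec, spatial, PiLp.inner_apply, dotProduct, Fin.sum_univ_three]
  ring

lemma det_restMap {u : Spacetime} (hu : mdot u u < 0) (hu0 : 0 < u 0) :
    LinearMap.det (restMap u) = u 0 * -mdot u u := by
  have hm : 0 < -mdot u u := by linarith
  have h1 := Real.sq_sqrt hm.le
  have h2 := Real.sqrt_pos.2 hm
  rw [restMap, show Matrix.toEuclideanLin (𝕜 := ℝ) (m := Fin 3) (n := Fin 3) = _ from
    Matrix.toLpLin_eq_toLin 2 2, LinearMap.det_toLin, Matrix.det_fin_three]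
  have h3 : u 1 ^ 2 + u 2 ^ 2 + u 3 ^ 2 = u 0 ^ 2 - √(-mdot u u) ^ 2 := by
    rw [h1]
    simp [mdot, metric, Matrix.mulVec_diagonal, dotProduct, Fin.sum_univ_four]; ring
  have h4 : (u 0 + √(-mdot u u))⁻¹ * (u 0 + √(-mdot u u)) = 1 :=
    inv_mul_cancel₀ (by positivity)
  conv_rhs => rw [← h1]
  generalize (u 0 + √(-mdot u u))⁻¹ = k at h4 ⊢
  generalize √(-mdot u u) = m at h3 h4 ⊢
  simp [Matrix.vecMulVec_apply]
  linear_combination m ^ 2 * k * h3 + m ^ 2 * (u 0 - m) * h4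

lemma dist_event_sq (u : Spacetime) (y : Space) :
    mdot (event 0 y) u ^ 2 - mdot u u * mdot (event 0 y) (event 0 y) =
      inner ℝ (spatial u) y ^ 2 + -mdot u u * ‖y‖ ^ 2 := by
  rw [mdot_eq_inner (event 0 y) u, mdot_eq_inner (event 0 y) (event 0 y), spatial_event, event_zero,
    real_inner_self_eq_norm_sq, real_inner_comm]
  ring

lemma norm_restMap {u : Spacetime} (hu : mdot u u < 0) (hu0 : 0 < u 0) (y : Space) :
    ‖restMap u y‖ = NearField.dist u (event 0 y) := by
  have hm : 0 < -mdot u u := by linarith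
  have h1 := Real.sq_sqrt hm.le
  have h2 := Real.sqrt_pos.2 hm
  have h3 := mdot_eq_inner u u
  rw [real_inner_self_eq_norm_sq] at h3
  rw [NearField.dist, dist_event_sq, ← Real.sqrt_sq (norm_nonneg (restMap u y))]
  congr 1
  rw [restMap_apply, norm_add_sq_real, norm_smul, norm_smul, inner_smul_left, inner_smul_right,
    real_inner_comm, mul_pow, mul_pow, Real.norm_eq_abs, Real.norm_eq_abs, sq_abs, sq_abs]
  simp only [conj_trivial]
  set m := √(-mdot u u)
  generalize inner ℝ (spatial u) y = b
  rw [← h1]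
  have h4 : ‖spatial u‖ ^ 2 = u 0 ^ 2 - m ^ 2 := by linarith
  rw [h4]
  field_simp
  ring

/-- The amplitude of the near field in a simultaneity plane. -/
def amplitude (u : Spacetime) (y : Space) : ℝ := -mdot u u / NearField.dist u (event 0 y) ^ 3

lemma continuous_dist_event (u : Spacetime) :
    Continuous fun y : Space => NearField.dist u (event 0 y) := by
  have h : (fun y : Space => NearField.dist u (event 0 y)) =
      fun y => √(inner ℝ (spatial u) y ^ 2 + -mdot u u * ‖y‖ ^ 2) :=
    funext fun y => by rw [NearField.dist, dist_event_sq]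
  rw [h]; fun_prop

lemma measurable_amplitude (u : Spacetime) : Measurable (amplitude u) :=
  measurable_const.div ((continuous_dist_event u).measurable.pow_const 3)

lemma le_dist_event {u : Spacetime} (hu : mdot u u < 0) (y : Space) :
    √(-mdot u u) * ‖y‖ ≤ NearField.dist u (event 0 y) := by
  have h2 : √(-mdot u u) * ‖y‖ = √(-mdot u u * ‖y‖ ^ 2) := by
    rw [Real.sqrt_mul (by linarith), Real.sqrt_sq (norm_nonneg y)]
  rw [NearField.dist, dist_event_sq, h2]
  exact Real.sqrt_le_sqrt (by nlinarith [sq_nonneg (inner ℝ (spatial u) y)])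

lemma dist_event_smul (u : Spacetime) (y : Space) {r : ℝ} (hr : 0 < r) :
    NearField.dist u (event 0 (r • y)) = r * NearField.dist u (event 0 y) := by
  have := event_smul r 0 y
  rw [mul_zero] at this
  rw [this, NearField.dist_smul hr]

lemma amplitude_smul (u : Spacetime) (y : Space) {r : ℝ} (hr : 0 < r) :
    amplitude u (r • y) = (r ^ 3)⁻¹ * amplitude u y := by
  rw [amplitude, amplitude, dist_event_smul u y hr, mul_pow, div_eq_mul_inv, mul_inv]; ring

/-- The flux of the near field is the same as that of a charge at rest. -/
theorem integral_amplitude_mul_holeRate {u : Spacetime} (hu : mdot u u < 0) (hu0 : 0 < u 0) :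
    ∫ y : Space, amplitude u y * holeRate ‖y‖ = 4 * Real.pi / u 0 := by
  have hm : 0 < -mdot u u := by linarith
  have hs := Real.sqrt_pos.2 hm
  set m := √(-mdot u u) with hmd
  obtain ⟨M, hM, hMb⟩ := exists_holeRate_le
  -- integrability for either gauge
  have hint : ∀ k : Space → ℝ, Continuous k → (∀ y, 0 ≤ k y) → ∀ b B : ℝ, 0 < b →
      (∀ y, b * ‖y‖ ≤ k y) → (∀ y, 1 / 2 ≤ k y → |amplitude u y| ≤ B) →
      Integrable fun y => amplitude u y * holeRate (k y) := fun k hk hk0 b B hb hbk hB => by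
    have hK : IsClosed {y | 1 / 2 ≤ k y ∧ k y ≤ 1} :=
      (isClosed_le continuous_const hk).inter (isClosed_le hk continuous_const)
    have hKf : volume {y | 1 / 2 ≤ k y ∧ k y ≤ 1} < ⊤ := by
      refine (measure_mono (t := Metric.closedBall 0 b⁻¹) fun y hy => ?_).trans_lt
        measure_closedBall_lt_top
      rw [mem_closedBall_zero_iff, ← one_div, le_div_iff₀ hb, mul_comm]
      exact (hbk y).trans hy.2
    refine integrable_mul_of_bounded (B := B) (M := M) hKf hK.measurableSet
      (measurable_amplitude u).aestronglyMeasurable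
      (continuous_holeRate.comp hk).aestronglyMeasurable (fun y hy => ?_)
      (fun y => hMb _ (hk0 y)) fun y hy => hB y hy.1
    refine holeRate_eq_zero (hk0 y) ?_
    by_contra! h
    exact hy h
  have hamp : ∀ y : Space, ∀ d, 0 < d → d ≤ NearField.dist u (event 0 y) →
      |amplitude u y| ≤ -mdot u u / d ^ 3 := fun y d hd h => by
    have hd' := hd.trans_le h
    rw [amplitude, abs_of_nonneg (by positivity)]
    gcongr
  have hI1 := hint (fun y => ‖y‖) continuous_norm (fun y => norm_nonneg y) 1
    (-mdot u u / (m / 2) ^ 3) one_pos (fun y => (one_mul _).le) fun y hy =>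
      hamp y _ (by positivity) ((by nlinarith : m / 2 ≤ m * ‖y‖).trans (le_dist_event hu y))
  have hI2 := hint (fun y => NearField.dist u (event 0 y)) (continuous_dist_event u)
    (fun y => Real.sqrt_nonneg _) m (-mdot u u / (1 / 2) ^ 3) hs (le_dist_event hu)
    fun y hy => hamp y _ (by norm_num) hy
  -- by homogeneity, the norm may be replaced by the gauge `dist u`, which becomes the norm in the
  -- coordinates `restMap u y`
  have e1 := integral_homogeneous_mul (fun r hr y => amplitude_smul u y hr)
    (fun r hr y => by rw [norm_smul, Real.norm_eq_abs, abs_of_pos hr])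
    (fun y hy => norm_pos_iff.2 hy) hI1
  have e2 := integral_homogeneous_mul (fun r hr y => amplitude_smul u y hr)
    (fun r hr y => dist_event_smul u y hr)
    (fun y hy => lt_of_lt_of_le (mul_pos hs (norm_pos_iff.2 hy)) (le_dist_event hu y)) hI2
  -- the spherically symmetric integral
  set H : Space → ℝ := fun w => (‖w‖ ^ 3)⁻¹ * holeRate ‖w‖ with hH
  have hHm : Measurable H :=
    (measurable_norm.pow_const 3).inv.mul (continuous_holeRate.comp continuous_norm).measurable
  have e3 : ∀ y, amplitude u y * holeRate (NearField.dist u (event 0 y)) =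
      -mdot u u * H (restMap u y) := fun y => by
    rw [hH]; simp only
    rw [norm_restMap hu hu0, amplitude]; ring
  have hdet := det_restMap hu hu0
  have hdet0 : LinearMap.det (restMap u) ≠ 0 := by rw [hdet]; positivity
  have e4 : ∫ y, H (restMap u y) = (u 0 * -mdot u u)⁻¹ * ∫ w, H w := by
    have h1 := Measure.map_linearMap_addHaar_eq_smul_addHaar (volume : Measure Space) hdet0
    have h2 := integral_map (μ := (volume : Measure Space)) (φ := restMap u)
      (LinearMap.continuous_of_finiteDimensional _).aemeasurable hHm.aestronglyMeasurable
    rw [← h2, h1, integral_smul_measure, hdet, abs_of_pos (by positivity),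
      ENNReal.toReal_ofReal (by positivity), smul_eq_mul]
  have e5 : ∫ w, H w = 4 * Real.pi := by
    rw [hH]
    rw [integral_fun_norm_addHaar (volume : Measure Space) fun ρ => (ρ ^ 3)⁻¹ * holeRate ρ,
      setIntegral_congr_fun (g := fun ρ => holeRate ρ / ρ) measurableSet_Ioi fun ρ hρ => ?_,
      integral_holeRate]
    · rw [Measure.real, EuclideanSpace.volume_ball_fin_three]
      simp
      rw [ENNReal.toReal_ofReal (by positivity)]
      ring
    · have : ρ ≠ 0 := ne_of_gt hρ
      simp
      field_simp
  rw [e1, ← e2]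
  simp only [e3]
  rw [integral_const_mul, e4, e5]
  have := hm.ne'
  generalize -mdot u u = k at *
  field_simp

/-! ### The flux of the mixed energy-momentum through a small tube -/

/-- The part transverse to the motion of the flux of the mixed energy-momentum of a near field and a
regular field `C`. -/
def transverseFlux (u : Spacetime) (C : Matrix (Fin 4) (Fin 4) ℝ) (β : Fin 4) (y : Space) : ℝ :=
  u β * ((metric *ᵥ Pi.single 0 1) ⬝ᵥ (C *ᵥ (metric *ᵥ event 0 y)))
    - event 0 y β * ((metric *ᵥ Pi.single 0 1) ⬝ᵥ (C *ᵥ (metric *ᵥ u)))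
    - (Pi.single 0 1 : Spacetime) β * ((metric *ᵥ u) ⬝ᵥ (C *ᵥ (metric *ᵥ event 0 y)))

lemma transverseFlux_add (u : Spacetime) (C : Matrix (Fin 4) (Fin 4) ℝ) (β : Fin 4) (y y' : Space) :
    transverseFlux u C β (y + y') = transverseFlux u C β y + transverseFlux u C β y' := by
  have h : event 0 (y + y') = event 0 y + event 0 y' := by simpa using event_add 0 0 y y'
  simp only [transverseFlux, h, Matrix.mulVec_add, dotProduct_add, Pi.add_apply]
  ring

lemma transverseFlux_smul_spatial {u : Spacetime} {C : Matrix (Fin 4) (Fin 4) ℝ}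
    (hC : ∀ μ ν, C μ ν = -C ν μ) (β : Fin 4) (k : ℝ) :
    transverseFlux u C β (k • spatial u) = 0 := by
  have h : event 0 (k • spatial u) = k • (u - u 0 • Pi.single 0 1) := by
    ext i
    refine Fin.cases ?_ (fun i => ?_) i
    · simp [event]
    · simp [event, spatial]
  have hd : ∀ i, C i i = 0 := fun i => by linarith [hC i i]
  rw [transverseFlux, h]
  simp only [metric, dotProduct, Fin.sum_univ_four, Matrix.mulVec,
    Pi.smul_apply, Pi.sub_apply, smul_eq_mul, Matrix.diagonal_apply, hd, hC 1 0, hC 2 0, hC 3 0,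
    hC 2 1, hC 3 1, hC 3 2]
  fin_cases β <;> simp <;> ring

lemma sum_stress_wedge {C : Matrix (Fin 4) (Fin 4) ℝ} (hC : ∀ μ ν, C μ ν = -C ν μ)
    {u : Spacetime} {v : Space} (hv : spatial u = u 0 • v) (y : Space) (β : Fin 4) :
    ∑ ν, (stress (Matrix.of (wedge u (event 0 y))) C ν β +
        stress C (Matrix.of (wedge u (event 0 y))) ν β) *
      inner ℝ y (spatial (Pi.single ν 1) - (Pi.single ν 1 : Spacetime) 0 • v) =
    -‖y‖ ^ 2 * (C *ᵥ (metric *ᵥ u)) β + inner ℝ y v * transverseFlux u C β y := by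
  have hd : ∀ i, C i i = 0 := fun i => by linarith [hC i i]
  have h1 : u 1 = u 0 * v 0 := by simpa [spatial] using congrArg (fun w : Space => w 0) hv
  have h2 : u 2 = u 0 * v 1 := by simpa [spatial] using congrArg (fun w : Space => w 1) hv
  have h3 : u 3 = u 0 * v 2 := by simpa [spatial] using congrArg (fun w : Space => w 2) hv
  have e1 : event 0 y 1 = y 0 := rfl
  have e2 : event 0 y 2 = y 1 := rfl
  have e3 : event 0 y 3 = y 2 := rfl
  rw [← real_inner_self_eq_norm_sq]
  simp only [stress, transverseFlux, mul_metric_apply]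
  fin_cases β <;> simp only [Fin.zero_eta, Fin.mk_one, Fin.reduceFinMk, wedge, Matrix.of_apply,
    metric, dotProduct, Fin.sum_univ_four, Matrix.mulVec, Matrix.diagonal_apply, PiLp.inner_apply,
    Fin.sum_univ_three] <;>
  simp [spatial, Pi.single_apply, event_zero, e1, e2, e3, h1, h2, h3, wedge, hd, hC 1 0, hC 2 0,
    hC 3 0, hC 2 1, hC 3 1, hC 3 2] <;> ring

/-! ### The renormalized field -/

lemma measurePreserving_neg_toSphere : MeasurePreserving
    (fun e : Metric.sphere (0 : Space) 1 => -e) (volume : Measure Space).toSphere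
    (volume : Measure Space).toSphere := by
  have hc : Continuous fun e : Metric.sphere (0 : Space) 1 => -e := continuous_neg
  refine ⟨hc.measurable, Measure.ext fun s hs => ?_⟩
  rw [Measure.map_apply hc.measurable hs, Measure.toSphere_apply' _ hs,
    Measure.toSphere_apply' _ (hc.measurable hs)]
  congr 1
  rw [← Measure.measure_neg volume]
  congr 1
  ext x
  simp only [Set.mem_neg, Set.mem_smul, Set.mem_image, Set.mem_preimage]
  constructor
  · rintro ⟨r, hr, _, ⟨e, he, rfl⟩, h⟩
    exact ⟨r, hr, _, ⟨-e, he, rfl⟩, by rw [coe_neg_sphere, smul_neg, h, neg_neg]⟩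
  · rintro ⟨r, hr, _, ⟨e, he, rfl⟩, h⟩
    exact ⟨r, hr, _, ⟨-e, by simpa using he, rfl⟩, by rw [coe_neg_sphere, smul_neg, h]⟩

lemma event_zero_smul (r : ℝ) (y : Space) : event 0 (r • y) = r • event 0 y := by
  simpa using event_smul r 0 y

lemma event_zero_neg (y : Space) : event 0 (-y) = -event 0 y := by
  simpa using event_smul (-1) 0 y

lemma continuous_event_zero : Continuous fun y : Space => event 0 y :=
  continuous_event.comp (continuous_const.prodMk continuous_id)

namespace System

variable {N : ℕ} {S : System N}

lemma IsRegular.eventually_ne (hreg : S.IsRegular) (n : Fin N) (c : ℝ) :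
    ∀ᶠ x in 𝓝 (S.worldline n c), ∀ k, k ≠ n → ∀ s, x ≠ S.worldline k s := by
  refine eventually_all.2 fun k => ?_
  by_cases hk : k = n
  · exact Eventually.of_forall fun x h => absurd hk h
  · have h2 : S.worldline n c ∉ Set.range (S.worldline k) := by
      rintro ⟨s, hs⟩
      exact hreg.noCollision k n hk s c hs
    filter_upwards [(hreg.worldlines k).isClosed_range.isOpen_compl.mem_nhds h2] with x hx _ s h
    exact hx ⟨s, h.symm⟩

lemma IsRegular.add_event_ne (hreg : S.IsRegular) (n : Fin N) (c s : ℝ) {y : Space} (hy : y ≠ 0) :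
    S.worldline n c + event 0 y ≠ S.worldline n s := by
  refine (hreg.worldlines n).ne_of_spacelike ?_ ?_ s
  · rw [event_zero, abs_zero]; exact norm_nonneg _
  · rw [spatial_event]; exact norm_pos_iff.2 hy

lemma event_time_add (X : ℝ → Spacetime) (c : ℝ) (y : Space) :
    event (X c 0) (spatial (X c) + y) = X c + event 0 y := by
  have := event_add (X c 0) 0 (spatial (X c)) y
  rw [add_zero] at this
  rw [this, event_spatial]

/-- The regular part of the field on the world-line is the renormalized field. -/
lemma IsRegular.hasRenormalizedField (hreg : S.IsRegular) {n : Fin N} {c : ℝ}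
    {F : Matrix (Fin 4) (Fin 4) ℝ} {C δ : ℝ} (hδ : 0 < δ)
    (h : ∀ y : Space, 0 < ‖y‖ → ‖y‖ < δ → ∀ μ ν,
      |S.field (S.worldline n c + event 0 y) μ ν + S.field (S.worldline n c - event 0 y) μ ν
        - 2 * (S.near₁ n c (event 0 y) μ ν + F μ ν)| ≤ C * ‖y‖)
    (h' : ∀ y : Space, 0 < ‖y‖ → ‖y‖ < δ → ∀ μ ν,
      |S.near₁ n c (event 0 y) μ ν| ≤ C * ‖y‖ ^ (-1 : ℤ)) : S.HasRenormalizedField n c F := by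
  intro μ ν
  set σ := (volume : Measure Space).toSphere with hσ
  have : NeZero σ := ⟨Measure.toSphere_ne_zero _⟩
  set P := (σ Set.univ)⁻¹ • σ with hP
  have : IsProbabilityMeasure P := inferInstance
  have hneg : ∀ f : Metric.sphere (0 : Space) 1 → ℝ, ∫ e, f (-e) ∂P = ∫ e, f e ∂P := fun f => by
    have h1 : MeasurePreserving (fun e : Metric.sphere (0 : Space) 1 => -e) P P :=
      measurePreserving_neg_toSphere.smul_measure _
    exact h1.integral_comp (Homeomorph.neg _).measurableEmbedding f
  obtain ⟨δ₁, hδ₁, hb⟩ := Metric.eventually_nhds_iff.1 (hreg.eventually_ne n c)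
  have hne : ∀ e : Metric.sphere (0 : Space) 1, ‖(e : Space)‖ = 1 := fun e => by simp
  have hev := continuous_event_zero
  -- the part of order `-1`
  set g : Metric.sphere (0 : Space) 1 → ℝ := fun e => S.near₁ n c (event 0 e) μ ν with hg
  have hgs : ∀ {r : ℝ}, 0 < r → ∀ e : Metric.sphere (0 : Space) 1,
      S.near₁ n c (event 0 (r • (e : Space))) μ ν = r⁻¹ * g e := fun {r} hr e => by
    rw [event_zero_smul, near₁_smul hreg n c
      (by rw [event_zero, spatial_event, hne, abs_zero]; exact one_pos) hr]
    rfl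
  have hI1 : Integrable g P := by
    have hδ2 : 0 < δ / 2 := by positivity
    refine Integrable.of_bound (C := (δ / 2) * (C * (δ / 2) ^ (-1 : ℤ)))
      ((S.measurable_near₁ n c μ ν).comp
        (hev.measurable.comp measurable_subtype_coe)).aestronglyMeasurable
      (ae_of_all _ fun e => ?_)
    have h1 := h' ((δ / 2) • (e : Space))
      (by rw [norm_smul, hne, Real.norm_of_nonneg hδ2.le]; simpa)
      (by rw [norm_smul, hne, Real.norm_of_nonneg hδ2.le]; linarith) μ ν
    rw [hgs hδ2, norm_smul, hne, Real.norm_of_nonneg hδ2.le, mul_one,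
      abs_mul, abs_of_pos (by positivity), inv_mul_le_iff₀ hδ2] at h1
    exact h1
  refine ⟨∫ e, g e ∂P, IsBigO.of_bound C ?_⟩
  filter_upwards [eventually_pos_lt (lt_min hδ hδ₁)] with r hr
  have hr0 := hr.1
  have hrδ := hr.2.trans_le (min_le_left _ _)
  have hrδ1 := hr.2.trans_le (min_le_right _ _)
  have hnr : ∀ e : Metric.sphere (0 : Space) 1, ‖r • (e : Space)‖ = r := fun e => by
    rw [norm_smul, hne, Real.norm_of_nonneg hr0.le, mul_one]
  set f : Metric.sphere (0 : Space) 1 → ℝ := fun e =>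
    S.field (S.worldline n c + event 0 (r • (e : Space))) μ ν with hf
  have hfc : Continuous f := by
    refine continuous_iff_continuousAt.2 fun e => ?_
    have hv : S.worldline n c + event 0 (r • (e : Space)) ∈ S.vacuum := fun k s => by
      by_cases hk : k = n
      · subst hk
        exact hreg.add_event_ne k c s (norm_pos_iff.1 ((hnr e).symm ▸ hr0))
      · refine hb ?_ k hk s
        rw [dist_eq_norm, add_sub_cancel_left]
        refine (norm_le_of_spatial _).trans_lt ?_
        rw [event_zero, spatial_event, hnr, abs_zero]
        exact max_lt hδ₁ hrδ1
    have h1 : Continuous fun e : Metric.sphere (0 : Space) 1 =>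
        S.worldline n c + event 0 (r • (e : Space)) :=
      continuous_const.add (hev.comp (continuous_subtype_val.const_smul r))
    exact ContinuousAt.comp (f := fun e : Metric.sphere (0 : Space) 1 =>
      S.worldline n c + event 0 (r • (e : Space))) ((hreg.contDiffOn μ ν).continuousOn.continuousAt
      (hreg.isOpen_vacuum.mem_nhds hv)) h1.continuousAt
  have hfI : Integrable f P := by
    obtain ⟨B, hB⟩ := (isCompact_univ.image hfc).isBounded.exists_norm_le
    exact Integrable.of_bound hfc.aestronglyMeasurable B
      (ae_of_all _ fun e => hB _ ⟨e, trivial, rfl⟩)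
  have hmean : sphereMean (fun x => S.field (event (S.worldline n c 0) x) μ ν)
      (spatial (S.worldline n c)) r = ∫ e, f e ∂P := by
    rw [sphereMean, average]
    simp only [event_time_add, hf]
    rfl
  have hpt : ∀ e, ‖f e + f (-e) - 2 * (r⁻¹ * g e + F μ ν)‖ ≤ C * r := fun e => by
    have h1 := h (r • (e : Space)) (by rw [hnr]; exact hr0) (by rw [hnr]; exact hrδ) μ ν
    rw [hgs hr0, hnr, sub_eq_add_neg (S.worldline n c), ← event_zero_neg, ← smul_neg,
      ← coe_neg_sphere] at h1
    exact h1
  rw [hmean]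
  have hfn : Integrable (fun e => f (-e)) P :=
    (hfc.comp (continuous_neg (G := Metric.sphere (0 : Space) 1))).integrable_of_hasCompactSupport
      (HasCompactSupport.of_compactSpace _)
  have i1 : Integrable (fun e => 2 * (r⁻¹ * g e + F μ ν)) P :=
    ((hI1.const_mul r⁻¹).add (integrable_const (μ := P) (F μ ν))).const_mul 2
  have i2 : Integrable (fun e => f e + f (-e)) P := hfI.add hfn
  have hid : 2 * ((∫ e, f e ∂P) - ((∫ e, g e ∂P) / r + F μ ν)) =
      ∫ e, (f e + f (-e) - 2 * (r⁻¹ * g e + F μ ν)) ∂P := by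
    have e1 : ∫ e, (f e + f (-e)) ∂P = 2 * ∫ e, f e ∂P := by
      rw [integral_add hfI hfn, hneg f]; ring
    have e2 : ∫ e, (r⁻¹ * g e + F μ ν) ∂P = (∫ e, g e ∂P) / r + F μ ν := by
      rw [integral_add (hI1.const_mul _) (integrable_const _), integral_const_mul, integral_const]
      simp only [probReal_univ, one_smul]
      ring
    rw [integral_sub i2 i1, integral_const_mul, e1, e2]
    ring
  have hle := norm_integral_le_of_norm_le_const (μ := P) (ae_of_all _ hpt)
  rw [← hid, probReal_univ, mul_one, norm_mul, Real.norm_of_nonneg two_pos.le] at hle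
  rw [Real.norm_of_nonneg hr0.le]
  linarith [norm_nonneg ((∫ e, f e ∂P) - ((∫ e, g e ∂P) / r + F μ ν))]

lemma HasRenormalizedField.unique {n : Fin N} {s : ℝ} {F F' : Matrix (Fin 4) (Fin 4) ℝ}
    (h : S.HasRenormalizedField n s F) (h' : S.HasRenormalizedField n s F') : F = F' :=
  Matrix.ext fun μ ν => (h μ ν).unique (h' μ ν)

lemma HasRenormalizedField.antisymm (hreg : S.IsRegular) {n : Fin N} {s : ℝ}
    {F : Matrix (Fin 4) (Fin 4) ℝ} (h : S.HasRenormalizedField n s F) (μ ν : Fin 4) :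
    F μ ν = -F ν μ := by
  refine (h μ ν).unique ?_
  convert (h ν μ).const_mul (-1) using 1
  · funext r
    simp only [sphereMean, average, hreg.antisymm _ μ ν, integral_neg, neg_one_mul]
  · ring

/-! ### The rate of change of the momentum in a small tube -/

lemma near₂_event (hreg : S.IsRegular) (n : Fin N) (c : ℝ) (y : Space) :
    S.near₂ n c (event 0 y) = (S.charge n / (4 * Real.pi) * amplitude (deriv (S.worldline n) c) y) •
      Matrix.of (wedge (deriv (S.worldline n) c) (event 0 y)) := by
  ext μ ν
  simp only [near₂, Matrix.of_apply, Matrix.smul_apply, smul_eq_mul,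
    NearField.F₂_eq ((hreg.worldlines n).timelike c).ne, amplitude]
  ring

/-- The derivative of the relative position with respect to a moving point. -/
def drag (v : Space) (ν : Fin 4) : Space :=
  spatial (Pi.single ν 1) - (Pi.single ν 1 : Spacetime) 0 • v

/-- The force which a regular field `F` exerts on the near field, as a flux through a moving tube. The
longitudinal part is given by Gauss's law, the transverse part vanishes by symmetry under the
rotation by `π` around the velocity. -/
lemma integral_mixed_stress (hreg : S.IsRegular) (n : Fin N) (c : ℝ)
    {F : Matrix (Fin 4) (Fin 4) ℝ} (hF : ∀ μ ν, F μ ν = -F ν μ) (β : Fin 4) {v : Space}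
    (hv : v = (deriv (S.worldline n) c 0)⁻¹ • spatial (deriv (S.worldline n) c))
    (hI : Integrable fun y : Space => ∑ ν, (stress (S.near₂ n c (event 0 y)) F ν β +
      stress F (S.near₂ n c (event 0 y)) ν β) * fderiv ℝ hole y (drag v ν)) :
    ∫ y : Space, ∑ ν, (stress (S.near₂ n c (event 0 y)) F ν β +
      stress F (S.near₂ n c (event 0 y)) ν β) * fderiv ℝ hole y (drag v ν) =
    -(S.charge n / deriv (S.worldline n) c 0 *
      (F *ᵥ (metric *ᵥ deriv (S.worldline n) c)) β) := by
  have hX := hreg.worldlines n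
  set u := deriv (S.worldline n) c with hu
  have hu0 : 0 < u 0 := hX.future c
  have hv' : spatial u = u 0 • v := by rw [hv, smul_smul, mul_inv_cancel₀ hu0.ne', one_smul]
  set w : Space → ℝ := fun y => 4 * deriv Real.smoothTransition (2 * ‖y‖ ^ 2 - 1) with hw
  have hG := integral_amplitude_mul_holeRate (u := u) (hX.timelike c) hu0
  have hGI : Integrable fun y : Space => amplitude u y * holeRate ‖y‖ := by
    -- the integral of a function which is not integrable would be zero
    by_contra h
    rw [integral_undef h] at hG
    have : 0 < 4 * Real.pi / u 0 := by positivity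
    linarith
  have e1 : ∀ y : Space, ∑ ν, (stress (S.near₂ n c (event 0 y)) F ν β +
      stress F (S.near₂ n c (event 0 y)) ν β) * fderiv ℝ hole y (drag v ν) =
      -(S.charge n / (4 * Real.pi) * (F *ᵥ (metric *ᵥ u)) β) * (amplitude u y * holeRate ‖y‖) +
      (S.charge n / (4 * Real.pi) * (amplitude u y * w y * inner ℝ y v)) *
        transverseFlux u F β y := fun y => by
    have h1 := sum_stress_wedge hF hv' y β
    have h2 : ∀ ν, (stress (S.near₂ n c (event 0 y)) F ν β +
      stress F (S.near₂ n c (event 0 y)) ν β) * fderiv ℝ hole y (drag v ν) =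
      S.charge n / (4 * Real.pi) * amplitude u y * w y *
        ((stress (Matrix.of (wedge u (event 0 y))) F ν β +
          stress F (Matrix.of (wedge u (event 0 y))) ν β) *
        inner ℝ y (spatial (Pi.single ν 1) - (Pi.single ν 1 : Spacetime) 0 • v)) := fun ν => by
      rw [near₂_event hreg, stress_smul_left, stress_smul_right, fderiv_hole, ← hu, hw, drag]
      ring
    simp only [h2]
    rw [← Finset.mul_sum, h1, holeRate, hw]
    ring
  simp only [e1] at hI ⊢
  have hI1 := hGI.const_mul (-(S.charge n / (4 * Real.pi) * (F *ᵥ (metric *ᵥ u)) β))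
  have hI2 : Integrable fun y : Space => (S.charge n / (4 * Real.pi) *
      (amplitude u y * w y * inner ℝ y v)) * transverseFlux u F β y :=
    (hI.sub hI1).congr (ae_of_all _ fun y => by simp)
  have hrefl : ∀ y z : Space, inner ℝ ((ℝ ∙ v).reflection y) ((ℝ ∙ v).reflection z) = inner ℝ y z :=
    fun y z => LinearIsometryEquiv.inner_map_map _ y z
  have hself : (ℝ ∙ v).reflection v = v := Submodule.reflection_mem_subspace_eq_self
    (Submodule.mem_span_singleton_self v)
  have hselfu : (ℝ ∙ v).reflection (spatial u) = spatial u := by rw [hv', map_smul, hself]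
  rw [integral_add hI1 hI2, integral_const_mul, hG,
    integral_mul_eq_zero_of_reflection v (fun y => ?_) fun y => ?_]
  · field_simp
    ring
  · have h1 : inner ℝ ((ℝ ∙ v).reflection y) v = inner ℝ y v := by
      have h3 := hrefl y v
      rwa [hself] at h3
    have h2 : inner ℝ (spatial u) ((ℝ ∙ v).reflection y) = inner ℝ (spatial u) y := by
      have h3 := hrefl (spatial u) y
      rwa [hselfu] at h3
    simp only [hw, amplitude, NearField.dist, dist_event_sq, LinearIsometryEquiv.norm_map, h1, h2]
  · -- the sum of a vector and its reflection is a multiple of the velocity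
    obtain ⟨k, hk⟩ : ∃ k : ℝ, (ℝ ∙ v).reflection y + y = k • spatial u := by
      have h1 := Submodule.reflection_apply (K := (ℝ ∙ v)) y
      obtain ⟨k, hk⟩ := Submodule.mem_span_singleton.1 ((ℝ ∙ v).starProjection_apply_mem y)
      refine ⟨2 * (k * (u 0)⁻¹), ?_⟩
      rw [h1, ← hk, hv', two_smul, smul_smul]
      rw [show 2 * (k * (u 0)⁻¹) * u 0 = 2 * k by field_simp]
      module
    have h2 := transverseFlux_add u F β ((ℝ ∙ v).reflection y) y
    rw [hk, transverseFlux_smul_spatial hF] at h2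
    linarith

end System

namespace System

variable {N : ℕ} {S : System N}

lemma norm_drag_le {v : Space} (hv : ‖v‖ ≤ 1) (ν : Fin 4) : ‖drag v ν‖ ≤ 3 := by
  have h1 : ‖(Pi.single ν 1 : Spacetime)‖ ≤ 1 := by simp [Pi.norm_single]
  have h2 := norm_spatial_le_two_mul (Pi.single ν 1 : Spacetime)
  have h3 := (abs_le_norm (Pi.single ν 1 : Spacetime) 0).trans h1
  refine (norm_sub_le _ _).trans ?_
  rw [norm_smul, Real.norm_eq_abs]
  nlinarith [abs_nonneg ((Pi.single ν 1 : Spacetime) 0), norm_nonneg v]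

lemma exists_abs_apply_le (F : Matrix (Fin 4) (Fin 4) ℝ) : ∃ b, 0 ≤ b ∧ ∀ μ ν, |F μ ν| ≤ b :=
  ⟨∑ μ, ∑ ν, |F μ ν|, Finset.sum_nonneg fun _ _ => Finset.sum_nonneg fun _ _ => abs_nonneg _,
    fun μ ν => (Finset.single_le_sum (f := fun ν => |F μ ν|) (fun _ _ => abs_nonneg _)
      (Finset.mem_univ ν)).trans (Finset.single_le_sum (f := fun μ => ∑ ν, |F μ ν|)
      (fun _ _ => Finset.sum_nonneg fun _ _ => abs_nonneg _) (Finset.mem_univ μ))⟩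

/-- Uniformly on a compact part of a world-line, a neighbourhood of the world-line does not meet the
other particles. -/
lemma IsRegular.exists_dist_ne (hreg : S.IsRegular) (n : Fin N) (A B : ℝ) :
    ∃ δ > 0, ∀ c ∈ Set.Icc A B, ∀ x, dist x (S.worldline n c) < δ → ∀ k, k ≠ n → ∀ s,
      x ≠ S.worldline k s := by
  have hX := hreg.worldlines n
  have hK : IsCompact (S.worldline n '' Set.Icc A B) := isCompact_Icc.image hX.continuous
  have hU : IsOpen {x | ∀ k, k ≠ n → ∀ s, x ≠ S.worldline k s} := by
    have h1 : {x | ∀ k, k ≠ n → ∀ s, x ≠ S.worldline k s} =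
        ⋂ k, {x | k ≠ n → x ∉ Set.range (S.worldline k)} := by
      ext x
      simp [eq_comm]
    rw [h1]
    refine isOpen_iInter_of_finite fun k => ?_
    by_cases hk : k = n
    · simp [hk]
    · have h2 := (hreg.worldlines k).isClosed_range.isOpen_compl
      simp only [ne_eq, hk, not_false_eq_true, forall_const]
      exact h2
  obtain ⟨δ, hδ, h⟩ := hK.exists_thickening_subset_open hU (by
    rintro _ ⟨c, -, rfl⟩ k hk s h
    exact hreg.noCollision k n hk s c h.symm)
  refine ⟨δ, hδ, fun c hc x hx => h ?_⟩
  exact Metric.mem_thickening_iff.2 ⟨_, ⟨c, hc, rfl⟩, hx⟩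

/-- The rate at which the field in a tube of radius `r` around a particle loses momentum: the term
which is independent of `r` is the force of the renormalized field on the particle. -/
theorem IsRegular.exists_tube_flux (hreg : S.IsRegular) (n : Fin N) :
    ∃ Fr : ℝ → Matrix (Fin 4) (Fin 4) ℝ, (∀ c, S.HasRenormalizedField n c (Fr c)) ∧
      ∀ A B β, ∃ (D : ℝ → ℝ) (C δ : ℝ), 0 < δ ∧ ∀ c ∈ Set.Icc A B, ∀ r, 0 < r → r < δ →
        |(∫ x : Space, S.exchange β ((hreg.worldlines n).tube r) (event (S.worldline n c 0) x)) -
          (D c / r - S.charge n / deriv (S.worldline n) c 0 *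
            (Fr c *ᵥ (metric *ᵥ deriv (S.worldline n) c)) β)| ≤ C * r := by
  obtain ⟨Fr, hFr⟩ := hreg.exists_near_stress n
  have hren : ∀ c, S.HasRenormalizedField n c (Fr c) := fun c => by
    obtain ⟨C, hC, δ, hδ, hb⟩ := hFr c c 0 le_rfl one_pos
    have hb' := fun (y : Space) (h0 : 0 < ‖y‖) (h1 : ‖y‖ < δ) => hb c ⟨le_rfl, le_rfl⟩ (event 0 y)
      (by rw [event_zero, abs_zero, zero_mul]) (by rwa [spatial_event]) (by rwa [spatial_event])
    simp only [spatial_event] at hb'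
    exact hreg.hasRenormalizedField hδ (fun y h0 h1 μ ν => (hb' y h0 h1 μ ν).1)
      fun y h0 h1 μ ν => (hb' y h0 h1 μ ν).2.2.2.2.2.2.2
  refine ⟨Fr, hren, fun A B β => ?_⟩
  have hX := hreg.worldlines n
  obtain ⟨C, hC, δ, hδ, hb⟩ := hFr A B 0 le_rfl one_pos
  have hb := fun c hc (y : Space) (h0 : 0 < ‖y‖) (h1 : ‖y‖ < δ) => hb c hc (event 0 y)
    (by rw [event_zero, abs_zero, zero_mul]) (by rwa [spatial_event]) (by rwa [spatial_event])
  simp only [spatial_event] at hb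
  obtain ⟨M, hM, hMb⟩ := exists_fderiv_hole_le
  obtain ⟨δ₁, hδ₁, hδ₁v⟩ := hreg.exists_dist_ne n A B
  -- after scaling, the gradient of the tube function is supported in a fixed shell
  set K : Set Space := {y | 1 / 2 ≤ ‖y‖ ∧ ‖y‖ ≤ 1} with hK
  have hKcl : IsClosed K := (isClosed_le continuous_const continuous_norm).inter
    (isClosed_le continuous_norm continuous_const)
  have hKf : volume K < ⊤ := (measure_mono fun y hy => by simpa using hy.2).trans_lt
    (measure_closedBall_lt_top (x := (0 : Space)) (r := 1))
  set V : ℝ → Space := fun c => (deriv (S.worldline n) c 0)⁻¹ • spatial (deriv (S.worldline n) c)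
    with hV
  have hV1 : ∀ c, ‖V c‖ ≤ 1 := fun c => by
    rw [hV]; simp only
    rw [norm_smul, norm_inv, Real.norm_of_nonneg (hX.future c).le, inv_mul_le_iff₀ (hX.future c),
      mul_one]
    exact (hX.speed_lt c).le
  -- the weight is odd, so that it selects the odd part of the energy-momentum tensor
  set Φ : ℝ → Fin 4 → Space → ℝ := fun c ν y => fderiv ℝ hole y (drag (V c) ν) with hΦ
  have hΦ0 : ∀ c ν, ∀ y ∉ K, Φ c ν y = 0 := fun c ν y hy => by
    have h2 : fderiv ℝ hole y = 0 := by
      refine fderiv_hole_eq_zero ?_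
      by_contra! hcon
      exact hy hcon
    simp [hΦ, h2]
  have hΦM : ∀ c ν y, |Φ c ν y| ≤ M * 3 := fun c ν y =>
    (hMb _ _).trans (mul_le_mul_of_nonneg_left (norm_drag_le (hV1 c) ν) hM.le)
  have hΦn : ∀ c ν y, Φ c ν (-y) = -1 * Φ c ν y := fun c ν y => by
    simp only [hΦ, fderiv_hole_neg]; ring
  have hΦm : ∀ c ν, Measurable (Φ c ν) := fun c ν =>
    ((contDiff_hole.continuous_fderiv (by simp)).clm_apply continuous_const).measurable
  have hz : ∀ (k : ℕ), ∀ y ∈ K, ‖y‖ ^ (-(k : ℤ)) ≤ 2 ^ k := fun k y hy => by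
    have := zpow_neg_le_zpow_neg (by norm_num : (0 : ℝ) < 1 / 2) hy.1 k
    refine this.trans_eq ?_
    rw [zpow_neg, zpow_natCast, ← inv_pow]; norm_num
  -- the homogeneous parts of the energy-momentum tensor
  set mix : ℝ → Fin 4 → Space → ℝ := fun c ν y =>
    stress (S.near₂ n c (event 0 y)) (Fr c) ν β + stress (Fr c) (S.near₂ n c (event 0 y)) ν β
    with hmix
  have hmixs : ∀ c ν y, ∀ {r : ℝ}, 0 < r → mix c ν (r • y) = (r ^ 2)⁻¹ * mix c ν y :=
    fun c ν y {r} hr => by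
    simp only [hmix, event_zero_smul, near₂_smul hreg n c _ hr, stress_smul_left,
      stress_smul_right]
    ring
  have hs3s : ∀ c ν y, y ∈ K → ∀ {r : ℝ}, 0 < r → S.stress₃ n c (event 0 (r • y)) ν β =
      (r ^ 3)⁻¹ * S.stress₃ n c (event 0 y) ν β := fun c ν y hy {r} hr => by
    rw [event_zero_smul, stress₃_smul hreg n c _ hr]
    rw [event_zero, abs_zero, spatial_event]
    linarith [hy.1]
  have hhalf : ∀ y ∈ K, 0 < ‖(δ / 2) • y‖ ∧ ‖(δ / 2) • y‖ < δ := fun y hy => by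
    have hd2 : 0 < δ / 2 := by positivity
    rw [norm_smul, Real.norm_of_nonneg hd2.le]
    have := hy.1
    exact ⟨by positivity, by nlinarith [hy.2]⟩
  have hI3 : ∀ c ∈ Set.Icc A B, ∀ ν, Integrable fun y => S.stress₃ n c (event 0 y) ν β * Φ c ν y :=
    fun c hc ν => by
    have hd2 : 0 < δ / 2 := by positivity
    refine integrable_mul_of_bounded (B := (δ / 2) ^ 3 * (C * (δ / 2) ^ (-3 : ℤ) * 8)) hKf
      hKcl.measurableSet ((S.measurable_stress₃ n c ν β).comp
      continuous_event_zero.measurable).aestronglyMeasurable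
      (hΦm c ν).aestronglyMeasurable (hΦ0 c ν) (hΦM c ν) fun y hy => ?_
    obtain ⟨e1, e2⟩ := hhalf y hy
    have h2 := (hb c hc ((δ / 2) • y) e1 e2 ν β).2.2.2.2.2.1
    rw [hs3s c ν y hy hd2, norm_smul, Real.norm_of_nonneg hd2.le, mul_zpow, abs_mul,
      abs_of_pos (by positivity), inv_mul_le_iff₀ (by positivity), ← mul_assoc C] at h2
    have h3 : ‖y‖ ^ (-3 : ℤ) ≤ 8 := (hz 3 y hy).trans_eq (by norm_num)
    refine h2.trans ?_
    gcongr
  have hImix : ∀ c ∈ Set.Icc A B, ∀ ν, Integrable fun y => mix c ν y * Φ c ν y :=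
    fun c hc ν => by
    have hd2 : 0 < δ / 2 := by positivity
    obtain ⟨b, hb0, hbF⟩ := exists_abs_apply_le (Fr c)
    have hm2 : ∀ μ ν, Measurable fun y : Space => S.near₂ n c (event 0 y) μ ν := fun μ ν =>
      (S.measurable_near₂ n c μ ν).comp continuous_event_zero.measurable
    have hmm : Measurable (mix c ν) :=
      (measurable_stress (F := fun y : Space => S.near₂ n c (event 0 y)) (G := fun _ => Fr c) hm2
        (fun _ _ => measurable_const) ν β).add
      (measurable_stress (F := fun _ => Fr c) (G := fun y : Space => S.near₂ n c (event 0 y))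
        (fun _ _ => measurable_const) hm2 ν β)
    refine integrable_mul_of_bounded (f := mix c ν)
      (B := (δ / 2) ^ 2 * (16 * (C * (δ / 2) ^ (-2 : ℤ) * 4 * b))) hKf
      hKcl.measurableSet hmm.aestronglyMeasurable
      (hΦm c ν).aestronglyMeasurable (hΦ0 c ν) (hΦM c ν) fun y hy => ?_
    obtain ⟨e1, e2⟩ := hhalf y hy
    have h2 : ∀ μ ν, |S.near₂ n c (event 0 ((δ / 2) • y)) μ ν| ≤ C * (δ / 2) ^ (-2 : ℤ) * 4 :=
      fun μ ν => by
      refine (hb c hc ((δ / 2) • y) e1 e2 μ ν).2.2.2.2.2.2.1.trans ?_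
      rw [norm_smul, Real.norm_of_nonneg hd2.le, mul_zpow, ← mul_assoc C]
      have h3 : ‖y‖ ^ (-2 : ℤ) ≤ 4 := (hz 2 y hy).trans_eq (by norm_num)
      gcongr
    have h4 : |mix c ν ((δ / 2) • y)| ≤ _ := (abs_add_le _ _).trans
      (add_le_add (abs_stress_le h2 hbF ν β) (abs_stress_le hbF h2 ν β))
    rw [hmixs c ν y hd2, abs_mul, abs_of_pos (by positivity), inv_mul_le_iff₀ (by positivity)] at h4
    refine h4.trans_eq ?_
    ring
  refine ⟨fun c => ∑ ν, ∫ y, S.stress₃ n c (event 0 y) ν β * Φ c ν y,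
    12 * C * M * volume.real K, min δ δ₁, lt_min hδ hδ₁, fun c hc r hr hrδ => ?_⟩
  have hrδ0 := hrδ.trans_le (min_le_left _ _)
  have hrδ1 := hrδ.trans_le (min_le_right _ _)
  have hnr : ∀ y : Space, ‖r • y‖ = r * ‖y‖ := fun y => by
    rw [norm_smul, Real.norm_of_nonneg hr.le]
  set T : Fin 4 → Space → ℝ := fun ν y =>
    energyMomentum (S.field (S.worldline n c + event 0 (r • y))) ν β with hT
  have hyK : ∀ y ∈ K, 0 < ‖r • y‖ ∧ ‖r • y‖ < δ ∧ ‖r • y‖ < δ₁ := fun y hy => by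
    rw [hnr]
    have := hy.1
    refine ⟨by positivity, ?_, ?_⟩ <;> nlinarith [hy.2]
  have hTm : ∀ ν, AEStronglyMeasurable (T ν) (volume.restrict K) := fun ν => by
    have h1 : ContinuousOn (T ν) K := by
      refine ((hreg.contDiffOn_energyMomentum ν β).continuousOn).comp (by
        have := continuous_event_zero
        fun_prop) fun y hy k s hks => ?_
      by_cases hk : k = n
      · subst hk
        exact hreg.add_event_ne k c s (norm_pos_iff.1 (hyK y hy).1) hks
      · refine hδ₁v c hc _ ?_ k hk s hks
        rw [dist_eq_norm, add_sub_cancel_left]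
        refine (norm_le_of_spatial _).trans_lt ?_
        rw [event_zero, spatial_event, abs_zero]
        exact max_lt hδ₁ (hyK y hy).2.2
    exact h1.aestronglyMeasurable hKcl.measurableSet
  have hTb : ∀ ν, ∀ y ∈ K, |T ν y| ≤ C * r ^ (-4 : ℤ) * 16 := fun ν y hy => by
    refine (hb c hc _ (hyK y hy).1 (hyK y hy).2.1 ν β).2.1.trans ?_
    rw [hnr, mul_zpow, ← mul_assoc]
    have := hz 4 y hy
    gcongr
    exact this.trans_eq (by norm_num)
  have hI : ∀ ν, Integrable fun y => T ν y * Φ c ν y := fun ν =>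
    integrable_mul_of_bounded hKf hKcl.measurableSet (hTm ν) (hΦm c ν).aestronglyMeasurable
      (hΦ0 c ν) (hΦM c ν) (hTb ν)
  have hν : ∀ ν, |(∫ y, T ν y * Φ c ν y) -
      ((r ^ 3)⁻¹ * (∫ y, S.stress₃ n c (event 0 y) ν β * Φ c ν y)
      + (r ^ 2)⁻¹ * ∫ y, mix c ν y * Φ c ν y)| ≤ C * r⁻¹ * (M * 3) * volume.real K := fun ν => by
    have key := abs_integral_sub_le_of_parity (μ := (volume : Measure Space)) (K := K) hKf
      hKcl.measurableSet (f := T ν)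
      (h := fun y => (r ^ 3)⁻¹ * S.stress₃ n c (event 0 y) ν β + (r ^ 2)⁻¹ * mix c ν y)
      (Φ := Φ c ν) (ε := C * r⁻¹) (σ := -1) (hTm ν) (hΦm c ν).aestronglyMeasurable (hΦ0 c ν)
      (hΦM c ν) (hΦn c ν) (hTb ν)
      ((((hI3 c hc ν).const_mul (r ^ 3)⁻¹).add ((hImix c hc ν).const_mul (r ^ 2)⁻¹)).congr
        (ae_of_all _ fun y => by simp; ring)) (by positivity)
      (fun y hy => by
        have h1 := (hb c hc _ (hyK y hy).1 (hyK y hy).2.1 ν β).2.2.2.1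
        rw [hs3s c ν y hy hr, show stress (S.near₂ n c (event 0 (r • y))) (Fr c) ν β +
          stress (Fr c) (S.near₂ n c (event 0 (r • y))) ν β = _ from hmixs c ν y hr,
          sub_eq_add_neg (S.worldline n c), ← event_zero_neg, ← smul_neg] at h1
        have h2 : T ν y + -1 * T ν (-y) - 2 * ((r ^ 3)⁻¹ * S.stress₃ n c (event 0 y) ν β +
            (r ^ 2)⁻¹ * mix c ν y) = T ν y - T ν (-y) -
            2 * ((r ^ 3)⁻¹ * S.stress₃ n c (event 0 y) ν β) - 2 * ((r ^ 2)⁻¹ * mix c ν y) := by ring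
        rw [h2]
        refine h1.trans ?_
        rw [hnr, mul_zpow]
        have := hz 1 y hy
        norm_num at this ⊢
        have h3 : 0 ≤ C * r⁻¹ := by positivity
        nlinarith)
    refine le_of_eq_of_le ?_ key
    congr 2
    rw [← integral_const_mul, ← integral_const_mul, ← integral_add ((hI3 c hc ν).const_mul _)
      ((hImix c hc ν).const_mul _)]
    congr 1; ext y; ring
  have hmixI : ∫ y, ∑ ν, mix c ν y * Φ c ν y = -(S.charge n / deriv (S.worldline n) c 0 *
      (Fr c *ᵥ (metric *ᵥ deriv (S.worldline n) c)) β) :=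
    integral_mixed_stress hreg n c ((hren c).antisymm hreg) β rfl
      (integrable_finsetSum _ fun ν _ => hImix c hc ν)
  rw [integral_finsetSum _ fun ν _ => hImix c hc ν] at hmixI
  -- three powers of `r` from the volume, and one inverse power from the gradient
  have hscale : ∫ x : Space, S.exchange β (hX.tube r) (event (S.worldline n c 0) x) =
      r ^ 2 * ∑ ν, ∫ y, T ν y * Φ c ν y := by
    rw [integral_comp_div _ (spatial (S.worldline n c)) hr, ← integral_finsetSum _ fun ν _ => hI ν]
    have h1 : ∀ y : Space, S.exchange β (hX.tube r)
        (event (S.worldline n c 0) (spatial (S.worldline n c) + r • y)) =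
        r⁻¹ * ∑ ν, T ν y * Φ c ν y := fun y => by
      rw [exchange, Finset.mul_sum]
      refine Finset.sum_congr rfl fun ν _ => ?_
      rw [hX.partialDeriv_tube, hX.offset_event, hX.position_time, add_sub_cancel_left, smul_smul,
        inv_mul_cancel₀ hr.ne', one_smul, event_zero, event_time_add, IsWorldline.velocity,
        hX.param_time]
      simp only [hT, hΦ, drag, hV]
      ring
    simp only [h1]
    rw [integral_const_mul]
    field_simp
  have hfin : (r ^ 2 * ∑ ν, ∫ y, T ν y * Φ c ν y) -
      ((∑ ν, ∫ y, S.stress₃ n c (event 0 y) ν β * Φ c ν y) / r -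
        S.charge n / deriv (S.worldline n) c 0 *
          (Fr c *ᵥ (metric *ᵥ deriv (S.worldline n) c)) β) =
      r ^ 2 * ∑ ν, ((∫ y, T ν y * Φ c ν y) -
        ((r ^ 3)⁻¹ * (∫ y, S.stress₃ n c (event 0 y) ν β * Φ c ν y)
          + (r ^ 2)⁻¹ * ∫ y, mix c ν y * Φ c ν y)) := by
    rw [Finset.sum_sub_distrib, Finset.sum_add_distrib, ← Finset.mul_sum, ← Finset.mul_sum, hmixI]
    field_simp
    ring
  beta_reduce
  rw [hscale, hfin, abs_mul, abs_of_pos (by positivity)]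
  have hsum := (Finset.abs_sum_le_sum_abs _ _).trans
    (Finset.sum_le_sum fun ν (_ : ν ∈ Finset.univ) => hν ν)
  rw [Finset.sum_const, Finset.card_univ, Fintype.card_fin, nsmul_eq_mul] at hsum
  refine (mul_le_mul_of_nonneg_left hsum (by positivity)).trans_eq ?_
  push_cast
  field_simp
  ring

end System

/-! ### The balance of momentum along a world-line -/

lemma HasRLim.comp_two_mul {f : ℝ → ℝ} {b : ℝ} (h : HasRLim f b) :
    HasRLim (fun r => f (2 * r)) b := by
  obtain ⟨a, ha⟩ := h
  have h1 : Tendsto (fun r : ℝ => 2 * r) (𝓝[>] 0) (𝓝[>] 0) := by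
    refine tendsto_nhdsWithin_iff.2 ⟨?_, ?_⟩
    · have : Tendsto (fun r : ℝ => 2 * r) (𝓝 0) (𝓝 (2 * 0)) := tendsto_id.const_mul 2
      rw [mul_zero] at this
      exact this.mono_left nhdsWithin_le_nhds
    · filter_upwards [self_mem_nhdsWithin] with r hr
      have : (0 : ℝ) < r := hr
      exact mul_pos two_pos this
  refine ⟨a / 2, ((ha.comp_tendsto h1).trans (IsBigO.of_bound 2 ?_)).congr_left fun r => ?_⟩
  · exact Eventually.of_forall fun r => by simp
  · simp only [Function.comp_apply]
    rw [div_div]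

lemma integrable_space_integral {f : Spacetime → ℝ} (hf : Integrable f) :
    Integrable fun t => ∫ x : Space, f (event t x) := by
  have h2 : Integrable (fun p : ℝ × Space => f (event p.1 p.2)) (volume.prod volume) :=
    (measurePreserving_event.integrable_comp_emb (eventEquiv.measurableEmbedding)).2 hf
  exact h2.integral_prod_left

namespace IsWorldline

variable {X : ℝ → Spacetime}

lemma properRate_pos (hX : IsWorldline X) (s : ℝ) : 0 < properRate X s :=
  Real.sqrt_pos.2 (by linarith [hX.timelike s])

lemma contDiff_fourVelocity (hX : IsWorldline X) : ContDiff ℝ ∞ (fourVelocity X) := by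
  have h1 : ContDiff ℝ ∞ fun s => mdot (deriv X s) (deriv X s) := by
    exact (mdotL.contDiff.comp hX.contDiff_deriv).clm_apply hX.contDiff_deriv
  have h3 : ContDiff ℝ ∞ (properRate X) := h1.neg.sqrt fun s => by
    have := hX.timelike s
    linarith
  exact (h3.inv fun s => (hX.properRate_pos s).ne').smul hX.contDiff_deriv

lemma hasDerivAt_fourVelocity (hX : IsWorldline X) (s : ℝ) :
    HasDerivAt (fourVelocity X) (deriv (fourVelocity X) s) s :=
  (hX.contDiff_fourVelocity.differentiable (by simp) s).hasDerivAt

/-- The integral over time of the derivative of the four-velocity. -/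
lemma integral_deriv_fourVelocity (hX : IsWorldline X) {s₀ s₁ : ℝ} (h : s₀ ≤ s₁) (β : Fin 4) :
    IntegrableOn (fun t => (deriv X (hX.param t) 0)⁻¹ * deriv (fourVelocity X) (hX.param t) β)
      (Set.Icc (X s₀ 0) (X s₁ 0)) ∧
    ∫ t in Set.Icc (X s₀ 0) (X s₁ 0),
      (deriv X (hX.param t) 0)⁻¹ * deriv (fourVelocity X) (hX.param t) β =
      fourVelocity X s₁ β - fourVelocity X s₀ β := by
  have hle : X s₀ 0 ≤ X s₁ 0 := hX.strictMono_time.monotone h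
  have hc : Continuous fun t =>
      (deriv X (hX.param t) 0)⁻¹ * deriv (fourVelocity X) (hX.param t) β := by
    have h1 : Continuous (deriv (fourVelocity X)) :=
      hX.contDiff_fourVelocity.continuous_deriv (by simp)
    exact (((continuous_apply 0).comp (hX.continuous_deriv.comp hX.continuous_param)).inv₀
      fun _ => (hX.future _).ne').mul ((continuous_apply β).comp (h1.comp hX.continuous_param))
  have hd : ∀ t, HasDerivAt (fun t => fourVelocity X (hX.param t) β)
      ((deriv X (hX.param t) 0)⁻¹ * deriv (fourVelocity X) (hX.param t) β) t := fun t => by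
    have h1 := (hasDerivAt_pi.1 (hX.hasDerivAt_fourVelocity (hX.param t)) β)
    have h2 : HasDerivAt (fun t => fourVelocity X (hX.param t) β) _ t :=
      HasDerivAt.comp (h₂ := fun s => fourVelocity X s β) t h1 (hX.hasDerivAt_param t)
    exact h2.congr_deriv (mul_comm _ _)
  refine ⟨hc.continuousOn.integrableOn_Icc, ?_⟩
  rw [integral_Icc_eq_integral_Ioc, ← intervalIntegral.integral_of_le hle,
    intervalIntegral.integral_eq_sub_of_hasDerivAt (fun t _ => hd t) (hc.intervalIntegrable _ _),
    hX.param_time, hX.param_time]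

lemma frameEvent_time (X : ℝ → Spacetime) (s : ℝ) :
    frameEvent 1 0 (X s 0) (spatial (X s)) = X s := by rw [frameEvent_one, event_spatial]

lemma dist_le_norm_offset (hX : IsWorldline X) (x : Spacetime) :
    dist x (X (hX.param (x 0))) ≤ ‖hX.offset x‖ := by
  rw [dist_eq_norm]
  refine (norm_le_of_spatial _).trans ?_
  rw [Pi.sub_apply, hX.time_param, sub_self, abs_zero, spatial_sub]
  exact max_le (norm_nonneg _) le_rfl

end IsWorldline

namespace System

variable {N : ℕ} {S : System N}

lemma slab_event (t₁ t₀ t : ℝ) (x : Space) : slab 1 0 t₁ t₀ (event t x) =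
    (Real.sign (t₁ - t) - Real.sign (t₀ - t)) / 2 := by
  rw [slab, Matrix.one_mulVec, add_zero, event_zero]

lemma mem_Icc_of_slab_ne_zero {t₁ t₀ : ℝ} (h : t₀ ≤ t₁) {x : Spacetime}
    (hx : slab 1 0 t₁ t₀ x ≠ 0) : x 0 ∈ Set.Icc t₀ t₁ := by
  have h1 := of_slab_ne_zero hx
  rw [Matrix.one_mulVec, add_zero] at h1
  by_contra hcon
  rw [Set.mem_Icc, not_and_or, not_le, not_le] at hcon
  rcases hcon with h2 | h2
  · have := mul_pos (sub_pos.2 (h2.trans_le h)) (sub_pos.2 h2)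
    linarith
  · have := mul_pos (sub_pos.2 h2) (sub_pos.2 (h.trans_lt h2))
    nlinarith

lemma integral_slab_mul {t₁ t₀ : ℝ} (h : t₀ ≤ t₁) {f : Spacetime → ℝ}
    (hf : Integrable fun x => slab 1 0 t₁ t₀ x * f x) :
    IntegrableOn (fun t => ∫ x : Space, f (event t x)) (Set.Icc t₀ t₁) ∧
    ∫ x, slab 1 0 t₁ t₀ x * f x = ∫ t in Set.Icc t₀ t₁, ∫ x : Space, f (event t x) := by
  have h1 : (fun t => ∫ x : Space, slab 1 0 t₁ t₀ (event t x) * f (event t x)) =ᵐ[volume]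
      (Set.Icc t₀ t₁).indicator fun t => ∫ x : Space, f (event t x) := by
    have h2 : ∀ᵐ t : ℝ, t ≠ t₀ := Measure.ae_ne volume t₀
    have h3 : ∀ᵐ t : ℝ, t ≠ t₁ := Measure.ae_ne volume t₁
    filter_upwards [h2, h3] with t ht₀ ht₁
    simp only [slab_event]
    rw [integral_const_mul]
    by_cases ht : t ∈ Set.Icc t₀ t₁
    · rw [Set.indicator_of_mem ht, Real.sign_of_pos (sub_pos.2 (lt_of_le_of_ne ht.2 ht₁)),
        Real.sign_of_neg (sub_neg.2 (lt_of_le_of_ne ht.1 ht₀.symm))]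
      norm_num
    · rw [Set.indicator_of_notMem ht]
      rw [Set.mem_Icc, not_and_or, not_le, not_le] at ht
      rcases ht with ht | ht
      · rw [Real.sign_of_pos (sub_pos.2 (ht.trans_le h)), Real.sign_of_pos (sub_pos.2 ht)]; simp
      · rw [Real.sign_of_neg (sub_neg.2 ht), Real.sign_of_neg (sub_neg.2 (h.trans_lt ht))]; simp
  have h4 := (integrable_space_integral hf).congr h1
  rw [integrable_indicator_iff measurableSet_Icc] at h4
  refine ⟨h4, ?_⟩
  rw [integral_spacetime _ hf, integral_congr_ae h1, integral_indicator measurableSet_Icc]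

/-- The momentum which flows out of thin tubes around a particle which obeys the equation of motion
is, after renormalization, the momentum which the particle loses. -/
theorem IsRegular.hasRLim_tube (hreg : S.IsRegular) {n : Fin N}
    (hmot : ∀ s, ∃ F, S.HasRenormalizedField n s F ∧
      S.mass n • fourAcceleration (S.worldline n) s =
        S.charge n • (F *ᵥ (metric *ᵥ fourVelocity (S.worldline n) s)))
    {s₀ s₁ : ℝ} (hs : s₀ ≤ s₁) (β : Fin 4) {δ b : ℝ} (hδ : 0 < δ)
    (hI : ∀ r, 0 < r → r < δ → Integrable fun x => slab 1 0 (S.worldline n s₁ 0)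
      (S.worldline n s₀ 0) x * S.exchange β ((hreg.worldlines n).tube r) x)
    (hb : HasRLim (fun r => ∫ x, slab 1 0 (S.worldline n s₁ 0) (S.worldline n s₀ 0) x *
      S.exchange β ((hreg.worldlines n).tube r) x) b) :
    b = -(S.mass n * (fourVelocity (S.worldline n) s₁ β - fourVelocity (S.worldline n) s₀ β)) := by
  have hX := hreg.worldlines n
  obtain ⟨Fr, hFr, hflux⟩ := hreg.exists_tube_flux n
  obtain ⟨D, C, δ', hδ', hfl⟩ := hflux s₀ s₁ β
  set t₀ := S.worldline n s₀ 0 with ht₀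
  set t₁ := S.worldline n s₁ 0 with ht₁
  have hle : t₀ ≤ t₁ := hX.strictMono_time.monotone hs
  -- the force on the particle
  have hforce : ∀ s, S.charge n / deriv (S.worldline n) s 0 *
      (Fr s *ᵥ (metric *ᵥ deriv (S.worldline n) s)) β =
      S.mass n * ((deriv (S.worldline n) s 0)⁻¹ * deriv (fourVelocity (S.worldline n)) s β) :=
    fun s => by
    obtain ⟨F, hF, he⟩ := hmot s
    rw [hF.unique (hFr s)] at he
    have h1 := congrFun he β
    have h2 := (hX.properRate_pos s).ne'
    simp only [fourAcceleration, fourVelocity, Matrix.mulVec_smul, Pi.smul_apply,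
      smul_eq_mul] at h1
    have h3 : S.mass n * deriv (fourVelocity (S.worldline n)) s β =
        S.charge n * (Fr s *ᵥ (metric *ᵥ deriv (S.worldline n) s)) β := by
      have h4 : (properRate (S.worldline n) s)⁻¹ ≠ 0 := inv_ne_zero h2
      refine mul_left_cancel₀ h4 ?_
      change S.mass n * ((properRate (S.worldline n) s)⁻¹ *
        deriv (fourVelocity (S.worldline n)) s β) = _ at h1
      linarith
    rw [div_mul_eq_mul_div, ← h3]
    field_simp
  obtain ⟨hkI, hk⟩ := hX.integral_deriv_fourVelocity hs β
  set k : ℝ → ℝ := fun t => (deriv (S.worldline n) (hX.param t) 0)⁻¹ *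
    deriv (fourVelocity (S.worldline n)) (hX.param t) β with hkd
  set J : ℝ → ℝ := fun r => ∫ x, slab 1 0 t₁ t₀ x * S.exchange β (hX.tube r) x with hJ
  -- the combination `J r - 2 * J (2 * r)` eliminates the terms `D c / r`, about whose dependence on
  -- `c` nothing is known
  have h1 : HasRLim (fun r => J r + -2 * J (2 * r)) (b + -2 * b) :=
    hb.add (hb.comp_two_mul.const_mul (-2))
  have h2 : HasRLim (fun r => J r + -2 * J (2 * r)) (∫ t in Set.Icc t₀ t₁, S.mass n * k t) := by
    refine (hasRLim_const _).of_abs_sub_le (a := 0) (C := 5 * C * (t₁ - t₀))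
      (δ := min (δ / 2) (δ' / 2)) (by positivity) fun r hr hrδ => ?_
    have hr1 := hrδ.trans_le (min_le_left _ _)
    have hr2 := hrδ.trans_le (min_le_right _ _)
    obtain ⟨i1, e1⟩ := integral_slab_mul hle (hI r hr (by linarith))
    obtain ⟨i2, e2⟩ := integral_slab_mul hle (hI (2 * r) (by positivity) (by linarith))
    have e3 : J r + -2 * J (2 * r) - (∫ t in Set.Icc t₀ t₁, S.mass n * k t) - 0 / r =
        ∫ t in Set.Icc t₀ t₁, ((∫ x : Space, S.exchange β (hX.tube r) (event t x)) +
          -2 * (∫ x : Space, S.exchange β (hX.tube (2 * r)) (event t x)) - S.mass n * k t) := by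
      have i3 : IntegrableOn (fun t => (∫ x : Space, S.exchange β (hX.tube r) (event t x)) +
          -2 * (∫ x : Space, S.exchange β (hX.tube (2 * r)) (event t x))) (Set.Icc t₀ t₁) :=
        i1.add (i2.const_mul (-2))
      rw [integral_sub i3 (hkI.const_mul _), integral_add i1 (i2.const_mul (-2)),
        integral_const_mul (-2), hJ]
      simp only
      rw [e1, e2]
      ring
    rw [e3]
    have h3 := norm_setIntegral_le_of_norm_le_const (μ := volume) (s := Set.Icc t₀ t₁)
      (f := fun t => (∫ x : Space, S.exchange β (hX.tube r) (event t x)) +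
          -2 * (∫ x : Space, S.exchange β (hX.tube (2 * r)) (event t x)) - S.mass n * k t)
      (C := 5 * C * r) measure_Icc_lt_top fun t ht => by
        have hc : hX.param t ∈ Set.Icc s₀ s₁ := by
          rw [← hX.param_time s₀, ← hX.param_time s₁]
          exact ⟨hX.strictMono_param.monotone ht.1, hX.strictMono_param.monotone ht.2⟩
        have f1 := hfl _ hc r hr (by linarith)
        have f2 := hfl _ hc (2 * r) (by positivity) (by linarith)
        rw [hX.time_param, hforce] at f1 f2
        rw [show D (hX.param t) / (2 * r) = D (hX.param t) / r / 2 by rw [div_div, mul_comm]] at f2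
        rw [Real.norm_eq_abs, abs_le]
        rw [abs_le] at f1 f2
        simp only [hkd]
        constructor <;> linarith
    rw [Real.norm_eq_abs, Real.volume_real_Icc_of_le hle] at h3
    exact h3.trans_eq (by ring)
  have h3 := h1.unique h2
  rw [integral_const_mul, hk] at h3
  linarith

/-- Between two times, the renormalized energy-momentum near a particle which obeys the equation of
motion changes by the exchange with the surroundings and by the momentum given to the particle. -/
theorem IsLocalizer.sub_eq_of_motion (hreg : S.IsRegular) (hmax : S.Maxwell) {n : Fin N}
    (hmot : ∀ s, ∃ F, S.HasRenormalizedField n s F ∧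
      S.mass n • fourAcceleration (S.worldline n) s =
        S.charge n • (F *ᵥ (metric *ᵥ fourVelocity (S.worldline n) s)))
    {s₀ s₁ : ℝ} (hs : s₀ ≤ s₁) {ζ : Spacetime → ℝ} (hζ : S.IsLocalizer n ζ)
    (h1 : ∀ s ∈ Set.Icc s₀ s₁, ∀ᶠ x in 𝓝 (S.worldline n s), ζ x = 1) {β : Fin 4} {b₀ b₁ : ℝ}
    (hb₀ : S.HasLocalFlux 1 0 (S.worldline n s₀ 0) β ζ (spatial (S.worldline n s₀)) b₀)
    (hb₁ : S.HasLocalFlux 1 0 (S.worldline n s₁ 0) β ζ (spatial (S.worldline n s₁)) b₁) :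
    Integrable (fun x => slab 1 0 (S.worldline n s₁ 0) (S.worldline n s₀ 0) x *
      S.exchange β ζ x) ∧
    b₁ - b₀ = (∫ x, slab 1 0 (S.worldline n s₁ 0) (S.worldline n s₀ 0) x * S.exchange β ζ x)
      - S.mass n * (fourVelocity (S.worldline n) s₁ β - fourVelocity (S.worldline n) s₀ β) := by
  have hX := hreg.worldlines n
  set t₀ := S.worldline n s₀ 0 with ht₀
  set t₁ := S.worldline n s₁ 0 with ht₁
  have hle : t₀ ≤ t₁ := hX.strictMono_time.monotone hs
  -- `ζ` equals `1` in a tube of radius `δ` around the world-line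
  obtain ⟨δ, hδ, hδ1⟩ : ∃ δ > 0, ∀ x : Spacetime, x 0 ∈ Set.Icc t₀ t₁ → ‖hX.offset x‖ < δ →
      ∀ᶠ y in 𝓝 x, ζ y = 1 := by
    obtain ⟨δ, hδ, h⟩ := (isCompact_Icc.image hX.continuous).exists_thickening_subset_open
      (s := S.worldline n '' Set.Icc s₀ s₁)
      (isOpen_setOfPred_eventually_nhds (p := fun x => ζ x = 1))
      (by rintro _ ⟨s, hs, rfl⟩; exact h1 s hs)
    refine ⟨δ, hδ, fun x hx hxδ => h (Metric.mem_thickening_iff.2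
      ⟨_, ⟨hX.param (x 0), ?_, rfl⟩, (hX.dist_le_norm_offset x).trans_lt hxδ⟩)⟩
    rw [← hX.param_time s₀, ← hX.param_time s₁]
    exact ⟨hX.strictMono_param.monotone hx.1, hX.strictMono_param.monotone hx.2⟩
  set χ : ℝ → Spacetime → ℝ := fun r x => ζ x * hX.tube r x with hχ
  have hof := hX.contDiff_offset.continuous.norm
  have hχc : ∀ r, ContDiff ℝ 1 (χ r) := fun r => hζ.contDiff.mul (hX.contDiff_tube _)
  have hχs : ∀ r, HasCompactSupport (χ r) := fun r => hζ.compact.mul_right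
  have hχv : ∀ {r : ℝ}, 0 < r → tsupport (χ r) ⊆ S.vacuum := fun hr x hx k s hk => by
    by_cases hkn : k = n
    · subst hkn
      exact hX.notMem_tsupport_tube hr s (hk ▸ tsupport_mul_subset_right hx)
    · exact hζ.avoids k hkn s (hk ▸ tsupport_mul_subset_left hx)
  have hnear : ∀ {r : ℝ}, ∀ x, slab 1 0 t₁ t₀ x ≠ 0 → ‖hX.offset x‖ < δ →
      χ r =ᶠ[𝓝 x] hX.tube r := fun {r} x hx hxδ => by
    filter_upwards [hδ1 x (mem_Icc_of_slab_ne_zero hle hx) hxδ] with y hy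
    simp only [hχ, hy, one_mul]
  have hfar : ∀ {r : ℝ}, 0 < r → ∀ x, r < ‖hX.offset x‖ →
      χ r =ᶠ[𝓝 x] ζ ∧ hX.tube r =ᶠ[𝓝 x] fun _ => 1 := fun {r} hr x hxr => by
    have h4 : hX.tube r =ᶠ[𝓝 x] fun _ => 1 := by
      filter_upwards [(isOpen_lt continuous_const hof).mem_nhds hxr] with y hy
      exact hX.tube_eq_one hr (le_of_lt hy)
    refine ⟨?_, h4⟩
    filter_upwards [h4] with y hy
    simp only [hχ, hy, mul_one]
  have hbal := fun {r : ℝ} (hr : 0 < r) =>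
    hmax.integral_slab_mul_exchange hreg isLorentz_one 0 (hχc r) (hχs r) (hχv hr) t₁ t₀ β
  have hζ0 : ∀ x, slab 1 0 t₁ t₀ x ≠ 0 → ‖hX.offset x‖ < δ → S.exchange β ζ x = 0 :=
    fun x hx hxδ => exchange_eq_zero (hδ1 x (mem_Icc_of_slab_ne_zero hle hx) hxδ) β
  have hIζ : Integrable fun x => slab 1 0 t₁ t₀ x * S.exchange β ζ x := by
    have h3 := (hbal (half_pos hδ)).1.indicator
      (isClosed_le continuous_const hof : IsClosed {x | δ ≤ ‖hX.offset x‖}).measurableSet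
    refine h3.congr (ae_of_all _ fun x => ?_)
    by_cases hx : slab 1 0 t₁ t₀ x = 0
    · simp [hx, Set.indicator]
    by_cases hxδ : δ ≤ ‖hX.offset x‖
    · rw [Set.indicator_of_mem (by exact hxδ),
        exchange_congr (hfar (half_pos hδ) x (by linarith)).1]
    · rw [Set.indicator_of_notMem (by exact hxδ)]
      change 0 = slab 1 0 t₁ t₀ x * S.exchange β ζ x
      rw [hζ0 x hx (not_le.1 hxδ), mul_zero]
  have hpt : ∀ {r : ℝ}, 0 < r → r < δ → ∀ x, slab 1 0 t₁ t₀ x * S.exchange β (χ r) x =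
      slab 1 0 t₁ t₀ x * S.exchange β ζ x + slab 1 0 t₁ t₀ x * S.exchange β (hX.tube r) x :=
    fun {r} hr hrδ x => by
    by_cases hx : slab 1 0 t₁ t₀ x = 0
    · simp [hx]
    by_cases hxδ : δ ≤ ‖hX.offset x‖
    · obtain ⟨e1, e2⟩ := hfar hr x (hrδ.trans_le hxδ)
      rw [exchange_congr e1, exchange_eq_zero e2, mul_zero, add_zero]
    · rw [exchange_congr (hnear x hx (not_le.1 hxδ)), hζ0 x hx (not_le.1 hxδ), mul_zero, zero_add]
  have hIH : ∀ r, 0 < r → r < δ → Integrable fun x =>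
      slab 1 0 t₁ t₀ x * S.exchange β (hX.tube r) x :=
    fun r hr hrδ => ((hbal hr).1.sub hIζ).congr (ae_of_all _ fun x => by
      simp only [Pi.sub_apply, hpt hr hrδ x, add_sub_cancel_left])
  refine ⟨hIζ, ?_⟩
  -- the fluxes through the two planes
  have hplane : ∀ (s : ℝ) (r : ℝ) (x : Space), χ r (frameEvent 1 0 (S.worldline n s 0) x) =
      ζ (frameEvent 1 0 (S.worldline n s 0) x) *
        hole (r⁻¹ • spatial (frameEvent 1 0 (S.worldline n s 0) x - S.worldline n s)) :=
    fun s r x => by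
    simp only [hχ, IsWorldline.tube, frameEvent_one, hX.offset_event, hX.position_time,
      spatial_sub, spatial_event]
  have hfl₀ := hζ.hasRLim_hole hreg isLorentz_one (IsWorldline.frameEvent_time _ s₀)
    (h1 s₀ ⟨le_rfl, hs⟩) hb₀
  have hfl₁ := hζ.hasRLim_hole hreg isLorentz_one (IsWorldline.frameEvent_time _ s₁)
    (h1 s₁ ⟨hs, le_rfl⟩) hb₁
  simp only [mul_assoc, ← hplane] at hfl₀ hfl₁
  have hR := (hfl₁.add (hfl₀.const_mul (-1))).add
    (hasRLim_const (-∫ x, slab 1 0 t₁ t₀ x * S.exchange β ζ x))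
  have hR' := hR.congr (g := fun r => ∫ x, slab 1 0 t₁ t₀ x * S.exchange β (hX.tube r) x) (by
    filter_upwards [eventually_pos_lt hδ] with r hr
    have h3 := (hbal hr.1).2
    rw [integral_congr_ae (ae_of_all _ (hpt hr.1 hr.2)), integral_add hIζ (hIH r hr.1 hr.2)] at h3
    linarith)
  have := hreg.hasRLim_tube hmot hs β hδ hIH hR'
  linarith

end System

namespace System

variable {N : ℕ} {S : System N} {L : Matrix (Fin 4) (Fin 4) ℝ}

/-- The closed region between two simultaneity planes. -/
def wedgeRegion (L : Matrix (Fin 4) (Fin 4) ℝ) (a : Spacetime) (t' t : ℝ) : Set Spacetime :=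
  {x | (t' - (L *ᵥ x + a) 0) * (t - x 0) ≤ 0}

lemma frameEvent_mem_wedgeRegion (hL : IsLorentz L) (a : Spacetime) (t' t : ℝ) (x : Space) :
    frameEvent L a t' x ∈ wedgeRegion L a t' t := by
  have h := ((hL.frameEvent_eq_iff a (t := t') (z := x)).1 rfl).1
  change (t' - (L *ᵥ frameEvent L a t' x + a) 0) * _ ≤ 0
  rw [h, sub_self, zero_mul]

lemma event_mem_wedgeRegion (a : Spacetime) (t' t : ℝ) (x : Space) :
    frameEvent 1 0 t x ∈ wedgeRegion L a t' t := by
  change _ * (t - frameEvent 1 0 t x 0) ≤ 0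
  rw [frameEvent_one, event_zero, sub_self, mul_zero]

lemma slab_swap (t₁ t₀ : ℝ) (x : Spacetime) : slab 1 0 t₀ t₁ x = -slab 1 0 t₁ t₀ x := by
  simp only [slab, Matrix.one_mulVec, add_zero]; ring

lemma slab_add (a : Spacetime) (t' t₁ t : ℝ) (x : Spacetime) :
    slab L a t' t₁ x + slab 1 0 t₁ t x = slab L a t' t x := by
  simp only [slab, Matrix.one_mulVec, add_zero]; ring

/-- The renormalized energy-momentum near a particle in two simultaneity planes. The momentum given
to the particle between its intersections with the planes enters only if they differ, in which case
the equation of motion is needed. -/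
theorem IsLocalizer.sub_eq (hreg : S.IsRegular) (hmax : S.Maxwell) (hL : IsLorentz L)
    (a : Spacetime) {n : Fin N} {t' t s' s : ℝ} (ht' : (L *ᵥ S.worldline n s' + a) 0 = t')
    (ht : S.worldline n s 0 = t)
    (hmot : s' = s ∨ ∀ s, ∃ F, S.HasRenormalizedField n s F ∧
      S.mass n • fourAcceleration (S.worldline n) s =
        S.charge n • (F *ᵥ (metric *ᵥ fourVelocity (S.worldline n) s)))
    {ζ : Spacetime → ℝ} (hζ : S.IsLocalizer n ζ)
    (h1 : ∀ s, S.worldline n s ∈ wedgeRegion L a t' t → ∀ᶠ x in 𝓝 (S.worldline n s), ζ x = 1)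
    {β : Fin 4} {z' : Space} {b b' : ℝ} (hz' : frameEvent L a t' z' = S.worldline n s')
    (hb : S.HasLocalFlux 1 0 t β ζ (spatial (S.worldline n s)) b)
    (hb' : S.HasLocalFlux L a t' β ζ z' b') :
    Integrable (fun x => slab L a t' t x * S.exchange β ζ x) ∧
    b' - b = (∫ x, slab L a t' t x * S.exchange β ζ x)
      - S.mass n * (fourVelocity (S.worldline n) s' β - fourVelocity (S.worldline n) s β) := by
  have hX := hreg.worldlines n
  have hX' := hX.transform hL a
  have hs' : ∀ᶠ x in 𝓝 (S.worldline n s'), ζ x = 1 := h1 s' (by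
    change (t' - (L *ᵥ S.worldline n s' + a) 0) * _ ≤ 0
    rw [ht', sub_self, zero_mul])
  -- the plane of the original frame through the event on the other plane
  obtain ⟨b₁, hb₁⟩ := hζ.exists_hasLocalFlux hreg isLorentz_one
    (IsWorldline.frameEvent_time (S.worldline n) s') hs' β
  obtain ⟨i1, e1⟩ := hζ.sub_eq_of_same_event hreg hmax hL a hs' rfl ht'
    (IsWorldline.frameEvent_time (S.worldline n) s') hz' hb₁ hb'
  have key : Integrable (fun x => slab 1 0 (S.worldline n s' 0) t x * S.exchange β ζ x) ∧
      b₁ - b = (∫ x, slab 1 0 (S.worldline n s' 0) t x * S.exchange β ζ x)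
      - S.mass n * (fourVelocity (S.worldline n) s' β - fourVelocity (S.worldline n) s β) := by
    rcases hmot with rfl | hmot
    · have h2 : ∀ x, slab 1 0 (S.worldline n s' 0) t x = 0 := fun x => by
        rw [ht, slab, Matrix.one_mulVec, add_zero, sub_self, zero_div]
      rw [ht] at hb₁
      simp only [h2, zero_mul, integral_zero, sub_self, mul_zero]
      exact ⟨integrable_zero _ _ _, sub_eq_zero.2 (hb₁.unique hb)⟩
    · subst ht
      rcases le_total s s' with hss | hss
      · refine hζ.sub_eq_of_motion hreg hmax hmot hss (fun c hc => h1 c ?_) hb hb₁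
        have h2 := hX'.strictMono_time.monotone hc.2
        have h3 := hX.strictMono_time.monotone hc.1
        rw [← ht']
        exact mul_nonpos_of_nonneg_of_nonpos (sub_nonneg.2 h2) (sub_nonpos.2 h3)
      · obtain ⟨i2, e2⟩ := hζ.sub_eq_of_motion hreg hmax hmot hss (fun c hc => h1 c (by
          have h2 := hX'.strictMono_time.monotone hc.1
          have h3 := hX.strictMono_time.monotone hc.2
          rw [← ht']
          exact mul_nonpos_of_nonpos_of_nonneg (sub_nonpos.2 h2) (sub_nonneg.2 h3))) hb₁ hb
        simp only [slab_swap (S.worldline n s 0), neg_mul, integral_neg]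
        exact ⟨i2.neg, by linarith⟩
  obtain ⟨i2, e2⟩ := key
  have h3 : ∀ x, slab L a t' t x * S.exchange β ζ x =
      slab L a t' (S.worldline n s' 0) x * S.exchange β ζ x +
        slab 1 0 (S.worldline n s' 0) t x * S.exchange β ζ x := fun x => by
    rw [← add_mul, slab_add]
  simp only [h3]
  refine ⟨i1.add i2, ?_⟩
  rw [integral_add i1 i2]
  linarith

/-- The part of a world-line within a bounded distance of the region between two simultaneity planes
is bounded. -/
lemma _root_.PointCharges.IsWorldline.exists_abs_time_le {X : ℝ → Spacetime} (hX : IsWorldline X)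
    (hL : IsLorentz L) (a : Spacetime) (t' t : ℝ) :
    ∃ T, 0 ≤ T ∧ ∀ x ∈ wedgeRegion L a t' t, ‖hX.offset x‖ ≤ 1 → |x 0| ≤ T := by
  obtain ⟨v, hv0, hv1, hv⟩ := hL.exists_slope
  have h1v : 0 < 1 - v := by linarith
  refine ⟨(1 + ‖hX.position 0‖ + (|t| + |t' - a 0|)) / (1 - v), by positivity,
    fun x hx ho => ?_⟩
  have h1 := hv x t (t' - a 0) (by
    have h2 : (t' - (L *ᵥ x + a) 0) * (t - x 0) ≤ 0 := hx
    rw [Pi.add_apply] at h2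
    linarith)
  have h2 : ‖hX.position (x 0) - hX.position 0‖ ≤ |x 0| := by
    by_cases h : hX.param 0 = hX.param (x 0)
    · rw [IsWorldline.position, IsWorldline.position, h, sub_self, norm_zero]
      exact abs_nonneg _
    · have h3 := (hX.norm_spatial_sub_lt h).le
      rw [spatial_sub, Pi.sub_apply, hX.time_param, hX.time_param, sub_zero] at h3
      exact h3
  have h3 : ‖spatial x‖ ≤ ‖hX.offset x‖ +
      (‖hX.position (x 0) - hX.position 0‖ + ‖hX.position 0‖) := by
    have h4 : spatial x = hX.offset x + ((hX.position (x 0) - hX.position 0) + hX.position 0) := by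
      rw [IsWorldline.offset]; abel
    conv_lhs => rw [h4]
    exact (norm_add_le _ _).trans (add_le_add le_rfl (norm_add_le _ _))
  rw [le_div_iff₀ h1v]
  nlinarith [norm_nonneg (spatial x), norm_nonneg (hX.position 0), abs_nonneg (x 0)]

/-- A partition of unity in the region between two simultaneity planes: it consists of a function
which vanishes near the world-lines, and of cutoff functions around the particles. -/
theorem IsRegular.exists_partition (hreg : S.IsRegular) (hL : IsLorentz L) (a : Spacetime)
    (t' t : ℝ) : ∃ (ψ : Spacetime → ℝ) (ζ : Fin N → Spacetime → ℝ),
      ContDiff ℝ 1 ψ ∧ tsupport ψ ⊆ S.vacuum ∧ (∀ x, |ψ x| ≤ 1) ∧ (∀ n, S.IsLocalizer n (ζ n)) ∧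
      (∀ x ∈ wedgeRegion L a t' t, ∀ᶠ y in 𝓝 x, ψ y + ∑ n, ζ n y = 1) ∧
      ∀ n s, S.worldline n s ∈ wedgeRegion L a t' t →
        ∀ᶠ x in 𝓝 (S.worldline n s), ζ n x = 1 := by
  have hX := hreg.worldlines
  choose T₀ hT₀ hT using fun n => (hX n).exists_abs_time_le hL a t' t
  set T := 1 + ∑ n, T₀ n with hTd
  have hTn : ∀ n, T₀ n < T := fun n => by
    have := Finset.single_le_sum (f := T₀) (fun n _ => hT₀ n) (Finset.mem_univ n)
    linarith
  have hT0 : 0 < T := by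
    have := Finset.sum_nonneg (s := Finset.univ) (f := T₀) fun n _ => hT₀ n
    linarith
  -- the distance between the particles
  obtain ⟨d, hd, hdd⟩ : ∃ d > 0, ∀ n k, n ≠ k → ∀ τ ∈ Set.Icc (-(T + 1)) (T + 1),
      d ≤ ‖(hX n).position τ - (hX k).position τ‖ := by
    have h1 : ∀ n k, ∃ d : ℝ, 0 < d ∧ (n ≠ k → ∀ τ ∈ Set.Icc (-(T + 1)) (T + 1),
        d ≤ ‖(hX n).position τ - (hX k).position τ‖) := fun n k => by
      by_cases hnk : n = k
      · exact ⟨1, one_pos, fun h => absurd hnk h⟩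
      obtain ⟨τ, -, hτ⟩ := isCompact_Icc.exists_isMinOn
        (⟨0, by constructor <;> linarith⟩ : (Set.Icc (-(T + 1)) (T + 1)).Nonempty)
        (((hX n).continuous_position.sub (hX k).continuous_position).norm.continuousOn)
      refine ⟨_, norm_pos_iff.2 fun h => ?_, fun _ σ hσ => hτ hσ⟩
      refine hreg.noCollision n k hnk ((hX n).param τ) ((hX k).param τ) ?_
      rw [← (hX n).event_position, ← (hX k).event_position, sub_eq_zero.1 h]
    choose d hd hdd using h1
    have h2 : ∀ᶠ e in 𝓝[>] (0 : ℝ), ∀ n k, e ≤ d n k := eventually_all.2 fun n =>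
      eventually_all.2 fun k => (eventually_pos_lt (hd n k)).mono fun e he => he.2.le
    obtain ⟨e, he, he0⟩ := (h2.and self_mem_nhdsWithin).exists
    exact ⟨e, he0, fun n k hnk τ hτ => (he n k).trans (hdd n k hnk τ hτ)⟩
  set ρ := min 1 (d / 3) with hρ
  have hρ0 : 0 < ρ := lt_min one_pos (by positivity)
  have hρ1 : ρ ≤ 1 := min_le_left _ _
  have hρd : 3 * ρ ≤ d := by
    have : ρ ≤ d / 3 := min_le_right _ _
    linarith
  have hsep : ∀ n k, n ≠ k → ∀ x : Spacetime, |x 0| ≤ T + 1 → ‖(hX n).offset x‖ ≤ ρ →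
      ρ < ‖(hX k).offset x‖ := fun n k hnk x hx hxn => by
    have h1 := hdd n k hnk (x 0) (abs_le.1 hx)
    have h2 : (hX n).position (x 0) - (hX k).position (x 0) =
        (hX k).offset x - (hX n).offset x := by
      simp only [IsWorldline.offset]; abel
    rw [h2] at h1
    have := norm_sub_le ((hX k).offset x) ((hX n).offset x)
    linarith
  let θ : ContDiffBump (0 : ℝ) := ⟨T, T + 1, hT0, by linarith⟩
  have hθc : ContDiff ℝ 1 fun x : Spacetime => θ (x 0) :=
    θ.contDiff.comp (contDiff_apply ℝ ℝ 0)
  set ζ : Fin N → Spacetime → ℝ := fun n x => θ (x 0) * (1 - (hX n).tube ρ x) with hζ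
  have hζc : ∀ n, ContDiff ℝ 1 (ζ n) := fun n =>
    hθc.mul (contDiff_const.sub ((hX n).contDiff_tube ρ))
  set K : Fin N → Set Spacetime := fun n => {x | |x 0| ≤ T + 1 ∧ ‖(hX n).offset x‖ ≤ ρ} with hK
  have hKcl : ∀ n, IsClosed (K n) := fun n => by
    have h1 : Continuous fun x : Spacetime => |x 0| := (continuous_apply 0).abs
    exact (isClosed_le h1 continuous_const).inter
      (isClosed_le (hX n).contDiff_offset.continuous.norm continuous_const)
  have hζ0 : ∀ n, ∀ x ∉ K n, ζ n x = 0 := fun n x hx => by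
    have h1 : T + 1 < |x 0| ∨ ρ < ‖(hX n).offset x‖ := by
      by_contra! h; exact hx h
    rcases h1 with h1 | h1
    · have h2 : θ (x 0) = 0 := θ.zero_of_le_dist (by
        rw [Real.dist_eq, sub_zero]; exact h1.le)
      simp [hζ, h2]
    · simp [hζ, (hX n).tube_eq_one hρ0 h1.le]
  have hζs : ∀ n, tsupport (ζ n) ⊆ K n := fun n => closure_minimal (fun x hx => by
    by_contra h
    exact hx (hζ0 n x h)) (hKcl n)
  have hKb : ∀ n, Bornology.IsBounded (K n) := fun n => by
    obtain ⟨M, hM⟩ := (isCompact_Icc.image (hX n).continuous_position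
      (s := Set.Icc (-(T + 1)) (T + 1))).isBounded.exists_norm_le
    refine (Metric.isBounded_closedBall (x := (0 : Spacetime)) (r := max (T + 1) (ρ + M))).subset
      fun x hx => ?_
    rw [mem_closedBall_zero_iff]
    refine (norm_le_of_spatial x).trans (max_le_max hx.1 ?_)
    have h1 : spatial x = (hX n).offset x + (hX n).position (x 0) := by
      rw [IsWorldline.offset]; abel
    rw [h1]
    exact (norm_add_le _ _).trans (add_le_add hx.2 (hM _ ⟨_, abs_le.1 hx.1, rfl⟩))
  have hloc : ∀ n, S.IsLocalizer n (ζ n) := fun n =>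
    ⟨hζc n, HasCompactSupport.intro' (Metric.isCompact_of_isClosed_isBounded (hKcl n) (hKb n))
      (hKcl n) fun x hx => hζ0 n x hx, fun k hk s h => by
      have h1 := hζs n h
      have h2 := hsep n k hk.symm _ h1.1 h1.2
      rw [(hX k).offset_eq_zero, norm_zero] at h2
      linarith⟩
  have hθ1 : ∀ x : Spacetime, |x 0| < T → ∀ᶠ y : Spacetime in 𝓝 x, θ (y 0) = 1 := fun x hx => by
    have h1 : Continuous fun x : Spacetime => |x 0| := (continuous_apply 0).abs
    filter_upwards [(isOpen_lt h1 continuous_const).mem_nhds hx] with y hy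
    refine θ.one_of_mem_closedBall ?_
    rw [mem_closedBall_zero_iff]
    exact (show |y 0| < T from hy).le
  have htube : ∀ n x, ρ < ‖(hX n).offset x‖ → ∀ᶠ y in 𝓝 x, (hX n).tube ρ y = 1 := fun n x hx => by
    filter_upwards [(isOpen_lt continuous_const
      (hX n).contDiff_offset.continuous.norm).mem_nhds hx] with y hy
    exact (hX n).tube_eq_one hρ0 (le_of_lt hy)
  refine ⟨fun x => ∏ n, (hX n).tube ρ x, ζ, contDiff_prod fun n _ => (hX n).contDiff_tube ρ,
    fun x hx n s hs => ?_, fun x => ?_, hloc, fun x hx => ?_, fun n s hs => ?_⟩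
  · revert hx
    rw [imp_false, notMem_tsupport_iff_eventuallyEq]
    have h1 := (hX n).notMem_tsupport_tube hρ0 s
    rw [notMem_tsupport_iff_eventuallyEq, ← hs] at h1
    filter_upwards [h1] with y hy
    exact Finset.prod_eq_zero (Finset.mem_univ n) hy
  · rw [Finset.abs_prod]
    exact Finset.prod_le_one (fun _ _ => abs_nonneg _) fun n _ => (hX n).abs_tube_le ρ x
  · by_cases h : ∃ n, ‖(hX n).offset x‖ ≤ ρ
    · obtain ⟨n, hn⟩ := h
      have hxT : |x 0| < T := (hT n x hx (hn.trans hρ1)).trans_lt (hTn n)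
      have h1 : ∀ᶠ y in 𝓝 x, ∀ k, k ≠ n → (hX k).tube ρ y = 1 := by
        refine eventually_all.2 fun k => ?_
        by_cases hk : k = n
        · exact Eventually.of_forall fun y h => absurd hk h
        · filter_upwards [htube k x (hsep n k (Ne.symm hk) x (by linarith) hn)] with y hy _
          exact hy
      filter_upwards [h1, hθ1 x hxT] with y hy hy1
      rw [Finset.prod_eq_single n (fun k _ hk => hy k hk) (by simp),
        Finset.sum_eq_single n (fun k _ hk => by simp [hζ, hy k hk]) (by simp)]
      simp [hζ, hy1]
    · push Not at h
      filter_upwards [eventually_all.2 fun n => htube n x (h n)] with y hy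
      rw [Finset.prod_eq_one fun n _ => hy n, Finset.sum_eq_zero fun n _ => by simp [hζ, hy n],
        add_zero]
  · have hxT : |S.worldline n s 0| < T := (hT n _ hs (by
      rw [(hX n).offset_eq_zero, norm_zero]; exact zero_le_one)).trans_lt (hTn n)
    have h1 := (hX n).notMem_tsupport_tube hρ0 s
    rw [notMem_tsupport_iff_eventuallyEq] at h1
    filter_upwards [h1, hθ1 _ hxT] with y hy hy1
    simp only [hζ, hy, hy1]
    simp

end System

/-! ### The energy-momentum at large distances -/

lemma isClosed_cutoff {N : ℕ} (z : Fin N → Space) (r : ℝ) : IsClosed (cutoff z r) := by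
  have h : cutoff z r = ⋂ n, {x | r ≤ ‖x - z n‖} := by ext x; simp [cutoff]
  rw [h]
  exact isClosed_iInter fun n => isClosed_le continuous_const (by fun_prop)

/-- A smooth function which is `1` in the ball of radius `R` in space-time, and `0` outside of the
ball of radius `2 R`. -/
def bigBump (R : ℝ) (x : Spacetime) : ℝ :=
  (⟨1, 2, one_pos, one_lt_two⟩ : ContDiffBump (0 : Spacetime)) (R⁻¹ • x)

lemma contDiff_bigBump (R : ℝ) : ContDiff ℝ 1 (bigBump R) :=
  (ContDiffBump.contDiff _).comp (contDiff_const_smul R⁻¹)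

lemma bigBump_eq_one {R : ℝ} (hR : 0 < R) {x : Spacetime} (hx : ‖x‖ ≤ R) : bigBump R x = 1 := by
  refine ContDiffBump.one_of_mem_closedBall _ ?_
  rw [mem_closedBall_zero_iff, norm_smul, norm_inv, Real.norm_of_nonneg hR.le,
    inv_mul_le_iff₀ hR, mul_one]
  exact hx

lemma bigBump_eq_zero {R : ℝ} (hR : 0 < R) {x : Spacetime} (hx : 2 * R ≤ ‖x‖) :
    bigBump R x = 0 := by
  refine ContDiffBump.zero_of_le_dist _ ?_
  rw [dist_zero_right, norm_smul, norm_inv, Real.norm_of_nonneg hR.le, le_inv_mul_iff₀ hR, mul_comm]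
  exact hx

lemma abs_bigBump_le (R : ℝ) (x : Spacetime) : |bigBump R x| ≤ 1 := by
  rw [bigBump, abs_of_nonneg (ContDiffBump.nonneg' _ _)]
  exact ContDiffBump.le_one _

lemma hasCompactSupport_bigBump {R : ℝ} (hR : 0 < R) : HasCompactSupport (bigBump R) :=
  HasCompactSupport.intro (isCompact_closedBall (0 : Spacetime) (2 * R)) fun x hx =>
    bigBump_eq_zero hR (by
      rw [mem_closedBall_zero_iff, not_le] at hx
      exact hx.le)

lemma bigBump_eventuallyEq_one {R : ℝ} (hR : 0 < R) {x : Spacetime} (hx : ‖x‖ < R) :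
    bigBump R =ᶠ[𝓝 x] fun _ => 1 := by
  filter_upwards [(isOpen_lt continuous_norm continuous_const).mem_nhds hx] with y hy
  exact bigBump_eq_one hR (le_of_lt hy)

lemma exists_partialDeriv_bigBump_le : ∃ M > 0, ∀ R, 0 < R → ∀ ν x,
    |partialDeriv ν (bigBump R) x| ≤ M * R⁻¹ := by
  set f : ContDiffBump (0 : Spacetime) := ⟨1, 2, one_pos, one_lt_two⟩ with hf
  have hc : Continuous (fderiv ℝ f) := (f.contDiff (n := 1)).continuous_fderiv one_ne_zero
  obtain ⟨M, hM⟩ := hc.bounded_above_of_compact_support (f.hasCompactSupport.fderiv (𝕜 := ℝ))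
  refine ⟨max M 1, lt_max_of_lt_right one_pos, fun R hR ν x => ?_⟩
  have h1 : HasFDerivAt (fun x : Spacetime => R⁻¹ • x)
      (R⁻¹ • ContinuousLinearMap.id ℝ Spacetime) x :=
    (hasFDerivAt_id x).const_smul R⁻¹
  have h2 : HasFDerivAt f (fderiv ℝ f (R⁻¹ • x)) (R⁻¹ • x) :=
    ((f.contDiff (n := 1)).differentiable one_ne_zero _).hasFDerivAt
  have h3 : HasFDerivAt (bigBump R) _ x := HasFDerivAt.comp (g := f) x h2 h1
  rw [partialDeriv, h3.fderiv]
  simp only [ContinuousLinearMap.comp_apply, smul_apply, map_smul, smul_eq_mul,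
    ContinuousLinearMap.id_apply]
  rw [abs_mul, abs_of_pos (inv_pos.2 hR), mul_comm]
  refine mul_le_mul_of_nonneg_right ?_ (inv_pos.2 hR).le
  refine (((fderiv ℝ f (R⁻¹ • x)).le_opNorm _).trans ?_)
  have h4 : ‖(Pi.single ν 1 : Spacetime)‖ ≤ 1 := by simp [Pi.norm_single]
  calc ‖fderiv ℝ f (R⁻¹ • x)‖ * ‖(Pi.single ν 1 : Spacetime)‖ ≤ max M 1 * 1 :=
        mul_le_mul ((hM _).trans (le_max_left _ _)) h4 (norm_nonneg _)
          (zero_le_one.trans (le_max_right _ _))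
    _ = max M 1 := mul_one _

namespace System

variable {N : ℕ} {S : System N} {L : Matrix (Fin 4) (Fin 4) ℝ}

/-- No energy-momentum escapes to infinity between two simultaneity planes. -/
lemma VanishesAtInfinity.tendsto_integral_bigBump (hinf : S.VanishesAtInfinity) (hL : IsLorentz L)
    (a : Spacetime) (t' t : ℝ) (β : Fin 4) :
    Tendsto (fun R => ∫ x, slab L a t' t x * S.exchange β (bigBump R) x) atTop (𝓝 0) := by
  obtain ⟨v, hv0, hv1, hv⟩ := hL.exists_slope
  obtain ⟨ε, C, ρ, hε, hb⟩ := hinf ((1 + v) / 2) (by linarith) (by linarith)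
  obtain ⟨M, hM, hMb⟩ := exists_partialDeriv_bigBump_le
  set c := |t| + |t' - a 0| with hc
  have hc0 : 0 ≤ c := by positivity
  have h1v : 0 < 1 - v := by linarith
  -- the region between the planes, outside of the ball of radius `R`
  have hreg : ∀ R, 2 * c ≤ R → 2 * ρ ≤ R → 4 * c / (1 - v) ≤ R → 0 < R → ∀ x,
      slab L a t' t x ≠ 0 → R ≤ ‖x‖ → ∀ μ ν,
      |energyMomentum (S.field x) μ ν| ≤ |C| * (R / 2) ^ (-3 - ε) :=
      fun R h1 h2 h3 hR x hx hxR μ ν => by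
    have h4 := hv x t (t' - a 0) (by
      have := of_slab_ne_zero hx
      rw [Pi.add_apply] at this
      linarith)
    rw [div_le_iff₀ h1v] at h3
    have h5 : R / 2 ≤ ‖spatial x‖ := by
      have h6 := hxR.trans (norm_le_of_spatial x)
      rcases le_max_iff.1 h6 with h6 | h6
      · nlinarith [norm_nonneg (spatial x)]
      · linarith
    have h7 := hb (x 0) (spatial x) (by linarith) (by nlinarith) μ ν
    rw [event_spatial] at h7
    refine h7.trans ?_
    have h8 : ‖spatial x‖ ^ (-3 - ε) ≤ (R / 2) ^ (-3 - ε) :=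
      Real.rpow_le_rpow_of_nonpos (by positivity) h5 (by linarith)
    calc C * ‖spatial x‖ ^ (-3 - ε) ≤ |C| * ‖spatial x‖ ^ (-3 - ε) := by
          gcongr; exact le_abs_self C
      _ ≤ _ := by gcongr
  have hbound : ∀ᶠ R : ℝ in atTop, ‖∫ x, slab L a t' t x * S.exchange β (bigBump R) x‖ ≤
      8192 * |C| * M * (R / 2) ^ (-ε) := by
    filter_upwards [eventually_ge_atTop (2 * c), eventually_ge_atTop (2 * ρ),
      eventually_ge_atTop (4 * c / (1 - v)), eventually_gt_atTop 0] with R h1 h2 h3 hR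
    have hpt : ∀ x, ‖slab L a t' t x * S.exchange β (bigBump R) x‖ ≤
        4 * (|C| * (R / 2) ^ (-3 - ε) * (M * R⁻¹)) := fun x => by
      have hnn : 0 ≤ 4 * (|C| * (R / 2) ^ (-3 - ε) * (M * R⁻¹)) := by positivity
      by_cases hx : slab L a t' t x = 0
      · rw [hx, zero_mul, norm_zero]; exact hnn
      by_cases hxR : ‖x‖ < R
      · rw [exchange_eq_zero (bigBump_eventuallyEq_one hR hxR), mul_zero, norm_zero]; exact hnn
      rw [norm_mul]
      have h4 : ‖S.exchange β (bigBump R) x‖ ≤ 4 * (|C| * (R / 2) ^ (-3 - ε) * (M * R⁻¹)) := by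
        refine (norm_sum_le _ _).trans ((Finset.sum_le_sum fun ν _ => (norm_mul_le _ _).trans
          (mul_le_mul (hreg R h1 h2 h3 hR x hx (not_lt.1 hxR) ν β) (hMb R hR ν x) (norm_nonneg _)
            (by positivity))).trans ?_)
        simp
      calc ‖slab L a t' t x‖ * ‖S.exchange β (bigBump R) x‖
          ≤ 1 * (4 * (|C| * (R / 2) ^ (-3 - ε) * (M * R⁻¹))) :=
            mul_le_mul (abs_slab_le _ _ _ _) h4 (norm_nonneg _) zero_le_one
        _ = _ := one_mul _
    have hz : ∀ x ∉ Metric.closedBall (0 : Spacetime) (2 * R),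
        slab L a t' t x * S.exchange β (bigBump R) x = 0 := fun x hx => by
      rw [mem_closedBall_zero_iff, not_le] at hx
      have h4 : bigBump R =ᶠ[𝓝 x] fun _ => 0 := by
        filter_upwards [(isOpen_lt continuous_const continuous_norm).mem_nhds hx] with y hy
        exact bigBump_eq_zero hR (le_of_lt hy)
      rw [exchange_eq_zero h4, mul_zero]
    rw [← setIntegral_eq_integral_of_forall_compl_eq_zero hz]
    refine (norm_setIntegral_le_of_norm_le_const measure_closedBall_lt_top
      fun x _ => hpt x).trans_eq ?_
    rw [Measure.real, Real.volume_pi_closedBall _ (by positivity),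
      ENNReal.toReal_ofReal (by positivity), Fintype.card_fin, sub_eq_add_neg,
      add_comm, Real.rpow_add (by positivity), Real.rpow_neg (by positivity) 3]
    norm_num
    field_simp
    ring
  refine squeeze_zero_norm' hbound ?_
  have h1 : Tendsto (fun R : ℝ => (R / 2) ^ (-ε)) atTop (𝓝 0) :=
    (tendsto_rpow_neg_atTop hε).comp (tendsto_id.atTop_div_const two_pos)
  simpa using h1.const_mul (8192 * |C| * M)

/-- The renormalized energy-momentum in a simultaneity plane, computed with a partition of unity. -/
lemma IsRegular.hasRIntegral_fluxDensity (hreg : S.IsRegular) (hinf : S.VanishesAtInfinity)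
    (hL : IsLorentz L) {a : Spacetime} {t' : ℝ} {ψ : Spacetime → ℝ} {ζ : Fin N → Spacetime → ℝ}
    (hψ : Continuous ψ) (hψv : tsupport ψ ⊆ S.vacuum) (hψ1 : ∀ x, |ψ x| ≤ 1)
    (hζ : ∀ n, S.IsLocalizer n (ζ n))
    (hsum : ∀ x, ψ (frameEvent L a t' x) + ∑ n, ζ n (frameEvent L a t' x) = 1)
    {s : Fin N → ℝ} {z : Fin N → Space} (hz : ∀ n, frameEvent L a t' (z n) = S.worldline n (s n))
    {β : Fin 4} {b : Fin N → ℝ} (hb : ∀ n, S.HasLocalFlux L a t' β (ζ n) (z n) (b n)) :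
    Integrable (fun x => S.fluxDensity L a t' β x * ψ (frameEvent L a t' x)) ∧
    HasRIntegral z (S.fluxDensity L a t' β)
      (∑ n, b n + ∫ x, S.fluxDensity L a t' β x * ψ (frameEvent L a t' x)) := by
  have hfe := continuous_frameEvent L a t'
  obtain ⟨ε, C, R, hε, hR, hdec⟩ := hinf.fluxDensity_le hL a t'
  have hI : ∀ r, 0 < r → IntegrableOn (S.fluxDensity L a t' β) (cutoff z r) := fun r hr => by
    refine integrableOn_of_decay (isClosed_cutoff z r)
      ((hreg.continuousOn_fluxDensity L a t' β).mono fun x hx k c => ?_) hε hR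
      fun x hxR => hdec x hxR β
    refine hreg.frameEvent_ne hL (hz k) (fun h => ?_) c
    have := hx k
    rw [h, sub_self, norm_zero] at this
    linarith
  -- in small balls around the particles, the cutoff functions around the others vanish
  obtain ⟨r₀, hr₀, hψ0, hζ0⟩ : ∃ r₀ > 0, (∀ n x, ‖x - z n‖ < r₀ → ψ (frameEvent L a t' x) = 0) ∧
      ∀ n k, k ≠ n → ∀ x, ‖x - z k‖ < r₀ → ζ n (frameEvent L a t' x) = 0 := by
    have h1 : ∀ (f : Spacetime → ℝ) k, S.worldline k (s k) ∉ tsupport f →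
        ∀ᶠ r in 𝓝[>] (0 : ℝ), ∀ x, ‖x - z k‖ < r → f (frameEvent L a t' x) = 0 := fun f k hf => by
      have h2 : ∀ᶠ x in 𝓝 (z k), frameEvent L a t' x ∉ tsupport f :=
        (hfe.tendsto (z k)).eventually ((isClosed_tsupport f).isOpen_compl.mem_nhds (by
          rw [hz k]; exact hf))
      obtain ⟨r, hr, h⟩ := Metric.eventually_nhds_iff.1 h2
      filter_upwards [eventually_pos_lt hr] with r' hr' x hx
      exact image_eq_zero_of_notMem_tsupport (h (by rw [dist_eq_norm]; exact hx.trans hr'.2))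
    have h2 : ∀ᶠ r in 𝓝[>] (0 : ℝ), ∀ n x, ‖x - z n‖ < r → ψ (frameEvent L a t' x) = 0 :=
      eventually_all.2 fun n => h1 ψ n fun h => hψv h n (s n) rfl
    have h3 : ∀ᶠ r in 𝓝[>] (0 : ℝ), ∀ n k, k ≠ n → ∀ x, ‖x - z k‖ < r →
        ζ n (frameEvent L a t' x) = 0 := by
      refine eventually_all.2 fun n => eventually_all.2 fun k => ?_
      by_cases hk : k = n
      · exact Eventually.of_forall fun r h => absurd hk h
      · exact (h1 (ζ n) k ((hζ n).avoids k hk (s k))).mono fun r hr _ => hr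
    obtain ⟨r, hr, hr'⟩ := ((h2.and h3).and self_mem_nhdsWithin).exists
    exact ⟨r, hr', hr.1, hr.2⟩
  have hψI : ∀ r, 0 < r → IntegrableOn
      (fun x => S.fluxDensity L a t' β x * ψ (frameEvent L a t' x)) (cutoff z r) := fun r hr =>
    (hI r hr).mul_bdd (c := 1) (hψ.comp hfe).aestronglyMeasurable (ae_of_all _ fun x => hψ1 _)
  have hψz : ∀ r, r < r₀ → ∀ x ∉ cutoff z r,
      S.fluxDensity L a t' β x * ψ (frameEvent L a t' x) = 0 := fun r hr x hx => by
    have h1 : ∃ n, ‖x - z n‖ < r := by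
      by_contra! h; exact hx h
    obtain ⟨n, hn⟩ := h1
    rw [hψ0 n x (hn.trans hr), mul_zero]
  refine ⟨(hψI (r₀ / 2) (by positivity)).integrable_of_forall_notMem_eq_zero
    (hψz _ (by linarith)), hI, ?_⟩
  refine ((HasRLim.sum Finset.univ fun n _ => hb n).add (hasRLim_const _)).congr ?_
  filter_upwards [eventually_pos_lt hr₀] with r hr
  have hζI : ∀ n, IntegrableOn (fun x => S.fluxDensity L a t' β x * ζ n (frameEvent L a t' x))
      (cutoff z r) := fun n =>
    ((hζ n).integrableOn hreg hL (hz n) β hr.1).mono_set fun x hx => hx n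
  have e1 : ∀ x, S.fluxDensity L a t' β x = (∑ n, S.fluxDensity L a t' β x *
      ζ n (frameEvent L a t' x)) + S.fluxDensity L a t' β x * ψ (frameEvent L a t' x) := fun x => by
    rw [← Finset.mul_sum, ← mul_add, add_comm, hsum, mul_one]
  have e2 : ∫ x in cutoff z r, S.fluxDensity L a t' β x = ∫ x in cutoff z r,
      ((∑ n, S.fluxDensity L a t' β x * ζ n (frameEvent L a t' x)) +
        S.fluxDensity L a t' β x * ψ (frameEvent L a t' x)) :=
    integral_congr_ae (ae_of_all _ e1)
  rw [e2, integral_add (integrable_finsetSum _ fun n _ => hζI n) (hψI r hr.1),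
    integral_finsetSum _ fun n _ => hζI n,
    setIntegral_eq_integral_of_forall_compl_eq_zero (hψz r hr.2)]
  congr 1
  refine Finset.sum_congr rfl fun n _ => ?_
  refine setIntegral_eq_of_subset_of_forall_sdiff_eq_zero
    (isClosed_le continuous_const (by fun_prop)).measurableSet (fun x hx => hx n) fun x hx => ?_
  have h1 : ∃ k, ‖x - z k‖ < r := by
    by_contra! h; exact hx.2 h
  obtain ⟨k, hk⟩ := h1
  have hkn : k ≠ n := by
    rintro rfl
    exact absurd hx.1 (not_le.2 hk)
  rw [hζ0 n k hkn x (hk.trans hr.2), mul_zero]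

lemma exchange_one_sub_sum {ζ : Fin N → Spacetime → ℝ} (hζ : ∀ n, ContDiff ℝ 1 (ζ n)) (β : Fin 4)
    (x : Spacetime) : S.exchange β (fun y => 1 - ∑ n, ζ n y) x = -∑ n, S.exchange β (ζ n) x := by
  have h1 : ∀ ν, partialDeriv ν (fun y => 1 - ∑ n, ζ n y) x = -∑ n, partialDeriv ν (ζ n) x :=
    fun ν => by
    have h2 : HasFDerivAt (fun y => 1 - ∑ n, ζ n y) (-∑ n, fderiv ℝ (ζ n) x) x :=
      (HasFDerivAt.fun_sum fun n _ =>
        ((hζ n).differentiable one_ne_zero x).hasFDerivAt).const_sub 1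
    rw [partialDeriv, h2.fderiv]
    simp [partialDeriv]
  simp only [exchange, h1, mul_neg, Finset.sum_neg_distrib, Finset.mul_sum]
  rw [Finset.sum_comm]

/-- Away from the particles, the difference of the energy-momentum in two simultaneity planes is the
exchange with the neighbourhoods of the particles. -/
theorem Maxwell.integral_sub_integral (hreg : S.IsRegular) (hmax : S.Maxwell)
    (hinf : S.VanishesAtInfinity) (hL : IsLorentz L) (a : Spacetime) (t' t : ℝ) {ψ : Spacetime → ℝ}
    {ζ : Fin N → Spacetime → ℝ} (hψ : ContDiff ℝ 1 ψ) (hψv : tsupport ψ ⊆ S.vacuum)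
    (hζ : ∀ n, S.IsLocalizer n (ζ n))
    (hsum : ∀ x ∈ wedgeRegion L a t' t, ∀ᶠ y in 𝓝 x, ψ y + ∑ n, ζ n y = 1) {β : Fin 4}
    (hI' : Integrable fun x => S.fluxDensity L a t' β x * ψ (frameEvent L a t' x))
    (hI : Integrable fun x => S.fluxDensity 1 0 t β x * ψ (frameEvent 1 0 t x))
    (hIζ : ∀ n, Integrable fun x => slab L a t' t x * S.exchange β (ζ n) x) :
    (∫ x, S.fluxDensity L a t' β x * ψ (frameEvent L a t' x)) -
      (∫ x, S.fluxDensity 1 0 t β x * ψ (frameEvent 1 0 t x)) =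
    -∑ n, ∫ x, slab L a t' t x * S.exchange β (ζ n) x := by
  have hlim : ∀ (M : Matrix (Fin 4) (Fin 4) ℝ) (d : Spacetime) (τ : ℝ),
      Integrable (fun x => S.fluxDensity M d τ β x * ψ (frameEvent M d τ x)) →
      Tendsto (fun R => ∫ x, S.fluxDensity M d τ β x *
        (ψ (frameEvent M d τ x) * bigBump R (frameEvent M d τ x))) atTop
        (𝓝 (∫ x, S.fluxDensity M d τ β x * ψ (frameEvent M d τ x))) := fun M d τ h => by
    simp only [← mul_assoc]
    refine tendsto_integral_filter_of_dominated_convergence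
      (fun x => ‖S.fluxDensity M d τ β x * ψ (frameEvent M d τ x)‖)
      (Eventually.of_forall fun R => h.aestronglyMeasurable.mul
        ((contDiff_bigBump R).continuous.comp (continuous_frameEvent M d τ)).aestronglyMeasurable)
      (Eventually.of_forall fun R => ae_of_all _ fun x => ?_) h.norm (ae_of_all _ fun x => ?_)
    · rw [norm_mul]
      exact mul_le_of_le_one_right (norm_nonneg _) (abs_bigBump_le R _)
    · refine tendsto_const_nhds.congr' ?_
      filter_upwards [eventually_gt_atTop 0, eventually_ge_atTop ‖frameEvent M d τ x‖] with R hR hxR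
      rw [bigBump_eq_one hR hxR, mul_one]
  have hζR : ∀ᶠ R : ℝ in atTop, ∀ n, ∀ x ∈ tsupport (ζ n), ‖x‖ < R := eventually_all.2 fun n => by
    obtain ⟨B, hB⟩ := (hζ n).compact.isBounded.exists_norm_le
    filter_upwards [eventually_gt_atTop B] with R hR x hx
    exact (hB x hx).trans_lt hR
  have hbal : ∀ᶠ R : ℝ in atTop, (∫ x, slab L a t' t x * S.exchange β (bigBump R) x) +
      -(∑ n, ∫ x, slab L a t' t x * S.exchange β (ζ n) x) =
      (∫ x, S.fluxDensity L a t' β x *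
        (ψ (frameEvent L a t' x) * bigBump R (frameEvent L a t' x))) -
      ∫ x, S.fluxDensity 1 0 t β x * (ψ (frameEvent 1 0 t x) * bigBump R (frameEvent 1 0 t x)) := by
    filter_upwards [hζR, eventually_gt_atTop 0] with R hR hR0
    have hpt : ∀ x, slab L a t' t x * S.exchange β (fun y => ψ y * bigBump R y) x =
        slab L a t' t x * S.exchange β (bigBump R) x +
          -∑ n, slab L a t' t x * S.exchange β (ζ n) x := fun x => by
      by_cases hx : slab L a t' t x = 0
      · simp [hx]
      have hxW : x ∈ wedgeRegion L a t' t := of_slab_ne_zero hx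
      rw [← Finset.mul_sum, ← mul_neg, ← mul_add]
      congr 1
      by_cases hxR : ‖x‖ < R
      · have h1 := bigBump_eventuallyEq_one hR0 hxR
        have h2 : (fun y => ψ y * bigBump R y) =ᶠ[𝓝 x] fun y => 1 - ∑ n, ζ n y := by
          filter_upwards [h1, hsum x hxW] with y hy1 hy2
          rw [hy1, mul_one]; linarith
        rw [exchange_eq_zero h1, zero_add, exchange_congr h2,
          exchange_one_sub_sum fun n => (hζ n).contDiff]
      · have h1 : ∀ n, ζ n =ᶠ[𝓝 x] fun _ => 0 := fun n =>
          notMem_tsupport_iff_eventuallyEq.1 fun h => hxR (hR n x h)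
        have h2 : (fun y => ψ y * bigBump R y) =ᶠ[𝓝 x] bigBump R := by
          filter_upwards [eventually_all.2 h1, hsum x hxW] with y hy1 hy2
          rw [Finset.sum_eq_zero fun n _ => hy1 n, add_zero] at hy2
          rw [hy2, one_mul]
        rw [exchange_congr h2, Finset.sum_eq_zero fun n _ => exchange_eq_zero (h1 n) β, neg_zero,
          add_zero]
    obtain ⟨i1, e1⟩ := hmax.integral_slab_mul_exchange hreg hL a
      (hψ.mul (contDiff_bigBump R)) (hasCompactSupport_bigBump hR0).mul_left
      ((closure_mono fun x hx => left_ne_zero_of_mul hx : tsupport (fun x => ψ x * bigBump R x) ⊆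
        tsupport ψ).trans hψv) t' t β
    have i2 : Integrable fun x => ∑ n, slab L a t' t x * S.exchange β (ζ n) x :=
      integrable_finsetSum _ fun n _ => hIζ n
    have i3 : Integrable fun x => slab L a t' t x * S.exchange β (bigBump R) x :=
      (i1.add i2).congr (ae_of_all _ fun x => by simp only [Pi.add_apply, hpt x]; ring)
    have i4 : Integrable fun x => -∑ n, slab L a t' t x * S.exchange β (ζ n) x := i2.neg
    rw [← e1, integral_congr_ae (ae_of_all _ hpt), integral_add i3 i4, integral_neg,
      integral_finsetSum _ fun n _ => hIζ n]
  have h1 := (hlim L a t' hI').sub (hlim 1 0 t hI)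
  have h2 := ((hinf.tendsto_integral_bigBump hL a t' t β).add_const
    (-(∑ n, ∫ x, slab L a t' t x * S.exchange β (ζ n) x))).congr' hbal
  rw [zero_add] at h2
  exact tendsto_nhds_unique h1 h2

end System

variable {N : ℕ} {L : Matrix (Fin 4) (Fin 4) ℝ}

/-! ### Change of the inertial frame -/

lemma energyMomentum_eq (F : Matrix (Fin 4) (Fin 4) ℝ) (μ ν : Fin 4) :
    energyMomentum F μ ν = (F * metric * Fᵀ - (1 / 4 * (F * metric * Fᵀ * metric).trace) • metric)
      μ ν := by
  have hg : metricᵀ = metric := by simp [metric]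
  have h1 : ∑ κ, F μ κ * (F * metric) ν κ = (F * metric * Fᵀ) μ ν := by
    have : F * metric * Fᵀ = F * (F * metric)ᵀ := by
      rw [Matrix.transpose_mul, hg, Matrix.mul_assoc]
    rw [this, Matrix.mul_apply]
    rfl
  have h2 : ∑ α, ∑ β, F α β * (metric * F * metric) α β = (F * metric * Fᵀ * metric).trace := by
    have : F * metric * Fᵀ * metric = F * (metric * F * metric)ᵀ := by
      rw [Matrix.transpose_mul, Matrix.transpose_mul, hg]; simp only [Matrix.mul_assoc]
    rw [this, Matrix.trace]
    simp only [Matrix.diag_apply, Matrix.mul_apply (M := F), Matrix.transpose_apply]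
  rw [energyMomentum, h1, h2, Matrix.sub_apply, Matrix.smul_apply, smul_eq_mul]
  ring

lemma IsLorentz.energyMomentum_conj (hL : IsLorentz L) (F : Matrix (Fin 4) (Fin 4) ℝ)
    (μ ν : Fin 4) : energyMomentum (L * F * Lᵀ) μ ν =
      ∑ β, L ν β * ∑ α, L μ α * energyMomentum F α β := by
  have h1 : L * F * Lᵀ * metric * (L * F * Lᵀ)ᵀ = L * (F * metric * Fᵀ) * Lᵀ := by
    calc L * F * Lᵀ * metric * (L * F * Lᵀ)ᵀ = L * F * (Lᵀ * metric * L) * Fᵀ * Lᵀ := by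
          simp only [Matrix.transpose_mul, Matrix.transpose_transpose, Matrix.mul_assoc]
      _ = _ := by rw [hL.1]; simp only [Matrix.mul_assoc]
  have h2 : (L * (F * metric * Fᵀ) * Lᵀ * metric).trace = (F * metric * Fᵀ * metric).trace := by
    rw [Matrix.mul_assoc, Matrix.mul_assoc, Matrix.trace_mul_comm, Matrix.mul_assoc, hL.1]
  have h3 : ∀ G : Matrix (Fin 4) (Fin 4) ℝ, (L * G * Lᵀ) μ ν = ∑ β, L ν β * ∑ α, L μ α * G α β :=
    fun G => by
    simp only [Matrix.mul_apply, Matrix.transpose_apply]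
    exact Finset.sum_congr rfl fun β _ => mul_comm _ _
  simp only [energyMomentum_eq F]
  rw [← h3, energyMomentum_eq, h1, h2, Matrix.mul_sub, Matrix.sub_mul, Matrix.mul_smul,
    Matrix.smul_mul, hL.mul_metric_mul_transpose]

lemma IsLorentz.fourVelocity_transform (hL : IsLorentz L) {X : ℝ → Spacetime} (hX : IsWorldline X)
    (a : Spacetime) (s : ℝ) : fourVelocity (fun s => L *ᵥ X s + a) s = L *ᵥ fourVelocity X s := by
  have h1 : deriv (fun s => L *ᵥ X s + a) s = L *ᵥ deriv X s := by
    have h2 := (LinearMap.toContinuousLinearMap (Matrix.toLin' L)).hasFDerivAt.comp_hasDerivAt s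
      (hX.smooth.differentiable (by simp) s).hasDerivAt
    simpa using (h2.add_const a).deriv
  simp only [fourVelocity, properRate, h1, hL.mdot_mulVec, Matrix.mulVec_smul]

lemma HasRIntegral.const_mul {z : Fin N → Space} {G : Space → ℝ} {b : ℝ} (h : HasRIntegral z G b)
    (c : ℝ) : HasRIntegral z (fun x => c * G x) (c * b) := by
  refine ⟨fun r hr => (h.1 r hr).const_mul c, ?_⟩
  simp only [integral_const_mul]
  exact h.2.const_mul c

lemma HasRIntegral.sum {ι : Type*} {z : Fin N → Space} {G : ι → Space → ℝ} {b : ι → ℝ}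
    (u : Finset ι) (h : ∀ i ∈ u, HasRIntegral z (G i) (b i)) :
    HasRIntegral z (fun x => ∑ i ∈ u, G i x) (∑ i ∈ u, b i) := by
  refine ⟨fun r hr => integrable_finsetSum _ fun i hi => (h i hi).1 r hr,
    (HasRLim.sum u fun i hi => (h i hi).2).congr ?_⟩
  filter_upwards [self_mem_nhdsWithin] with r hr
  exact (integral_finsetSum _ fun i hi => (h i hi).1 r hr).symm

namespace System

variable {S : System N}

/-- The field momentum in another frame, in terms of the flux of energy-momentum through the
simultaneity planes of that frame. -/
lemma IsLorentz.hasRIntegral_transform (hL : IsLorentz L) (a : Spacetime) {t' : ℝ}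
    {z : Fin N → Space} {Q : Spacetime} (h : ∀ β, HasRIntegral z (S.fluxDensity L a t' β) (Q β))
    (μ : Fin 4) : HasRIntegral z
      (fun x => energyMomentum ((S.transform L a).field (event t' x)) 0 μ) ((L *ᵥ Q) μ) := by
  have h1 := HasRIntegral.sum Finset.univ fun β _ => (h β).const_mul (L μ β)
  have h2 : (fun x => energyMomentum ((S.transform L a).field (event t' x)) 0 μ) =
      fun x => ∑ β, L μ β * S.fluxDensity L a t' β x :=
    funext fun x => hL.energyMomentum_conj _ 0 μ
  rw [h2]
  exact h1

/-- The renormalized energy-momenta in a plane `x⁰ = t` and in a simultaneity plane of another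
frame exist, and differ by the change of the momenta `m u` of the particles, if each particle
either crosses both planes in the same event or satisfies its equation of motion. -/
theorem IsRegular.exists_hasRIntegral_fluxDensity (hreg : S.IsRegular) (hmax : S.Maxwell)
    (hinf : S.VanishesAtInfinity) (hL : IsLorentz L) (a : Spacetime) {t' t : ℝ} {s' s : Fin N → ℝ}
    (hs' : ∀ n, (L *ᵥ S.worldline n (s' n) + a) 0 = t') (hs : S.AtTime t s)
    (hmot : ∀ n, s' n = s n ∨ ∀ s, ∃ F, S.HasRenormalizedField n s F ∧
      S.mass n • fourAcceleration (S.worldline n) s =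
        S.charge n • (F *ᵥ (metric *ᵥ fourVelocity (S.worldline n) s))) :
    ∃ Q Q' : Spacetime,
      (∀ β, HasRIntegral (fun n => spatial (S.worldline n (s n))) (S.fluxDensity 1 0 t β) (Q β)) ∧
      (∀ β, HasRIntegral (fun n => spatial (L *ᵥ S.worldline n (s' n) + a))
        (S.fluxDensity L a t' β) (Q' β)) ∧
      Q' + ∑ n, S.mass n • fourVelocity (S.worldline n) (s' n) =
        Q + ∑ n, S.mass n • fourVelocity (S.worldline n) (s n) := by
  obtain ⟨ψ, ζ, hψ, hψv, hψ1, hζ, hsum, h1⟩ := hreg.exists_partition hL a t' t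
  have hz' : ∀ n, frameEvent L a t' (spatial (L *ᵥ S.worldline n (s' n) + a)) =
      S.worldline n (s' n) := fun n => (hL.frameEvent_eq_iff a).2 ⟨hs' n, rfl⟩
  have hz : ∀ n, frameEvent 1 0 t (spatial (S.worldline n (s n))) = S.worldline n (s n) :=
    fun n => by rw [← hs n]; exact IsWorldline.frameEvent_time _ _
  choose b hb using fun n β => (hζ n).exists_hasLocalFlux hreg isLorentz_one (hz n)
    (h1 n (s n) (by rw [← hz n]; exact event_mem_wedgeRegion a t' t _)) β
  choose b' hb' using fun n β => (hζ n).exists_hasLocalFlux hreg hL (hz' n)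
    (h1 n (s' n) (by rw [← hz' n]; exact frameEvent_mem_wedgeRegion hL a t' t _)) β
  have hQ := fun β => hreg.hasRIntegral_fluxDensity hinf isLorentz_one hψ.continuous hψv hψ1 hζ
    (fun x => (hsum _ (event_mem_wedgeRegion a t' t x)).self_of_nhds) hz fun n => hb n β
  have hQ' := fun β => hreg.hasRIntegral_fluxDensity hinf hL hψ.continuous hψv hψ1 hζ
    (fun x => (hsum _ (frameEvent_mem_wedgeRegion hL a t' t x)).self_of_nhds) hz' fun n => hb' n β
  refine ⟨_, _, fun β => (hQ β).2, fun β => (hQ' β).2, ?_⟩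
  ext β
  have hloc := fun n => (hζ n).sub_eq hreg hmax hL a (hs' n) (hs n) (hmot n) (h1 n) (hz' n)
    (hb n β) (hb' n β)
  have hext := hmax.integral_sub_integral hreg hinf hL a t' t hψ hψv hζ hsum (hQ' β).1 (hQ β).1
    fun n => (hloc n).1
  have hsumloc := Finset.sum_congr rfl fun n (_ : n ∈ Finset.univ) => (hloc n).2
  simp only [Finset.sum_sub_distrib, mul_sub] at hsumloc
  simp only [Pi.add_apply, Finset.sum_apply, Pi.smul_apply, smul_eq_mul]
  linarith

lemma IsRegular.exists_atTime (hreg : S.IsRegular) (hL : IsLorentz L) (a : Spacetime) (t' : ℝ) :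
    ∃ s : Fin N → ℝ, ∀ n, (L *ᵥ S.worldline n (s n) + a) 0 = t' := by
  choose s hs using fun n => ((hreg.worldlines n).transform hL a).inextendible t'
  exact ⟨s, hs⟩

lemma hasFieldMomentum_of_fluxDensity {t : ℝ} {s : Fin N → ℝ} (hs : S.AtTime t s) {Q : Spacetime}
    (h : ∀ β, HasRIntegral (fun n => spatial (S.worldline n (s n))) (S.fluxDensity 1 0 t β) (Q β)) :
    S.HasFieldMomentum t Q := by
  refine ⟨s, hs, fun μ => ?_⟩
  convert h μ using 1
  ext x
  simp [fluxDensity, frameEvent_one, Matrix.one_apply]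

end System

end PointCharges

end

open PointCharges System in
theorem theorem2 {N : ℕ} (S : PointCharges.System N) (hreg : S.IsRegular) (hmax : S.Maxwell)
    (hinf : S.VanishesAtInfinity) :
    (N = 1 → ∀ (n : Fin N) (s : ℝ),
      (∃ Pem : PointCharges.Spacetime, S.HasFieldMomentum (S.worldline n s 0) Pem ∧
        ∀ (L : Matrix (Fin 4) (Fin 4) ℝ) (a : PointCharges.Spacetime),
          PointCharges.IsLorentz L →
          (S.transform L a).HasFieldMomentum ((S.transform L a).worldline n s 0) (L *ᵥ Pem)) ∧
      (∃ P : PointCharges.Spacetime, S.HasTotalMomentum (S.worldline n s 0) P ∧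
        ∀ (L : Matrix (Fin 4) (Fin 4) ℝ) (a : PointCharges.Spacetime),
          PointCharges.IsLorentz L →
          (S.transform L a).HasTotalMomentum ((S.transform L a).worldline n s 0) (L *ᵥ P))) ∧
    (S.EquationsOfMotion →
      ∃ P : PointCharges.Spacetime, (∀ t, S.HasTotalMomentum t P) ∧
        ∀ (L : Matrix (Fin 4) (Fin 4) ℝ) (a : PointCharges.Spacetime),
          PointCharges.IsLorentz L → ∀ t', (S.transform L a).HasTotalMomentum t' (L *ᵥ P)) := by
  have hU : ∀ (L : Matrix (Fin 4) (Fin 4) ℝ) (a : Spacetime), IsLorentz L → ∀ s : Fin N → ℝ,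
      ∑ n, (S.transform L a).mass n • fourVelocity ((S.transform L a).worldline n) (s n) =
        L *ᵥ ∑ n, S.mass n • fourVelocity (S.worldline n) (s n) := fun L a hL s => by
    rw [Matrix.mulVec_sum]
    refine Finset.sum_congr rfl fun n _ => ?_
    rw [Matrix.mulVec_smul, ← hL.fourVelocity_transform (hreg.worldlines n) a]
    rfl
  refine ⟨?_, fun heom => ?_⟩
  · rintro rfl n s
    have hn : ∀ k, k = n := fun k => Subsingleton.elim _ _
    have hs : S.AtTime (S.worldline n s 0) fun _ => s := fun k => by rw [hn k]
    -- the particle crosses all simultaneity planes through the given event in that same event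
    have key : ∀ (L : Matrix (Fin 4) (Fin 4) ℝ) (a : Spacetime) (hL : IsLorentz L),
        ∃ Q : Spacetime,
        (∀ β, HasRIntegral (fun k => spatial (S.worldline k s))
          (S.fluxDensity 1 0 (S.worldline n s 0) β) (Q β)) ∧
        ∀ β, HasRIntegral (fun k => spatial (L *ᵥ S.worldline k s + a))
          (S.fluxDensity L a ((L *ᵥ S.worldline n s + a) 0) β) (Q β) := fun L a hL => by
      obtain ⟨Q, Q', h, h', e⟩ := hreg.exists_hasRIntegral_fluxDensity hmax hinf hL a
        (s' := fun _ => s) (fun k => by rw [hn k]) hs fun k => Or.inl rfl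
      rw [add_left_inj] at e
      exact ⟨Q, h, e ▸ h'⟩
    obtain ⟨Q, hQ, -⟩ := key 1 0 isLorentz_one
    have hP := hasFieldMomentum_of_fluxDensity hs hQ
    have hP' : ∀ (L : Matrix (Fin 4) (Fin 4) ℝ) (a : Spacetime), IsLorentz L →
        (S.transform L a).HasFieldMomentum ((S.transform L a).worldline n s 0) (L *ᵥ Q) :=
      fun L a hL => by
      obtain ⟨Q₁, h, h'⟩ := key L a hL
      obtain rfl : Q = Q₁ := funext fun β => (hQ β).2.unique (h β).2
      exact ⟨fun _ => s, fun k => by rw [hn k], IsLorentz.hasRIntegral_transform hL a h'⟩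
    refine ⟨⟨Q, hP, hP'⟩, _, ⟨_, hs, Q, hP, rfl⟩, fun L a hL =>
      ⟨fun _ => s, fun k => by rw [hn k], _, hP' L a hL, ?_⟩⟩
    rw [Matrix.mulVec_add, hU L a hL]
  · obtain ⟨s₀, hs₀⟩ := hreg.exists_atTime isLorentz_one 0 0
    simp only [Matrix.one_mulVec, add_zero] at hs₀
    obtain ⟨Q₀, -, hQ₀, -⟩ := hreg.exists_hasRIntegral_fluxDensity hmax hinf isLorentz_one 0
      (s' := s₀) (by simpa using hs₀) hs₀ fun k => Or.inl rfl
    have key : ∀ (L : Matrix (Fin 4) (Fin 4) ℝ) (a : Spacetime), IsLorentz L → ∀ t',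
        ∃ (s' : Fin N → ℝ) (Q' : Spacetime), (∀ n, (L *ᵥ S.worldline n (s' n) + a) 0 = t') ∧
        (∀ β, HasRIntegral (fun n => spatial (L *ᵥ S.worldline n (s' n) + a))
          (S.fluxDensity L a t' β) (Q' β)) ∧
        Q' + ∑ n, S.mass n • fourVelocity (S.worldline n) (s' n) =
          Q₀ + ∑ n, S.mass n • fourVelocity (S.worldline n) (s₀ n) := fun L a hL t' => by
      obtain ⟨s', hs'⟩ := hreg.exists_atTime hL a t'
      obtain ⟨Q, Q', h, h', e⟩ := hreg.exists_hasRIntegral_fluxDensity hmax hinf hL a hs' hs₀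
        fun k => Or.inr (heom k)
      obtain rfl : Q₀ = Q := funext fun β => (hQ₀ β).2.unique (h β).2
      exact ⟨s', Q', hs', h', e⟩
    refine ⟨Q₀ + ∑ n, S.mass n • fourVelocity (S.worldline n) (s₀ n), fun t => ?_,
      fun L a hL t' => ?_⟩
    · obtain ⟨s, Q, hs, hQ, e⟩ := key 1 0 isLorentz_one t
      simp only [Matrix.one_mulVec, add_zero] at hs hQ
      exact ⟨s, hs, Q, hasFieldMomentum_of_fluxDensity hs hQ, e.symm⟩
    · obtain ⟨s', Q', hs', hQ', e⟩ := key L a hL t'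
      refine ⟨s', hs', L *ᵥ Q', ⟨s', hs', IsLorentz.hasRIntegral_transform hL a hQ'⟩, ?_⟩
      rw [← e, Matrix.mulVec_add, hU L a hL]
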